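/- Let $K\subset S^3$ be a (tame) knot, and let $J_K(n)=J_K(n,t)$, $n\ge 1$, be its colored Jones polynomials, Laurent polynomials in $t^{1/2}$, normalized so that $J_K(2,t)$ is the (unreduced) Jones polynomial and $$J_{\mathrm{unknot}}(n)=\frac{t^{n/2}-t^{-n/2}}{t^{1/2}-t^{-1/2}}.$$ Let $d_+[J_K(n)]$ and $d_-[J_K(n)]$ be the maximal and the minimal degree of $J_K(n)$ in $t$. For $n$ large these are quadratic quasi-polynomials $a(n)n^2+b(n)n+c(n)$ and $a^*(n)n^2+b^*(n)n+c^*(n)$, with periodic rational coefficients. Let $js_K$, $js_K^*$, $jx_K$, $jx_K^*$ be the sets of cluster points of the sequences $4n^{-2}d_+[J_K(n)]$, $4n^{-2}d_-[J_K(n)]$, $2b(n)$, $2b^*(n)$, respectively. Let $n(K)$ be a tubular neighbourhood of $K$, let $M_K=\overline{S^3\setminus n(K)}$ be the exterior, and let $\mu,\lambda$ be the canonical meridian and longitude on $\partial n(K)$. A compact, properly embedded surface $S\subset M_K$ (possibly disconnected or non-orientable) is called essential if it is $\pi_1$-injective, no component of it is a boundary parallel annulus, and no component of it is a 2-sphere.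 It has boundary slope $\alpha/\beta$ ($\beta>0$, $\gcd(\alpha,\beta)=1$) if $\partial S\neq\emptyset$ and each component of $\partial S$ represents, up to orientation, $\alpha\mu+\beta\lambda\in H_1(\partial n(K))$. Let $\chi(S)$ be the Euler characteristic of $S$ and $|\partial S|$ the number of components of $\partial S$. The knot $K$ is said to satisfy the strong slope conjecture if * for every $\alpha/\beta\in js_K$ ($\beta>0$, $\gcd(\alpha,\beta)=1$) there is an essential surface $S\subset M_K$ of boundary slope $\alpha/\beta$ with $\dfrac{\chi(S)}{|\partial S|\,\beta}\in jx_K$, and * for every $\alpha^*/\beta^*\in js_K^*$ ($\beta^*>0$, $\gcd(\alpha^*,\beta^*)=1$) there is an essential surface $S^*\subset M_K$ of boundary slope $\alpha^*/\beta^*$ with $-\dfrac{\chi(S^*)}{|\partial S^*|\,\beta^*}\in jx_K^*$. **Corollary.** Suppose that $K$ satisfies the strong slope conjecture. If $d_+[J_K(n)]=d_+[J_{\mathrm{unknot}}(n)]$ for all $n\ge 1$, or $d_-[J_K(n)]=d_-[J_{\mathrm{unknot}}(n)]$ for all $n\ge 1$, then $K$ is isotopic to the unknot. -/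

import Mathlib

open Filter Topology Set

namespace KnotSSC

noncomputable section

/-! ### Space, isotopy, polygonal knots

The 3-sphere is the one-point compactification of Euclidean 3-space, with the piecewise linear
structure of Euclidean space away from the point at infinity. Knots, their tubular neighbourhoods
and compact surfaces are polyhedral and are placed in the complement of the point at infinity. -/

/-- Euclidean 3-space. -/
abbrev E3 : Type := EuclideanSpace ℝ (Fin 3)

/-- The 3-sphere. -/
abbrev S3 : Type := OnePoint E3

/-- The inclusion of Euclidean space into the 3-sphere. -/
def toS3 (p : E3) : S3 := (p : OnePoint E3)

/-- Ambient isotopy of subsets of the 3-sphere. -/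
def AmbientIsotopic (A B : Set S3) : Prop :=
  ∃ H : S3 × unitInterval → S3, Continuous H ∧
    (∀ t, IsHomeomorph (fun p => H (p, t))) ∧
    (∀ p, H (p, 0) = p) ∧
    (fun p => H (p, 1)) '' A = B

/-- An oriented polygonal knot: the closed polygon with vertices `v 0, v 1, …, v n` in this cyclic
order (the addition in `Fin (n + 1)` is cyclic), which is required to be embedded. Every tame knot
is isotopic to one of these. -/
structure PolygonalKnot where
  n : ℕ
  v : Fin (n + 1) → E3
  embedded : ∀ i j : Fin (n + 1), ∀ s ∈ Ico (0 : ℝ) 1, ∀ t ∈ Ico (0 : ℝ) 1,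
    AffineMap.lineMap (v i) (v (i + 1)) s = AffineMap.lineMap (v j) (v (j + 1)) t →
      i = j ∧ s = t

namespace PolygonalKnot

/-- The point with parameter `s` on the `i`-th edge. -/
def point (K : PolygonalKnot) (i : Fin (K.n + 1)) (s : ℝ) : E3 :=
  AffineMap.lineMap (K.v i) (K.v (i + 1)) s

/-- The direction vector of the `i`-th edge. -/
def dir (K : PolygonalKnot) (i : Fin (K.n + 1)) : E3 := K.v (i + 1) - K.v i

/-- The knot as a subset of Euclidean space. -/
def carrier (K : PolygonalKnot) : Set E3 := ⋃ i, segment ℝ (K.v i) (K.v (i + 1))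

/-- The knot as a subset of the 3-sphere. -/
def inS3 (K : PolygonalKnot) : Set S3 := toS3 '' K.carrier

end PolygonalKnot

/-- The standard unknot: the unit circle in a plane. -/
def unknot : Set S3 := toS3 '' {p : E3 | p 0 ^ 2 + p 1 ^ 2 = 1 ∧ p 2 = 0}

/-! ### Knot diagrams -/

/-- The combinatorial data of an oriented knot diagram with `c` crossings (a signed Gauss code).
Travelling once along the knot from a base point, one passes every crossing twice;
`passage a = (x, true)` says that the `a`-th passage is the over-passage of the crossing `x`, and
`passage a = (x, false)` that it is the under-passage of `x`. The crossing `x` is positive when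
`positive x = true` and negative otherwise. -/
structure Diagram where
  c : ℕ
  passage : Fin (2 * c) ≃ Fin c × Bool
  positive : Fin c → Bool

namespace Diagram

/-- `D` is read off the projection of `K` along the third coordinate. The function `pos` lists the
passages through crossings, in the order in which they are met when one travels along `K` from its
first vertex: a passage is a pair of an edge and a parameter in the interior of the edge. The last
condition says that the double points of the projection are exactly the crossings; in particular the
projection is regular. A crossing is positive when the over-direction followed by the
under-direction is a positively oriented basis of the plane of projection. -/
def IsProjectionOf (D : Diagram) (K : PolygonalKnot) : Prop :=
  ∃ pos : Fin (2 * D.c) → Fin (K.n + 1) × ℝ,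
    StrictMono (fun a => toLex (pos a)) ∧
    (∀ a, (pos a).2 ∈ Ioo (0 : ℝ) 1) ∧
    (∀ x : Fin D.c,
      let o := pos (D.passage.symm (x, true))
      let u := pos (D.passage.symm (x, false))
      let P := K.point o.1 o.2
      let Q := K.point u.1 u.2
      let d := K.dir o.1 0 * K.dir u.1 1 - K.dir o.1 1 * K.dir u.1 0
      P 0 = Q 0 ∧ P 1 = Q 1 ∧ Q 2 < P 2 ∧
        (if D.positive x = true then 0 < d else d < 0)) ∧
    (∀ i j : Fin (K.n + 1), ∀ s ∈ Ico (0 : ℝ) 1, ∀ t ∈ Ico (0 : ℝ) 1, (i, s) ≠ (j, t) →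
      K.point i s 0 = K.point j t 0 → K.point i s 1 = K.point j t 1 →
        ∃ x : Fin D.c, ({(i, s), (j, t)} : Set (Fin (K.n + 1) × ℝ)) =
          {pos (D.passage.symm (x, true)), pos (D.passage.symm (x, false))})

/-- `D` is a diagram of the knot `K`. -/
def IsDiagramOf (D : Diagram) (K : PolygonalKnot) : Prop :=
  ∃ K' : PolygonalKnot, AmbientIsotopic K.inS3 K'.inS3 ∧ D.IsProjectionOf K'

/-- The diagram without crossings, which is a diagram of the unknot. -/
def trivial : Diagram where
  c := 0
  passage := ⟨fun a => absurd a.2 (by simp), fun a => a.1.elim0,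
    fun a => absurd a.2 (by simp), fun a => a.1.elim0⟩
  positive := fun x => x.elim0

/-- The writhe. -/
def writhe (D : Diagram) : ℤ := ∑ x, if D.positive x = true then 1 else -1

/-! ### Kauffman bracket of the blackboard cables, and the colored Jones polynomial

In the `k`-cable of `D` the knot is replaced by `k` parallel copies, numbered from left to right, and
every crossing `x` by the `k * k` crossings `(x, a, b)` of copy `a` of the over-strand with copy `b`
of the under-strand. -/

/-- Pieces of the strands of the `k`-cable: `(p, j, r)` is the piece of copy `j`, near the `p`-th
passage, that has gone through exactly `r` of the `k` crossings there. The value `p = 2 * c` stands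
for the base point, where there is no crossing. -/
abbrev Node (D : Diagram) (k : ℕ) : Type := Fin (2 * D.c + 1) × Fin k × Fin (k + 1)

/-- The crossings of the `k`-cable. -/
abbrev CableCrossing (D : Diagram) (k : ℕ) : Type := Fin D.c × Fin k × Fin k

variable (D : Diagram) {k : ℕ}

/-- The piece that enters `(x, a, b)` on the over-strand (`out = false`), or leaves it there. From
left to right is the order in which the over-strand of a positive crossing meets the copies of the
under-strand; at a negative crossing it is the reversed order. -/
def overNode (out : Bool) (y : D.CableCrossing k) : D.Node k :=
  let r : Fin k := if D.positive y.1 = true then y.2.2 else y.2.2.rev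
  ((D.passage.symm (y.1, true)).castSucc, y.2.1, if out = true then r.succ else r.castSucc)

/-- The piece that enters `(x, a, b)` on the under-strand (`out = false`), or leaves it there. -/
def underNode (out : Bool) (y : D.CableCrossing k) : D.Node k :=
  let r : Fin k := if D.positive y.1 = true then y.2.1.rev else y.2.1
  ((D.passage.symm (y.1, false)).castSucc, y.2.2, if out = true then r.succ else r.castSucc)

/-- Pieces that are joined after all crossings of the cable are smoothed: every copy leads from one
passage to the next one (cyclically), goes straight through the base point, and `s y` says whether
the crossing `y` gets the A-smoothing (`true`) or the B-smoothing (`false`). The A-smoothing of a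
positive crossing and the B-smoothing of a negative crossing respect the orientation of the
strands, the other two smoothings do not. -/
inductive Joined (s : D.CableCrossing k → Bool) : D.Node k → D.Node k → Prop
  | next (p : Fin (2 * D.c + 1)) (j : Fin k) : Joined s (p, j, Fin.last k) (p + 1, j, 0)
  | base (j : Fin k) (r : Fin (k + 1)) : Joined s (Fin.last _, j, 0) (Fin.last _, j, r)
  | oriented (y : D.CableCrossing k) (h : s y = D.positive y.1) :
      Joined s (D.overNode false y) (D.underNode true y)
  | oriented' (y : D.CableCrossing k) (h : s y = D.positive y.1) :
      Joined s (D.underNode false y) (D.overNode true y)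
  | unoriented (y : D.CableCrossing k) (h : s y ≠ D.positive y.1) :
      Joined s (D.overNode false y) (D.underNode false y)
  | unoriented' (y : D.CableCrossing k) (h : s y ≠ D.positive y.1) :
      Joined s (D.overNode true y) (D.underNode true y)

/-- The number of circles of a smoothed cable. -/
def loops (s : D.CableCrossing k → Bool) : ℕ := Nat.card (Quot (D.Joined s))

open LaurentPolynomial in
/-- The Kauffman bracket of the `k`-cable, `∑ A ^ (#A - #B) * (-A ^ 2 - A ^ (-2)) ^ #circles`, where
`A = t ^ (-1/4)`. The variable of the Laurent polynomial ring is `t ^ (1/4)`, so `T m` stands for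
`t ^ (m/4)`. -/
def bracket (k : ℕ) : LaurentPolynomial ℤ :=
  ∑ s : D.CableCrossing k → Bool,
    T (∑ y, if s y = true then -1 else 1) * (-T 2 - T (-2)) ^ D.loops s

open LaurentPolynomial in
/-- The `n`-th colored Jones polynomial, of the representation of dimension `n`, computed from the
diagram `D`: the bracket of the cable by the Chebyshev polynomial `S (n - 1)`
(`S 0 = 1`, `S 1 = X`, `S (m + 2) = X * S (m + 1) - S m`), corrected by the factor
`((-1) ^ (n - 1) * A ^ (n ^ 2 - 1)) ^ (-writhe)` and normalized by the sign `(-1) ^ (n - 1)`, so that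
the unknot has the value `(t ^ (n/2) - t ^ (-n/2)) / (t ^ (1/2) - t ^ (-1/2))`. The variable of the
Laurent polynomial ring is `t ^ (1/4)`. -/
def coloredJones (n : ℕ) : LaurentPolynomial ℤ :=
  C ((((n : ℤ) - 1) * (D.writhe + 1)).negOnePow : ℤ) * T (D.writhe * ((n : ℤ) ^ 2 - 1)) *
    (Polynomial.Chebyshev.S ℤ ((n : ℤ) - 1)).sum (fun k a => C a * D.bracket k)

/-- The maximal degree in `t` of the `n`-th colored Jones polynomial. -/
def dPlus (n : ℕ) : ℚ := ((D.coloredJones n).degree.unbotD 0 : ℤ) / 4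

/-- The minimal degree in `t` of the `n`-th colored Jones polynomial. -/
def dMinus (n : ℕ) : ℚ := ((D.coloredJones n).coeff.support.min.untopD 0 : ℤ) / 4

end Diagram

/-! ### Jones slopes -/

/-- The set of cluster points of `4 * n⁻² * d n`. For `d = d₊[J_K]` and `d = d₋[J_K]` these are the
two sets of Jones slopes. -/
def slopeSet (d : ℕ → ℚ) : Set ℝ :=
  {x | MapClusterPt x atTop (fun n : ℕ => ((4 * ((n : ℚ) ^ 2)⁻¹ * d n : ℚ) : ℝ))}

/-- `d n = a n * n ^ 2 + b n * n + c n` for all large `n`, with periodic coefficients. -/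
def IsQuadraticQuasiPolynomial (d a b c : ℕ → ℚ) : Prop :=
  (∃ p : ℕ, 0 < p ∧ Function.Periodic a p ∧ Function.Periodic b p ∧ Function.Periodic c p) ∧
    ∃ N : ℕ, ∀ n > N, d n = a n * (n : ℚ) ^ 2 + b n * n + c n

/-- The set of cluster points of `2 * n⁻¹ * ℓd n`, where `ℓd n = b n * n` is the linear term of the
quadratic quasi-polynomial `d` (its coefficients are determined by `d`). -/
def linearSet (d : ℕ → ℚ) : Set ℝ :=
  {x | ∃ a b c : ℕ → ℚ, IsQuadraticQuasiPolynomial d a b c ∧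
    MapClusterPt x atTop (fun n : ℕ => ((2 * (n : ℚ)⁻¹ * (b n * n) : ℚ) : ℝ))}

/-! ### Tubular neighbourhoods and exteriors -/

/-- The infinite square tube around the first coordinate axis. -/
def tube : Set E3 := {p | |p 1| ≤ 1 ∧ |p 2| ≤ 1}

/-- A polyhedral tubular neighbourhood of `K`, parametrized by a piecewise linear,
orientation-preserving homeomorphism from the solid torus `(ℝ / ℤ) × [-1, 1] ^ 2`, written as a
map on the tube `ℝ × [-1, 1] ^ 2` with period 1 in the first coordinate. The core goes to `K`, and
the parametrization is chosen so that the longitude `f (·, 1, 0)` is null-homologous in the exterior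
of `K`. -/
structure TubularNeighborhood (K : PolygonalKnot) where
  f : E3 → E3
  periodic : ∀ p, f (p + !₂[1, 0, 0]) = f p
  /-- The box `[0, 1] × [-1, 1] ^ 2` is a finite union of convex polytopes on each of which `f`
  agrees with an affine map of positive determinant. -/
  piecewiseLinear : ∃ P : Set (Finset E3 × (E3 →ᵃ[ℝ] E3)), P.Finite ∧
    (⋃ q ∈ P, convexHull ℝ (q.1 : Set E3)) = tube ∩ {p | p 0 ∈ Icc (0 : ℝ) 1} ∧
    ∀ q ∈ P, 0 < LinearMap.det q.2.linear ∧ ∀ p ∈ convexHull ℝ (q.1 : Set E3), f p = q.2 p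
  injective : ∀ p ∈ tube, ∀ q ∈ tube, f p = f q → ∃ m : ℤ, q = p + (m : ℝ) • !₂[1, 0, 0]
  core : f '' {p | p 1 = 0 ∧ p 2 = 0} = K.carrier
  /-- The class of the longitude in the abelianized fundamental group of the exterior is trivial. -/
  longitude : ∃ (x : {z : S3 | ∀ q : E3, |q 1| < 1 → |q 2| < 1 → z ≠ toS3 (f q)}) (γ : Path x x),
    (∀ s : unitInterval, (γ s : S3) = toS3 (f !₂[(s : ℝ), 1, 0])) ∧
    Abelianization.of (FundamentalGroup.fromPath (Path.Homotopic.Quotient.mk γ)) = 1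

namespace TubularNeighborhood

variable {K : PolygonalKnot} (N : TubularNeighborhood K)

/-- The exterior of `K`: the complement in the 3-sphere of the open tubular neighbourhood. -/
def exterior : Set S3 := {z | ∀ q : E3, |q 1| < 1 → |q 2| < 1 → z ≠ toS3 (N.f q)}

/-- The boundary torus of the tubular neighbourhood. -/
def torus : Set E3 := N.f '' {p | max |p 1| |p 2| = 1}

/-- The point of the boundary torus with longitudinal coordinate `x` and meridional angle
`2 * π * θ`: the central projection of the unit circle to the boundary of the square is used. -/
def torusPoint (x θ : ℝ) : E3 :=
  let c := Real.cos (2 * Real.pi * θ)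
  let s := Real.sin (2 * Real.pi * θ)
  N.f !₂[x, c / max |c| |s|, s / max |c| |s|]

/-- `c` is a simple closed curve on the boundary torus which, with a suitable orientation,
represents `α * μ + β * l` in the homology of the torus, where `μ` is the meridian and `l` the
longitude: in the universal cover of the torus, a parametrization of `c` moves by `α` in the
meridional and by `β` in the longitudinal direction. -/
def Represents (c : Set E3) (α β : ℤ) : Prop :=
  ∃ X Θ : ℝ → ℝ, ContinuousOn X (Icc 0 1) ∧ ContinuousOn Θ (Icc 0 1) ∧
    X 1 - X 0 = β ∧ Θ 1 - Θ 0 = α ∧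
    InjOn (fun s => N.torusPoint (X s) (Θ s)) (Ico 0 1) ∧
    (fun s => N.torusPoint (X s) (Θ s)) '' Icc 0 1 = c

end TubularNeighborhood

/-! ### Surfaces in the exterior -/

/-- The Euler characteristic of a finite set of vertices, edges and triangles. -/
def eulerChar (F : Set (Finset E3)) : ℤ :=
  ({s ∈ F | s.card = 1}.ncard : ℤ) - {s ∈ F | s.card = 2}.ncard + {s ∈ F | s.card = 3}.ncard

/-- The boundary of a triangulated surface: the union of the edges that lie in one triangle only. -/
def bdry (T : Geometry.SimplicialComplex ℝ E3) : Set E3 :=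
  ⋃ e ∈ {e ∈ T.faces | e.card = 2 ∧ {t ∈ T.faces | t.card = 3 ∧ e ⊆ t}.ncard = 1},
    convexHull ℝ (e : Set E3)

/-- A compact, properly embedded polyhedral surface in the exterior of a knot, possibly disconnected
or non-orientable, given with a triangulation. Every simplex lies in a triangle, every edge in at most
two triangles, and the link of every vertex is connected (so that it is an arc or a circle). -/
structure ProperSurface {K : PolygonalKnot} (N : TubularNeighborhood K) where
  T : Geometry.SimplicialComplex ℝ E3
  finite : T.faces.Finite
  card_le : ∀ s ∈ T.faces, s.card ≤ 3
  pure : ∀ s ∈ T.faces, ∃ t ∈ T.faces, s ⊆ t ∧ t.card = 3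
  edge : ∀ e ∈ T.faces, e.card = 2 → {t ∈ T.faces | t.card = 3 ∧ e ⊆ t}.ncard ≤ 2
  link : ∀ v a b : E3, a ≠ v → b ≠ v → (∃ s ∈ T.faces, v ∈ s ∧ a ∈ s) →
    (∃ s ∈ T.faces, v ∈ s ∧ b ∈ s) →
    Relation.ReflTransGen
      (fun x y => x ≠ v ∧ y ≠ v ∧ ∃ t ∈ T.faces, v ∈ t ∧ x ∈ t ∧ y ∈ t) a b
  inside : ∀ p ∈ T.space, toS3 p ∈ N.exterior
  proper : T.space ∩ N.torus = bdry T

namespace ProperSurface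

variable {K : PolygonalKnot} {N : TubularNeighborhood K} (S : ProperSurface N)

/-- The Euler characteristic of the surface. -/
def chi : ℤ := eulerChar S.T.faces

/-- The number of boundary components. -/
def numBdry : ℕ := {c | ∃ p ∈ bdry S.T, c = connectedComponentIn (bdry S.T) p}.ncard

/-- The inclusion of the surface into the exterior. -/
def incl : C(S.T.space, N.exterior) where
  toFun p := ⟨toS3 p, S.inside p p.2⟩
  continuous_toFun :=
    (OnePoint.continuous_coe.comp continuous_subtype_val).subtype_mk _

/-- The surface is injective on fundamental groups. -/
def PiOneInjective : Prop :=
  ∀ p : S.T.space, Function.Injective (FundamentalGroup.map S.incl p)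

/-- A component `c` is a boundary parallel annulus: it is an annulus, and there is a product region
`c × [0, 1]` in the exterior that meets the boundary torus in `c × {1} ∪ ∂c × [0, 1]`. -/
def IsBoundaryParallelAnnulus (N : TubularNeighborhood K) (c : Set E3) : Prop :=
  Nonempty (c ≃ₜ Circle × unitInterval) ∧
    ∃ h : c × unitInterval → S3, Continuous h ∧ Function.Injective h ∧
      (∀ p s, h (p, s) ∈ N.exterior) ∧ (∀ p, h (p, 0) = toS3 p) ∧
      ∀ p s, h (p, s) ∈ toS3 '' N.torus ↔ s = 1 ∨ (p : E3) ∈ N.torus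

/-- The surface is essential: it is injective on fundamental groups, no component is a boundary
parallel annulus, and no component is a 2-sphere. The spheres are excluded by the Euler
characteristic: the closed connected surfaces of positive Euler characteristic are the 2-sphere and
the projective plane, and the latter does not embed into the 3-sphere. -/
def IsEssential : Prop :=
  S.PiOneInjective ∧
  (∀ p ∈ S.T.space, ¬ IsBoundaryParallelAnnulus N (connectedComponentIn S.T.space p)) ∧
  (∀ p ∈ S.T.space, Disjoint (connectedComponentIn S.T.space p) (bdry S.T) →
    eulerChar {s ∈ S.T.faces | (s : Set E3) ⊆ connectedComponentIn S.T.space p} ≤ 0)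

/-- The surface has non-empty boundary, and each boundary component has the slope `r = α / β`, with
`β > 0` and `α`, `β` coprime. -/
def HasBoundarySlope (r : ℚ) : Prop :=
  (bdry S.T).Nonempty ∧
    ∀ p ∈ bdry S.T, N.Represents (connectedComponentIn (bdry S.T) p) r.num r.den

end ProperSurface

/-! ### The strong slope conjecture -/

/-- The knot `K`, with exterior given by `N` and colored Jones polynomials computed from the diagram
`D` of `K`, satisfies the strong slope conjecture. -/
def SatisfiesStrongSlopeConjecture {K : PolygonalKnot} (N : TubularNeighborhood K) (D : Diagram) :
    Prop :=
  (∀ r : ℚ, (r : ℝ) ∈ slopeSet D.dPlus → ∃ S : ProperSurface N, S.IsEssential ∧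
    S.HasBoundarySlope r ∧
    (((S.chi : ℚ) / (S.numBdry * r.den) : ℚ) : ℝ) ∈ linearSet D.dPlus) ∧
  (∀ r : ℚ, (r : ℝ) ∈ slopeSet D.dMinus → ∃ S : ProperSurface N, S.IsEssential ∧
    S.HasBoundarySlope r ∧
    ((-((S.chi : ℚ) / (S.numBdry * r.den)) : ℚ) : ℝ) ∈ linearSet D.dMinus)

end

end KnotSSC

/-!
The hypothesis on the degrees says that the maximal (or minimal) degree of the colored Jones polynomial
is the linear function `n ↦ ε (n - 1) / 2` with `ε = 1` (or `ε = -1`), see `Diagram.dPlus_trivial` and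
`Diagram.dMinus_trivial`. So `0` is a Jones slope and `ε` is the only value of `2 b`, and the strong slope
conjecture provides an essential surface of boundary slope `0` whose Euler characteristic is the number of
its boundary components (`exists_surface_of_degree`). Since no component is a sphere, some component has
boundary and positive Euler characteristic; a dimension count in its homology modulo 2 shows that every
edge cycle in it bounds (`ProperSurface.exists_component`, `IsSurface.cyclesBound`), as in a disk.

Let `c` be a boundary curve of that component. A set of triangles which `c` bounds can be removed
triangle by triangle (`IsSurface.exists_shelling_step`), and each step is a triangle move of the polygon
in space. Hence `c` is unknotted (`ambientIsotopic_unknot_of_fills`, `exists_unknotted_boundary`).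

It remains to see that `c`, a curve on the boundary of the tubular neighbourhood which runs once along
the longitude and is trivial around the meridian, is ambient isotopic to the core `K`. In the coordinates
of the tube `ℝ × [-1, 1]²`, periodic under translation by `e0`, it is a polygon
(`exists_polygonal_lift`), because the parametrization is affine on pieces. A triangle in the tube can be
cut by the planes of the faces of these pieces into triangles on which the parametrization is affine, so
that a move across the triangle is realized by an ambient isotopy (`IsPieceSet.movable`). Consequently
small displacements of the vertices of an embedded polygon, and then all linear motions through embedded
polygons, are ambient isotopies in space (`IsPieceSet.ambientIsotopic_of_near`,
`IsPieceSet.ambientIsotopic_of_linear_path`). As `c` does not wind around the core, its projection to the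
square lifts to the universal cover of the boundary of the square, and a small displacement of the
vertices turns it into a simple polygon (`exists_simple_cross_section`). While the cross-section is simple
the longitudinal coordinate can be straightened, and once this is done the cross-section can be contracted
to the centre (`IsPieceSet.ambientIsotopic_core`).
-/

namespace KnotSSC

/-! ### Ambient isotopy -/

theorem AmbientIsotopic.refl (A : Set S3) : AmbientIsotopic A A :=
  ⟨fun q => q.1, continuous_fst, fun _ => (Homeomorph.refl S3).isHomeomorph, fun _ => rfl,
    by simp⟩

theorem AmbientIsotopic.trans {A B C : Set S3} (h₁ : AmbientIsotopic A B)
    (h₂ : AmbientIsotopic B C) : AmbientIsotopic A C := by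
  obtain ⟨H, hc, hh, h0, hA⟩ := h₁
  obtain ⟨G, gc, gh, g0, gA⟩ := h₂
  refine ⟨fun q => G (H q, q.2), gc.comp (hc.prodMk continuous_snd), fun t => ?_, ?_, ?_⟩
  · exact (gh t).comp (hh t)
  · simp [h0, g0]
  · rw [← gA, ← hA, image_image]

theorem AmbientIsotopic.symm {A B : Set S3} (h : AmbientIsotopic A B) : AmbientIsotopic B A := by
  obtain ⟨H, hc, hh, h0, hA⟩ := h
  -- the level-preserving map `(p, t) ↦ (H (p, t), t)` is a homeomorphism by compactness
  have hΦ : IsHomeomorph (fun q : S3 × unitInterval => (H q, q.2)) := by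
    rw [isHomeomorph_iff_continuous_bijective]
    refine ⟨hc.prodMk continuous_snd, ?_, ?_⟩
    · rintro ⟨p, s⟩ ⟨q, t⟩ hpq
      simp only [Prod.mk.injEq] at hpq
      obtain ⟨h1, rfl⟩ := hpq
      rw [(hh s).bijective.1 h1]
    · rintro ⟨p, s⟩
      obtain ⟨q, hq⟩ := (hh s).bijective.2 p
      exact ⟨(q, s), by simp only at hq; simp [hq]⟩
  let Φ := hΦ.homeomorph
  have hΦa : ∀ q, Φ q = (H q, q.2) := fun q => rfl
  have key : ∀ p t, H ((Φ.symm (p, t)).1, t) = p ∧ (Φ.symm (p, t)).2 = t := by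
    intro p t
    have h1 := Φ.apply_symm_apply (p, t)
    rw [hΦa] at h1
    simp only [Prod.mk.injEq] at h1
    refine ⟨?_, h1.2⟩
    conv_rhs => rw [← h1.1]
    congr 1
    exact Prod.ext rfl h1.2.symm
  have key' : ∀ p t, (Φ.symm (H (p, t), t)).1 = p := by
    intro p t
    exact (hh t).bijective.1 (key _ _).1
  refine ⟨fun q => (Φ.symm q).1, continuous_fst.comp Φ.symm.continuous, fun t => ?_, ?_, ?_⟩
  · rw [isHomeomorph_iff_continuous_bijective]
    refine ⟨by fun_prop, ?_, ?_⟩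
    · intro p q hpq
      rw [← (key p t).1, ← (key q t).1]
      simp only at hpq
      rw [hpq]
    · intro p
      exact ⟨H (p, t), key' p t⟩
  · intro p
    have := key' p 0
    rwa [h0] at this
  · rw [← hA, image_image]
    simp [key']

/-- A compactly supported isotopy of Euclidean space extends to the 3-sphere. -/
theorem ambientIsotopic_of_compact_support (h : E3 × unitInterval → E3) (hc : Continuous h)
    {C : Set E3} (hC : IsCompact C) (hout : ∀ p ∉ C, ∀ t, h (p, t) = p)
    (hb : ∀ t, Function.Bijective (fun p => h (p, t))) (h0 : ∀ p, h (p, 0) = p) (A : Set E3) :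
    AmbientIsotopic (toS3 '' A) (toS3 '' ((fun p => h (p, 1)) '' A)) := by
  -- the point at infinity is kept fixed
  let H : S3 × unitInterval → S3 := fun q => q.1.elim (OnePoint.infty) (fun p => toS3 (h (p, q.2)))
  have Hs : ∀ p t, H (toS3 p, t) = toS3 (h (p, t)) := fun p t => rfl
  have Hi : ∀ t, H (OnePoint.infty, t) = OnePoint.infty := fun t => rfl
  have Hc : Continuous H := by
    rw [continuous_iff_continuousAt]
    rintro ⟨p, t⟩
    induction p using OnePoint.rec with
    | infty =>
      have hev : (fun q : S3 × unitInterval => q.1) =ᶠ[𝓝 (OnePoint.infty, t)] H := by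
        have ho : IsOpen ((toS3 '' C)ᶜ ×ˢ (univ : Set unitInterval)) :=
          (OnePoint.isOpen_compl_image_coe.2 ⟨hC.isClosed, hC⟩).prod isOpen_univ
        have hm : ((OnePoint.infty : S3), t) ∈ (toS3 '' C)ᶜ ×ˢ (univ : Set unitInterval) := by
          refine ⟨?_, mem_univ _⟩
          rintro ⟨x, _, hx⟩
          exact OnePoint.coe_ne_infty x hx
        filter_upwards [ho.mem_nhds hm] with q hq
        obtain ⟨q, s⟩ := q
        induction q using OnePoint.rec with
        | infty => rfl
        | coe x =>
          have hx : x ∉ C := fun hx => hq.1 ⟨x, hx, rfl⟩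
          change (x : S3) = toS3 (h (x, s))
          rw [hout x hx s]
          rfl
      exact continuousAt_fst.congr hev
    | coe p =>
      have hoe := (OnePoint.isOpenEmbedding_coe (X := E3)).prodMap
        (IsOpenEmbedding.id (X := unitInterval))
      have : ContinuousAt (H ∘ Prod.map (fun x : E3 => (x : S3)) id) (p, t) := by
        have : Continuous (fun q : E3 × unitInterval => toS3 (h q)) :=
          OnePoint.continuous_coe.comp hc
        exact this.continuousAt
      exact (hoe.continuousAt_iff (x := (p, t))).1 this
  refine ⟨H, Hc, fun t => ?_, ?_, ?_⟩
  · rw [isHomeomorph_iff_continuous_bijective]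
    refine ⟨Hc.comp (by fun_prop), ?_, ?_⟩
    · intro p q hpq
      induction p using OnePoint.rec with
      | infty =>
        induction q using OnePoint.rec with
        | infty => rfl
        | coe y => exact absurd hpq.symm (OnePoint.coe_ne_infty _)
      | coe x =>
        induction q using OnePoint.rec with
        | infty => exact absurd hpq (OnePoint.coe_ne_infty _)
        | coe y =>
          have := OnePoint.coe_injective hpq
          exact congrArg _ ((hb t).1 this)
    · intro p
      induction p using OnePoint.rec with
      | infty => exact ⟨OnePoint.infty, rfl⟩
      | coe x =>
        obtain ⟨y, hy⟩ := (hb t).2 x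
        exact ⟨toS3 y, congrArg toS3 hy⟩
  · intro p
    induction p using OnePoint.rec with
    | infty => rfl
    | coe x => exact congrArg toS3 (h0 x)
  · rw [image_image, image_image]
    rfl

/-! ### Lipschitz displacements -/

theorem E3.norm_le_of_coord {x : E3} {a : ℝ} (ha : 0 ≤ a) (h : ∀ i, |x i| ≤ a) : ‖x‖ ≤ 2 * a := by
  rw [EuclideanSpace.norm_eq]
  apply Real.sqrt_le_iff.2 ⟨by positivity, ?_⟩
  simp only [Fin.sum_univ_three, Real.norm_eq_abs]
  have h0 := pow_le_pow_left₀ (abs_nonneg _) (h 0) 2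
  have h1 := pow_le_pow_left₀ (abs_nonneg _) (h 1) 2
  have h2 := pow_le_pow_left₀ (abs_nonneg _) (h 2) 2
  nlinarith

theorem E3.abs_coord_le (x : E3) (i : Fin 3) : |x i| ≤ ‖x‖ := by
  simpa using PiLp.norm_apply_le x i

/-- McShane extension of a partially defined Lipschitz displacement field, given by its graph `Z`.
The factor 2 comes from extending coordinate by coordinate. -/
theorem exists_lipschitz_extension (Z : Set (E3 × E3)) (hne : Z.Nonempty) {ε : ℝ} (hε : 0 ≤ ε)
    (h : ∀ p ∈ Z, ∀ q ∈ Z, ‖p.2 - q.2‖ ≤ ε * ‖p.1 - q.1‖) :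
    ∃ w : E3 → E3, (∀ x y, ‖w x - w y‖ ≤ 2 * ε * ‖x - y‖) ∧ (∀ p ∈ Z, w p.1 = p.2) := by
  have hZ : Nonempty Z := hne.to_subtype
  let g : Fin 3 → E3 → ℝ := fun i x => ⨅ p : Z, (p.1.2 i + ε * ‖x - p.1.1‖)
  have hco : ∀ p ∈ Z, ∀ q ∈ Z, ∀ i, p.2 i ≤ q.2 i + ε * ‖p.1 - q.1‖ := by
    intro p hp q hq i
    have h1 := E3.abs_coord_le (p.2 - q.2) i
    have h2 := h p hp q hq
    have h3 : p.2 i - q.2 i ≤ |(p.2 - q.2) i| := le_abs_self _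
    linarith
  have hB : ∀ i x, BddBelow (range fun p : Z => (p.1.2 i + ε * ‖x - p.1.1‖)) := by
    intro i x
    obtain ⟨z, hz⟩ := hne
    refine ⟨z.2 i - ε * ‖x - z.1‖, ?_⟩
    rintro _ ⟨p, rfl⟩
    have h1 := hco z hz p.1 p.2 i
    have h2 : ‖z.1 - p.1.1‖ ≤ ‖x - z.1‖ + ‖x - p.1.1‖ := by
      rw [norm_sub_rev x z.1]
      exact norm_sub_le_norm_sub_add_norm_sub _ _ _
    have h3 := mul_le_mul_of_nonneg_left h2 hε
    simp only
    linarith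
  have hg : ∀ i, ∀ p ∈ Z, g i p.1 = p.2 i := by
    intro i p hp
    refine le_antisymm ?_ (le_ciInf fun q => hco p hp q.1 q.2 i)
    have := ciInf_le (hB i p.1) ⟨p, hp⟩
    simpa using this
  have hl1 : ∀ i x y, g i x ≤ g i y + ε * ‖x - y‖ := by
    intro i x y
    rw [← sub_le_iff_le_add]
    refine le_ciInf fun p => ?_
    rw [sub_le_iff_le_add]
    refine (ciInf_le (hB i x) p).trans ?_
    have h2 : ‖x - p.1.1‖ ≤ ‖x - y‖ + ‖y - p.1.1‖ := norm_sub_le_norm_sub_add_norm_sub _ _ _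
    have h3 := mul_le_mul_of_nonneg_left h2 hε
    linarith
  refine ⟨fun x => WithLp.toLp 2 (fun i => g i x), ?_, ?_⟩
  · intro x y
    rw [mul_assoc]
    refine E3.norm_le_of_coord (by positivity) fun i => ?_
    rw [abs_le]
    have h1 := hl1 i x y
    have h2 := hl1 i y x
    rw [norm_sub_rev] at h2
    constructor <;> simp <;> linarith
  · intro p hp
    ext i
    exact hg i p hp

/-- Perturbing the identity by a contraction gives a bijection: preimages are fixed points. -/
theorem bijective_add_smul {w : E3 → E3} {K : ℝ} (hK : K < 1)
    (hw : ∀ x y, ‖w x - w y‖ ≤ K * ‖x - y‖) {t : ℝ} (ht : t ∈ Icc (0 : ℝ) 1) :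
    Function.Bijective (fun x => x + t • w x) := by
  constructor
  · intro x y hxy
    simp only at hxy
    have h1 : x - y = t • (w y - w x) := by
      rw [smul_sub]
      have := sub_eq_zero.2 hxy
      rw [← sub_eq_zero, ← this]
      abel
    have h2 : ‖x - y‖ ≤ K * ‖x - y‖ := by
      calc ‖x - y‖ = t * ‖w y - w x‖ := by
            conv_lhs => rw [h1, norm_smul, Real.norm_of_nonneg ht.1]
        _ ≤ 1 * ‖w y - w x‖ := by gcongr; exact ht.2
        _ ≤ K * ‖x - y‖ := by rw [one_mul, norm_sub_rev x y]; exact hw y x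
    have h3 : ‖x - y‖ ≤ 0 := by
      by_contra h
      push Not at h
      nlinarith
    exact sub_eq_zero.1 (norm_le_zero_iff.1 h3)
  · intro y
    have hc : ContractingWith (Real.toNNReal K) (fun x => y - t • w x) := by
      refine ⟨by rw [← NNReal.coe_lt_coe]; simp [hK], LipschitzWith.of_dist_le_mul fun a b => ?_⟩
      rw [dist_eq_norm, dist_eq_norm]
      have : y - t • w a - (y - t • w b) = t • (w b - w a) := by rw [smul_sub]; abel
      rw [this, norm_smul, Real.norm_of_nonneg ht.1, norm_sub_rev a b]
      have h1 : K * ‖b - a‖ ≤ (Real.toNNReal K : ℝ) * ‖b - a‖ := by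
        gcongr
        exact Real.le_coe_toNNReal K
      have h2 := hw b a
      nlinarith [norm_nonneg (w b - w a), ht.2]
    obtain ⟨x, hx, -⟩ := hc.exists_fixedPoint y (edist_ne_top _ _)
    refine ⟨x, ?_⟩
    have hx' : y - t • w x = x := hx
    simp only
    nth_rewrite 1 [← hx']
    abel

theorem continuous_of_lipschitz_bound {E F : Type*} [SeminormedAddCommGroup E]
    [SeminormedAddCommGroup F] {w : E → F} {K : ℝ} (hw : ∀ x y, ‖w x - w y‖ ≤ K * ‖x - y‖) :
    Continuous w :=
  (LipschitzWith.of_dist_le_mul (K := K.toNNReal) fun a b => by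
    rw [dist_eq_norm, dist_eq_norm]
    exact (hw a b).trans (by gcongr; exact Real.le_coe_toNNReal K)).continuous

/-- Moving a bounded set by a small displacement with small Lipschitz constant is realized by an
ambient isotopy. -/
theorem ambientIsotopic_of_small_displacement {ι : Type*} [Nonempty ι] (γ δ : ι → E3) {R : ℝ}
    (hR : ∀ i, ‖γ i‖ ≤ R)
    (h1 : ∀ i j, ‖(δ i - γ i) - (δ j - γ j)‖ ≤ 1 / 4 * ‖γ i - γ j‖)
    (h2 : ∀ i, ‖δ i - γ i‖ ≤ 1 / 4) :
    AmbientIsotopic (toS3 '' range γ) (toS3 '' range δ) := by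
  -- the displacement is prescribed on the set and vanishes far away
  let Z : Set (E3 × E3) := range (fun i => (γ i, δ i - γ i)) ∪ {p | R + 1 ≤ ‖p.1‖ ∧ p.2 = 0}
  have hfar : ∀ i, ∀ x : E3, R + 1 ≤ ‖x‖ → ‖δ i - γ i‖ ≤ 1 / 4 * ‖γ i - x‖ := by
    intro i x hx
    have := norm_sub_norm_le x (γ i)
    rw [norm_sub_rev] at this
    linarith [hR i, h2 i]
  obtain ⟨w, hw1, hw2⟩ := exists_lipschitz_extension Z
    ⟨_, Or.inl ⟨Classical.arbitrary ι, rfl⟩⟩ (ε := 1 / 4) (by norm_num) (by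
      rintro p (⟨i, rfl⟩ | ⟨hp, hp0⟩) q (⟨j, rfl⟩ | ⟨hq, hq0⟩)
      · exact h1 i j
      · rw [hq0, sub_zero]
        exact hfar i _ hq
      · rw [hp0, zero_sub, norm_neg, norm_sub_rev p.1]
        exact hfar j _ hp
      · rw [hp0, hq0]
        simp)
  norm_num at hw1
  have hwi : ∀ i, w (γ i) = δ i - γ i := fun i => hw2 (γ i, δ i - γ i) (Or.inl ⟨i, rfl⟩)
  have hwo : ∀ x : E3, R + 1 ≤ ‖x‖ → w x = 0 := fun x hx => hw2 (x, 0) (Or.inr ⟨hx, rfl⟩)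
  have hwc := continuous_of_lipschitz_bound hw1
  have := ambientIsotopic_of_compact_support (fun q => q.1 + (q.2 : ℝ) • w q.1)
    (by fun_prop) (isCompact_closedBall (0 : E3) (R + 1)) (by
      intro p hp t
      have : R + 1 ≤ ‖p‖ := by
        simp only [Metric.mem_closedBall, dist_zero_right, not_le] at hp
        exact hp.le
      simp [hwo p this]) (fun t => bijective_add_smul (by norm_num) hw1 t.2) (by simp) (range γ)
  have himg : (fun p => ((p, (1 : unitInterval)).1 + ((p, (1 : unitInterval)).2 : ℝ) •
      w (p, (1 : unitInterval)).1)) '' range γ = range δ := by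
    rw [← range_comp]
    congr 1
    ext i : 1
    simp [hwi]
  rwa [himg] at this

/-- Transport of an equivalence relation along a path on which it holds locally. -/
theorem rel_of_locally_rel {α : Type*} (Rel : α → α → Prop) (hs : ∀ a b, Rel a b → Rel b a)
    (ht : ∀ a b c, Rel a b → Rel b c → Rel a c) (A : ℝ → α)
    (h : ∀ t ∈ Icc (0 : ℝ) 1, ∃ ε > 0, ∀ t' ∈ Icc (0 : ℝ) 1, |t' - t| < ε → Rel (A t) (A t')) :
    Rel (A 0) (A 1) := by
  refine isPreconnected_Icc.induction₂' (s := Icc (0 : ℝ) 1) (fun a b => Rel (A a) (A b)) ?_ ?_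
    (by simp) (by simp)
  · intro t htI
    obtain ⟨ε, hε, H⟩ := h t htI
    have : Metric.ball t ε ∩ Icc 0 1 ∈ 𝓝[Icc 0 1] t :=
      inter_mem (mem_nhdsWithin_of_mem_nhds (Metric.ball_mem_nhds t hε)) self_mem_nhdsWithin
    filter_upwards [this] with t' ht'
    have := H t' ht'.2 (by simpa [Real.dist_eq] using ht'.1)
    exact ⟨this, hs _ _ this⟩
  · intro x y z _ _ _ h1 h2
    exact ht _ _ _ h1 h2

/-- A relation between parametrized sets that holds for displacements which are small, and Lipschitz
with a small constant, is transported along a path of bi-Lipschitz parametrized sets. -/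
theorem rel_of_path {ι : Type*} [Nonempty ι] {Rel : (ι → E3) → (ι → E3) → Prop}
    (hs : ∀ γ δ, Rel γ δ → Rel δ γ) (ht : ∀ γ δ ε, Rel γ δ → Rel δ ε → Rel γ ε) (d : ι → ι → ℝ)
    (γ : ℝ → ι → E3) {M κ : ℝ} (hκ : 0 < κ)
    (hrel : ∀ t ∈ Icc (0 : ℝ) 1, ∀ t' ∈ Icc (0 : ℝ) 1,
      (∀ i j, ‖(γ t' i - γ t i) - (γ t' j - γ t j)‖ ≤ κ * ‖γ t i - γ t j‖) →
      (∀ i, ‖γ t' i - γ t i‖ ≤ κ) → Rel (γ t) (γ t'))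
    (hanti : ∀ t ∈ Icc (0 : ℝ) 1, ∃ c > 0, ∀ i j, c * d i j ≤ ‖γ t i - γ t j‖)
    (hmix : ∀ t ∈ Icc (0 : ℝ) 1, ∀ t' ∈ Icc (0 : ℝ) 1, ∀ i j,
      ‖(γ t' i - γ t i) - (γ t' j - γ t j)‖ ≤ M * |t' - t| * d i j)
    (htime : ∀ t ∈ Icc (0 : ℝ) 1, ∀ t' ∈ Icc (0 : ℝ) 1, ∀ i,
      ‖γ t' i - γ t i‖ ≤ M * |t' - t|) : Rel (γ 0) (γ 1) := by
  refine rel_of_locally_rel Rel hs ht γ fun t ht => ?_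
  obtain ⟨c, hc, hanti⟩ := hanti t ht
  have hM0 : 0 ≤ M := by
    simpa using (norm_nonneg _).trans (htime 0 (by simp) 1 (by simp) (Classical.arbitrary ι))
  refine ⟨min 1 c * κ / (M + 1), by positivity, fun t' ht' htt => ?_⟩
  have hlt : M * |t' - t| ≤ min 1 c * κ := by
    rw [lt_div_iff₀ (by positivity)] at htt
    nlinarith [abs_nonneg (t' - t)]
  refine hrel t ht t' ht' (fun i j => (hmix t ht t' ht' i j).trans ?_) fun i =>
    (htime t ht t' ht' i).trans (hlt.trans (mul_le_of_le_one_left hκ.le (min_le_left _ _)))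
  rcases le_or_gt 0 (d i j) with hd | hd
  · have h2 : M * |t' - t| ≤ c * κ := hlt.trans (by gcongr; exact min_le_right _ _)
    nlinarith [hanti i j, mul_le_mul_of_nonneg_right h2 hd]
  · exact (mul_nonpos_of_nonneg_of_nonpos (by positivity) hd.le).trans (by positivity)

/-- Straight-line version of `rel_of_path`. -/
theorem rel_of_linear_path {ι : Type*} [Nonempty ι] {Rel : (ι → E3) → (ι → E3) → Prop}
    (hs : ∀ γ δ, Rel γ δ → Rel δ γ) (ht : ∀ γ δ ε, Rel γ δ → Rel δ ε → Rel γ ε) (d : ι → ι → ℝ)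
    (γ δ : ι → E3) {M κ : ℝ} (hκ : 0 < κ)
    (hrel : ∀ t ∈ Icc (0 : ℝ) 1, ∀ t' ∈ Icc (0 : ℝ) 1, ∀ γ' δ' : ι → E3,
      (γ' = fun i => γ i + t • (δ i - γ i)) → (δ' = fun i => γ i + t' • (δ i - γ i)) →
      (∀ i j, ‖(δ' i - γ' i) - (δ' j - γ' j)‖ ≤ κ * ‖γ' i - γ' j‖) →
      (∀ i, ‖δ' i - γ' i‖ ≤ κ) → Rel γ' δ')
    (hanti : ∀ t ∈ Icc (0 : ℝ) 1, ∃ c > 0, ∀ i j,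
      c * d i j ≤ ‖(γ i + t • (δ i - γ i)) - (γ j + t • (δ j - γ j))‖)
    (hmix : ∀ i j, ‖(δ i - γ i) - (δ j - γ j)‖ ≤ M * d i j) (hbd : ∀ i, ‖δ i - γ i‖ ≤ M) :
    Rel γ δ := by
  have e : ∀ (i : ι) (t t' : ℝ),
      γ i + t' • (δ i - γ i) - (γ i + t • (δ i - γ i)) = (t' - t) • (δ i - γ i) :=
    fun i t t' => by module
  have := rel_of_path hs ht d (fun t i => γ i + t • (δ i - γ i)) (M := M) hκ
    (fun t ht t' ht' => hrel t ht t' ht' _ _ rfl rfl) hanti (fun t _ t' _ i j => by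
      rw [e, e, ← smul_sub, norm_smul, Real.norm_eq_abs]
      linarith [mul_le_mul_of_nonneg_left (hmix i j) (abs_nonneg (t' - t))]) fun t _ t' _ i => by
      rw [e, norm_smul, Real.norm_eq_abs]
      linarith [mul_le_mul_of_nonneg_left (hbd i) (abs_nonneg (t' - t))]
  simpa using this

/-- A linear motion of a bounded parametrized set is realized by an ambient isotopy if the set stays
embedded, as measured from below by a comparison function `d` that bounds the variation of the
displacement from above. -/
theorem ambientIsotopic_of_linear_path {ι : Type*} [Nonempty ι] (d : ι → ι → ℝ) (γ δ : ι → E3)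
    {M : ℝ} (hγ : ∀ i, ‖γ i‖ ≤ M) (hδ : ∀ i, ‖δ i‖ ≤ M)
    (hanti : ∀ t ∈ Icc (0 : ℝ) 1, ∃ c > 0, ∀ i j,
      c * d i j ≤ ‖(γ i + t • (δ i - γ i)) - (γ j + t • (δ j - γ j))‖)
    (hmix : ∀ i j, ‖(δ i - γ i) - (δ j - γ j)‖ ≤ M * d i j) :
    AmbientIsotopic (toS3 '' range γ) (toS3 '' range δ) := by
  have hd : ∀ i, ‖δ i - γ i‖ ≤ 2 * M := fun i => by linarith [norm_sub_le (δ i) (γ i), hγ i, hδ i]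
  refine rel_of_linear_path (Rel := fun γ δ => AmbientIsotopic (toS3 '' range γ) (toS3 '' range δ))
    (fun _ _ h => h.symm) (fun _ _ _ h h' => h.trans h') d γ δ (M := 2 * M)
    (by norm_num : (0 : ℝ) < 1 / 4) ?_ hanti (fun i j => ?_) hd
  · rintro t ht t' - _ _ rfl rfl h1 h2
    refine ambientIsotopic_of_small_displacement _ _ (R := 3 * M) (fun i => ?_) h1 h2
    refine (norm_add_le _ _).trans ?_
    rw [norm_smul, Real.norm_of_nonneg ht.1]
    nlinarith [hγ i, ht.2, norm_nonneg (δ i - γ i), hd i]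
  · linarith [hmix i j, (norm_nonneg _).trans (hmix i j)]

/-! ### Triangle moves -/

/-- The coefficient of `u` is controlled by the norm modulo the line through `v`. -/
theorem exists_norm_add_smul_ge {u v : E3} (h : ∀ s : ℝ, u ≠ s • v) :
    ∃ c > 0, ∀ α β : ℝ, c * |α| ≤ ‖α • u + β • v‖ := by
  -- `n` is the component of `u` orthogonal to `v`
  let n := u - (inner ℝ u v / inner ℝ v v) • v
  have hn : n ≠ 0 := sub_ne_zero.2 (h _)
  have hnv : inner ℝ n v = 0 := by
    simp only [n, inner_sub_left, inner_smul_left, conj_trivial]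
    rcases eq_or_ne v 0 with rfl | hv
    · simp
    · have : inner ℝ v v ≠ 0 := by simpa using hv
      field_simp
      ring
  have hnu : inner ℝ n u = ‖n‖ ^ 2 := by
    have : u = n + (inner ℝ u v / inner ℝ v v) • v := by simp [n]
    conv_lhs => rw [this]
    rw [inner_add_right, inner_smul_right, hnv, real_inner_self_eq_norm_sq]
    ring
  have hn0 : 0 < ‖n‖ := norm_pos_iff.2 hn
  refine ⟨‖n‖, hn0, fun α β => ?_⟩
  have h1 := abs_real_inner_le_norm n (α • u + β • v)
  rw [inner_add_right, inner_smul_right, inner_smul_right, hnv, hnu, mul_zero, add_zero, abs_mul,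
    abs_of_nonneg (sq_nonneg ‖n‖)] at h1
  nlinarith

/-- The key estimate behind triangle moves: the tent `a, m + t (d - m), b` over the segment `[a, b]`
may be raised from `t = 0` to `t = 1` when the rest `R` of the set stays away from the triangle at
a positive angle. -/
theorem ambientIsotopic_triangle_of_separated {a b d : E3}
    (hind : ∀ s t : ℝ, s • (b - a) + t • (d - a) = 0 → s = 0 ∧ t = 0) {R : Set E3}
    (hR : IsCompact R) {c : ℝ} (hc : 0 < c)
    (hsep : ∀ y ∈ R, ∀ x ∈ convexHull ℝ {a, b, d}, c * min ‖x - a‖ ‖x - b‖ ≤ ‖x - y‖) :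
    AmbientIsotopic (toS3 '' (R ∪ segment ℝ a b))
      (toS3 '' (R ∪ (segment ℝ a d ∪ segment ℝ d b))) := by
  classical
  have hab : b - a ≠ 0 := by
    intro h
    have := (hind 1 0 (by rw [h]; simp)).1
    norm_num at this
  set L := ‖b - a‖ with hL
  have hL0 : 0 < L := norm_pos_iff.2 hab
  set v : E3 := d - midpoint ℝ a b with hv
  have hmid : midpoint ℝ a b = (1 / 2 : ℝ) • a + (1 / 2 : ℝ) • b := by
    rw [midpoint_eq_smul_add, smul_add]
    norm_num
  obtain ⟨c0, hc0, hc0'⟩ := exists_norm_add_smul_ge (u := b - a) (v := v) (by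
    intro s hs
    have h2 : (1 + s / 2) • (b - a) + (-s) • (d - a) = 0 := by
      rw [hv, hmid] at hs
      have : b - a - s • (d - ((1 / 2 : ℝ) • a + (1 / 2 : ℝ) • b)) = 0 := sub_eq_zero.2 hs
      rw [← this]
      module
    obtain ⟨h3, h4⟩ := hind _ _ h2
    linarith)
  -- `τ` is the tent function of the segment, extended by zero; `γ t` is the motion at time `t`
  let μ : E3 → ℝ := fun y => min ‖y - a‖ ‖y - b‖
  let τ : E3 → ℝ := fun y => if y ∈ segment ℝ a b then 2 / L * μ y else 0
  have hμ0 : ∀ y, 0 ≤ μ y := fun y => le_min (norm_nonneg _) (norm_nonneg _)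
  have hμl : ∀ y y', |μ y - μ y'| ≤ ‖y - y'‖ := by
    intro y y'
    refine (abs_min_sub_min_le_max _ _ _ _).trans (max_le ?_ ?_)
    · refine (abs_norm_sub_norm_le _ _).trans (by rw [sub_sub_sub_cancel_right])
    · refine (abs_norm_sub_norm_le _ _).trans (by rw [sub_sub_sub_cancel_right])
  have hseg : ∀ y ∈ segment ℝ a b, ∃ l ∈ Icc (0 : ℝ) 1, y = a + l • (b - a) := by
    intro y hy
    rw [segment_eq_image'] at hy
    obtain ⟨l, hl, rfl⟩ := hy
    exact ⟨l, hl, rfl⟩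
  have hsegm : ∀ l ∈ Icc (0 : ℝ) 1, a + l • (b - a) ∈ segment ℝ a b := by
    intro l hl
    rw [segment_eq_image']
    exact ⟨l, hl, rfl⟩
  have hμs : ∀ l ∈ Icc (0 : ℝ) 1, μ (a + l • (b - a)) = min l (1 - l) * L := by
    intro l hl
    simp only [μ]
    have e1 : a + l • (b - a) - a = l • (b - a) := by abel
    have e2 : a + l • (b - a) - b = (-(1 - l)) • (b - a) := by module
    rw [e1, e2, norm_smul, norm_smul, norm_neg, Real.norm_of_nonneg hl.1,
      Real.norm_of_nonneg (by linarith [hl.2]), min_mul_of_nonneg _ _ hL0.le]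
  have hτs : ∀ l ∈ Icc (0 : ℝ) 1, τ (a + l • (b - a)) = 2 * min l (1 - l) := by
    intro l hl
    simp only [τ]
    rw [if_pos (hsegm l hl), hμs l hl]
    field_simp
  have hτ0 : ∀ y, 0 ≤ τ y := by
    intro y
    simp only [τ]
    split_ifs
    · have := hμ0 y; positivity
    · exact le_rfl
  have hτ1 : ∀ y ∈ segment ℝ a b, τ y ≤ 1 := by
    intro y hy
    obtain ⟨l, hl, rfl⟩ := hseg y hy
    rw [hτs l hl]
    linarith [min_le_left l (1 - l), min_le_right l (1 - l)]
  have hτle : ∀ y, τ y ≤ 2 / L * μ y := by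
    intro y
    simp only [τ]
    split_ifs
    · exact le_rfl
    · have := hμ0 y; positivity
  let γ : ℝ → E3 → E3 := fun t y => y + (t * τ y) • v
  have haseg : a ∈ segment ℝ a b := left_mem_segment ℝ a b
  have hbseg : b ∈ segment ℝ a b := right_mem_segment ℝ a b
  have hτa : τ a = 0 := by simp [τ, μ]
  have hτb : τ b = 0 := by simp [τ, μ]
  have htri : ∀ y ∈ segment ℝ a b, τ y ≤ 1 →
      (y + τ y • v ∈ segment ℝ a d ∪ segment ℝ d b) := by
    intro y hy _
    obtain ⟨l, hl, rfl⟩ := hseg y hy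
    rw [hτs l hl, hv, hmid]
    rcases le_total l (1 - l) with h | h
    · left
      rw [min_eq_left h, segment_eq_image']
      refine ⟨2 * l, ⟨by linarith [hl.1], by linarith⟩, ?_⟩
      module
    · right
      rw [min_eq_right h, segment_eq_image']
      refine ⟨2 * l - 1, ⟨by linarith, by linarith [hl.2]⟩, ?_⟩
      module
  have hconv : Convex ℝ (convexHull ℝ {a, b, d}) := convex_convexHull ℝ _
  have ha' : a ∈ convexHull ℝ {a, b, d} := subset_convexHull ℝ _ (by simp)
  have hb' : b ∈ convexHull ℝ {a, b, d} := subset_convexHull ℝ _ (by simp)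
  have hd' : d ∈ convexHull ℝ {a, b, d} := subset_convexHull ℝ _ (by simp)
  have hγtri : ∀ t ∈ Icc (0 : ℝ) 1, ∀ y ∈ segment ℝ a b, γ t y ∈ convexHull ℝ {a, b, d} := by
    intro t ht y hy
    have h1 : y ∈ convexHull ℝ {a, b, d} := hconv.segment_subset ha' hb' hy
    have h2 : y + τ y • v ∈ convexHull ℝ {a, b, d} := by
      rcases htri y hy (hτ1 y hy) with h | h
      · exact hconv.segment_subset ha' hd' h
      · exact hconv.segment_subset hd' hb' h
    have := hconv.add_smul_sub_mem h1 h2 ht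
    simpa [γ, mul_smul] using this
  -- the points that `R` and the segment have in common are end points, so `R` does not move
  have hRτ : ∀ y ∈ R, τ y = 0 := by
    intro y hy
    by_cases hys : y ∈ segment ℝ a b
    · have h1 := hsep y hy y (hconv.segment_subset ha' hb' hys)
      rw [sub_self, norm_zero] at h1
      have h2 : μ y ≤ 0 := by
        by_contra h
        push Not at h
        have : 0 < c * μ y := by positivity
        simp only [μ] at this
        linarith
      have h3 := hτle y
      have h4 : 2 / L * μ y ≤ 0 := mul_nonpos_of_nonneg_of_nonpos (by positivity) h2
      linarith [hτ0 y]
    · simp [τ, hys]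
  -- the tent map is uniformly antilipschitz on the segment
  have hanti1 : ∀ t : ℝ, ∀ y ∈ segment ℝ a b, ∀ y' ∈ segment ℝ a b,
      c0 / L * ‖y - y'‖ ≤ ‖γ t y - γ t y'‖ := by
    intro t y hy y' hy'
    obtain ⟨l, hl, rfl⟩ := hseg y hy
    obtain ⟨l', hl', rfl⟩ := hseg y' hy'
    have e1 : a + l • (b - a) - (a + l' • (b - a)) = (l - l') • (b - a) := by module
    have e2 : γ t (a + l • (b - a)) - γ t (a + l' • (b - a)) = (l - l') • (b - a) +
      (t * τ (a + l • (b - a)) - t * τ (a + l' • (b - a))) • v := by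
      simp only [γ]
      module
    rw [e2, e1, norm_smul, Real.norm_eq_abs, ← hL]
    refine le_trans (le_of_eq ?_) (hc0' _ _)
    field_simp
  have hγa : ∀ t, γ t a = a := by intro t; simp [γ, hτa]
  have hγb : ∀ t, γ t b = b := by intro t; simp [γ, hτb]
  have hμγ : ∀ t, ∀ y ∈ segment ℝ a b, c0 / L * μ y ≤ min ‖γ t y - a‖ ‖γ t y - b‖ := by
    intro t y hy
    have h1 := hanti1 t y hy a haseg
    have h2 := hanti1 t y hy b hbseg
    rw [hγa] at h1
    rw [hγb] at h2
    refine le_min (le_trans ?_ h1) (le_trans ?_ h2)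
    · gcongr; exact min_le_left _ _
    · gcongr; exact min_le_right _ _
  set c1 := c * (c0 / L) with hc1
  have hc1p : 0 < c1 := by positivity
  -- separation of the moving segment from the rest
  have hRs : ∀ t ∈ Icc (0 : ℝ) 1, ∀ y ∈ R, ∀ y' ∈ segment ℝ a b,
      c1 * μ y' ≤ ‖γ t y' - y‖ := by
    intro t ht y hy y' hy'
    refine le_trans ?_ (hsep y hy _ (hγtri t ht y' hy'))
    rw [hc1, mul_assoc]
    gcongr
    exact hμγ t y' hy'
  -- a point near the ends of the segment moves little, which bounds distances to `R` after the motion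
  -- by the distances before it
  set k := 2 / L * ‖v‖ with hk
  have hk0 : 0 ≤ k := by positivity
  have hmove : ∀ t ∈ Icc (0 : ℝ) 1, ∀ y, ‖γ t y - y‖ ≤ k * μ y := by
    intro t ht y
    have e : γ t y - y = (t * τ y) • v := by simp [γ]
    rw [e, norm_smul, Real.norm_of_nonneg (mul_nonneg ht.1 (hτ0 y))]
    have h1 : t * τ y ≤ 2 / L * μ y := by
      have := hτle y
      have h0 := hτ0 y
      nlinarith [ht.2]
    calc t * τ y * ‖v‖ ≤ 2 / L * μ y * ‖v‖ := by gcongr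
      _ = k * μ y := by rw [hk]; ring
  have hRs' : ∀ t ∈ Icc (0 : ℝ) 1, ∀ y ∈ R, ∀ y' ∈ segment ℝ a b,
      c1 / (c1 + k) * ‖y' - y‖ ≤ ‖γ t y' - y‖ := by
    intro t ht y hy y' hy'
    have h1 := hRs t ht y hy y' hy'
    have h2 := hmove t ht y'
    have h3 : ‖y' - y‖ ≤ ‖γ t y' - y‖ + ‖γ t y' - y'‖ := by
      rw [norm_sub_rev (γ t y') y', add_comm]
      exact norm_sub_le_norm_sub_add_norm_sub _ _ _
    rw [div_mul_eq_mul_div, div_le_iff₀ (by positivity)]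
    have h4 : c1 * ‖y' - y‖ ≤ c1 * (‖γ t y' - y‖ + ‖γ t y' - y'‖) := by gcongr
    have h5 : k * (c1 * μ y') ≤ k * ‖γ t y' - y‖ := by gcongr
    nlinarith
  have hτlip : ∀ i ∈ R ∪ segment ℝ a b, ∀ j ∈ R ∪ segment ℝ a b,
      |τ i - τ j| ≤ (2 / L + 2 / L / c1) * ‖i - j‖ := by
    have hmixed : ∀ i ∈ R, ∀ j ∈ segment ℝ a b, |τ i - τ j| ≤ (2 / L + 2 / L / c1) * ‖i - j‖ := by
      intro i hi j hj
      rw [hRτ i hi, zero_sub, abs_neg, abs_of_nonneg (hτ0 j)]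
      have h1 := hRs 0 (by simp) i hi j hj
      have e : γ 0 j = j := by simp [γ]
      rw [e, norm_sub_rev] at h1
      calc τ j ≤ 2 / L * μ j := hτle j
        _ = 2 / L / c1 * (c1 * μ j) := by field_simp
        _ ≤ 2 / L / c1 * ‖i - j‖ := by gcongr
        _ ≤ _ := by
          gcongr
          have : 0 < 2 / L := by positivity
          linarith
    rintro i (hi | hi) j (hj | hj)
    · rw [hRτ i hi, hRτ j hj]
      simp only [sub_self, abs_zero]
      positivity
    · exact hmixed i hi j hj
    · rw [abs_sub_comm, norm_sub_rev]
      exact hmixed j hj i hi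
    · simp only [τ, if_pos hi, if_pos hj]
      rw [← mul_sub, abs_mul, abs_of_pos (by positivity : 0 < 2 / L)]
      have := hμl i j
      have h2 : 0 ≤ 2 / L / c1 * ‖i - j‖ := by positivity
      nlinarith [mul_le_mul_of_nonneg_left this (by positivity : 0 ≤ 2 / L)]
  have hScomp : IsCompact (R ∪ segment ℝ a b) := by
    refine hR.union ?_
    rw [segment_eq_image']
    exact isCompact_Icc.image (by fun_prop)
  obtain ⟨B, hB⟩ := hScomp.isBounded.exists_norm_le
  have hB0 : 0 ≤ B := (norm_nonneg a).trans (hB a (Or.inr haseg))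
  set Kτ := 2 / L + 2 / L / c1 with hKτ
  have hKτ0 : 0 ≤ Kτ := by positivity
  have hτ1' : ∀ y ∈ R ∪ segment ℝ a b, τ y ≤ 1 := by
    rintro y (hy | hy)
    · rw [hRτ y hy]; norm_num
    · exact hτ1 y hy
  have hne : Nonempty ↥(R ∪ segment ℝ a b) := ⟨⟨a, Or.inr haseg⟩⟩
  have e1 : ∀ t (i : E3), i + t • (γ 1 i - i) = γ t i := fun t i => by simp only [γ]; module
  have main := ambientIsotopic_of_linear_path (fun i j : ↥(R ∪ segment ℝ a b) => ‖(i : E3) - j‖)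
    (fun i => i.1) (fun i => γ 1 i) (M := B + ‖v‖ + Kτ * ‖v‖) (fun i => by
      linarith [hB i i.2, norm_nonneg v, mul_nonneg hKτ0 (norm_nonneg v)]) (fun i => by
      have h2 : ‖(1 * τ i) • v‖ ≤ ‖v‖ := by
        rw [one_mul, norm_smul, Real.norm_of_nonneg (hτ0 i)]
        exact mul_le_of_le_one_left (norm_nonneg v) (hτ1' i i.2)
      linarith [norm_add_le (i : E3) ((1 * τ i) • v), hB i i.2, mul_nonneg hKτ0 (norm_nonneg v)])
      (by
      intro t ht
      simp only [e1]
      have hR' : ∀ i ∈ R, γ t i = i := fun i hi => by simp [γ, hRτ i hi]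
      refine ⟨min 1 (min (c0 / L) (c1 / (c1 + k))), by positivity, ?_⟩
      rintro ⟨i, hi | hi⟩ ⟨j, hj | hj⟩ <;> simp only
      · rw [hR' i hi, hR' j hj]
        exact mul_le_of_le_one_left (norm_nonneg _) (min_le_left _ _)
      · rw [hR' i hi, norm_sub_rev i j, norm_sub_rev i]
        refine le_trans ?_ (hRs' t ht i hi j hj)
        gcongr
        exact (min_le_right _ _).trans (min_le_right _ _)
      · rw [hR' j hj]
        refine le_trans ?_ (hRs' t ht j hj i hi)
        gcongr
        exact (min_le_right _ _).trans (min_le_right _ _)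
      · refine le_trans ?_ (hanti1 t i hi j hj)
        gcongr
        exact (min_le_right _ _).trans (min_le_left _ _)) (fun i j => by
      have e : γ 1 i - i - (γ 1 j - j) = (τ i - τ j) • v := by
        simp only [γ]
        module
      rw [e, norm_smul, Real.norm_eq_abs]
      calc |τ i - τ j| * ‖v‖ ≤ Kτ * ‖(i : E3) - j‖ * ‖v‖ := by gcongr; exact hτlip i i.2 j j.2
        _ = (Kτ * ‖v‖) * ‖(i : E3) - j‖ := by ring
        _ ≤ _ := by gcongr; linarith [norm_nonneg v])
  have hr1 : range (fun i : ↥(R ∪ segment ℝ a b) => γ 1 i) =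
      R ∪ (segment ℝ a d ∪ segment ℝ d b) := by
    ext x
    constructor
    · rintro ⟨⟨i, hi | hi⟩, rfl⟩
      · left
        simpa [γ, hRτ i hi] using hi
      · right
        simpa [γ] using htri i hi (hτ1 i hi)
    · rintro (hx | hx | hx)
      · exact ⟨⟨x, Or.inl hx⟩, by simp [γ, hRτ x hx]⟩
      · rw [segment_eq_image'] at hx
        obtain ⟨l, hl, rfl⟩ := hx
        have hl2 : l / 2 ∈ Icc (0 : ℝ) 1 := ⟨by linarith [hl.1], by linarith [hl.2]⟩
        refine ⟨⟨a + (l / 2) • (b - a), Or.inr (hsegm _ hl2)⟩, ?_⟩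
        simp only [γ]
        rw [hτs _ hl2, min_eq_left (by linarith [hl.2]), hv, hmid]
        module
      · rw [segment_eq_image'] at hx
        obtain ⟨l, hl, rfl⟩ := hx
        have hl2 : (1 + l) / 2 ∈ Icc (0 : ℝ) 1 := ⟨by linarith [hl.1], by linarith [hl.2]⟩
        refine ⟨⟨a + ((1 + l) / 2) • (b - a), Or.inr (hsegm _ hl2)⟩, ?_⟩
        simp only [γ]
        rw [hτs _ hl2, min_eq_right (by linarith [hl.1]), hv, hmid]
        module
  rwa [Subtype.range_coe, hr1] at main

/-- A segment that issues from the vertex `a` of a triangle and has no other point in common with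
it leaves the triangle at a positive angle. -/
theorem segment_separated_from_triangle {a b d q : E3}
    (hind : ∀ s t : ℝ, s • (b - a) + t • (d - a) = 0 → s = 0 ∧ t = 0)
    (h : ∀ x ∈ segment ℝ a q, x ∈ convexHull ℝ {a, b, d} → x = a) :
    ∃ c > 0, ∀ y ∈ segment ℝ a q, ∀ x ∈ convexHull ℝ {a, b, d}, c * ‖x - a‖ ≤ ‖x - y‖ := by
  rcases eq_or_ne q a with rfl | hq
  · refine ⟨1, one_pos, fun y hy x _ => ?_⟩
    rw [segment_same, mem_singleton_iff] at hy
    rw [hy, one_mul]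
  -- points of the triangle are `a + l (z - a)` with `z` on the opposite side
  have hz : ∀ z ∈ segment ℝ b d, z ∈ convexHull ℝ {a, b, d} := fun z hz =>
    (convex_convexHull ℝ _).segment_subset (subset_convexHull ℝ _ (by simp))
      (subset_convexHull ℝ _ (by simp)) hz
  have hza : ∀ z ∈ segment ℝ b d, z ≠ a := by
    rintro z hzm rfl
    rw [segment_eq_image'] at hzm
    obtain ⟨l, -, hl⟩ := hzm
    simp only at hl
    have : (1 - l) • (b - z) + l • (d - z) = 0 := by
      have h0 : b + l • (d - b) - z = 0 := sub_eq_zero.2 hl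
      rw [← h0]
      module
    obtain ⟨h1, h2⟩ := hind _ _ this
    linarith
  have hcomp : IsCompact (segment ℝ b d) := by
    rw [segment_eq_image']
    exact isCompact_Icc.image (by fun_prop)
  -- by homogeneity it suffices to bound `‖l (z - a) - m (q - a)‖` from below for `l + m = 1`, where
  -- its minimum is attained and does not vanish
  let Q : Set (ℝ × E3) := Icc 0 1 ×ˢ segment ℝ b d
  have hQ : IsCompact Q := isCompact_Icc.prod hcomp
  have hQne : Q.Nonempty := ⟨(0, b), by simp, left_mem_segment ℝ _ _⟩
  let F : ℝ × E3 → ℝ := fun p => ‖p.1 • (p.2 - a) - (1 - p.1) • (q - a)‖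
  obtain ⟨p0, hp0, hmin⟩ := hQ.exists_isMinOn hQne (f := F) (by fun_prop)
  have hF0 : 0 < F p0 := by
    refine norm_pos_iff.2 fun h0 => ?_
    obtain ⟨⟨hl0, hl1⟩, hz0⟩ := hp0
    have e := sub_eq_zero.1 h0
    have hx1 : a + p0.1 • (p0.2 - a) ∈ convexHull ℝ {a, b, d} :=
      (convex_convexHull ℝ _).add_smul_sub_mem (subset_convexHull ℝ _ (by simp)) (hz _ hz0)
        ⟨hl0, hl1⟩
    have hx2 : a + p0.1 • (p0.2 - a) ∈ segment ℝ a q := by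
      rw [e, segment_eq_image']
      exact ⟨1 - p0.1, ⟨by linarith, by linarith⟩, rfl⟩
    have h3 := h _ hx2 hx1
    have h4 : p0.1 • (p0.2 - a) = 0 := by simpa using h3
    have h5 : (1 - p0.1) • (q - a) = 0 := by rw [← e, h4]
    rw [smul_eq_zero] at h4 h5
    rcases h4 with h4 | h4
    · rcases h5 with h5 | h5
      · linarith
      · exact hq (sub_eq_zero.1 h5)
    · exact hza _ hz0 (sub_eq_zero.1 h4)
  obtain ⟨B, hB⟩ := hcomp.isBounded.exists_norm_le
  have hB0 : 0 ≤ B := (norm_nonneg b).trans (hB b (left_mem_segment ℝ _ _))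
  refine ⟨F p0 / (B + ‖a‖ + 1), by positivity, fun y hy x hx => ?_⟩
  rw [segment_eq_image'] at hy
  obtain ⟨m, hm, rfl⟩ := hy
  have hx' : ∃ l ∈ Icc (0 : ℝ) 1, ∃ z ∈ segment ℝ b d, x = a + l • (z - a) := by
    rw [convexHull_insert (by simp), convexHull_pair, mem_convexJoin] at hx
    obtain ⟨w, hw, z, hzm, hxz⟩ := hx
    rw [mem_singleton_iff] at hw
    subst hw
    rw [segment_eq_image'] at hxz
    obtain ⟨l, hl, rfl⟩ := hxz
    exact ⟨l, hl, z, hzm, rfl⟩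
  obtain ⟨l, hl, z, hz, rfl⟩ := hx'
  have e1 : a + l • (z - a) - (a + m • (q - a)) = l • (z - a) - m • (q - a) := by abel
  have e2 : a + l • (z - a) - a = l • (z - a) := by abel
  simp only
  rw [e1, e2, norm_smul, Real.norm_of_nonneg hl.1, div_mul_eq_mul_div,
    div_le_iff₀ (by positivity)]
  have hzn : ‖z - a‖ ≤ B + ‖a‖ + 1 := by
    have := norm_sub_le z a
    linarith [hB z hz]
  have hF : F p0 * (l + m) ≤ ‖l • (z - a) - m • (q - a)‖ := by
    rcases eq_or_lt_of_le (add_nonneg hl.1 hm.1) with h0 | h0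
    · rw [← h0, mul_zero]
      positivity
    · have h1 : (l / (l + m), z) ∈ Q := by
        refine ⟨⟨by have := hl.1; positivity, ?_⟩, hz⟩
        rw [div_le_one h0]
        linarith [hm.1]
      have h2 : F p0 ≤ F (l / (l + m), z) := hmin h1
      have h3 : l • (z - a) - m • (q - a) =
          (l + m) • ((l / (l + m)) • (z - a) - (1 - l / (l + m)) • (q - a)) := by
        have e3 : (l + m) * (l / (l + m)) = l := mul_div_cancel₀ _ h0.ne'
        rw [smul_sub (l + m), smul_smul, smul_smul, mul_sub, e3, mul_one, add_sub_cancel_left]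
      rw [h3, norm_smul, Real.norm_of_nonneg h0.le, mul_comm]
      gcongr
  calc F p0 * (l * ‖z - a‖) ≤ F p0 * ((l + m) * (B + ‖a‖ + 1)) := by
        gcongr
        · linarith [hl.1, hm.1]
        · linarith [hm.1]
    _ = F p0 * (l + m) * (B + ‖a‖ + 1) := by ring
    _ ≤ _ := by gcongr

/-- Triangle move: in a finite union of segments, the side `[a, b]` of a triangle may be replaced by
the other two sides if the other segments meet the triangle at most in `a` and `b`, and only with
their end points. -/
theorem ambientIsotopic_triangle_move {a b d : E3}
    (hind : ∀ s t : ℝ, s • (b - a) + t • (d - a) = 0 → s = 0 ∧ t = 0) {σ : Set (E3 × E3)}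
    (hσ : σ.Finite)
    (h : ∀ e ∈ σ, ∀ x ∈ segment ℝ e.1 e.2, x ∈ convexHull ℝ {a, b, d} →
      (x = a ∨ x = b) ∧ (x = e.1 ∨ x = e.2)) :
    AmbientIsotopic (toS3 '' ((⋃ e ∈ σ, segment ℝ e.1 e.2) ∪ segment ℝ a b))
      (toS3 '' ((⋃ e ∈ σ, segment ℝ e.1 e.2) ∪ (segment ℝ a d ∪ segment ℝ d b))) := by
  have hcs : ∀ p q : E3, IsCompact (segment ℝ p q) := fun p q => by
    rw [segment_eq_image']
    exact isCompact_Icc.image (by fun_prop)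
  have hct : IsCompact (convexHull ℝ {a, b, d}) :=
    (by simp : Set.Finite ({a, b, d} : Set E3)).isCompact_convexHull (𝕜 := ℝ)
  have hind' : ∀ s t : ℝ, s • (a - b) + t • (d - b) = 0 → s = 0 ∧ t = 0 := by
    intro s t hst
    have : (-s - t) • (b - a) + t • (d - a) = 0 := by
      rw [← hst]
      module
    obtain ⟨h1, h2⟩ := hind _ _ this
    exact ⟨by linarith, h2⟩
  have hperm : ({b, a, d} : Set E3) = {a, b, d} := insert_comm _ _ _
  have hmemab : segment ℝ a b ⊆ convexHull ℝ {a, b, d} :=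
    (convex_convexHull ℝ _).segment_subset (subset_convexHull ℝ _ (by simp))
      (subset_convexHull ℝ _ (by simp))
  have hab : a ≠ b := by
    rintro rfl
    have := (hind 1 0 (by simp)).1
    norm_num at this
  -- each single segment is separated from the triangle
  have key : ∀ e ∈ σ, ∃ c > 0, ∀ y ∈ segment ℝ e.1 e.2, ∀ x ∈ convexHull ℝ {a, b, d},
      c * min ‖x - a‖ ‖x - b‖ ≤ ‖x - y‖ := by
    intro e he
    have hnot : ¬ (a ∈ segment ℝ e.1 e.2 ∧ b ∈ segment ℝ e.1 e.2) := by
      rintro ⟨ha, hb⟩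
      have hm : midpoint ℝ a b ∈ segment ℝ a b := midpoint_mem_segment a b
      have := (h e he _ ((convex_segment e.1 e.2).segment_subset ha hb hm) (hmemab hm)).1
      rcases this with h1 | h1
      · exact hab ((midpoint_eq_left_iff ℝ).1 h1)
      · exact hab ((midpoint_eq_right_iff ℝ).1 h1)
    -- a segment that meets the triangle does so in exactly one of `a` and `b`, as its end point
    have fromA : ∀ q, segment ℝ a q = segment ℝ e.1 e.2 → ∃ c > 0, ∀ y ∈ segment ℝ e.1 e.2,
        ∀ x ∈ convexHull ℝ {a, b, d}, c * min ‖x - a‖ ‖x - b‖ ≤ ‖x - y‖ := by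
      intro q hq
      have ha : a ∈ segment ℝ e.1 e.2 := hq ▸ left_mem_segment ℝ a q
      obtain ⟨c, hc, hc'⟩ := segment_separated_from_triangle (q := q) hind (by
        intro x hx hx'
        rw [hq] at hx
        rcases (h e he x hx hx').1 with rfl | rfl
        · rfl
        · exact absurd ⟨ha, hx⟩ hnot)
      refine ⟨c, hc, fun y hy x hx => le_trans ?_ (hc' y (hq ▸ hy) x hx)⟩
      gcongr
      exact min_le_left _ _
    have fromB : ∀ q, segment ℝ b q = segment ℝ e.1 e.2 → ∃ c > 0, ∀ y ∈ segment ℝ e.1 e.2,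
        ∀ x ∈ convexHull ℝ {a, b, d}, c * min ‖x - a‖ ‖x - b‖ ≤ ‖x - y‖ := by
      intro q hq
      have hb : b ∈ segment ℝ e.1 e.2 := hq ▸ left_mem_segment ℝ b q
      obtain ⟨c, hc, hc'⟩ := segment_separated_from_triangle (q := q) hind' (by
        intro x hx hx'
        rw [hq] at hx
        rw [hperm] at hx'
        rcases (h e he x hx hx').1 with rfl | rfl
        · exact absurd ⟨hx, hb⟩ hnot
        · rfl)
      refine ⟨c, hc, fun y hy x hx => le_trans ?_ (hc' y (hq ▸ hy) x (by rwa [hperm]))⟩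
      gcongr
      exact min_le_right _ _
    by_cases hdis : ∃ x ∈ segment ℝ e.1 e.2, x ∈ convexHull ℝ {a, b, d}
    · obtain ⟨x, hx, hx'⟩ := hdis
      obtain ⟨h1, h2⟩ := h e he x hx hx'
      rcases h1 with rfl | rfl <;> rcases h2 with h2 | h2
      · exact fromA e.2 (by rw [h2])
      · exact fromA e.1 (by rw [h2, segment_symm])
      · exact fromB e.2 (by rw [h2])
      · exact fromB e.1 (by rw [h2, segment_symm])
    · push Not at hdis
      obtain ⟨r, hr, hr'⟩ := (disjoint_left.2 hdis).exists_thickenings (hcs e.1 e.2) hct.isClosed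
      obtain ⟨B, hB⟩ := hct.isBounded.exists_norm_le
      have hB0 : 0 ≤ B := (norm_nonneg a).trans (hB a (subset_convexHull ℝ _ (by simp)))
      refine ⟨r / (B + ‖a‖ + 1), by positivity, fun y hy x hx => ?_⟩
      have h1 : r ≤ ‖x - y‖ := by
        by_contra hlt
        push Not at hlt
        have hx1 : x ∈ Metric.thickening r (segment ℝ e.1 e.2) := by
          rw [Metric.mem_thickening_iff]
          exact ⟨y, hy, by rwa [dist_eq_norm]⟩
        exact Set.disjoint_left.1 hr' hx1 (Metric.self_subset_thickening hr _ hx)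
      refine le_trans ?_ h1
      rw [div_mul_eq_mul_div, div_le_iff₀ (by positivity)]
      gcongr
      refine (min_le_left _ _).trans ((norm_sub_le _ _).trans ?_)
      linarith [hB x hx]
  -- a common constant
  have hall : ∃ c > 0, ∀ e ∈ σ, ∀ y ∈ segment ℝ e.1 e.2, ∀ x ∈ convexHull ℝ {a, b, d},
      c * min ‖x - a‖ ‖x - b‖ ≤ ‖x - y‖ := by
    clear h
    induction σ, hσ using Set.Finite.induction_on with
    | empty => exact ⟨1, one_pos, by simp⟩
    | @insert e s _ _ ih =>
      obtain ⟨c1, hc1, h1⟩ := ih (fun e he => key e (mem_insert_of_mem _ he))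
      obtain ⟨c2, hc2, h2⟩ := key e (mem_insert _ _)
      refine ⟨min c1 c2, lt_min hc1 hc2, ?_⟩
      intro e' he' y hy x hx
      have h0 : 0 ≤ min ‖x - a‖ ‖x - b‖ := le_min (norm_nonneg _) (norm_nonneg _)
      rcases he' with rfl | he'
      · exact le_trans (mul_le_mul_of_nonneg_right (min_le_right _ _) h0) (h2 y hy x hx)
      · exact le_trans (mul_le_mul_of_nonneg_right (min_le_left _ _) h0) (h1 e' he' y hy x hx)
  obtain ⟨c, hc, hsep⟩ := hall
  refine ambientIsotopic_triangle_of_separated hind (hσ.isCompact_biUnion fun e _ => hcs _ _) hc ?_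
  intro y hy x hx
  obtain ⟨e, he, hye⟩ := mem_iUnion₂.1 hy
  exact hsep e he y hye x hx

/-! ### Planar curves that are star-shaped around a point -/

/-- Linear independence of two vectors. -/
def Indep2 (u w : E3) : Prop := ∀ s t : ℝ, s • u + t • w = 0 → s = 0 ∧ t = 0

theorem Indep2.exists_norm_ge {u w : E3} (h : Indep2 u w) :
    ∃ c > 0, ∀ α β : ℝ, c * (|α| + |β|) ≤ ‖α • u + β • w‖ := by
  obtain ⟨c1, hc1, h1⟩ := exists_norm_add_smul_ge (u := u) (v := w) (by
    intro s hs
    have := (h 1 (-s) (by rw [hs]; module)).1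
    norm_num at this)
  obtain ⟨c2, hc2, h2⟩ := exists_norm_add_smul_ge (u := w) (v := u) (by
    intro s hs
    have := (h (-s) 1 (by rw [hs]; module)).2
    norm_num at this)
  refine ⟨min c1 c2 / 2, by positivity, fun α β => ?_⟩
  have a1 := h1 α β
  have a2 := h2 β α
  rw [add_comm] at a2
  have b1 : min c1 c2 * |α| ≤ c1 * |α| := by gcongr; exact min_le_left _ _
  have b2 : min c1 c2 * |β| ≤ c2 * |β| := by gcongr; exact min_le_right _ _
  linarith

/-- The unit circle of the complex plane. -/
abbrev UCircle : Type := {z : ℂ // ‖z‖ = 1}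

instance : Nonempty UCircle := ⟨⟨1, by simp⟩⟩

/-- The star-shaped curve with radius function `ρ` in the affine frame `(p, u, w)`. -/
def starCurve (p u w : E3) (ρ : UCircle → ℝ) (z : UCircle) : E3 :=
  p + ρ z • (z.1.re • u + z.1.im • w)

/-- The radial projection of the complement of a disk to its boundary does not increase distances. -/
theorem norm_smul_sub_smul_ge {r r' m : ℝ} (hm : 0 ≤ m) (hr : m ≤ r) (hr' : m ≤ r')
    (z z' : UCircle) : m * ‖z.1 - z'.1‖ ≤ ‖(r : ℂ) * z.1 - (r' : ℂ) * z'.1‖ := by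
  have h1 : z.1.re ^ 2 + z.1.im ^ 2 = 1 := by
    have := Complex.sq_norm z.1
    rw [z.2, Complex.normSq_apply] at this
    linarith
  have h2 : z'.1.re ^ 2 + z'.1.im ^ 2 = 1 := by
    have := Complex.sq_norm z'.1
    rw [z'.2, Complex.normSq_apply] at this
    linarith
  refine le_of_sq_le_sq ?_ (norm_nonneg _)
  rw [mul_pow, Complex.sq_norm, Complex.sq_norm, Complex.normSq_apply, Complex.normSq_apply]
  simp only [Complex.sub_re, Complex.sub_im, Complex.mul_re, Complex.mul_im, Complex.ofReal_re,
    Complex.ofReal_im, zero_mul, sub_zero, add_zero]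
  have key : (r * z.1.re - r' * z'.1.re) * (r * z.1.re - r' * z'.1.re) +
      (r * z.1.im - r' * z'.1.im) * (r * z.1.im - r' * z'.1.im) = (r - r') ^ 2 +
      r * r' * ((z.1.re - z'.1.re) ^ 2 + (z.1.im - z'.1.im) ^ 2) := by
    linear_combination (r ^ 2 - r * r') * h1 + (r' ^ 2 - r * r') * h2
  rw [key]
  have h3 : m ^ 2 ≤ r * r' := by nlinarith
  have h4 : 0 ≤ (z.1.re - z'.1.re) ^ 2 + (z.1.im - z'.1.im) ^ 2 := by positivity
  nlinarith [sq_nonneg (r - r'), mul_le_mul_of_nonneg_right h3 h4]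

theorem starCurve_antilipschitz {u w : E3} (h : Indep2 u w) {m : ℝ} (hm : 0 < m) :
    ∃ c > 0, ∀ (p : E3) (ρ : UCircle → ℝ), (∀ z, m ≤ ρ z) → ∀ z z' : UCircle,
      c * ‖z.1 - z'.1‖ ≤ ‖starCurve p u w ρ z - starCurve p u w ρ z'‖ := by
  obtain ⟨c, hc, h⟩ := h.exists_norm_ge
  refine ⟨c * m, by positivity, fun p ρ hρ z z' => ?_⟩
  have e : starCurve p u w ρ z - starCurve p u w ρ z' =
      (ρ z * z.1.re - ρ z' * z'.1.re) • u + (ρ z * z.1.im - ρ z' * z'.1.im) • w := by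
    simp only [starCurve]
    module
  rw [e]
  refine le_trans ?_ (h _ _)
  rw [mul_assoc]
  gcongr
  refine (norm_smul_sub_smul_ge hm.le (hρ z) (hρ z') z z').trans ?_
  refine (Complex.norm_le_abs_re_add_abs_im _).trans ?_
  simp

theorem starCurve_norm_le (p u w : E3) {ρ : UCircle → ℝ} {M : ℝ} (hρ : ∀ z, |ρ z| ≤ M)
    (z : UCircle) : ‖starCurve p u w ρ z‖ ≤ ‖p‖ + M * (‖u‖ + ‖w‖) := by
  have h1 : |z.1.re| ≤ 1 := (Complex.abs_re_le_norm _).trans z.2.le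
  have h2 : |z.1.im| ≤ 1 := (Complex.abs_im_le_norm _).trans z.2.le
  refine (norm_add_le _ _).trans ?_
  rw [norm_smul, Real.norm_eq_abs]
  have h3 : ‖z.1.re • u + z.1.im • w‖ ≤ ‖u‖ + ‖w‖ := by
    refine (norm_add_le _ _).trans ?_
    rw [norm_smul, norm_smul, Real.norm_eq_abs, Real.norm_eq_abs]
    nlinarith [norm_nonneg u, norm_nonneg w]
  have := hρ z
  have h0 : 0 ≤ M := (abs_nonneg (ρ z)).trans this
  gcongr

theorem starCurve_lipschitz (p u w : E3) {ρ : UCircle → ℝ} {M K : ℝ} (hρ : ∀ z, |ρ z| ≤ M)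
    (hK : ∀ z z', |ρ z - ρ z'| ≤ K * ‖z.1 - z'.1‖) (z z' : UCircle) :
    ‖starCurve p u w ρ z - starCurve p u w ρ z'‖ ≤
      (K + M) * (‖u‖ + ‖w‖) * ‖z.1 - z'.1‖ := by
  have h1 : |z.1.re| ≤ 1 := (Complex.abs_re_le_norm _).trans z.2.le
  have h2 : |z.1.im| ≤ 1 := (Complex.abs_im_le_norm _).trans z.2.le
  have h3 : |z.1.re - z'.1.re| ≤ ‖z.1 - z'.1‖ := by simpa using Complex.abs_re_le_norm (z.1 - z'.1)
  have h4 : |z.1.im - z'.1.im| ≤ ‖z.1 - z'.1‖ := by simpa using Complex.abs_im_le_norm (z.1 - z'.1)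
  have e : starCurve p u w ρ z - starCurve p u w ρ z' =
      ((ρ z - ρ z') * z.1.re + ρ z' * (z.1.re - z'.1.re)) • u +
      ((ρ z - ρ z') * z.1.im + ρ z' * (z.1.im - z'.1.im)) • w := by
    simp only [starCurve]
    module
  have h5 := hK z z'
  have h6 := hρ z'
  have h0 := norm_nonneg (z.1 - z'.1)
  have hM0 : 0 ≤ M := (abs_nonneg _).trans h6
  have key : ∀ x y : ℝ, |x| ≤ 1 → |y| ≤ ‖z.1 - z'.1‖ →
      |(ρ z - ρ z') * x + ρ z' * y| ≤ (K + M) * ‖z.1 - z'.1‖ := by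
    intro x y hx hy
    refine (abs_add_le _ _).trans ?_
    rw [abs_mul, abs_mul, add_mul]
    have ha : |ρ z - ρ z'| * |x| ≤ K * ‖z.1 - z'.1‖ := by
      nlinarith [abs_nonneg (ρ z - ρ z'), abs_nonneg x]
    have hb : |ρ z'| * |y| ≤ M * ‖z.1 - z'.1‖ := by gcongr
    linarith
  rw [e]
  refine (norm_add_le _ _).trans ?_
  rw [norm_smul, norm_smul, Real.norm_eq_abs, Real.norm_eq_abs]
  have ka := key _ _ h1 h3
  have kb := key _ _ h2 h4
  nlinarith [norm_nonneg u, norm_nonneg w]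

/-- Radial isotopy to the curve of constant radius: interpolating radius functions keeps them
bounded below, hence keeps the curve embedded. -/
theorem starCurve_ambientIsotopic_round {p u w : E3} (h : Indep2 u w) {ρ : UCircle → ℝ}
    {m M K : ℝ} (hm : 0 < m) (hρ0 : ∀ z, m ≤ ρ z) (hρ : ∀ z, |ρ z| ≤ M)
    (hK : ∀ z z', |ρ z - ρ z'| ≤ K * ‖z.1 - z'.1‖) :
    AmbientIsotopic (toS3 '' range (starCurve p u w ρ))
      (toS3 '' range (starCurve p u w fun _ => 1)) := by
  have hM0 : 0 ≤ M := (abs_nonneg _).trans (hρ (Classical.arbitrary _))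
  have e : ∀ (t : ℝ) z, starCurve p u w ρ z + t • (starCurve p u w (fun _ => 1) z -
      starCurve p u w ρ z) = starCurve p u w (fun z => ρ z + t * (1 - ρ z)) z := by
    intro t z
    simp only [starCurve]
    module
  have e1 : ∀ z, starCurve p u w (fun _ => 1) z - starCurve p u w ρ z =
      starCurve 0 u w (fun z => 1 - ρ z) z := by
    intro z
    simp only [starCurve]
    module
  set N := ‖p‖ + (M + 1) * (‖u‖ + ‖w‖) + |(K + (M + 1)) * (‖u‖ + ‖w‖)| with hN
  refine ambientIsotopic_of_linear_path (fun z z' : UCircle => ‖z.1 - z'.1‖) _ _ (M := N)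
    (fun z => ?_) (fun z => ?_) (fun t ht => ?_) (fun z z' => ?_)
  · refine (starCurve_norm_le p u w (M := M + 1) (fun z => (hρ z).trans (by linarith)) z).trans ?_
    rw [hN]
    linarith [abs_nonneg ((K + (M + 1)) * (‖u‖ + ‖w‖))]
  · refine (starCurve_norm_le p u w (M := M + 1) (fun z => by simp [hM0]) z).trans ?_
    rw [hN]
    linarith [abs_nonneg ((K + (M + 1)) * (‖u‖ + ‖w‖))]
  · obtain ⟨c, hc, hc'⟩ := starCurve_antilipschitz h (m := min m 1) (by positivity)
    refine ⟨c, hc, fun z z' => ?_⟩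
    rw [e, e]
    refine hc' p _ (fun z => ?_) z z'
    have h1 := hρ0 z
    have h2 : min m 1 ≤ m := min_le_left _ _
    have h3 : min m 1 ≤ 1 := min_le_right _ _
    nlinarith [ht.1, ht.2]
  · rw [e1, e1]
    refine (starCurve_lipschitz 0 u w (M := M + 1) (K := K) (fun z => ?_) (fun z z' => ?_)
      z z').trans ?_
    · refine (abs_sub _ _).trans ?_
      rw [abs_one]
      linarith [hρ z]
    · have := hK z z'
      rwa [sub_sub_sub_cancel_left, abs_sub_comm]
    · gcongr
      rw [hN]
      have := le_abs_self ((K + (M + 1)) * (‖u‖ + ‖w‖))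
      have h3 : 0 ≤ ‖p‖ + (M + 1) * (‖u‖ + ‖w‖) := by positivity
      linarith

/-- Round curves whose frames are joined by a segment of frames. -/
theorem roundCurve_ambientIsotopic {p u w p' u' w' : E3}
    (h : ∀ t ∈ Icc (0 : ℝ) 1, Indep2 (u + t • (u' - u)) (w + t • (w' - w))) :
    AmbientIsotopic (toS3 '' range (starCurve p u w fun _ => 1))
      (toS3 '' range (starCurve p' u' w' fun _ => 1)) := by
  have e : ∀ (t : ℝ) z, starCurve p u w (fun _ => 1) z + t • (starCurve p' u' w' (fun _ => 1) z -
      starCurve p u w (fun _ => 1) z) =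
      starCurve (p + t • (p' - p)) (u + t • (u' - u)) (w + t • (w' - w)) (fun _ => 1) z := by
    intro t z
    simp only [starCurve]
    module
  have e1 : ∀ z, starCurve p' u' w' (fun _ => 1) z - starCurve p u w (fun _ => 1) z =
      starCurve (p' - p) (u' - u) (w' - w) (fun _ => 1) z := by
    intro z
    simp only [starCurve]
    module
  have hone : ∀ z : UCircle, |(1 : ℝ)| ≤ 1 := by simp
  refine ambientIsotopic_of_linear_path (fun z z' : UCircle => ‖z.1 - z'.1‖) _ _
    (M := (‖p‖ + (‖u‖ + ‖w‖)) + (‖p'‖ + (‖u'‖ + ‖w'‖)) + (‖u' - u‖ + ‖w' - w‖))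
    (fun z => ?_) (fun z => ?_) (fun t ht => ?_) (fun z z' => ?_)
  · refine (starCurve_norm_le p u w hone z).trans ?_
    have : 0 ≤ (‖p'‖ + (‖u'‖ + ‖w'‖)) + (‖u' - u‖ + ‖w' - w‖) := by positivity
    linarith
  · refine (starCurve_norm_le p' u' w' hone z).trans ?_
    have : 0 ≤ (‖p‖ + (‖u‖ + ‖w‖)) + (‖u' - u‖ + ‖w' - w‖) := by positivity
    linarith
  · obtain ⟨c, hc, hc'⟩ := starCurve_antilipschitz (h t ht) one_pos
    refine ⟨c, hc, fun z z' => ?_⟩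
    rw [e, e]
    exact hc' _ _ (fun _ => le_rfl) z z'
  · rw [e1, e1]
    refine (starCurve_lipschitz _ _ _ (K := 0) hone (by simp) z z').trans ?_
    gcongr
    have : 0 ≤ (‖p‖ + (‖u‖ + ‖w‖)) + (‖p'‖ + (‖u'‖ + ‖w'‖)) := by positivity
    linarith

/-- A vector space of dimension three is not the union of two planes. -/
theorem exists_notMem_span_pairs (a b c d : E3) :
    ∃ z : E3, z ∉ Submodule.span ℝ {a, b} ∧ z ∉ Submodule.span ℝ {c, d} := by
  have key : ∀ a b : E3, ∃ x, x ∉ Submodule.span ℝ {a, b} := by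
    intro a b
    by_contra! h
    have h1 : Submodule.span ℝ {a, b} = ⊤ := Submodule.eq_top_iff'.2 h
    have h2 := finrank_span_finset_le_card (R := ℝ) ({a, b} : Finset E3)
    rw [Set.finrank, Finset.coe_pair, h1, finrank_top, finrank_euclideanSpace_fin] at h2
    have := Finset.card_le_two (a := a) (b := b)
    omega
  obtain ⟨x, hx⟩ := key a b
  obtain ⟨y, hy⟩ := key c d
  by_cases h1 : x ∈ Submodule.span ℝ {c, d}
  · by_cases h2 : y ∈ Submodule.span ℝ {a, b}
    · exact ⟨x + y, fun h => hx ((Submodule.add_mem_iff_left _ h2).1 h),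
        fun h => hy ((Submodule.add_mem_iff_right _ h1).1 h)⟩
    · exact ⟨y, h2, hy⟩
  · exact ⟨x, hx, h1⟩

theorem Indep2.segment {u w z : E3} (h : Indep2 u w) (hz : z ∉ Submodule.span ℝ {u, w}) (t : ℝ) :
    Indep2 (u + t • (z - u)) w := by
  intro s r hsr
  have h0 : s * t = 0 := by
    by_contra hne
    apply hz
    rw [Submodule.mem_span_pair]
    refine ⟨-(s * (1 - t)) / (s * t), -r / (s * t), ?_⟩
    have h1 : (s * t) • z = (-(s * (1 - t))) • u + (-r) • w := by
      rw [← sub_eq_zero, ← hsr]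
      module
    have h2 : z = (s * t)⁻¹ • ((s * t) • z) := by rw [smul_smul, inv_mul_cancel₀ hne, one_smul]
    rw [h2, h1, smul_add, smul_smul, smul_smul]
    congr 2 <;> ring
  have h1 : (s * (1 - t)) • u + r • w = 0 := by
    have : (s * (1 - t)) • u + r • w = (s • (u + t • (z - u)) + r • w) - (s * t) • z := by module
    rw [this, hsr, h0]
    simp
  obtain ⟨h2, h3⟩ := h _ _ h1
  exact ⟨by linarith, h3⟩

theorem Indep2.symm {u w : E3} (h : Indep2 u w) : Indep2 w u := fun s t hst =>
  (h t s (by rw [add_comm]; exact hst)).symm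

theorem indep2_of_notMem_span {a b z : E3} (hz : z ∉ Submodule.span ℝ {a, b}) (hb : b ≠ 0) :
    Indep2 z b := by
  intro s t hst
  have hs : s = 0 := by
    by_contra hne
    apply hz
    rw [Submodule.mem_span_pair]
    refine ⟨0, -t / s, ?_⟩
    have h1 : s • z = (-t) • b := by
      rw [← sub_eq_zero, ← hst]
      module
    have h2 : z = s⁻¹ • (s • z) := by rw [smul_smul, inv_mul_cancel₀ hne, one_smul]
    rw [h2, h1, smul_smul, zero_smul, zero_add]
    congr 1
    ring
  refine ⟨hs, ?_⟩
  rw [hs, zero_smul, zero_add, smul_eq_zero] at hst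
  exact hst.resolve_right hb

/-- Any two round curves are isotopic: a frame is moved to another one by changing one vector at a
time, through auxiliary vectors in general position. -/
theorem roundCurve_ambientIsotopic_roundCurve {p u w p' u' w' : E3} (h : Indep2 u w)
    (h' : Indep2 u' w') :
    AmbientIsotopic (toS3 '' range (starCurve p u w fun _ => 1))
      (toS3 '' range (starCurve p' u' w' fun _ => 1)) := by
  have hw : w ≠ 0 := by
    rintro rfl
    have := (h 0 1 (by simp)).2
    norm_num at this
  have hw' : w' ≠ 0 := by
    rintro rfl
    have := (h' 0 1 (by simp)).2
    norm_num at this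
  obtain ⟨z, hz1, hz2⟩ := exists_notMem_span_pairs u w u' w'
  obtain ⟨y, hy1, hy2⟩ := exists_notMem_span_pairs w z w' z
  have i1 : Indep2 z w := indep2_of_notMem_span hz1 hw
  have i2 : Indep2 z w' := indep2_of_notMem_span hz2 hw'
  have s1 : AmbientIsotopic (toS3 '' range (starCurve p u w fun _ => 1))
      (toS3 '' range (starCurve p' z w fun _ => 1)) := roundCurve_ambientIsotopic (fun t _ => by
    simpa using h.segment hz1 t)
  have s2 : AmbientIsotopic (toS3 '' range (starCurve p' z w fun _ => 1))
      (toS3 '' range (starCurve p' z y fun _ => 1)) := roundCurve_ambientIsotopic (fun t _ => by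
    simpa using (i1.symm.segment hy1 t).symm)
  have s3 : AmbientIsotopic (toS3 '' range (starCurve p' z w' fun _ => 1))
      (toS3 '' range (starCurve p' z y fun _ => 1)) := roundCurve_ambientIsotopic (fun t _ => by
    simpa using (i2.symm.segment hy2 t).symm)
  have s4 : AmbientIsotopic (toS3 '' range (starCurve p' u' w' fun _ => 1))
      (toS3 '' range (starCurve p' z w' fun _ => 1)) := roundCurve_ambientIsotopic (fun t _ => by
    simpa using h'.segment hz2 t)
  exact s1.trans (s2.trans (s3.symm.trans s4.symm))

theorem unknot_eq_range :
    unknot = toS3 '' range (starCurve 0 !₂[1, 0, 0] !₂[0, 1, 0] fun _ => 1) := by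
  rw [unknot]
  congr 1
  ext x
  constructor
  · rintro ⟨h1, h2⟩
    refine ⟨⟨⟨x 0, x 1⟩, ?_⟩, ?_⟩
    · rw [← sq_eq_sq₀ (norm_nonneg _) zero_le_one, Complex.sq_norm, Complex.normSq_apply]
      simp only
      linarith
    · ext i
      fin_cases i <;> simp [starCurve, h2]
  · rintro ⟨z, rfl⟩
    have := Complex.sq_norm z.1
    rw [z.2, Complex.normSq_apply] at this
    simp [starCurve]
    linarith

/-- The boundary of a triangle is unknotted. -/
theorem triangle_ambientIsotopic_unknot {a b d : E3} (hind : Indep2 (b - a) (d - a)) :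
    AmbientIsotopic (toS3 '' (segment ℝ a b ∪ (segment ℝ b d ∪ segment ℝ d a))) unknot := by
  -- the boundary is star-shaped around the barycentre, the level set 1 of the gauge `N`
  let N : ℝ → ℝ → ℝ := fun x y => max (max (-3 * x) (-3 * y)) (3 * x + 3 * y)
  have hNh : ∀ r x y : ℝ, 0 ≤ r → N (r * x) (r * y) = r * N x y := by
    intro r x y hr
    simp only [N]
    rw [mul_max_of_nonneg _ _ hr, mul_max_of_nonneg _ _ hr]
    congr 1
    · congr 1 <;> ring
    · ring
  have hNl : ∀ z : UCircle, 1 / 3 ≤ N z.1.re z.1.im := by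
    intro z
    by_contra! hlt
    simp only [N, max_lt_iff] at hlt
    obtain ⟨⟨h1, h2⟩, h3⟩ := hlt
    have := Complex.sq_norm z.1
    rw [z.2, Complex.normSq_apply] at this
    nlinarith
  have hNlip : ∀ z z' : UCircle, |N z.1.re z.1.im - N z'.1.re z'.1.im| ≤ 6 * ‖z.1 - z'.1‖ := by
    intro z z'
    have h3 : |z.1.re - z'.1.re| ≤ ‖z.1 - z'.1‖ := by
      simpa using Complex.abs_re_le_norm (z.1 - z'.1)
    have h4 : |z.1.im - z'.1.im| ≤ ‖z.1 - z'.1‖ := by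
      simpa using Complex.abs_im_le_norm (z.1 - z'.1)
    rw [abs_le] at h3 h4
    refine (abs_max_sub_max_le_max _ _ _ _).trans (max_le ?_ ?_)
    · refine (abs_max_sub_max_le_max _ _ _ _).trans (max_le ?_ ?_) <;> rw [abs_le] <;>
        constructor <;> linarith
    · rw [abs_le]
      constructor <;> linarith
  have hNu : ∀ z : UCircle, N z.1.re z.1.im ≤ 6 := by
    intro z
    have h1 := abs_le.1 ((Complex.abs_re_le_norm z.1).trans z.2.le)
    have h2 := abs_le.1 ((Complex.abs_im_le_norm z.1).trans z.2.le)
    simp only [N, max_le_iff]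
    refine ⟨⟨?_, ?_⟩, ?_⟩ <;> linarith
  set p : E3 := a + (1 / 3 : ℝ) • (b - a) + (1 / 3 : ℝ) • (d - a) with hp
  -- in these coordinates the gauge takes values between 1/3 and 6 on the unit circle, so that the
  -- radius function `1 / N` lies between 1/6 and 3
  let ρ : UCircle → ℝ := fun z => (N z.1.re z.1.im)⁻¹
  have hset : segment ℝ a b ∪ (segment ℝ b d ∪ segment ℝ d a) =
      range (starCurve p (b - a) (d - a) ρ) := by
    have hN1 : segment ℝ a b ∪ (segment ℝ b d ∪ segment ℝ d a) =
        {q | ∃ x y : ℝ, N x y = 1 ∧ q = p + (x • (b - a) + y • (d - a))} := by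
      ext q
      constructor
      · rintro (hq | hq | hq) <;> rw [segment_eq_image'] at hq <;> obtain ⟨l, ⟨hl0, hl1⟩, rfl⟩ := hq
        · refine ⟨l - 1 / 3, -1 / 3, ?_, ?_⟩
          · apply le_antisymm
            · simp only [N, max_le_iff]
              refine ⟨⟨?_, ?_⟩, ?_⟩ <;> linarith
            · exact le_max_of_le_left (le_max_of_le_right (by linarith))
          · rw [hp]; module
        · refine ⟨2 / 3 - l, l - 1 / 3, ?_, ?_⟩
          · apply le_antisymm
            · simp only [N, max_le_iff]
              refine ⟨⟨?_, ?_⟩, ?_⟩ <;> linarith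
            · exact le_max_of_le_right (by linarith)
          · rw [hp]; module
        · refine ⟨-1 / 3, 2 / 3 - l, ?_, ?_⟩
          · apply le_antisymm
            · simp only [N, max_le_iff]
              refine ⟨⟨?_, ?_⟩, ?_⟩ <;> linarith
            · exact le_max_of_le_left (le_max_of_le_left (by linarith))
          · rw [hp]; module
      · rintro ⟨x, y, hN, rfl⟩
        have hle : N x y ≤ 1 := hN.le
        simp only [N, max_le_iff] at hle
        obtain ⟨⟨h1, h2⟩, h3⟩ := hle
        rcases max_choice (max (-3 * x) (-3 * y)) (3 * x + 3 * y) with h | h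
        · rcases max_choice (-3 * x) (-3 * y) with h' | h'
          · right; right
            have hx : x = -1 / 3 := by
              have : N x y = -3 * x := by simp only [N]; rw [h, h']
              linarith
            subst hx
            rw [segment_eq_image']
            refine ⟨2 / 3 - y, ⟨by linarith, by linarith⟩, ?_⟩
            rw [hp]; module
          · left
            have hy : y = -1 / 3 := by
              have : N x y = -3 * y := by simp only [N]; rw [h, h']
              linarith
            subst hy
            rw [segment_eq_image']
            refine ⟨x + 1 / 3, ⟨by linarith, by linarith⟩, ?_⟩
            rw [hp]; module
        · right; left
          have hx : x = 1 / 3 - y := by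
            have : N x y = 3 * x + 3 * y := by simp only [N]; rw [h]
            linarith
          subst hx
          rw [segment_eq_image']
          refine ⟨1 / 3 + y, ⟨by linarith, by linarith⟩, ?_⟩
          rw [hp]; module
    rw [hN1]
    ext q
    constructor
    · rintro ⟨x, y, hN, rfl⟩
      have hr : (0 : ℝ) < ‖(⟨x, y⟩ : ℂ)‖ := by
        rw [norm_pos_iff]
        intro h0
        have hx : x = 0 := congrArg Complex.re h0
        have hy : y = 0 := congrArg Complex.im h0
        subst hx hy
        simp [N] at hN
      set r := ‖(⟨x, y⟩ : ℂ)‖ with hrd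
      refine ⟨⟨⟨r⁻¹ * x, r⁻¹ * y⟩, ?_⟩, ?_⟩
      · have : (⟨r⁻¹ * x, r⁻¹ * y⟩ : ℂ) = ((r⁻¹ : ℝ) : ℂ) * ⟨x, y⟩ := by
          apply Complex.ext <;> simp
        rw [this, norm_mul, ← hrd, Complex.norm_real, Real.norm_of_nonneg (by positivity)]
        field_simp
      · simp only [starCurve, ρ]
        rw [hNh _ _ _ (by positivity), hN, mul_one, inv_inv, smul_add, smul_smul, smul_smul,
          mul_inv_cancel_left₀ hr.ne', mul_inv_cancel_left₀ hr.ne']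
    · rintro ⟨z, rfl⟩
      have h0 : 0 < N z.1.re z.1.im := by linarith [hNl z]
      refine ⟨ρ z * z.1.re, ρ z * z.1.im, ?_, ?_⟩
      · rw [hNh _ _ _ (by simp only [ρ]; positivity)]
        simp only [ρ]
        exact inv_mul_cancel₀ h0.ne'
      · simp only [starCurve]
        module
  have hρ3 : ∀ z, ρ z ≤ 3 := by
    intro z
    simp only [ρ]
    rw [inv_le_comm₀ (by linarith [hNl z]) (by norm_num)]
    linarith [hNl z]
  have hρ0 : ∀ z, 1 / 6 ≤ ρ z := by
    intro z
    simp only [ρ]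
    rw [le_inv_comm₀ (by norm_num) (by linarith [hNl z])]
    linarith [hNu z]
  rw [hset, unknot_eq_range]
  refine (starCurve_ambientIsotopic_round hind (m := 1 / 6) (M := 3) (K := 54) (by norm_num) hρ0
    (fun z => ?_) (fun z z' => ?_)).trans (roundCurve_ambientIsotopic_roundCurve hind ?_)
  · rw [abs_of_nonneg (by linarith [hρ0 z])]
    exact hρ3 z
  · have h0 : 0 < N z.1.re z.1.im := by linarith [hNl z]
    have h0' : 0 < N z'.1.re z'.1.im := by linarith [hNl z']
    have e : ρ z - ρ z' = (N z'.1.re z'.1.im - N z.1.re z.1.im) * (ρ z * ρ z') := by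
      simp only [ρ]
      field_simp
    rw [e, abs_mul, abs_sub_comm]
    have h1 : |ρ z * ρ z'| ≤ 9 := by
      have a1 := hρ0 z
      have a2 := hρ0 z'
      rw [abs_of_nonneg (mul_nonneg (by linarith) (by linarith))]
      nlinarith [hρ3 z, hρ3 z']
    calc _ ≤ 6 * ‖z.1 - z'.1‖ * 9 := by
          gcongr
          exact hNlip z z'
      _ = _ := by ring
  · intro s t hst
    have h0 := congrArg (fun x : E3 => x 0) hst
    have h1 := congrArg (fun x : E3 => x 1) hst
    simp at h0 h1
    exact ⟨h0, h1⟩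

/-! ### Edge cycles -/

section Combinatorics

variable {V : Type*} [DecidableEq V]

/-- The edges of an edge path, given by the list of its vertices. -/
def pathEdges : List V → Set (Finset V)
  | [] => ∅
  | [_] => ∅
  | x :: y :: l => insert {x, y} (pathEdges (y :: l))

/-- The edges of a closed edge path, given by the cyclic list of its vertices. -/
def cycEdges (l : List V) : Set (Finset V) :=
  {e | ∃ x y m, l.IsRotated (y :: (m ++ [x])) ∧ e = {x, y}}

theorem mem_pathEdges {l : List V} {e : Finset V} :
    e ∈ pathEdges l ↔ ∃ l₁ l₂ x y, l = l₁ ++ x :: y :: l₂ ∧ e = {x, y} := by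
  induction l with
  | nil => simp [pathEdges]
  | cons z l ih =>
    cases l with
    | nil =>
      simp only [pathEdges, mem_empty_iff_false, false_iff]
      rintro ⟨l₁, l₂, x, y, h, -⟩
      have := congrArg List.length h
      grind
    | cons w l =>
      simp only [pathEdges, mem_insert_iff, ih]
      constructor
      · rintro (rfl | ⟨l₁, l₂, x, y, h, rfl⟩)
        · exact ⟨[], l, z, w, rfl, rfl⟩
        grind
      · rintro ⟨l₁, l₂, x, y, h, rfl⟩
        cases l₁ with
        | nil =>
          grind
        | cons q l₁ =>
          grind

theorem pathEdges_append (l₁ : List V) (d : V) (l₂ : List V) :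
    pathEdges (l₁ ++ d :: l₂) = pathEdges (l₁ ++ [d]) ∪ pathEdges (d :: l₂) := by
  induction l₁ with
  | nil => simp [pathEdges]
  | cons x l₁ ih =>
    cases l₁ with
    | nil =>
      simp [pathEdges]
    | cons y l₁ =>
      simp only [List.cons_append, pathEdges] at ih ⊢
      rw [ih, insert_union]

theorem pathEdges_reverse (l : List V) : pathEdges l.reverse = pathEdges l := by
  have key : ∀ l : List V, pathEdges l ⊆ pathEdges l.reverse := by
    intro l e he
    obtain ⟨l₁, l₂, x, y, rfl, rfl⟩ := mem_pathEdges.1 he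
    refine mem_pathEdges.2 ⟨l₂.reverse, l₁.reverse, y, x, by simp, Finset.pair_comm _ _⟩
  grind

theorem mem_of_mem_pathEdges {l : List V} {e : Finset V} (he : e ∈ pathEdges l) {v : V}
    (hv : v ∈ e) : v ∈ l := by
  obtain ⟨l₁, l₂, x, y, rfl, rfl⟩ := mem_pathEdges.1 he
  grind

theorem card_of_mem_pathEdges {l : List V} (hl : l.Nodup) {e : Finset V} (he : e ∈ pathEdges l) :
    e.card = 2 := by
  obtain ⟨l₁, l₂, x, y, rfl, rfl⟩ := mem_pathEdges.1 he
  grind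

theorem cycEdges_eq (b : V) (m : List V) (a : V) :
    cycEdges (b :: (m ++ [a])) = insert {a, b} (pathEdges (b :: (m ++ [a]))) := by
  ext e
  constructor
  · rintro ⟨x, y, m', hr, rfl⟩
    obtain ⟨n, hn, h⟩ := List.isRotated_iff_mod.1 hr
    rw [List.rotate_eq_drop_append_take hn] at h
    set l := b :: (m ++ [a])
    have hl : l = l.take n ++ l.drop n := (List.take_append_drop n l).symm
    rcases List.eq_nil_or_concat (l.take n) with h1 | ⟨p, z, h1⟩
    · rw [h1, List.append_nil] at h
      rw [h1, List.nil_append, h] at hl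
      simp only [l, List.cons.injEq] at hl
      simp_all
    · rcases hd : l.drop n with _ | ⟨w, q⟩
      · grind
      · right
        rw [hd, h1, List.concat_eq_append, List.cons_append] at h
        simp only [List.cons.injEq] at h
        obtain ⟨rfl, h2⟩ := h
        rw [← List.append_assoc] at h2
        obtain ⟨-, h3⟩ := List.append_inj' h2 rfl
        simp only [List.cons.injEq, and_true] at h3
        subst h3
        refine mem_pathEdges.2 ⟨p, q, z, w, ?_, rfl⟩
        grind
  · rintro (rfl | he)
    · exact ⟨a, b, m, List.IsRotated.refl _, rfl⟩
    · obtain ⟨l₁, l₂, x, y, h, rfl⟩ := mem_pathEdges.1 he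
      refine ⟨x, y, l₂ ++ l₁, ?_, rfl⟩
      rw [h]
      have := List.isRotated_append (l := l₁ ++ [x]) (l' := y :: l₂)
      simpa using this

theorem cycEdges_congr {l l' : List V} (h : l.IsRotated l') : cycEdges l = cycEdges l' := by
  ext e
  exact ⟨fun ⟨x, y, m, h1, h2⟩ => ⟨x, y, m, h.symm.trans h1, h2⟩,
    fun ⟨x, y, m, h1, h2⟩ => ⟨x, y, m, h.trans h1, h2⟩⟩

theorem mem_of_mem_cycEdges {l : List V} {e : Finset V} (he : e ∈ cycEdges l) {v : V}
    (hv : v ∈ e) : v ∈ l := by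
  obtain ⟨x, y, m, h1, rfl⟩ := he
  rw [h1.mem_iff]
  grind

theorem card_of_mem_cycEdges {l : List V} (hl : l.Nodup) {e : Finset V} (he : e ∈ cycEdges l) :
    e.card = 2 := by
  obtain ⟨x, y, m, h1, rfl⟩ := he
  refine Finset.card_pair ?_
  rintro rfl
  have := h1.nodup_iff.1 hl
  simp at this

theorem exists_mem_cycEdges {l : List V} (hl : 2 ≤ l.length) {v : V} (hv : v ∈ l) :
    ∃ e ∈ cycEdges l, v ∈ e := by
  obtain ⟨l₁, l₂, rfl⟩ := List.append_of_mem hv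
  have h1 : (l₁ ++ v :: l₂).IsRotated (v :: (l₂ ++ l₁)) := by
    have := List.isRotated_append (l := l₁) (l' := v :: l₂)
    simpa using this
  rcases List.eq_nil_or_concat (l₂ ++ l₁) with h | ⟨m, x, h⟩
  · simp_all
  · rw [h, List.concat_eq_append] at h1
    exact ⟨{x, v}, ⟨x, v, m, h1, rfl⟩, by simp⟩

/-! ### Fillings of edge cycles in a triangulated surface -/

/-- The edge set `C` is the boundary modulo 2 of the set of triangles `R`. -/
def Fills (R : Finset (Finset V)) (C : Set (Finset V)) : Prop :=
  ∀ e : Finset V, e.card = 2 → (Odd (R.filter (e ⊆ ·)).card ↔ e ∈ C)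

/-- Two triangles have a common edge. -/
def Adj (s s' : Finset V) : Prop := ∃ e : Finset V, e.card = 2 ∧ e ⊆ s ∧ e ⊆ s'

/-- `D` is the set of triangles of a triangulated connected surface with boundary. -/
structure IsSurface (D : Finset (Finset V)) : Prop where
  card_eq : ∀ t ∈ D, t.card = 3
  edge_le : ∀ e : Finset V, e.card = 2 → (D.filter (e ⊆ ·)).card ≤ 2
  link : ∀ v : V, ∀ t ∈ D, v ∈ t → ∀ t' ∈ D, v ∈ t' →
    Relation.ReflTransGen (fun s s' => s' ∈ D ∧ ∃ e : Finset V, e.card = 2 ∧ v ∈ e ∧ e ⊆ s ∧ e ⊆ s')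
      t t'
  conn : ∀ t ∈ D, ∀ t' ∈ D, Relation.ReflTransGen (fun s s' => s' ∈ D ∧ Adj s s') t t'
  free : ∃ e : Finset V, e.card = 2 ∧ (D.filter (e ⊆ ·)).card = 1

theorem odd_card_symmDiff (A B : Finset V) :
    Odd (symmDiff A B).card ↔ ¬ (Odd A.card ↔ Odd B.card) := by
  have h1 : (symmDiff A B).card = (A \ B).card + (B \ A).card := by
    rw [symmDiff_def, Finset.sup_eq_union, Finset.card_union_of_disjoint]
    exact disjoint_sdiff_sdiff
  grind

variable {D : Finset (Finset V)}

/-- A proper set of triangles that is closed under adjacency is empty. -/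
theorem IsSurface.closed (hD : IsSurface D) {Q : Finset (Finset V)} (hQ : Q ⊆ D)
    (h : ∀ s ∈ Q, ∀ s' ∈ D, Adj s s' → s' ∈ Q) {t : Finset V} (ht : t ∈ D) (htQ : t ∉ Q) :
    Q = ∅ := by
  by_contra hne
  obtain ⟨s, hs⟩ := Finset.nonempty_iff_ne_empty.2 hne
  have key : ∀ t', Relation.ReflTransGen (fun s s' => s' ∈ D ∧ Adj s s') s t' → t' ∈ Q := by
    intro t' ht'
    induction ht' with
    | refl => exact hs
    | tail _ h1 ih => grind
  exact htQ (key t (hD.conn s (hQ hs) t ht))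

/-- Two triangles with a common edge are the only ones that contain it. -/
theorem IsSurface.filter_eq (hD : IsSurface D) {e s s' : Finset V} (he : e.card = 2) (hs : s ∈ D)
    (hs' : s' ∈ D) (hne : s ≠ s') (h : e ⊆ s) (h' : e ⊆ s') : D.filter (e ⊆ ·) = {s, s'} := by
  refine (Finset.eq_of_subset_of_card_le ?_ ?_).symm
  · grind
  · rw [Finset.card_pair hne]
    exact hD.edge_le e he

/-- Membership in a filling changes only across the edges of its boundary. -/
theorem IsSurface.mem_iff_of_notMem (hD : IsSurface D) {R : Finset (Finset V)} (hR : R ⊆ D)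
    {C : Set (Finset V)} (hC : Fills R C) {e s s' : Finset V} (he : e.card = 2) (hs : s ∈ D)
    (hs' : s' ∈ D) (h : e ⊆ s) (h' : e ⊆ s') (heC : e ∉ C) : s ∈ R ↔ s' ∈ R := by
  by_cases hne : s = s'
  · rw [hne]
  have key : ∀ s s' : Finset V, s ∈ D → s' ∈ D → s ≠ s' → e ⊆ s → e ⊆ s' → s ∈ R → s' ∈ R := by
    intro s s' hs hs' hne h h' hsR
    by_contra hsR'
    apply heC
    rw [← hC e he]
    have : R.filter (e ⊆ ·) = {s} := by
      ext x
      simp only [Finset.mem_filter, Finset.mem_singleton]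
      constructor
      · rintro ⟨h1, h2⟩
        have h3 : x ∈ D.filter (e ⊆ ·) := by simp [hR h1, h2]
        rw [hD.filter_eq he hs hs' hne h h'] at h3
        grind
      grind
    rw [this]
    simp
  grind

/-- A boundary edge lies in exactly one triangle of the filling. -/
theorem IsSurface.existsUnique_of_mem (hD : IsSurface D) {R : Finset (Finset V)} (hR : R ⊆ D)
    {C : Set (Finset V)} (hC : Fills R C) {e : Finset V} (he : e.card = 2) (heC : e ∈ C) :
    ∃ t ∈ R, e ⊆ t ∧ ∀ t' ∈ R, e ⊆ t' → t' = t := by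
  have h1 := (hC e he).2 heC
  have h2 : (R.filter (e ⊆ ·)).card ≤ 2 :=
    (Finset.card_le_card (Finset.filter_subset_filter _ hR)).trans (hD.edge_le e he)
  have h3 : (R.filter (e ⊆ ·)).card = 1 := by grind
  obtain ⟨t, ht⟩ := Finset.card_eq_one.1 h3
  have h4 : t ∈ R.filter (e ⊆ ·) := by simp [ht]
  refine ⟨t, (Finset.mem_filter.1 h4).1, (Finset.mem_filter.1 h4).2, fun t' h5 h6 => ?_⟩
  have : t' ∈ R.filter (e ⊆ ·) := Finset.mem_filter.2 ⟨h5, h6⟩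
  grind

/-- There are no closed surfaces in `D`: a non-empty set of triangles without boundary would be all
of `D`, but `D` has a free edge. -/
theorem IsSurface.eq_empty_of_fills_empty (hD : IsSurface D) {R : Finset (Finset V)} (hR : R ⊆ D)
    (hC : Fills R ∅) : R = ∅ := by
  obtain ⟨e, he, h1⟩ := hD.free
  obtain ⟨t, ht⟩ := Finset.card_eq_one.1 h1
  have h4 : t ∈ D.filter (e ⊆ ·) := by simp [ht]
  have htD := (Finset.mem_filter.1 h4).1
  refine hD.closed hR (fun s hs s' hs' ⟨e', he', h, h'⟩ =>
    (hD.mem_iff_of_notMem hR hC he' (hR hs) hs' h h' (by simp)).1 hs) htD (fun htR => ?_)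
  have := (hC e he).1 (by
    have : R.filter (e ⊆ ·) = {t} := by grind
    rw [this]
    simp)
  exact this

theorem Fills.symmDiff_singleton {R : Finset (Finset V)} {C : Set (Finset V)} (h : Fills R C)
    {R' : Finset (Finset V)} {C' : Set (Finset V)} (h' : Fills R' C') {e : Finset V}
    (he : e.card = 2) :
    Odd ((symmDiff R R').filter (e ⊆ ·)).card ↔ ¬ (e ∈ C ↔ e ∈ C') := by
  rw [← h e he, ← h' e he, ← odd_card_symmDiff]
  have : (symmDiff R R').filter (e ⊆ ·) = symmDiff (R.filter (e ⊆ ·)) (R'.filter (e ⊆ ·)) := by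
    ext x
    simp only [Finset.mem_filter, Finset.mem_symmDiff]
    tauto
  rw [this]

/-- Around a vertex off the boundary, membership in a filling is constant. -/
theorem IsSurface.star_const (hD : IsSurface D) {R : Finset (Finset V)} (hR : R ⊆ D)
    {C : Set (Finset V)} (hC : Fills R C) {v : V} (hv : ∀ e ∈ C, v ∉ e) {s s' : Finset V}
    (hs : s ∈ D) (hs' : s' ∈ D) (h : v ∈ s) (h' : v ∈ s') : s ∈ R ↔ s' ∈ R := by
  have key : ∀ s', Relation.ReflTransGen
      (fun s s' => s' ∈ D ∧ ∃ e : Finset V, e.card = 2 ∧ v ∈ e ∧ e ⊆ s ∧ e ⊆ s') s s' →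
      s' ∈ D ∧ (s ∈ R ↔ s' ∈ R) := by
    intro s' hss
    induction hss with
    | refl => exact ⟨hs, Iff.rfl⟩
    | tail _ h1 ih =>
      obtain ⟨h2, e, he, hve, h3, h4⟩ := h1
      refine ⟨h2, ih.2.trans ?_⟩
      exact hD.mem_iff_of_notMem hR hC he ih.1 h2 h3 h4 fun heC => hv e heC hve
  exact (key s' (hD.link v s hs h s' hs' h')).2

/-- Along an edge path off the boundary, membership in a filling is constant. -/
theorem IsSurface.path_const (hD : IsSurface D) {R : Finset (Finset V)} (hR : R ⊆ D)
    {C : Set (Finset V)} (hC : Fills R C) {P : Prop} (p : List V) (x : V)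
    (hp : ∀ v ∈ x :: p, ∀ e ∈ C, v ∉ e) (he : ∀ e ∈ pathEdges (x :: p), ∃ s ∈ D, e ⊆ s)
    (hx : ∀ s ∈ D, x ∈ s → (s ∈ R ↔ P)) : ∀ v ∈ x :: p, ∀ s ∈ D, v ∈ s → (s ∈ R ↔ P) := by
  induction p generalizing x with
  | nil =>
    grind
  | cons y p ih =>
    intro v hv
    rcases List.mem_cons.1 hv with rfl | hv
    · exact hx
    refine ih y (fun v hv => hp v (List.mem_cons_of_mem _ hv))
      (fun e h => he e (mem_insert_of_mem _ h)) ?_ v hv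
    obtain ⟨s0, hs0, hxy⟩ := he {x, y} (mem_insert _ _)
    have hxs : x ∈ s0 := hxy (by simp)
    have hys : y ∈ s0 := hxy (by simp)
    intro s hs hys'
    rw [← hx s0 hs0 hxs]
    exact hD.star_const hR hC (hp y (by simp)) hs hs0 hys' hys

theorem subset_triple_iff {a b d : V} {e : Finset V} (he : e.card = 2) :
    e ⊆ {a, b, d} ↔ e = {a, b} ∧ a ≠ b ∨ e = {b, d} ∧ b ≠ d ∨ e = {a, d} ∧ a ≠ d := by
  obtain ⟨x, y, hxy, rfl⟩ := Finset.card_eq_two.1 he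
  constructor
  · intro h
    have hx := h (by simp : x ∈ ({x, y} : Finset V))
    have hy := h (by simp : y ∈ ({x, y} : Finset V))
    grind
  grind

/-- Every closed edge path in `D` bounds modulo 2. -/
def CyclesBound (D : Finset (Finset V)) : Prop :=
  ∀ l : List V, l.Nodup → 3 ≤ l.length → (∀ e ∈ cycEdges l, ∃ s ∈ D, e ⊆ s) →
    ∃ R ⊆ D, Fills R (cycEdges l)

set_option maxHeartbeats 1000000 in
/-- If a triangle `t = {a, b, d}` of a filling `R` meets the boundary cycle in the edge `{a, b}` and
the opposite vertex `d`, then `t` cuts `R` into two parts. The part on one side is a filling of one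
of the two cycles into which the chord splits the boundary. The point is to exclude that this
filling lies on the wrong side of its boundary; in that case the two partial fillings would cover
all of `D`, and `D` would be a closed surface. -/
theorem IsSurface.exists_part (hD : IsSurface D) (hB : CyclesBound D) {R : Finset (Finset V)}
    (hR : R ⊆ D) {b d a : V} {m₁ m₂ : List V}
    (hnd : (b :: ((m₁ ++ d :: m₂) ++ [a])).Nodup)
    (hC : Fills R (cycEdges (b :: ((m₁ ++ d :: m₂) ++ [a])))) (ht : {a, b, d} ∈ R)
    (hbd : {b, d} ∉ cycEdges (b :: ((m₁ ++ d :: m₂) ++ [a])))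
    (had : {a, d} ∉ cycEdges (b :: ((m₁ ++ d :: m₂) ++ [a]))) :
    ∃ R₁ ⊆ R, R₁.card < R.card ∧ Fills R₁ (cycEdges (b :: (m₁ ++ [d]))) ∧
      ∀ s ∈ R₁, ∀ v ∈ m₂ ++ [a], v ∉ s := by
  set t : Finset V := {a, b, d} with htd
  have htD := hR ht
  have hsplit : b :: ((m₁ ++ d :: m₂) ++ [a]) = (b :: m₁) ++ d :: (m₂ ++ [a]) := by simp
  set P₁ := pathEdges (b :: (m₁ ++ [d])) with hP₁
  set P₂ := pathEdges (d :: (m₂ ++ [a])) with hP₂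
  have hCe : cycEdges (b :: ((m₁ ++ d :: m₂) ++ [a])) = insert {a, b} (P₁ ∪ P₂) := by
    rw [cycEdges_eq, hsplit, pathEdges_append]
    rfl
  have hC₁e : cycEdges (b :: (m₁ ++ [d])) = insert {d, b} P₁ := cycEdges_eq _ _ _
  rw [hCe] at hC hbd had
  rw [hsplit] at hnd
  have hnd1 : (b :: (m₁ ++ [d])).Nodup := by grind
  have hnd2 : (d :: (m₂ ++ [a])).Nodup := hnd.sublist (List.sublist_append_right _ _)
  have hdis : ∀ v, v ∈ b :: m₁ → v ∈ d :: (m₂ ++ [a]) → False := by grind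
  have hda : d ≠ a := by grind
  have hdb : d ≠ b := by grind
  have hab : a ≠ b := by grind
  -- an edge of either cycle has a vertex different from `d`
  have hv₁ : ∀ e ∈ insert {d, b} P₁, ∃ v ∈ b :: m₁, v ∈ e := by
    rintro e (rfl | he)
    · grind
    · have h2 := card_of_mem_pathEdges hnd1 he
      obtain ⟨v, hv, hvd⟩ := Finset.exists_mem_ne (by omega : 1 < e.card) d
      have := mem_of_mem_pathEdges he hv
      grind
  have hv₂ : ∀ e ∈ insert {a, d} P₂, ∃ v ∈ m₂ ++ [a], v ∈ e := by
    rintro e (rfl | he)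
    · simp
    · have h2 := card_of_mem_pathEdges hnd2 he
      obtain ⟨v, hv, hvd⟩ := Finset.exists_mem_ne (by omega : 1 < e.card) d
      have := mem_of_mem_pathEdges he hv
      grind
  have hw₁ : ∀ e ∈ insert {d, b} P₁, ∀ v ∈ e, v ∈ b :: m₁ ∨ v = d := by
    rintro e (rfl | he) v hv
    · grind
    · have := mem_of_mem_pathEdges he hv
      grind
  have hw₂ : ∀ e ∈ insert {a, d} P₂, ∀ v ∈ e, v ∈ m₂ ++ [a] ∨ v = d := by
    rintro e (rfl | he) v hv
    · grind
    · have := mem_of_mem_pathEdges he hv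
      grind
  have hd' : ∀ v, v ∈ b :: m₁ → v ∈ m₂ ++ [a] → False := fun v h1 h2 =>
    hdis v h1 (List.mem_cons_of_mem _ h2)
  have hd₁ : d ∉ b :: m₁ := fun h => hdis d h (by simp)
  have hd₂ : d ∉ m₂ ++ [a] := (List.nodup_cons.1 hnd2).1
  have hnot : ∀ e : Finset V, e.card = 2 → e ∈ insert {d, b} P₁ → e ∈ insert {a, d} P₂ → False := by
    intro e he h1 h2
    obtain ⟨v, hv, hve⟩ := hv₁ e h1
    grind
  have hCD : ∀ e ∈ insert {a, b} (P₁ ∪ P₂), ∃ s ∈ D, e ⊆ s := by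
    intro e he
    have h2 : e.card = 2 := by
      rw [← hCe] at he
      exact card_of_mem_cycEdges (by rw [hsplit]; exact hnd) he
    obtain ⟨s, hs, hes, -⟩ := hD.existsUnique_of_mem hR hC h2 he
    grind
  have hm₁ : m₁ ≠ [] := by
    rintro rfl
    apply hbd
    right; left
    simp [hP₁, pathEdges]
  obtain ⟨R₁, hR₁, hF₁⟩ := hB (b :: (m₁ ++ [d])) hnd1 (by
    have := List.length_pos_iff.2 hm₁
    simp
    omega) (by
    rw [hC₁e]
    rintro e (rfl | he)
    · exact ⟨t, htD, by grind⟩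
    simp_all)
  rw [hC₁e] at hF₁
  -- modulo 2 the boundary of `R + R₁ + t` is the second cycle `{a, d} ∪ P₂`
  set R₂ := symmDiff (symmDiff R R₁) {t} with hR₂d
  have hR₂ : R₂ ⊆ D := by
    intro x hx
    simp only [hR₂d, Finset.mem_symmDiff, Finset.mem_singleton] at hx
    grind
  have hF₂ : Fills R₂ (insert {a, d} P₂) := by
    intro e he
    have h1 : Fills (symmDiff R R₁) {e | ¬ (e ∈ insert {a, b} (P₁ ∪ P₂) ↔ e ∈ insert {d, b} P₁)} :=
      fun e he => hC.symmDiff_singleton hF₁ he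
    have h2 : Fills {t} {e | e ⊆ t} := by
      intro e he
      rw [Finset.filter_singleton]
      split_ifs with h <;> simp [h]
    rw [hR₂d, h1.symmDiff_singleton h2 he]
    simp only [mem_ofPred_eq, htd, subset_triple_iff he]
    have e1 : ({d, b} : Finset V) = {b, d} := Finset.pair_comm _ _
    rw [e1]
    rw [e1] at hnot
    simp only [mem_insert_iff, mem_union] at hnot hbd had ⊢
    have n1 : ({a, b} : Finset V) ∉ P₁ := fun h => by
      rcases hw₁ _ (Or.inr h) a (by simp) with h | h
      · exact hd' a h (by simp)
      · exact hda h.symm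
    have n2 : ({a, b} : Finset V) ∉ P₂ := fun h => by
      rcases hw₂ _ (Or.inr h) b (by simp) with h | h
      · exact hd' b (by simp) h
      · exact hdb h.symm
    have n3 : ({a, b} : Finset V) ≠ {b, d} := fun h => by grind
    have n4 : ({a, b} : Finset V) ≠ {a, d} := fun h => by grind
    have n5 : ({b, d} : Finset V) ≠ {a, d} := fun h => by grind
    by_cases q1 : e = {a, b}
    · grind
    by_cases q2 : e = {b, d}
    · grind
    by_cases q3 : e = {a, d}
    · grind
    have := hnot e he
    simp only [q1, q2, q3, false_or, false_and, or_false] at this ⊢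
    tauto
  have hmem₂ : ∀ x, x ∈ R₂ ↔ ¬ (¬ (x ∈ R ↔ x ∈ R₁) ↔ x = t) := by
    intro x
    simp only [hR₂d, Finset.mem_symmDiff, Finset.mem_singleton]
    tauto
  have htt : t ∈ R₂ ↔ t ∈ R₁ := by grind
  -- the filling `R₁` is constant along the other arc, and `R₂` along the first one
  have hs₁ : ∀ v ∈ m₂ ++ [a], ∀ s ∈ D, v ∈ s → (s ∈ R₁ ↔ t ∈ R₁) := by
    have hoff : ∀ v ∈ m₂ ++ [a], ∀ e ∈ insert {d, b} P₁, v ∉ e := by grind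
    have := hD.path_const hR₁ hF₁ (P := t ∈ R₁) m₂.reverse a (by grind) (by
      intro e he
      apply hCD e
      right; right
      have : a :: m₂.reverse = (m₂ ++ [a]).reverse := by simp
      rw [this, pathEdges_reverse] at he
      rw [hP₂]
      obtain ⟨y, m, hy⟩ : ∃ y m, m₂ ++ [a] = y :: m := List.exists_cons_of_ne_nil (by simp)
      rw [hy] at he ⊢
      exact mem_insert_of_mem _ he) (by
      intro s hs has
      exact hD.star_const hR₁ hF₁ (hoff a (by simp)) hs htD has (by simp [htd]))
    grind
  have hs₂ : ∀ v ∈ b :: m₁, ∀ s ∈ D, v ∈ s → (s ∈ R₂ ↔ t ∈ R₁) := by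
    have hoff : ∀ v ∈ b :: m₁, ∀ e ∈ insert {a, d} P₂, v ∉ e := by grind
    refine hD.path_const hR₂ hF₂ (P := t ∈ R₁) m₁ b hoff (by
      intro e he
      apply hCD e
      right; left
      have h1 : pathEdges ((b :: m₁).reverse) ⊆ P₁ := by
        have : P₁ = pathEdges (d :: (b :: m₁).reverse) := by
          rw [hP₁, ← pathEdges_reverse]
          simp
        rw [this]
        obtain ⟨y, m, hy⟩ : ∃ y m, (b :: m₁).reverse = y :: m :=
          List.exists_cons_of_ne_nil (by simp)
        rw [hy]
        exact subset_insert _ _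
      rw [pathEdges_reverse] at h1
      exact h1 he) (by
      intro s hs has
      rw [← htt]
      exact hD.star_const hR₂ hF₂ (hoff b (by simp)) hs htD has (by simp [htd]))
  by_cases htR : t ∈ R₁
  · -- the wrong side: then `R₁` and `R₂` cover `D`; the triangle at a free edge lies in one of
    -- them, hence in both, so that the free edge belongs to both cycles, which is impossible
    exfalso
    have hO : D.filter (fun s => s ∉ R₁ ∧ s ∉ R₂) = ∅ := by
      refine hD.closed (Finset.filter_subset _ _) ?_ htD (by simp [htR])
      intro s hs s' hs' ⟨e, he, hes, hes'⟩
      simp only [Finset.mem_filter] at hs ⊢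
      refine ⟨hs', fun h => ?_, fun h => ?_⟩
      · by_cases heC : e ∈ insert {d, b} P₁
        · obtain ⟨v, hv, hve⟩ := hv₁ e heC
          grind
        · exact hs.2.1 ((hD.mem_iff_of_notMem hR₁ hF₁ he hs.1 hs' hes hes' heC).2 h)
      · by_cases heC : e ∈ insert {a, d} P₂
        · obtain ⟨v, hv, hve⟩ := hv₂ e heC
          grind
        · exact hs.2.2 ((hD.mem_iff_of_notMem hR₂ hF₂ he hs.1 hs' hes hes' heC).2 h)
    obtain ⟨e, he, h1⟩ := hD.free
    obtain ⟨s, hs⟩ := Finset.card_eq_one.1 h1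
    have h4 : s ∈ D.filter (e ⊆ ·) := by simp [hs]
    obtain ⟨hsD, hes⟩ := Finset.mem_filter.1 h4
    have hbdry : ∀ (R' : Finset (Finset V)) (C' : Set (Finset V)), R' ⊆ D → Fills R' C' → s ∈ R' →
        e ∈ C' := by
      intro R' C' hR' hF' hsR'
      rw [← hF' e he]
      have : R'.filter (e ⊆ ·) = {s} := by
        refine Finset.Subset.antisymm ?_ ?_
        · grind
        · simp [hsR', hes]
      rw [this]
      simp
    have hs12 : s ∈ R₁ ∨ s ∈ R₂ := by
      by_contra! h
      have : s ∈ D.filter (fun s => s ∉ R₁ ∧ s ∉ R₂) := by simp [hsD, h]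
      grind
    have hboth : s ∈ R₁ ∧ s ∈ R₂ := by
      rcases hs12 with h | h
      · obtain ⟨v, hv, hve⟩ := hv₁ e (hbdry R₁ _ hR₁ hF₁ h)
        grind
      · obtain ⟨v, hv, hve⟩ := hv₂ e (hbdry R₂ _ hR₂ hF₂ h)
        grind
    grind
  · -- the right side: then `R₁` and `R₂` are disjoint, so `R₁` is a part of `R`
    have hO : R₁ ∩ R₂ = ∅ := by
      refine hD.closed (Finset.inter_subset_left.trans hR₁) ?_ htD (by simp [htR])
      intro s hs s' hs' ⟨e, he, hes, hes'⟩
      rw [Finset.mem_inter] at hs ⊢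
      refine ⟨?_, ?_⟩
      · by_cases heC : e ∈ insert {d, b} P₁
        · obtain ⟨v, hv, hve⟩ := hv₁ e heC
          grind
        · exact (hD.mem_iff_of_notMem hR₁ hF₁ he (hR₁ hs.1) hs' hes hes' heC).1 hs.1
      · by_cases heC : e ∈ insert {a, d} P₂
        · obtain ⟨v, hv, hve⟩ := hv₂ e heC
          grind
        · exact (hD.mem_iff_of_notMem hR₂ hF₂ he (hR₁ hs.1) hs' hes hes' heC).1 hs.2
    have hsub : R₁ ⊆ R.erase t := by
      intro s hs
      have h1 : s ≠ t := by grind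
      have h2 : s ∉ R₂ := fun h => by
        have : s ∈ R₁ ∩ R₂ := Finset.mem_inter.2 ⟨hs, h⟩
        grind
      grind
    refine ⟨R₁, hsub.trans (Finset.erase_subset _ _), ?_, ?_, ?_⟩
    · exact (Finset.card_le_card hsub).trans_lt (Finset.card_erase_lt_of_mem ht)
    · rwa [hC₁e]
    grind

theorem eq_of_mem_pathEdges_head {b y d : V} {m : List V} (hnd : (b :: y :: m).Nodup)
    (h : {b, d} ∈ pathEdges (b :: y :: m)) : d = y := by
  have hb : b ∉ y :: m := (List.nodup_cons.1 hnd).1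
  rcases h with h | h
  · have h1 : y ∈ ({b, d} : Finset V) := h ▸ (by simp)
    grind
  · exact absurd (mem_of_mem_pathEdges h (by simp)) hb

theorem cycEdges_reverse (b : V) (m : List V) (a : V) :
    cycEdges (a :: (m.reverse ++ [b])) = cycEdges (b :: (m ++ [a])) := by
  rw [cycEdges_eq, cycEdges_eq, Finset.pair_comm]
  have : a :: (m.reverse ++ [b]) = (b :: (m ++ [a])).reverse := by simp
  rw [this, pathEdges_reverse]

theorem exists_third {t : Finset V} (ht : t.card = 3) {a b : V} (hab : a ≠ b) (h : {a, b} ⊆ t) :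
    ∃ d, t = {a, b, d} ∧ b ≠ d ∧ a ≠ d := by
  have h1 : (t \ {a, b}).card = 1 := by grind
  obtain ⟨d, hd⟩ := Finset.card_eq_one.1 h1
  grind

/-- The triangle `{a, b, d}` of `R` can be removed from `R` so that the boundary `C` remains a
single cycle: it meets `C` in an edge and does not contain further vertices of `C`, or it meets `C`
in exactly two edges. -/
def Removable (R : Finset (Finset V)) (C : Set (Finset V)) (a b d : V) : Prop :=
  {a, b, d} ∈ R ∧ a ≠ b ∧ b ≠ d ∧ a ≠ d ∧ {a, b} ∈ C ∧
    ((∀ e ∈ C, d ∉ e) ∨ ({a, d} ∈ C ∧ {b, d} ∉ C))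

/-- Inductive step: the part of `R` that the triangle `{a, b, d}` cuts off on the side opposite to the
edge `e₀` contains a removable triangle, which does not have `e₀` as an edge. -/
theorem IsSurface.exists_removable_of_chord (hD : IsSurface D) (hB : CyclesBound D)
    {R : Finset (Finset V)} (hR : R ⊆ D) {b d a : V} {m₁ m₂ : List V}
    (hnd : (b :: ((m₁ ++ d :: m₂) ++ [a])).Nodup)
    (hC : Fills R (cycEdges (b :: ((m₁ ++ d :: m₂) ++ [a])))) (ht : {a, b, d} ∈ R)
    (hbd : {b, d} ∉ cycEdges (b :: ((m₁ ++ d :: m₂) ++ [a])))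
    (had : {a, d} ∉ cycEdges (b :: ((m₁ ++ d :: m₂) ++ [a])))
    (ih : ∀ R' ⊆ D, R'.card < R.card → ∀ l : List V, Fills R' (cycEdges l) → l.Nodup →
      3 ≤ l.length → 2 ≤ R'.card → ∀ e₀ ∈ cycEdges l,
      ∃ a b d, Removable R' (cycEdges l) a b d ∧ ¬ e₀ ⊆ {a, b, d})
    {e₀ : Finset V} (he₀ : e₀ ∈ pathEdges (d :: (m₂ ++ [a]))) :
    ∃ a' b' d', Removable R (cycEdges (b :: ((m₁ ++ d :: m₂) ++ [a]))) a' b' d' ∧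
      ¬ e₀ ⊆ {a', b', d'} := by
  obtain ⟨R₁, hR₁, hlt, hF₁, hav⟩ := hD.exists_part hB hR hnd hC ht hbd had
  have hsplit : b :: ((m₁ ++ d :: m₂) ++ [a]) = (b :: m₁) ++ d :: (m₂ ++ [a]) := by simp
  have hCe : cycEdges (b :: ((m₁ ++ d :: m₂) ++ [a])) =
      insert {a, b} (pathEdges (b :: (m₁ ++ [d])) ∪ pathEdges (d :: (m₂ ++ [a]))) := by
    rw [cycEdges_eq, hsplit, pathEdges_append]
    rfl
  set C := cycEdges (b :: ((m₁ ++ d :: m₂) ++ [a])) with hCdef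
  rw [hsplit] at hnd
  have hnd1 : (b :: (m₁ ++ [d])).Nodup := by
    have : List.Sublist ((b :: m₁) ++ [d]) ((b :: m₁) ++ d :: (m₂ ++ [a])) := by
      simp
    exact hnd.sublist this
  have hnd2 : (d :: (m₂ ++ [a])).Nodup := hnd.sublist (List.sublist_append_right _ _)
  have hC₁e : cycEdges (b :: (m₁ ++ [d])) = insert {d, b} (pathEdges (b :: (m₁ ++ [d]))) :=
    cycEdges_eq _ _ _
  set C₁ := cycEdges (b :: (m₁ ++ [d])) with hC₁def
  have hm₁ : m₁ ≠ [] := by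
    rintro rfl
    apply hbd
    rw [hCe]
    right; left
    simp [pathEdges]
  have hlen : 3 ≤ (b :: (m₁ ++ [d])).length := by
    have := List.length_pos_iff.2 hm₁
    simp
    omega
  have hP₁C : ∀ e ∈ C₁, e ≠ {d, b} → e ∈ C := by grind
  have hP₂ : ∀ e ∈ pathEdges (d :: (m₂ ++ [a])), ∃ v ∈ m₂ ++ [a], v ∈ e := by
    intro e he
    have h2 := card_of_mem_pathEdges hnd2 he
    obtain ⟨v, hv, hvd⟩ := Finset.exists_mem_ne (by omega : 1 < e.card) d
    rcases List.mem_cons.1 (mem_of_mem_pathEdges he hv) with h | h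
    · exact absurd h hvd
    · exact ⟨v, h, hv⟩
  -- the triangles of `R₁` contain none of the edges on the other side
  have hother : ∀ s ∈ R₁, ∀ e ∈ pathEdges (d :: (m₂ ++ [a])), ¬ e ⊆ s := by
    intro s hs e he h
    obtain ⟨v, hv, hve⟩ := hP₂ e he
    grind
  have hdbC : ({d, b} : Finset V) ∉ C := by rwa [Finset.pair_comm]
  have hdb1 : ({d, b} : Finset V) ∈ C₁ := by grind
  have hdb : d ≠ b := by grind
  have hne : 1 ≤ R₁.card := by
    rw [Finset.one_le_card]
    obtain ⟨t, h, -⟩ := hD.existsUnique_of_mem (hR₁.trans hR) hF₁ (Finset.card_pair hdb) hdb1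
    exact ⟨t, h⟩
  rcases hne.eq_or_lt with h1 | h2
  · -- a single triangle meets `C` in its two edges different from the chord
    obtain ⟨s, hs⟩ := Finset.card_eq_one.1 h1.symm
    have hF : ∀ e : Finset V, e.card = 2 → (e ∈ C₁ ↔ e ⊆ s) := by
      intro e he
      rw [← hF₁ e he, hs, Finset.filter_singleton]
      split_ifs with h <;> simp [h]
    have hsR : s ∈ R₁ := by simp [hs]
    obtain ⟨c, hc, hbc, hdc⟩ := exists_third (hD.card_eq s (hR (hR₁ hsR))) hdb
      ((hF _ (Finset.card_pair hdb)).1 hdb1)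
    have hcb : ({c, b} : Finset V) ∈ C₁ := (hF _ (Finset.card_pair hbc.symm)).2 (by
      rw [hc]; intro z; simp; tauto)
    have hcd : ({c, d} : Finset V) ∈ C₁ := (hF _ (Finset.card_pair hdc.symm)).2 (by
      rw [hc]; intro z; simp; tauto)
    have hse : ({c, b, d} : Finset V) = s := by rw [hc]; ext z; simp; tauto
    refine ⟨c, b, d, ⟨by grind, hbc.symm, hdb.symm, hdc.symm, hP₁C _ hcb ?_,
      Or.inr ⟨hP₁C _ hcd ?_, hbd⟩⟩, ?_⟩
    · intro h
      have : c ∈ ({d, b} : Finset V) := h ▸ (by simp)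
      grind
    · intro h
      have : c ∈ ({d, b} : Finset V) := h ▸ (by simp)
      grind
    grind
  · -- a triangle that avoids the chord and is removable from `R₁` is removable from `R`
    obtain ⟨a', b', d', ⟨h1, h3, h4, h5, h6, h7⟩, h8⟩ :=
      ih R₁ (hR₁.trans hR) hlt _ hF₁ hnd1 hlen h2 _ hdb1
    have hne : ∀ e ⊆ ({a', b', d'} : Finset V), e ≠ {d, b} := by grind
    refine ⟨a', b', d', ⟨hR₁ h1, h3, h4, h5, hP₁C _ h6 (hne _ (by intro z; simp; tauto)), ?_⟩,
      hother _ h1 _ he₀⟩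
    rcases h7 with h7 | ⟨h7, h9⟩
    · left
      intro e he hde
      rw [hCe] at he
      rcases he with rfl | he | he
      · simp only [Finset.mem_insert, Finset.mem_singleton] at hde
        rcases hde with rfl | rfl
        · exact hav _ h1 d' (by simp) (by simp)
        grind
      · grind
      · rcases List.mem_cons.1 (mem_of_mem_pathEdges he hde) with rfl | h
        · grind
        · exact hav _ h1 d' h (by simp)
    · right
      refine ⟨hP₁C _ h7 (hne _ (by intro z; simp; tauto)), fun he => ?_⟩
      have hsub : ({b', d'} : Finset V) ⊆ {a', b', d'} := by intro z; simp; tauto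
      rw [hCe] at he
      rcases he with he | he | he
      · have : a ∈ ({b', d'} : Finset V) := he ▸ (by simp)
        grind
      · grind
      grind

/-- A filling with at least two triangles has a removable triangle that avoids a prescribed boundary
edge. -/
theorem IsSurface.exists_removable (hD : IsSurface D) (hB : CyclesBound D)
    (n : ℕ) : ∀ R ⊆ D, R.card = n → ∀ l : List V, Fills R (cycEdges l) → l.Nodup →
      3 ≤ l.length → 2 ≤ R.card → ∀ e₀ ∈ cycEdges l,
      ∃ a b d, Removable R (cycEdges l) a b d ∧ ¬ e₀ ⊆ {a, b, d} := by
  induction n using Nat.strong_induction_on with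
  | _ n ih =>
  intro R hR hn l hF hnd hlen h2 e₀ he₀
  have hcard : ∀ e ∈ cycEdges l, e.card = 2 := fun e he => card_of_mem_cycEdges hnd he
  obtain ⟨t₀, ht₀, he₀t, huniq⟩ := hD.existsUnique_of_mem hR hF (hcard _ he₀) he₀
  -- if all boundary edges were edges of `t₀`, the boundary would be that of `t₀` and `R = {t₀}`
  obtain ⟨e, heC, het₀⟩ : ∃ e ∈ cycEdges l, ¬ e ⊆ t₀ := by
    by_contra! hall
    have hsub : l.toFinset ⊆ t₀ := by
      intro v hv
      obtain ⟨e, he, hve⟩ := exists_mem_cycEdges (by omega) (List.mem_toFinset.1 hv)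
      exact hall e he hve
    have hl3 : l.toFinset = t₀ := by
      apply Finset.eq_of_subset_of_card_le hsub
      rw [List.toFinset_card_of_nodup hnd, hD.card_eq t₀ (hR ht₀)]
      exact hlen
    have hll : l.length = 3 := by
      rw [← List.toFinset_card_of_nodup hnd, hl3, hD.card_eq t₀ (hR ht₀)]
    obtain ⟨x, y, z, rfl⟩ := List.length_eq_three.1 hll
    have hce : cycEdges [x, y, z] = insert {z, x} {{x, y}, {y, z}} := by
      have := cycEdges_eq x [y] z
      simpa [pathEdges] using this
    have hF0 : Fills (symmDiff R {t₀}) ∅ := by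
      have h3 : Fills {t₀} {e | e ⊆ t₀} := by
        intro e he
        rw [Finset.filter_singleton]
        grind
      intro e he
      rw [hF.symmDiff_singleton h3 he]
      simp only [mem_empty_iff_false, iff_false, not_not]
      refine ⟨fun h => hall e h, fun h => ?_⟩
      have h4 : e ⊆ {x, y, z} := by simp_all
      rw [subset_triple_iff he] at h4
      rw [hce]
      rcases h4 with ⟨rfl, -⟩ | ⟨rfl, -⟩ | ⟨rfl, -⟩
      · simp
      · simp
      · left
        grind
    have h6 := hD.eq_empty_of_fills_empty (by
      intro w hw
      simp only [Finset.mem_symmDiff, Finset.mem_singleton] at hw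
      grind) hF0
    rw [Finset.symmDiff_eq_empty] at h6
    grind
  obtain ⟨t, ht, het, -⟩ := hD.existsUnique_of_mem hR hF (hcard _ heC) heC
  have he₀t' : ¬ e₀ ⊆ t := by grind
  obtain ⟨a, b, m, hrot, rfl⟩ := heC
  have hCeq := cycEdges_congr hrot
  rw [hCeq] at hF he₀ hcard ⊢
  have hnd' := hrot.nodup_iff.1 hnd
  have hab : a ≠ b := by grind
  obtain ⟨d, rfl, hbd, had⟩ := exists_third (hD.card_eq t (hR ht)) hab het
  have habC : ({a, b} : Finset V) ∈ cycEdges (b :: (m ++ [a])) := ⟨a, b, m, List.IsRotated.refl _, rfl⟩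
  -- the triangle `t` at `e` is removable unless its third vertex cuts the boundary in two arcs
  by_cases hdm : d ∈ m
  swap
  · refine ⟨a, b, d, ⟨ht, hab, hbd, had, habC, Or.inl fun e he hde => ?_⟩, he₀t'⟩
    have := mem_of_mem_cycEdges he hde
    grind
  by_cases h1 : ({a, d} : Finset V) ∈ cycEdges (b :: (m ++ [a])) <;>
    by_cases h3 : ({b, d} : Finset V) ∈ cycEdges (b :: (m ++ [a]))
  · -- with three edges of `t` the boundary would be that of `t`, which does not contain `e₀`
    exfalso
    have hm : ∀ (a b : V) (m : List V), (b :: (m ++ [a])).Nodup → d ∈ m → a ≠ d →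
        ({b, d} : Finset V) ∈ cycEdges (b :: (m ++ [a])) → ∃ m', m = d :: m' := by
      intro a b m hnd hdm had h
      obtain ⟨y, m', rfl⟩ := List.exists_cons_of_ne_nil (List.ne_nil_of_mem hdm)
      rw [cycEdges_eq] at h
      rcases h with h | h
      · have : d ∈ ({a, b} : Finset V) := h ▸ (by simp)
        grind
      · rw [eq_of_mem_pathEdges_head hnd h]
        exact ⟨m', rfl⟩
    obtain ⟨m', rfl⟩ := hm a b m hnd' hdm had h3
    obtain ⟨m'', hm''⟩ := hm b a (d :: m').reverse (by
        have : a :: ((d :: m').reverse ++ [b]) = (b :: ((d :: m') ++ [a])).reverse := by simp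
        grind) (by simp) hbd (by
        rw [cycEdges_reverse]; exact h1)
    have hm' : m' = [] := by
      by_contra hne
      have h4 : (d :: m').Nodup := hnd'.sublist (by grind)
      have h5 : d ∈ m' := by
        rcases List.eq_nil_or_concat m' with h | ⟨p, z, h⟩
        · exact absurd h hne
        · rw [h, List.concat_eq_append] at hm''
          simp at hm''
          rw [h]
          simp [hm''.1]
      grind
    subst hm'
    apply he₀t'
    intro v hv
    have := mem_of_mem_cycEdges he₀ hv
    grind
  · exact ⟨a, b, d, ⟨ht, hab, hbd, had, habC, Or.inr ⟨h1, h3⟩⟩, he₀t'⟩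
  · have e1 : ({b, a, d} : Finset V) = {a, b, d} := by ext z; simp; tauto
    refine ⟨b, a, d, ⟨by rwa [e1], hab.symm, had, hbd, by rwa [Finset.pair_comm],
      Or.inr ⟨h3, h1⟩⟩, by rwa [e1]⟩
  · -- a chord: pass to the side on which `e₀` does not lie
    obtain ⟨m₁, m₂, rfl⟩ := List.append_of_mem hdm
    have ih' : ∀ R' ⊆ D, R'.card < R.card → ∀ l : List V, Fills R' (cycEdges l) → l.Nodup →
        3 ≤ l.length → 2 ≤ R'.card → ∀ e₀ ∈ cycEdges l,
        ∃ a b d, Removable R' (cycEdges l) a b d ∧ ¬ e₀ ⊆ {a, b, d} :=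
      fun R' h4 h5 => ih R'.card (hn ▸ h5) R' h4 rfl
    have hCe : cycEdges (b :: ((m₁ ++ d :: m₂) ++ [a])) =
        insert {a, b} (pathEdges (b :: (m₁ ++ [d])) ∪ pathEdges (d :: (m₂ ++ [a]))) := by
      have hsplit : b :: ((m₁ ++ d :: m₂) ++ [a]) = (b :: m₁) ++ d :: (m₂ ++ [a]) := by simp
      rw [cycEdges_eq, hsplit, pathEdges_append]
      rfl
    have he' := he₀
    rw [hCe] at he'
    rcases he' with rfl | he' | he'
    · exact absurd het he₀t'
    · have e1 : ({b, a, d} : Finset V) = {a, b, d} := by ext z; simp; tauto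
      have e2 : (m₁ ++ d :: m₂).reverse = m₂.reverse ++ d :: m₁.reverse := by simp
      have e3 := cycEdges_reverse b (m₁ ++ d :: m₂) a
      rw [e2] at e3
      have e4 : a :: (m₂.reverse ++ d :: m₁.reverse ++ [b]) =
          (b :: (m₁ ++ d :: m₂ ++ [a])).reverse := by simp
      have := hD.exists_removable_of_chord hB hR (b := a) (d := d) (a := b) (m₁ := m₂.reverse)
        (m₂ := m₁.reverse) (by rw [e4]; exact List.nodup_reverse.2 hnd') (by rwa [e3])
        (by rwa [e1]) (by rwa [e3]) (by rwa [e3]) ih' (e₀ := e₀) (by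
          have : d :: (m₁.reverse ++ [b]) = (b :: (m₁ ++ [d])).reverse := by simp
          rwa [this, pathEdges_reverse])
      rwa [e3] at this
    · exact hD.exists_removable_of_chord hB hR hnd' hF ht h3 h1 ih' he'

/-- The cycle `C'` arises from the cycle `C` by replacing the edge `{a, b}` by the two other edges of
the triangle `{a, b, d}`, where `d` is not on `C`. -/
def Flip (C C' : Set (Finset V)) (a b d : V) : Prop :=
  ∃ σ : Set (Finset V), C = insert {a, b} σ ∧ C' = insert {a, d} (insert {d, b} σ) ∧
    {a, b} ∉ σ ∧ ∀ e ∈ σ, d ∉ e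

/-- Removing a triangle changes the boundary by the boundary of the triangle. -/
theorem Fills.erase {R : Finset (Finset V)} {C : Set (Finset V)} (h : Fills R C) {t : Finset V}
    (ht : t ∈ R) {C' : Set (Finset V)} (hC : ∀ e : Finset V, e.card = 2 →
      (e ∈ C' ↔ ¬ (e ∈ C ↔ e ⊆ t))) : Fills (R.erase t) C' := by
  have h2 : Fills {t} {e | e ⊆ t} := by
    intro e he
    rw [Finset.filter_singleton]
    split_ifs with h <;> simp [h]
  intro e he
  have h3 : symmDiff R {t} = R.erase t := by
    ext x
    simp only [Finset.mem_symmDiff, Finset.mem_singleton, Finset.mem_erase]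
    constructor
    · rintro (h | ⟨rfl, h⟩)
      · tauto
      · exact absurd ht h
    · tauto
  rw [← h3, h.symmDiff_singleton h2 he, hC e he]
  rfl

/-- A filling can be made smaller by removing one triangle, its boundary remaining a cycle. -/
theorem IsSurface.exists_shelling_step (hD : IsSurface D) (hB : CyclesBound D)
    {R : Finset (Finset V)} (hR : R ⊆ D) {l : List V} (hF : Fills R (cycEdges l)) (hnd : l.Nodup)
    (hlen : 3 ≤ l.length) (h2 : 2 ≤ R.card) :
    ∃ t ∈ R, ∃ l' : List V, l'.Nodup ∧ 3 ≤ l'.length ∧ Fills (R.erase t) (cycEdges l') ∧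
      ∃ a b d, t = {a, b, d} ∧ a ≠ b ∧ b ≠ d ∧ a ≠ d ∧
        (Flip (cycEdges l) (cycEdges l') a b d ∨ Flip (cycEdges l') (cycEdges l) a b d) := by
  obtain ⟨e₀, he₀⟩ : ∃ e, e ∈ cycEdges l := by
    obtain ⟨e, he, -⟩ := exists_mem_cycEdges (l := l) (by omega)
      (List.getElem_mem (by omega : 0 < l.length))
    exact ⟨e, he⟩
  obtain ⟨a, b, d, ⟨ht, hab, hbd, had, habC, h⟩, -⟩ :=
    hD.exists_removable hB _ R hR rfl l hF hnd hlen h2 e₀ he₀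
  have hflip : ∀ C C' : Set (Finset V), ∀ a b d : V, a ≠ b → b ≠ d → a ≠ d → Flip C C' a b d →
      ∀ e : Finset V, e.card = 2 → (e ∈ C' ↔ ¬ (e ∈ C ↔ e ⊆ {a, b, d})) := by
    rintro C C' a b d hab hbd had ⟨σ, rfl, rfl, h1, h2⟩ e he
    rw [subset_triple_iff he]
    have e1 : ({d, b} : Finset V) = {b, d} := Finset.pair_comm _ _
    have n1 : ({a, b} : Finset V) ≠ {a, d} := fun h => by
      have : b ∈ ({a, d} : Finset V) := h ▸ (by simp)
      simp [hab.symm, hbd] at this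
    have n2 : ({a, b} : Finset V) ≠ {b, d} := fun h => by
      have : a ∈ ({b, d} : Finset V) := h ▸ (by simp)
      simp [hab, had] at this
    simp only [e1, mem_insert_iff]
    by_cases q1 : e = {a, b}
    · subst q1
      simp [n1, n2, h1, hab]
    · by_cases q2 : e = {a, d}
      · subst q2
        have : ({a, d} : Finset V) ∉ σ := fun h => h2 _ h (by simp)
        simp [this, n1.symm, had]
      · by_cases q3 : e = {b, d}
        · subst q3
          have : ({b, d} : Finset V) ∉ σ := fun h => h2 _ h (by simp)
          simp [this, n2.symm, hbd]
        · simp [q1, q2, q3]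
  rcases h with h | ⟨hadC, hbdC⟩
  · -- the vertex `d` is off the cycle and is inserted between `a` and `b`
    obtain ⟨x, y, m, hrot, hxy⟩ := habC
    have hxy' : x ≠ y := by
      rintro rfl
      have := hrot.nodup_iff.1 hnd
      simp at this
    have hCeq := cycEdges_congr hrot
    have hnd' := hrot.nodup_iff.1 hnd
    rw [hCeq] at hF h ⊢
    have hdl : d ∉ y :: (m ++ [x]) := fun hd => by
      obtain ⟨e, he, hde⟩ := exists_mem_cycEdges (l := y :: (m ++ [x])) (by simp) hd
      exact h e he hde
    have hm : m ≠ [] := by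
      rintro rfl
      have := hrot.perm.length_eq
      simp at this
      omega
    have htxy : ({x, y, d} : Finset V) = {a, b, d} := by
      ext z
      have : z ∈ ({a, b} : Finset V) ↔ z ∈ ({x, y} : Finset V) := by rw [hxy]
      simp only [Finset.mem_insert, Finset.mem_singleton] at this ⊢
      tauto
    have hxd : x ≠ d := by
      rintro rfl
      simp at hdl
    have hyd : y ≠ d := by
      rintro rfl
      simp at hdl
    have hfl : Flip (cycEdges (y :: (m ++ [x]))) (cycEdges (y :: ((m ++ [x]) ++ [d]))) x y d := by
      refine ⟨pathEdges (y :: (m ++ [x])), cycEdges_eq _ _ _, ?_, ?_, ?_⟩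
      · rw [cycEdges_eq]
        have : y :: ((m ++ [x]) ++ [d]) = (y :: m) ++ x :: [d] := by simp
        rw [this, pathEdges_append]
        ext e
        simp [pathEdges]
        tauto
      · intro hmem
        obtain ⟨z, m', rfl⟩ := List.exists_cons_of_ne_nil hm
        rw [Finset.pair_comm] at hmem
        have := eq_of_mem_pathEdges_head hnd' hmem
        subst this
        simp at hnd'
      · intro e he hde
        exact hdl (mem_of_mem_pathEdges he hde)
    refine ⟨{x, y, d}, by rwa [htxy], y :: ((m ++ [x]) ++ [d]), ?_, by simp, ?_, x, y, d, rfl, hxy',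
      hyd, hxd, Or.inl hfl⟩
    · have : y :: ((m ++ [x]) ++ [d]) = (y :: (m ++ [x])) ++ [d] := by simp
      rw [this, List.nodup_append]
      refine ⟨hnd', by simp, ?_⟩
      rintro z hz w hw rfl
      simp only [List.mem_singleton] at hw
      exact hdl (hw ▸ hz)
    · exact hF.erase (by rwa [htxy]) (hflip _ _ _ _ _ hxy' hyd hxd hfl)
  · -- two edges of the triangle are on the cycle, and their common vertex `a` is cut off
    obtain ⟨m, hndm, hlm, hCm⟩ : ∃ m : List V, (a :: (m ++ [d])).Nodup ∧
        (a :: (m ++ [d])).length = l.length ∧ cycEdges l = cycEdges (a :: (m ++ [d])) := by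
      obtain ⟨x, y, m, hrot, hxy⟩ := hadC
      have hor : x = a ∧ y = d ∨ x = d ∧ y = a := by
        have h3 : x ∈ ({a, d} : Finset V) := hxy ▸ (by simp)
        have h4 : y ∈ ({a, d} : Finset V) := hxy ▸ (by simp)
        have h5 : x ≠ y := by
          rintro rfl
          have := hrot.nodup_iff.1 hnd
          simp at this
        simp only [Finset.mem_insert, Finset.mem_singleton] at h3 h4
        rcases h3 with rfl | rfl <;> rcases h4 with rfl | rfl <;> simp_all
      rcases hor with ⟨rfl, rfl⟩ | ⟨rfl, rfl⟩
      · refine ⟨m.reverse, ?_, ?_, ?_⟩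
        · have : x :: (m.reverse ++ [y]) = (y :: (m ++ [x])).reverse := by simp
          rw [this]
          exact List.nodup_reverse.2 (hrot.nodup_iff.1 hnd)
        · rw [hrot.perm.length_eq]
          simp
        · rw [cycEdges_reverse]
          exact cycEdges_congr hrot
      · exact ⟨m, hrot.nodup_iff.1 hnd, hrot.perm.length_eq.symm, cycEdges_congr hrot⟩
    have hm : m ≠ [] := by
      rintro rfl
      simp at hlm
      omega
    obtain ⟨y, m, rfl⟩ := List.exists_cons_of_ne_nil hm
    rw [hCm] at hF habC hbdC ⊢
    have hby : b = y := by
      rw [cycEdges_eq] at habC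
      rcases habC with h | h
      · have : b ∈ ({d, a} : Finset V) := h ▸ (by simp)
        simp [hbd, hab.symm] at this
      · exact eq_of_mem_pathEdges_head hndm h
    subst hby
    have hC1 : cycEdges (a :: (b :: m ++ [d])) =
        insert {d, a} (insert {a, b} (pathEdges (b :: (m ++ [d])))) := by
      rw [cycEdges_eq]
      rfl
    have hm' : m ≠ [] := by
      rintro rfl
      apply hbdC
      rw [hC1]
      simp [pathEdges]
    have hnd' : (b :: (m ++ [d])).Nodup := (List.nodup_cons.1 hndm).2
    have hfl : Flip (cycEdges (b :: (m ++ [d]))) (cycEdges (a :: (b :: m ++ [d]))) d b a := by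
      refine ⟨pathEdges (b :: (m ++ [d])), cycEdges_eq _ _ _, hC1, ?_, ?_⟩
      · intro h
        apply hbdC
        rw [hC1]
        rw [Finset.pair_comm] at h
        exact Or.inr (Or.inr h)
      · intro e he hae
        exact (List.nodup_cons.1 hndm).1 (mem_of_mem_pathEdges he hae)
    have htd : ({d, b, a} : Finset V) = {a, b, d} := by ext z; simp; tauto
    refine ⟨{d, b, a}, by rwa [htd], b :: (m ++ [d]), hnd', ?_, ?_, d, b, a, rfl, hbd.symm, hab.symm,
      had.symm, Or.inr hfl⟩
    · have := List.length_pos_iff.2 hm'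
      simp
      omega
    · refine hF.erase (by rwa [htd]) fun e he => ?_
      have := hflip _ _ _ _ _ hbd.symm hab.symm had.symm hfl e he
      tauto

end Combinatorics

/-! ### The boundary of a disk is unknotted -/

/-- The union of the edges of a cycle. -/
def edgeCurve (C : Set (Finset E3)) : Set E3 := ⋃ e ∈ C, convexHull ℝ (e : Set E3)

theorem indep_of_mem_faces (T : Geometry.SimplicialComplex ℝ E3) {a b d : E3} (hab : a ≠ b)
    (hbd : b ≠ d) (had : a ≠ d) (ht : ({a, b, d} : Finset E3) ∈ T.faces) (s t : ℝ)
    (h : s • (b - a) + t • (d - a) = 0) : s = 0 ∧ t = 0 := by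
  have h1 := T.indep ht
  let φ : Fin 3 ↪ ({a, b, d} : Finset E3) :=
    ⟨![⟨a, by simp⟩, ⟨b, by simp⟩, ⟨d, by simp⟩], by
      intro i j hij
      fin_cases i <;> fin_cases j <;> simp [hab, hbd, had, hab.symm, hbd.symm, had.symm] at hij ⊢⟩
  have h2 := h1.comp_embedding φ
  rw [affineIndependent_iff] at h2
  have h3 := h2 Finset.univ ![-s - t, s, t] (by simp [Fin.sum_univ_three]; ring) (by
    have : (-s - t) • a + s • b + t • d = 0 := by
      rw [← h]
      module
    rw [Fin.sum_univ_three]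
    exact this)
  exact ⟨h3 1 (Finset.mem_univ _), h3 2 (Finset.mem_univ _)⟩

theorem finite_pathEdges {V : Type*} [DecidableEq V] (l : List V) : (pathEdges l).Finite := by
  induction l with
  | nil => exact finite_empty
  | cons x l ih =>
    cases l with
    | nil => exact finite_empty
    | cons y l => exact ih.insert _

theorem finite_cycEdges {V : Type*} [DecidableEq V] (l : List V) : (cycEdges l).Finite := by
  by_cases h : ∃ b m a, l = b :: (m ++ [a])
  · obtain ⟨b, m, a, rfl⟩ := h
    rw [cycEdges_eq]
    exact (finite_pathEdges _).insert _
  · refine (finite_empty).subset ?_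
    rintro e ⟨x, y, m, hr, rfl⟩
    exfalso
    apply h
    have h2 : 2 ≤ l.length := by
      rw [hr.perm.length_eq]
      simp
    match l, h2 with
    | b :: c :: l, _ =>
      refine ⟨b, (c :: l).dropLast, (c :: l).getLast (by simp), ?_⟩
      rw [List.dropLast_append_getLast]

/-- Replacing one edge of a triangle of a simplicial complex by the other two is a triangle move: the
simplices of a complex meet in common faces only, so the rest of the curve stays away. -/
theorem ambientIsotopic_of_flip (T : Geometry.SimplicialComplex ℝ E3) {C C' : Set (Finset E3)}
    {a b d : E3} (hab : a ≠ b) (hbd : b ≠ d) (had : a ≠ d)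
    (ht : ({a, b, d} : Finset E3) ∈ T.faces) (hfin : C.Finite)
    (hC : ∀ e ∈ C, e ∈ T.faces ∧ e.card = 2) (h : Flip C C' a b d) :
    AmbientIsotopic (toS3 '' edgeCurve C) (toS3 '' edgeCurve C') := by
  obtain ⟨σ, rfl, rfl, habσ, hd⟩ := h
  have hσ : σ.Finite := hfin.subset (subset_insert _ _)
  have hch : ∀ e : Finset E3, ∃ p : E3 × E3, e ∈ σ → e = {p.1, p.2} := by
    intro e
    by_cases he : e ∈ σ
    · obtain ⟨x, y, -, hxy⟩ := Finset.card_eq_two.1 (hC e (Or.inr he)).2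
      exact ⟨(x, y), fun _ => hxy⟩
    · exact ⟨(0, 0), fun h => absurd h he⟩
  choose p hp using hch
  have hseg : ∀ e ∈ σ, segment ℝ (p e).1 (p e).2 = convexHull ℝ (e : Set E3) := by
    intro e he
    conv_rhs => rw [hp e he]
    rw [Finset.coe_pair, convexHull_pair]
  have hun : (⋃ q ∈ p '' σ, segment ℝ q.1 q.2) = edgeCurve σ := by
    rw [biUnion_image]
    exact iUnion₂_congr hseg
  have key := ambientIsotopic_triangle_move (a := a) (b := b) (d := d)
    (indep_of_mem_faces T hab hbd had ht) (σ := p '' σ) (hσ.image _) (by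
      rintro _ ⟨e, he, rfl⟩ x hx hxt
      rw [hseg e he] at hx
      have hx' : x ∈ convexHull ℝ ((e : Set E3) ∩ (({a, b, d} : Finset E3) : Set E3)) := by
        refine T.inter_subset_convexHull (hC e (Or.inr he)).1 ht ⟨hx, ?_⟩
        simpa using hxt
      rw [← Finset.coe_inter] at hx'
      have hsub : e ∩ {a, b, d} ⊆ {a, b} := by
        intro z hz
        have hzd : z ≠ d := by
          rintro rfl
          exact hd e he (Finset.mem_inter.1 hz).1
        simp only [Finset.mem_inter, Finset.mem_insert, Finset.mem_singleton] at hz ⊢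
        tauto
      -- `e` is not the edge `{a, b}`, so it meets the triangle at most in one vertex
      have hcard : (e ∩ {a, b, d}).card ≤ 1 := by
        by_contra! h2
        have h3 : e ∩ {a, b, d} = {a, b} := Finset.eq_of_subset_of_card_le hsub (by
          rw [Finset.card_pair hab]
          omega)
        have h4 : e ∩ {a, b, d} = e := Finset.eq_of_subset_of_card_le Finset.inter_subset_left (by
          rw [h3, Finset.card_pair hab, (hC e (Or.inr he)).2])
        grind
      rcases Nat.le_one_iff_eq_zero_or_eq_one.1 hcard with h0 | h1
      · rw [Finset.card_eq_zero] at h0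
        rw [h0] at hx'
        simp at hx'
      · obtain ⟨w, hw⟩ := Finset.card_eq_one.1 h1
        rw [hw, Finset.coe_singleton, convexHull_singleton] at hx'
        have hx' : x = w := hx'
        subst hx'
        have h5 : x ∈ e ∩ {a, b, d} := by simp [hw]
        have h6 := hsub h5
        have h7 := (Finset.mem_inter.1 h5).1
        rw [hp e he] at h7
        simpa using And.intro h6 h7)
  rw [hun] at key
  have e1 : edgeCurve (insert {a, b} σ) = edgeCurve σ ∪ segment ℝ a b := by
    simp only [edgeCurve, biUnion_insert, Finset.coe_pair, convexHull_pair]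
    exact union_comm _ _
  have e2 : edgeCurve (insert {a, d} (insert {d, b} σ)) =
      edgeCurve σ ∪ (segment ℝ a d ∪ segment ℝ d b) := by
    simp only [edgeCurve, biUnion_insert, Finset.coe_pair, convexHull_pair]
    grind
  rwa [e1, e2]

/-- An edge cycle that bounds in a triangulated surface with boundary in which every cycle bounds is
unknotted: a filling is reduced to a single triangle by removing one triangle after the other, and
each removal is a triangle move. -/
theorem ambientIsotopic_unknot_of_fills (T : Geometry.SimplicialComplex ℝ E3)
    {D : Finset (Finset E3)} (hD : IsSurface D) (hB : CyclesBound D) (hDT : ∀ t ∈ D, t ∈ T.faces)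
    (n : ℕ) : ∀ R ⊆ D, R.card = n → ∀ l : List E3, Fills R (cycEdges l) → l.Nodup → 3 ≤ l.length →
      AmbientIsotopic (toS3 '' edgeCurve (cycEdges l)) unknot := by
  induction n using Nat.strong_induction_on with
  | _ n ih =>
  intro R hR hn l hF hnd hlen
  have hCf : ∀ R ⊆ D, ∀ l : List E3, Fills R (cycEdges l) → l.Nodup → ∀ e ∈ cycEdges l,
      e ∈ T.faces ∧ e.card = 2 := by
    intro R hR l hF hnd e he
    have h2 := card_of_mem_cycEdges hnd he
    obtain ⟨t, ht, het, -⟩ := hD.existsUnique_of_mem hR hF h2 he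
    exact ⟨T.down_closed (hDT t (hR ht)) het (Finset.card_pos.1 (by omega)), h2⟩
  by_cases h2 : 2 ≤ R.card
  · obtain ⟨t, ht, l', hnd', hlen', hF', a, b, d, rfl, hab, hbd, had, hfl⟩ :=
      hD.exists_shelling_step hB hR hF hnd hlen h2
    have hR' : R.erase {a, b, d} ⊆ D := (Finset.erase_subset _ _).trans hR
    have h3 := ih (R.erase {a, b, d}).card (hn ▸ Finset.card_erase_lt_of_mem ht) _ hR' rfl l' hF'
      hnd' hlen'
    rcases hfl with hfl | hfl
    · exact (ambientIsotopic_of_flip T hab hbd had (hDT _ (hR ht)) (finite_cycEdges _)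
        (hCf R hR l hF hnd) hfl).trans h3
    · exact (ambientIsotopic_of_flip T hab hbd had (hDT _ (hR ht)) (finite_cycEdges _)
        (hCf _ hR' l' hF' hnd') hfl).symm.trans h3
  · obtain ⟨e, he, -⟩ := exists_mem_cycEdges (l := l) (by omega)
      (List.getElem_mem (by omega : 0 < l.length))
    obtain ⟨t, ht, -, -⟩ := hD.existsUnique_of_mem hR hF (card_of_mem_cycEdges hnd he) he
    have hRt : R = {t} := by
      have : R.card = 1 := by
        have := Finset.card_pos.2 ⟨t, ht⟩
        omega
      obtain ⟨s, hs⟩ := Finset.card_eq_one.1 this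
      rw [hs, Finset.mem_singleton] at ht
      rw [hs, ht]
    obtain ⟨a, b, d, hab, had, hbd, rfl⟩ := Finset.card_eq_three.1 (hD.card_eq t (hR ht))
    have hC : cycEdges l = {{a, b}, {b, d}, {d, a}} := by
      ext e
      have e1 : ({d, a} : Finset E3) = {a, d} := Finset.pair_comm _ _
      have key : ∀ e : Finset E3, e.card = 2 → (e ∈ cycEdges l ↔ e ⊆ {a, b, d}) := by
        intro e he
        rw [← hF e he, hRt, Finset.filter_singleton]
        split_ifs with h <;> simp [h]
      simp only [mem_insert_iff, mem_singleton_iff, e1]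
      constructor
      · intro he
        have h2 := card_of_mem_cycEdges hnd he
        have := (key e h2).1 he
        rw [subset_triple_iff h2] at this
        tauto
      · have : e = {a, b} ∨ e = {b, d} ∨ e = {a, d} → e.card = 2 := by grind
        intro h
        rw [key e (this h), subset_triple_iff (this h)]
        tauto
    have hcurve : edgeCurve (cycEdges l) = segment ℝ a b ∪ (segment ℝ b d ∪ segment ℝ d a) := by
      rw [hC]
      simp only [edgeCurve, biUnion_insert, biUnion_singleton, Finset.coe_pair, convexHull_pair]
    rw [hcurve]
    exact triangle_ambientIsotopic_unknot (indep_of_mem_faces T hab hbd had (hDT _ (hR ht)))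

/-! ### Homology modulo 2 of a triangulated surface -/

section Homology

variable {V : Type*} [DecidableEq V]

/-- The edges of a set of triangles. -/
def edgesOf (D : Finset (Finset V)) : Finset (Finset V) := D.biUnion (Finset.powersetCard 2)

/-- The vertices of a set of triangles. -/
def verticesOf (D : Finset (Finset V)) : Finset V := D.biUnion id

theorem mem_edgesOf {D : Finset (Finset V)} {e : Finset V} :
    e ∈ edgesOf D ↔ e.card = 2 ∧ ∃ t ∈ D, e ⊆ t := by
  simp only [edgesOf, Finset.mem_biUnion, Finset.mem_powersetCard]
  grind

theorem mem_verticesOf {D : Finset (Finset V)} {v : V} :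
    v ∈ verticesOf D ↔ ∃ t ∈ D, v ∈ t := by
  simp [verticesOf]

/-- The boundary of 2-chains modulo 2. -/
def boundaryTwo (D : Finset (Finset V)) : (D → ZMod 2) →ₗ[ZMod 2] (edgesOf D → ZMod 2) where
  toFun x e := ∑ t : D, if (e : Finset V) ⊆ t then x t else 0
  map_add' x y := by
    ext e
    simp only [Pi.add_apply, ← Finset.sum_add_distrib]
    grind
  map_smul' c x := by
    ext e
    simp only [Pi.smul_apply, smul_eq_mul, RingHom.id_apply, Finset.mul_sum]
    grind

/-- The boundary of 1-chains modulo 2. -/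
def boundaryOne (D : Finset (Finset V)) :
    (edgesOf D → ZMod 2) →ₗ[ZMod 2] (verticesOf D → ZMod 2) where
  toFun y v := ∑ e : edgesOf D, if (v : V) ∈ (e : Finset V) then y e else 0
  map_add' x y := by
    ext e
    simp only [Pi.add_apply, ← Finset.sum_add_distrib]
    grind
  map_smul' c x := by
    ext e
    simp only [Pi.smul_apply, smul_eq_mul, RingHom.id_apply, Finset.mul_sum]
    grind

open Classical in
/-- The set of triangles of a 2-chain. -/
def chainSupport {D : Finset (Finset V)} (x : D → ZMod 2) : Finset (Finset V) :=
  (Finset.univ.filter (fun t => x t = 1)).map (Function.Embedding.subtype _)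

theorem mem_chainSupport {D : Finset (Finset V)} {x : D → ZMod 2} {t : Finset V} :
    t ∈ chainSupport x ↔ ∃ h : t ∈ D, x ⟨t, h⟩ = 1 := by
  simp [chainSupport]

theorem zmod_two_eq_ite (a : ZMod 2) : a = if a = 1 then 1 else 0 := by
  revert a
  decide

theorem boundaryTwo_apply {D : Finset (Finset V)} (x : D → ZMod 2) (e : edgesOf D) :
    boundaryTwo D x e = (((chainSupport x).filter ((e : Finset V) ⊆ ·)).card : ZMod 2) := by
  classical
  have h1 : (chainSupport x).filter ((e : Finset V) ⊆ ·) =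
      (Finset.univ.filter (fun t : D => (e : Finset V) ⊆ t ∧ x t = 1)).map
        (Function.Embedding.subtype _) := by
    ext t
    simp only [Finset.mem_filter, mem_chainSupport, Finset.mem_map, Finset.mem_univ, true_and,
      Function.Embedding.subtype_apply, Subtype.exists, exists_and_right, exists_eq_right]
    grind
  rw [h1, Finset.card_map, Finset.card_filter]
  push_cast
  change (∑ t : D, if (e : Finset V) ⊆ t then x t else 0) = _
  refine Finset.sum_congr rfl fun t _ => ?_
  rw [ite_and]
  split_ifs with h h'
  · exact h'
  · have := zmod_two_eq_ite (x t)
    rwa [if_neg h'] at this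
  · rfl

theorem odd_card_iff {D : Finset (Finset V)} (x : D → ZMod 2) (e : edgesOf D) :
    Odd ((chainSupport x).filter ((e : Finset V) ⊆ ·)).card ↔ boundaryTwo D x e = 1 := by
  rw [boundaryTwo_apply, ZMod.natCast_eq_one_iff_odd]

variable {D : Finset (Finset V)}

/-- A 2-cycle would be a closed surface in a connected surface with boundary. -/
theorem IsSurface.boundaryTwo_injective (hD : IsSurface D) :
    Function.Injective (boundaryTwo D) := by
  rw [← LinearMap.ker_eq_bot, LinearMap.ker_eq_bot']
  intro x hx
  have hsub : chainSupport x ⊆ D := fun t ht => (mem_chainSupport.1 ht).1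
  have h1 : chainSupport x = ∅ := by
    refine hD.eq_empty_of_fills_empty hsub fun e he => ?_
    simp only [mem_empty_iff_false, iff_false]
    by_cases h : e ∈ edgesOf D
    · have := odd_card_iff x ⟨e, h⟩
      rw [this, hx]
      simp
    · have : (chainSupport x).filter (e ⊆ ·) = ∅ := by
        rw [Finset.filter_eq_empty_iff]
        intro t ht het
        exact h (mem_edgesOf.2 ⟨he, t, hsub ht, het⟩)
      rw [this]
      simp
  ext t
  rw [zmod_two_eq_ite (x t), if_neg]
  · rfl
  · intro h
    have : (t : Finset V) ∈ chainSupport x := mem_chainSupport.2 ⟨t.2, h⟩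
    grind

/-- A vertex of a triangle lies on exactly two of its edges. -/
theorem IsSurface.boundaryOne_boundaryTwo (hD : IsSurface D) (x : D → ZMod 2) :
    boundaryOne D (boundaryTwo D x) = 0 := by
  ext v
  change (∑ e : edgesOf D, if (v : V) ∈ (e : Finset V) then
    (∑ t : D, if (e : Finset V) ⊆ t then x t else 0) else 0) = 0
  have h1 : ∀ e : edgesOf D, (if (v : V) ∈ (e : Finset V) then
      (∑ t : D, if (e : Finset V) ⊆ t then x t else 0) else 0) =
      ∑ t : D, if (v : V) ∈ (e : Finset V) ∧ (e : Finset V) ⊆ t then x t else 0 := by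
    intro e
    split_ifs with h <;> simp [h]
  rw [Finset.sum_congr rfl fun e _ => h1 e, Finset.sum_comm]
  refine Finset.sum_eq_zero fun t _ => ?_
  rw [← Finset.sum_filter, Finset.sum_const]
  have h2 : (Finset.univ.filter fun e : edgesOf D =>
      (v : V) ∈ (e : Finset V) ∧ (e : Finset V) ⊆ t).card =
      ((edgesOf D).filter fun e : Finset V => (v : V) ∈ e ∧ e ⊆ (t : Finset V)).card := by
    rw [← Finset.card_map (Function.Embedding.subtype _)]
    congr 1
    ext e
    simp
    tauto
  have h3 : ((edgesOf D).filter fun e : Finset V => (v : V) ∈ e ∧ e ⊆ (t : Finset V)).card = 0 ∨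
      ((edgesOf D).filter fun e : Finset V => (v : V) ∈ e ∧ e ⊆ (t : Finset V)).card = 2 := by
    by_cases hv : (v : V) ∈ (t : Finset V)
    · right
      obtain ⟨a, ha, hav⟩ := Finset.exists_mem_ne
        (by rw [hD.card_eq t t.2]; omega : 1 < (t : Finset V).card) v
      obtain ⟨d, hd, had, hvd⟩ := exists_third (hD.card_eq t t.2) hav.symm (by grind)
      have : ((edgesOf D).filter fun e : Finset V => (v : V) ∈ e ∧ e ⊆ (t : Finset V)) =
          {{(v : V), a}, {(v : V), d}} := by
        ext e
        simp only [Finset.mem_filter, Finset.mem_insert, Finset.mem_singleton]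
        constructor
        · rintro ⟨h4, h5, h6⟩
          rw [hd, subset_triple_iff (mem_edgesOf.1 h4).1] at h6
          grind
        · have hsub : ∀ z ∈ (t : Finset V), (v : V) ≠ z → ({(v : V), z} : Finset V) ∈ edgesOf D ∧
              ({(v : V), z} : Finset V) ⊆ t := by
            intro z hz hne
            have : ({(v : V), z} : Finset V) ⊆ t := by grind
            exact ⟨mem_edgesOf.2 ⟨Finset.card_pair hne, t, t.2, this⟩, this⟩
          grind
      grind
    · left
      rw [Finset.card_eq_zero, Finset.filter_eq_empty_iff]
      grind
  rw [h2]
  rcases h3 with h | h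
  · rw [h, zero_smul]
  · rw [h, two_nsmul, CharTwo.add_self_eq_zero]

/-- Since the surface is connected, the boundaries of 1-chains and a single vertex span the space of
0-chains. -/
theorem IsSurface.card_vertices_le (hD : IsSurface D) :
    (verticesOf D).card ≤ Module.finrank (ZMod 2) (LinearMap.range (boundaryOne D)) + 1 := by
  obtain ⟨e₀, he₀, h1⟩ := hD.free
  obtain ⟨t₀, ht₀⟩ := Finset.card_eq_one.1 h1
  have ht₀D : t₀ ∈ D := (Finset.mem_filter.1 (by rw [ht₀]; simp : t₀ ∈ D.filter (e₀ ⊆ ·))).1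
  obtain ⟨v₀, hv₀⟩ : t₀.Nonempty := Finset.card_pos.1 (by rw [hD.card_eq t₀ ht₀D]; omega)
  set w₀ : verticesOf D := ⟨v₀, mem_verticesOf.2 ⟨t₀, ht₀D, hv₀⟩⟩
  set W := LinearMap.range (boundaryOne D) ⊔ Submodule.span (ZMod 2) {Pi.single w₀ (1 : ZMod 2)}
  have hmem : ∀ v w : verticesOf D, (∃ t ∈ D, (v : V) ∈ t ∧ (w : V) ∈ t) →
      Pi.single v (1 : ZMod 2) ∈ W → Pi.single w (1 : ZMod 2) ∈ W := by
    rintro v w ⟨t, ht, hv, hw⟩ h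
    by_cases hvw : v = w
    · rwa [← hvw]
    have hvw' : (v : V) ≠ w := fun h => hvw (Subtype.ext h)
    have he : ({(v : V), (w : V)} : Finset V) ∈ edgesOf D := by
      refine mem_edgesOf.2 ⟨Finset.card_pair hvw', t, ht, ?_⟩
      grind
    have h2 : boundaryOne D (Pi.single ⟨_, he⟩ 1) = Pi.single v 1 + Pi.single w 1 := by
      ext z
      change (∑ e : edgesOf D, if (z : V) ∈ (e : Finset V) then
        (Pi.single (⟨_, he⟩ : edgesOf D) (1 : ZMod 2) : edgesOf D → ZMod 2) e else 0) = _
      rw [Finset.sum_eq_single ⟨_, he⟩]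
      · simp only [Finset.mem_insert, Finset.mem_singleton, Pi.single_eq_same, Pi.add_apply,
          Pi.single_apply, Subtype.ext_iff]
        grind
      · grind
      grind
    have h3 : (Pi.single w (1 : ZMod 2) : verticesOf D → ZMod 2) =
        (Pi.single v 1 + Pi.single w 1) - Pi.single v 1 := by
      abel
    rw [h3, ← h2]
    exact W.sub_mem (Submodule.mem_sup_left ⟨_, rfl⟩) h
  have hall : ∀ t, Relation.ReflTransGen (fun s s' => s' ∈ D ∧ Adj s s') t₀ t →
      t ∈ D ∧ ∀ v : verticesOf D, (v : V) ∈ t → Pi.single v (1 : ZMod 2) ∈ W := by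
    intro t h
    induction h with
    | refl =>
      refine ⟨ht₀D, fun v hv => hmem w₀ v ⟨t₀, ht₀D, hv₀, hv⟩ ?_⟩
      exact Submodule.mem_sup_right (Submodule.mem_span_singleton_self _)
    | tail _ h2 ih =>
      obtain ⟨h3, e, he, h4, h5⟩ := h2
      refine ⟨h3, fun v hv => ?_⟩
      obtain ⟨z, hz⟩ : e.Nonempty := Finset.card_pos.1 (by omega)
      exact hmem ⟨z, mem_verticesOf.2 ⟨_, ih.1, h4 hz⟩⟩ v ⟨_, h3, h5 hz, hv⟩ (ih.2 _ (h4 hz))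
  have htop : W = ⊤ := by
    rw [eq_top_iff, ← (Pi.basisFun (ZMod 2) (verticesOf D)).span_eq, Submodule.span_le]
    rintro _ ⟨v, rfl⟩
    rw [Pi.basisFun_apply]
    obtain ⟨t, ht, hv⟩ := mem_verticesOf.1 v.2
    exact (hall t (hD.conn t₀ ht₀D t ht)).2 v hv
  have h5 := Submodule.finrank_add_le_finrank_add_finrank (LinearMap.range (boundaryOne D))
    (Submodule.span (ZMod 2) {Pi.single w₀ (1 : ZMod 2)})
  have h6 : Module.finrank (ZMod 2) W = (verticesOf D).card := by
    rw [htop, finrank_top, Module.finrank_fintype_fun_eq_card, Fintype.card_coe]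
  have h7 : Module.finrank (ZMod 2)
      (Submodule.span (ZMod 2) {(Pi.single w₀ (1 : ZMod 2) : verticesOf D → ZMod 2)}) ≤ 1 :=
    (finrank_span_le_card _).trans (by simp)
  change Module.finrank (ZMod 2) W ≤ _ at h5
  omega

/-- A vertex of an edge cycle lies on exactly two edges of the cycle. -/
theorem boundaryOne_cycle {l : List V} (hnd : l.Nodup) (hlen : 3 ≤ l.length) (y : edgesOf D → ZMod 2)
    (hl : ∀ e ∈ cycEdges l, e ∈ edgesOf D)
    (hy : ∀ e : edgesOf D, (e : Finset V) ∈ cycEdges l ∧ y e = 1 ∨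
      (e : Finset V) ∉ cycEdges l ∧ y e = 0) :
    boundaryOne D y = 0 := by
  classical
  ext v
  change (∑ e : edgesOf D, if (v : V) ∈ (e : Finset V) then y e else 0) = 0
  have h1 : ∀ e : edgesOf D, (if (v : V) ∈ (e : Finset V) then y e else 0) =
      if (v : V) ∈ (e : Finset V) ∧ (e : Finset V) ∈ cycEdges l then 1 else 0 := by grind
  rw [Finset.sum_congr rfl fun e _ => h1 e, ← Finset.sum_filter, Finset.sum_const, nsmul_one]
  have h2 : (Finset.univ.filter fun e : edgesOf D => (v : V) ∈ (e : Finset V) ∧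
      (e : Finset V) ∈ cycEdges l).card =
      ((edgesOf D).filter fun e => (v : V) ∈ e ∧ e ∈ cycEdges l).card := by
    rw [← Finset.card_map (Function.Embedding.subtype _)]
    congr 1
    ext e
    simp
    tauto
  rw [h2]
  by_cases hv : (v : V) ∈ l
  · obtain ⟨l₁, l₂, rfl⟩ := List.append_of_mem hv
    have hr : (l₁ ++ (v : V) :: l₂).IsRotated ((v : V) :: (l₂ ++ l₁)) := by
      have := List.isRotated_append (l := l₁) (l' := (v : V) :: l₂)
      simpa using this
    have hnd' := hr.nodup_iff.1 hnd
    have hlen' : 2 ≤ (l₂ ++ l₁).length := by grind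
    rw [cycEdges_congr hr] at hl ⊢
    obtain ⟨b, q, hq⟩ := List.exists_cons_of_ne_nil (l := l₂ ++ l₁) (by grind)
    rw [hq] at hl hnd' hlen' ⊢
    rcases List.eq_nil_or_concat q with rfl | ⟨p, a, rfl⟩
    · simp at hlen'
    rw [List.concat_eq_append] at *
    have hce : cycEdges ((v : V) :: b :: (p ++ [a])) =
        insert {a, (v : V)} (insert {(v : V), b} (pathEdges (b :: (p ++ [a])))) := by
      have := cycEdges_eq (v : V) (b :: p) a
      simpa [pathEdges] using this
    have hvn : (v : V) ∉ b :: (p ++ [a]) := (List.nodup_cons.1 hnd').1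
    have hab : a ≠ b := by grind
    have : ((edgesOf D).filter fun e => (v : V) ∈ e ∧ e ∈ cycEdges ((v : V) :: b :: (p ++ [a]))) =
        {{a, (v : V)}, {(v : V), b}} := by
      ext e
      simp only [Finset.mem_filter, Finset.mem_insert, Finset.mem_singleton]
      constructor
      · rintro ⟨-, h4, h5⟩
        rw [hce] at h5
        rcases h5 with h | h | h
        · exact Or.inl h
        · exact Or.inr h
        · exact absurd (mem_of_mem_pathEdges h h4) hvn
      · have h6 : e = {a, (v : V)} ∨ e = {(v : V), b} → e ∈ cycEdges ((v : V) :: b :: (p ++ [a])) := by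
          grind
        intro h
        refine ⟨hl e (h6 h), ?_, h6 h⟩
        rcases h with rfl | rfl <;> simp
    rw [this, Finset.card_pair]
    · rfl
    · intro h
      have : a ∈ ({(v : V), b} : Finset V) := h ▸ (by simp)
      grind
  · have : ((edgesOf D).filter fun e => (v : V) ∈ e ∧ e ∈ cycEdges l) = ∅ := by
      rw [Finset.filter_eq_empty_iff]
      rintro e - ⟨h4, h5⟩
      exact hv (mem_of_mem_cycEdges h5 h4)
    rw [this]
    simp

/-- In a connected surface with boundary and positive Euler characteristic every cycle bounds: the
first homology modulo 2 vanishes by a dimension count. -/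
theorem IsSurface.cyclesBound (hD : IsSurface D)
    (hχ : (edgesOf D).card + 1 ≤ (verticesOf D).card + D.card) : CyclesBound D := by
  classical
  intro l hnd hlen hl
  have hl' : ∀ e ∈ cycEdges l, e ∈ edgesOf D := fun e he =>
    mem_edgesOf.2 ⟨card_of_mem_cycEdges hnd he, hl e he⟩
  have hle : LinearMap.range (boundaryTwo D) ≤ LinearMap.ker (boundaryOne D) := by
    rintro _ ⟨x, rfl⟩
    exact hD.boundaryOne_boundaryTwo x
  have h1 : Module.finrank (ZMod 2) (LinearMap.range (boundaryTwo D)) = D.card := by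
    rw [LinearMap.finrank_range_of_inj hD.boundaryTwo_injective,
      Module.finrank_fintype_fun_eq_card, Fintype.card_coe]
  have h2 := LinearMap.finrank_range_add_finrank_ker (boundaryOne D)
  rw [Module.finrank_fintype_fun_eq_card, Fintype.card_coe] at h2
  have h3 := hD.card_vertices_le
  -- with `V`, `E`, `F` simplices in dimensions 0, 1, 2: the image of 2-chains has dimension `F`, and
  -- the space of 1-cycles has dimension at most `E - (V - 1) ≤ F`
  have heq : LinearMap.range (boundaryTwo D) = LinearMap.ker (boundaryOne D) :=
    Submodule.eq_of_le_of_finrank_le hle (by omega)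
  let y : edgesOf D → ZMod 2 := fun e => if (e : Finset V) ∈ cycEdges l then 1 else 0
  have hy : y ∈ LinearMap.ker (boundaryOne D) := by
    refine boundaryOne_cycle hnd hlen y hl' fun e => ?_
    grind
  rw [← heq] at hy
  obtain ⟨x, hx⟩ := hy
  have hsub : chainSupport x ⊆ D := fun t ht => (mem_chainSupport.1 ht).1
  refine ⟨chainSupport x, hsub, fun e he => ?_⟩
  by_cases h : e ∈ edgesOf D
  · have := odd_card_iff x ⟨e, h⟩
    rw [this, hx]
    simp [y]
  · have h4 : (chainSupport x).filter (e ⊆ ·) = ∅ := by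
      rw [Finset.filter_eq_empty_iff]
      intro t ht het
      exact h (mem_edgesOf.2 ⟨he, t, hsub ht, het⟩)
    grind

end Homology

/-! ### Components of a triangulated surface -/

section Components

variable {V : Type*} [DecidableEq V]

/-- The simplices of a triangulated compact surface. -/
structure IsPureSurface (F : Finset (Finset V)) : Prop where
  nonempty : ∀ s ∈ F, s.Nonempty
  down : ∀ s ∈ F, ∀ s' ⊆ s, s'.Nonempty → s' ∈ F
  pure : ∀ s ∈ F, ∃ t ∈ F, s ⊆ t ∧ t.card = 3
  edge_le : ∀ e ∈ F, e.card = 2 → (F.filter (fun t => t.card = 3 ∧ e ⊆ t)).card ≤ 2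
  link : ∀ v a b : V, a ≠ v → b ≠ v → (∃ s ∈ F, v ∈ s ∧ a ∈ s) → (∃ s ∈ F, v ∈ s ∧ b ∈ s) →
    Relation.ReflTransGen (fun x y => x ≠ v ∧ y ≠ v ∧ ∃ t ∈ F, v ∈ t ∧ x ∈ t ∧ y ∈ t) a b

variable {F : Finset (Finset V)}

/-- The triangles among the simplices. -/
def triangles (F : Finset (Finset V)) : Finset (Finset V) := F.filter (fun t => t.card = 3)

theorem mem_triangles {t : Finset V} : t ∈ triangles F ↔ t ∈ F ∧ t.card = 3 := by
  simp [triangles]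

/-- Two triangles are joined by a chain of triangles with common edges. -/
def SameComp (F : Finset (Finset V)) : Finset V → Finset V → Prop :=
  Relation.ReflTransGen (fun s s' => s ∈ triangles F ∧ s' ∈ triangles F ∧ Adj s s')

theorem SameComp.symm {s s' : Finset V} (h : SameComp F s s') : SameComp F s' s := by
  induction h with
  | refl => exact Relation.ReflTransGen.refl
  | tail _ h ih =>
    obtain ⟨h1, h2, e, h3, h4, h5⟩ := h
    exact Relation.ReflTransGen.head ⟨h2, h1, e, h3, h5, h4⟩ ih

/-- Triangles with a common vertex are joined by a chain of triangles around this vertex. -/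
theorem IsPureSurface.star (hF : IsPureSurface F) {v : V} {t t' : Finset V} (ht : t ∈ triangles F)
    (ht' : t' ∈ triangles F) (hv : v ∈ t) (hv' : v ∈ t') :
    Relation.ReflTransGen (fun s s' => s ∈ triangles F ∧ s' ∈ triangles F ∧
      ∃ e : Finset V, e.card = 2 ∧ v ∈ e ∧ e ⊆ s ∧ e ⊆ s') t t' := by
  rw [mem_triangles] at ht ht'
  obtain ⟨a, ha, hav⟩ := Finset.exists_mem_ne (by omega : 1 < t.card) v
  obtain ⟨b, hb, hbv⟩ := Finset.exists_mem_ne (by omega : 1 < t'.card) v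
  have hstep : ∀ s ∈ triangles F, ∀ s' ∈ triangles F, ∀ x, x ≠ v → v ∈ s → x ∈ s → v ∈ s' →
      x ∈ s' → (s ∈ triangles F ∧ s' ∈ triangles F ∧
        ∃ e : Finset V, e.card = 2 ∧ v ∈ e ∧ e ⊆ s ∧ e ⊆ s') := by
    intro s hs s' hs' x hx h1 h2 h3 h4
    refine ⟨hs, hs', {v, x}, Finset.card_pair hx.symm, by simp, ?_, ?_⟩ <;>
    · grind
  have key : ∀ y, Relation.ReflTransGen
      (fun x y => x ≠ v ∧ y ≠ v ∧ ∃ t ∈ F, v ∈ t ∧ x ∈ t ∧ y ∈ t) a y → y ≠ v ∧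
      ∀ s ∈ triangles F, v ∈ s → y ∈ s → Relation.ReflTransGen (fun s s' => s ∈ triangles F ∧
        s' ∈ triangles F ∧ ∃ e : Finset V, e.card = 2 ∧ v ∈ e ∧ e ⊆ s ∧ e ⊆ s') t s := by
    intro y h
    induction h with
    | refl =>
      exact ⟨hav, fun s hs h1 h2 => Relation.ReflTransGen.single
        (hstep t (mem_triangles.2 ht) s hs a hav hv ha h1 h2)⟩
    | tail _ h2 ih =>
      obtain ⟨h3, h4, u, hu, hvu, hxu, hyu⟩ := h2
      obtain ⟨w, hw, huw, hw3⟩ := hF.pure u hu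
      have hwT : w ∈ triangles F := mem_triangles.2 ⟨hw, hw3⟩
      grind
  exact (key b (hF.link v a b hav hbv ⟨t, ht.1, hv, ha⟩ ⟨t', ht'.1, hv', hb⟩)).2 t'
    (mem_triangles.2 ht') hv' hb

theorem IsPureSurface.sameComp (hF : IsPureSurface F) {v : V} {t t' : Finset V}
    (ht : t ∈ triangles F) (ht' : t' ∈ triangles F) (hv : v ∈ t) (hv' : v ∈ t') :
    SameComp F t t' := by
  refine Relation.ReflTransGen.mono ?_ _ _ (hF.star ht ht' hv hv')
  rintro s s' ⟨h1, h2, e, h3, -, h4, h5⟩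
  exact ⟨h1, h2, e, h3, h4, h5⟩

open Classical in
/-- The triangles in the component of a triangle. Components are formed along common edges; in a
surface these are the connected components, by `IsPureSurface.star`. -/
noncomputable def comp (F : Finset (Finset V)) (t : Finset V) : Finset (Finset V) :=
  (triangles F).filter (SameComp F t)

theorem mem_comp {t s : Finset V} : s ∈ comp F t ↔ s ∈ triangles F ∧ SameComp F t s := by
  simp [comp]

theorem mem_comp_of_mem (hF : IsPureSurface F) {v : V} {t s s' : Finset V} (hs : s ∈ comp F t)
    (hs' : s' ∈ triangles F) (hv : v ∈ s) (hv' : v ∈ s') : s' ∈ comp F t := by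
  rw [mem_comp] at hs ⊢
  exact ⟨hs', hs.2.trans (hF.sameComp hs.1 hs' hv hv')⟩

theorem comp_eq_of_sameComp {t t' : Finset V} (h : SameComp F t t') : comp F t = comp F t' := by
  ext s
  rw [mem_comp, mem_comp]
  exact ⟨fun h1 => ⟨h1.1, h.symm.trans h1.2⟩, fun h1 => ⟨h1.1, h.trans h1.2⟩⟩

/-- A component with a free edge is a connected surface with boundary. -/
theorem IsPureSurface.isSurface_comp (hF : IsPureSurface F) {t : Finset V}
    (hfree : ∃ e : Finset V, e.card = 2 ∧ ((comp F t).filter (e ⊆ ·)).card = 1) :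
    IsSurface (comp F t) where
  card_eq s hs := (mem_triangles.1 (mem_comp.1 hs).1).2
  edge_le e he := by
    by_cases h : ∃ s ∈ comp F t, e ⊆ s
    · obtain ⟨s, hs, hes⟩ := h
      have heF : e ∈ F := hF.down s (mem_triangles.1 (mem_comp.1 hs).1).1 e hes
        (Finset.card_pos.1 (by omega))
      refine (Finset.card_le_card ?_).trans (hF.edge_le e heF he)
      intro s' hs'
      rw [Finset.mem_filter] at hs' ⊢
      have := mem_triangles.1 (mem_comp.1 hs'.1).1
      grind
    · have : (comp F t).filter (e ⊆ ·) = ∅ := by grind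
      rw [this]
      simp
  link v s hs hv s' hs' hv' := by
    have h := hF.star (mem_comp.1 hs).1 (mem_comp.1 hs').1 hv hv'
    clear hs' hv'
    induction h with
    | refl => grind
    | tail _ h2 ih =>
      refine ih.tail ⟨?_, h2.2.2⟩
      obtain ⟨e, -, h3, -, h4⟩ := h2.2.2
      exact mem_comp_of_mem hF hs h2.2.1 hv (h4 h3)
  conn s hs s' hs' := by
    have h : SameComp F s s' := (mem_comp.1 hs).2.symm.trans (mem_comp.1 hs').2
    clear hs'
    induction h with
    | refl => grind
    | tail h1 h2 ih =>
      refine ih.tail ⟨mem_comp.2 ⟨h2.2.1, ?_⟩, h2.2.2⟩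
      exact ((mem_comp.1 hs).2.trans h1).tail h2
  free := hfree

/-- The Euler characteristic of a finite set of simplices. -/
def chiOf (F : Finset (Finset V)) : ℤ :=
  ∑ s ∈ F, if s.card = 1 then 1 else if s.card = 2 then -1 else if s.card = 3 then 1 else 0

theorem chiOf_eq (F : Finset (Finset V)) :
    chiOf F = ((F.filter (fun s => s.card = 1)).card : ℤ) - (F.filter (fun s => s.card = 2)).card +
      (F.filter (fun s => s.card = 3)).card := by
  simp only [Finset.card_filter, chiOf]
  push_cast
  rw [← Finset.sum_sub_distrib, ← Finset.sum_add_distrib]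
  grind

/-- Some component of a surface of positive Euler characteristic has positive Euler
characteristic. -/
theorem IsPureSurface.exists_chi_pos (hF : IsPureSurface F) (hχ : 0 < chiOf F) :
    ∃ t ∈ triangles F, 0 < chiOf (F.filter (fun s => ∃ t' ∈ comp F t, s ⊆ t')) := by
  classical
  have hch : ∀ s : Finset V, ∃ t : Finset V, s ∈ F → t ∈ triangles F ∧ s ⊆ t := by
    intro s
    by_cases h : s ∈ F
    · obtain ⟨t, h1, h2, h3⟩ := hF.pure s h
      exact ⟨t, fun _ => ⟨mem_triangles.2 ⟨h1, h3⟩, h2⟩⟩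
    · exact ⟨∅, fun h' => absurd h' h⟩
  -- sort the simplices by the component of a triangle that contains them
  choose τ hτ using hch
  have hsum := Finset.sum_fiberwise_of_maps_to (s := F) (t := F.image fun s => comp F (τ s))
    (g := fun s => comp F (τ s)) (fun s hs => Finset.mem_image_of_mem _ hs)
    (fun s => (if s.card = 1 then 1 else if s.card = 2 then -1 else if s.card = 3 then 1 else 0 : ℤ))
  have hpos : ∃ D ∈ F.image fun s => comp F (τ s), 0 < ∑ s ∈ F with comp F (τ s) = D,
      (if s.card = 1 then 1 else if s.card = 2 then -1 else if s.card = 3 then 1 else 0 : ℤ) := by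
    by_contra! hle
    have := Finset.sum_nonpos hle
    rw [hsum] at this
    exact absurd hχ (not_lt.2 this)
  obtain ⟨D, hD, h⟩ := hpos
  obtain ⟨s₀, hs₀, rfl⟩ := Finset.mem_image.1 hD
  refine ⟨τ s₀, (hτ s₀ hs₀).1, ?_⟩
  have : (F.filter fun s => comp F (τ s) = comp F (τ s₀)) =
      F.filter (fun s => ∃ t' ∈ comp F (τ s₀), s ⊆ t') := by
    refine Finset.filter_congr fun s hs => ?_
    obtain ⟨h1, h2⟩ := hτ s hs
    constructor
    · intro h3
      refine ⟨τ s, ?_, h2⟩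
      rw [← h3]
      exact mem_comp.2 ⟨h1, Relation.ReflTransGen.refl⟩
    · rintro ⟨t', ht', hst⟩
      obtain ⟨v, hv⟩ := hF.nonempty s hs
      exact (comp_eq_of_sameComp (mem_comp.1 (mem_comp_of_mem hF ht' h1 (hst hv) (h2 hv))).2).symm
  rw [this] at h
  exact h

/-- Positivity of the Euler characteristic of a component, in terms of vertices, edges and
triangles. -/
theorem IsPureSurface.card_le_of_chi_pos (hF : IsPureSurface F) {t : Finset V}
    (h : 0 < chiOf (F.filter (fun s => ∃ t' ∈ comp F t, s ⊆ t'))) :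
    (edgesOf (comp F t)).card + 1 ≤ (verticesOf (comp F t)).card + (comp F t).card := by
  have hcF : ∀ t' ∈ comp F t, t' ∈ F ∧ t'.card = 3 := fun t' h => mem_triangles.1 (mem_comp.1 h).1
  rw [chiOf_eq, Finset.filter_filter, Finset.filter_filter, Finset.filter_filter] at h
  have h1 : (F.filter fun s => (∃ t' ∈ comp F t, s ⊆ t') ∧ s.card = 2) = edgesOf (comp F t) := by
    ext e
    rw [Finset.mem_filter, mem_edgesOf]
    constructor
    · grind
    · rintro ⟨h3, t', ht', het⟩
      exact ⟨hF.down t' (hcF t' ht').1 e het (Finset.card_pos.1 (by omega)), ⟨t', ht', het⟩, h3⟩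
  have h2 : (F.filter fun s => (∃ t' ∈ comp F t, s ⊆ t') ∧ s.card = 3) = comp F t := by
    ext s
    rw [Finset.mem_filter]
    constructor
    · rintro ⟨-, ⟨t', ht', hst⟩, h3⟩
      rwa [Finset.eq_of_subset_of_card_le hst (by rw [h3, (hcF t' ht').2])]
    grind
  have h3 : (F.filter fun s => (∃ t' ∈ comp F t, s ⊆ t') ∧ s.card = 1) =
      (verticesOf (comp F t)).map ⟨singleton, Finset.singleton_injective⟩ := by
    ext s
    simp only [Finset.mem_filter, Finset.mem_map, Function.Embedding.coeFn_mk, mem_verticesOf]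
    constructor
    · rintro ⟨-, ⟨t', ht', hst⟩, h3⟩
      obtain ⟨v, rfl⟩ := Finset.card_eq_one.1 h3
      grind
    · rintro ⟨v, ⟨t', ht', hv⟩, rfl⟩
      have hsub : {v} ⊆ t' := Finset.singleton_subset_iff.2 hv
      exact ⟨hF.down t' (hcF t' ht').1 _ hsub (by simp), ⟨t', ht', hsub⟩, by simp⟩
  grind

end Components

/-! ### A component with boundary of a spanning surface -/

theorem ProperSurface.isPureSurface {K : PolygonalKnot} {N : TubularNeighborhood K}
    (S : ProperSurface N) : IsPureSurface S.finite.toFinset where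
  nonempty s hs := S.T.nonempty_of_mem_faces (by simpa using hs)
  down s hs s' h h' := by
    simp only [Finite.mem_toFinset] at hs ⊢
    exact S.T.down_closed hs h h'
  pure s hs := by
    obtain ⟨t, h1, h2, h3⟩ := S.pure s (by simpa using hs)
    exact ⟨t, by simpa using h1, h2, h3⟩
  edge_le e he h2 := by
    have := S.edge e (by simpa using he) h2
    rw [← Set.ncard_coe_finset]
    convert this using 2
    ext t
    simp
  link v a b ha hb h1 h2 := by
    have := S.link v a b ha hb (by simpa using h1) (by simpa using h2)
    simpa using this

/-- The union of a set of triangles. -/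
def support (D : Finset (Finset E3)) : Set E3 := ⋃ t ∈ D, convexHull ℝ (t : Set E3)

namespace ProperSurface

variable {K : PolygonalKnot} {N : TubularNeighborhood K} (S : ProperSurface N)

theorem mem_faces_of_mem_comp {t s : Finset E3} (h : s ∈ comp S.finite.toFinset t) :
    s ∈ S.T.faces ∧ s.card = 3 := by
  have := mem_triangles.1 (mem_comp.1 h).1
  simpa using this

/-- A simplex that meets the support of a component is a simplex of this component. -/
theorem exists_mem_comp_of_inter {t s : Finset E3} (hs : s ∈ S.T.faces) {x : E3}
    (hx : x ∈ convexHull ℝ (s : Set E3)) (hx' : x ∈ support (comp S.finite.toFinset t))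
    {u : Finset E3} (hu : u ∈ S.T.faces) (hu3 : u.card = 3) (hsu : s ⊆ u) :
    u ∈ comp S.finite.toFinset t := by
  simp only [support, mem_iUnion] at hx'
  obtain ⟨t', ht', hxt⟩ := hx'
  have h1 := S.T.inter_subset_convexHull hs (S.mem_faces_of_mem_comp ht').1 ⟨hx, hxt⟩
  obtain ⟨v, hv⟩ := convexHull_nonempty_iff.1 ⟨x, h1⟩
  exact mem_comp_of_mem S.isPureSurface ht' (mem_triangles.2 ⟨by simpa using hu, hu3⟩) hv.2
    (hsu hv.1)

theorem isClosed_support (D : Finset (Finset E3)) : IsClosed (support D) := by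
  refine D.finite_toSet.isClosed_biUnion fun t _ => ?_
  exact (t.finite_toSet.isCompact_convexHull ℝ).isClosed

/-- Adjacent triangles meet, so their union is connected. -/
theorem isPreconnected_support_comp {t : Finset E3} :
    IsPreconnected (support (comp S.finite.toFinset t)) := by
  refine IsPreconnected.biUnion_of_reflTransGen
    (fun s _ => (convex_convexHull ℝ _).isPreconnected) fun s hs s' hs' => ?_
  have h : SameComp S.finite.toFinset s s' := (mem_comp.1 hs).2.symm.trans (mem_comp.1 hs').2
  clear hs'
  induction h with
  | refl => grind
  | tail h1 h2 ih =>
    refine ih.tail ⟨?_, mem_comp.2 ⟨h2.1, (mem_comp.1 hs).2.trans h1⟩⟩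
    obtain ⟨e, he, h3, h4⟩ := h2.2.2
    obtain ⟨v, hv⟩ : e.Nonempty := Finset.card_pos.1 (by omega)
    exact ⟨v, subset_convexHull ℝ _ (h3 hv), subset_convexHull ℝ _ (h4 hv)⟩

/-- The combinatorial components are the topological ones: the remaining triangles form a disjoint
closed set. -/
theorem connectedComponentIn_space {t : Finset E3} {p : E3}
    (hp : p ∈ support (comp S.finite.toFinset t)) :
    connectedComponentIn S.T.space p = support (comp S.finite.toFinset t) := by
  have hsub : support (comp S.finite.toFinset t) ⊆ S.T.space := by
    refine iUnion₂_subset fun s hs => ?_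
    exact S.T.convexHull_subset_space (S.mem_faces_of_mem_comp hs).1
  refine subset_antisymm ?_
    (S.isPreconnected_support_comp.subset_connectedComponentIn hp hsub)
  set B := support ((triangles S.finite.toFinset) \ (comp S.finite.toFinset t)) with hB
  have hcov : S.T.space ⊆ support (comp S.finite.toFinset t) ∪ B := by
    intro x hx
    obtain ⟨s, hs, hxs⟩ := Geometry.SimplicialComplex.mem_space_iff.1 hx
    obtain ⟨u, hu, hsu, hu3⟩ := S.pure s hs
    have hxu := convexHull_mono (by exact_mod_cast hsu) hxs
    by_cases h : u ∈ comp S.finite.toFinset t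
    · exact Or.inl (mem_biUnion (t := fun u : Finset E3 => convexHull ℝ (u : Set E3)) h hxu)
    · refine Or.inr (mem_biUnion (t := fun u : Finset E3 => convexHull ℝ (u : Set E3)) ?_ hxu)
      exact Finset.mem_sdiff.2 ⟨mem_triangles.2 ⟨by simpa using hu, hu3⟩, h⟩
  have hdis : Disjoint (support (comp S.finite.toFinset t)) B := by
    rw [Set.disjoint_left]
    intro x hx hxB
    simp only [hB, support, mem_iUnion] at hxB
    obtain ⟨u, hu, hxu⟩ := hxB
    rw [Finset.mem_sdiff, mem_triangles] at hu
    exact hu.2 (S.exists_mem_comp_of_inter (s := u) (by simpa using hu.1.1) hxu hx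
      (by simpa using hu.1.1) hu.1.2 subset_rfl)
  have hpre := isPreconnected_connectedComponentIn (x := p) (F := S.T.space)
  intro x hx
  by_contra hxn
  obtain ⟨y, -, hy⟩ := isPreconnected_closed_iff.1 hpre _ _ (isClosed_support _)
    (isClosed_support _) ((connectedComponentIn_subset _ _).trans hcov)
    ⟨p, mem_connectedComponentIn (hsub hp), hp⟩
    ⟨x, hx, (hcov (connectedComponentIn_subset _ _ hx)).resolve_left hxn⟩
  exact Set.disjoint_left.1 hdis hy.1 hy.2

theorem eulerChar_eq_chiOf (F : Finset (Finset E3)) :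
    eulerChar (F : Set (Finset E3)) = chiOf F := by
  have h : ∀ k, {s ∈ (F : Set (Finset E3)) | s.card = k} =
      ((F.filter fun s => s.card = k : Finset _) : Set (Finset E3)) := by
    intro k
    ext s
    simp
  rw [chiOf_eq, eulerChar, h, h, h, ncard_coe_finset, ncard_coe_finset, ncard_coe_finset]

theorem isFree_iff {t e : Finset E3} (he : e.card = 2) {s : Finset E3}
    (hs : s ∈ comp S.finite.toFinset t) (hes : e ⊆ s) :
    {u ∈ S.T.faces | u.card = 3 ∧ e ⊆ u}.ncard =
      ((comp S.finite.toFinset t).filter (e ⊆ ·)).card := by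
  rw [← ncard_coe_finset]
  congr 1
  ext u
  simp only [mem_ofPred_eq, Finset.coe_filter]
  constructor
  · rintro ⟨h1, h2, h3⟩
    obtain ⟨v, hv⟩ : e.Nonempty := Finset.card_pos.1 (by omega)
    exact ⟨mem_comp_of_mem S.isPureSurface hs (mem_triangles.2 ⟨by simpa using h1, h2⟩) (hes hv)
      (h3 hv), h3⟩
  · rintro ⟨h1, h2⟩
    exact ⟨(S.mem_faces_of_mem_comp h1).1, (S.mem_faces_of_mem_comp h1).2, h2⟩

/-- The edges of the boundary. -/
def freeEdges : Set (Finset E3) :=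
  {e ∈ S.T.faces | e.card = 2 ∧ {t ∈ S.T.faces | t.card = 3 ∧ e ⊆ t}.ncard = 1}

/-- An essential surface of positive Euler characteristic has a component with non-empty boundary in
which every cycle bounds. -/
theorem exists_component (hS : S.IsEssential) (hχ : 0 < S.chi) :
    ∃ t : Finset E3, IsSurface (comp S.finite.toFinset t) ∧ CyclesBound (comp S.finite.toFinset t) ∧
      ∃ e ∈ S.freeEdges, ∃ s ∈ comp S.finite.toFinset t, e ⊆ s := by
  have hF := S.isPureSurface
  have h1 : 0 < chiOf S.finite.toFinset := by
    rw [← eulerChar_eq_chiOf, Finite.coe_toFinset]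
    exact hχ
  obtain ⟨t, ht, hpos⟩ := hF.exists_chi_pos h1
  have htc : t ∈ comp S.finite.toFinset t := mem_comp.2 ⟨ht, Relation.ReflTransGen.refl⟩
  obtain ⟨e, he, s, hs, hes⟩ : ∃ e ∈ S.freeEdges, ∃ s ∈ comp S.finite.toFinset t, e ⊆ s := by
    -- otherwise the component would be closed with positive Euler characteristic, that is, a sphere
    by_contra! hno
    obtain ⟨v, hv⟩ := S.T.nonempty_of_mem_faces (S.mem_faces_of_mem_comp htc).1
    have hvs : v ∈ support (comp S.finite.toFinset t) :=
      mem_biUnion (t := fun u : Finset E3 => convexHull ℝ (u : Set E3)) htc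
        (subset_convexHull ℝ _ hv)
    have hvS : v ∈ S.T.space :=
      S.T.convexHull_subset_space (S.mem_faces_of_mem_comp htc).1 (subset_convexHull ℝ _ hv)
    have h2 := hS.2.2 v hvS
    rw [S.connectedComponentIn_space hvs] at h2
    have h3 := h2 (by
      rw [Set.disjoint_left]
      intro x hx hxb
      simp only [bdry, mem_iUnion] at hxb
      obtain ⟨e, he, hxe⟩ := hxb
      obtain ⟨u, hu, heu, hu3⟩ := S.pure e he.1
      exact hno e he u (S.exists_mem_comp_of_inter he.1 hxe hx hu hu3 heu) heu)
    have h4 : {s ∈ S.T.faces | (s : Set E3) ⊆ support (comp S.finite.toFinset t)} =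
        ((S.finite.toFinset.filter (fun s => ∃ t' ∈ comp S.finite.toFinset t, s ⊆ t') : Finset _) :
          Set (Finset E3)) := by
      ext s
      simp only [mem_ofPred_eq, Finset.coe_filter, Finite.mem_toFinset]
      constructor
      · rintro ⟨h5, h6⟩
        obtain ⟨u, hu, hsu, hu3⟩ := S.pure s h5
        obtain ⟨w, hw⟩ := S.T.nonempty_of_mem_faces h5
        exact ⟨h5, u, S.exists_mem_comp_of_inter h5 (subset_convexHull ℝ _ hw) (h6 hw) hu hu3 hsu,
          hsu⟩
      · rintro ⟨h5, t', ht', hst⟩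
        refine ⟨h5, fun w hw => ?_⟩
        exact mem_biUnion (t := fun u : Finset E3 => convexHull ℝ (u : Set E3)) ht'
          (subset_convexHull ℝ _ (hst hw))
    rw [h4, eulerChar_eq_chiOf] at h3
    grind
  have hsurf : IsSurface (comp S.finite.toFinset t) := hF.isSurface_comp
    ⟨e, he.2.1, by rw [← S.isFree_iff he.2.1 hs hes]; exact he.2.2⟩
  exact ⟨t, hsurf, hsurf.cyclesBound (hF.card_le_of_chi_pos hpos), e, he, s, hs, hes⟩

end ProperSurface

/-! ### Planes that carry the frontiers of polytopes -/

/-- The plane with equation `h.1 x = h.2`. -/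
def planeOf (h : (E3 →ₗ[ℝ] ℝ) × ℝ) : Set E3 := {x | h.1 x = h.2}

theorem mem_planeOf {h : (E3 →ₗ[ℝ] ℝ) × ℝ} {x : E3} : x ∈ planeOf h ↔ h.1 x = h.2 := Iff.rfl

/-- A full-dimensional simplex has its facets as frontier, where a barycentric coordinate vanishes; a
simplex of smaller dimension lies on a plane. -/
theorem exists_planes_of_simplex {t : Finset E3} (ht : AffineIndependent ℝ ((↑) : t → E3)) :
    ∃ H : Set ((E3 →ₗ[ℝ] ℝ) × ℝ), H.Finite ∧ (∀ h ∈ H, h.1 ≠ 0) ∧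
      ∀ x ∈ convexHull ℝ (t : Set E3), x ∉ interior (convexHull ℝ (t : Set E3)) →
        ∃ h ∈ H, x ∈ planeOf h := by
  by_cases htop : affineSpan ℝ (t : Set E3) = ⊤
  · let b : AffineBasis t ℝ E3 := ⟨(↑), ht, by simpa using htop⟩
    have hb : range b = (t : Set E3) := by
      change range ((↑) : t → E3) = _
      simp
    refine ⟨range (fun i : t => ((b.coord i).linear, -(b.coord i) 0)) ∩ {h | h.1 ≠ 0},
      (finite_range _).inter_of_left _, fun h hh => hh.2, fun x hx hxi => ?_⟩
    rw [← hb, b.interior_convexHull] at hxi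
    rw [← hb, b.convexHull_eq_nonneg_coord] at hx
    simp only [mem_ofPred_eq, not_forall, not_lt] at hxi hx
    obtain ⟨i, hi⟩ := hxi
    have h0 : b.coord i x = 0 := le_antisymm hi (hx i)
    have hd : ∀ y : E3, b.coord i y = (b.coord i).linear y + b.coord i 0 := fun y => by
      simpa using (b.coord i).map_vadd 0 y
    refine ⟨_, ⟨⟨i, rfl⟩, fun hl => ?_⟩, ?_⟩
    · have h1 : b.coord i (b i) = 1 := b.coord_apply_eq i
      simp only at hl
      rw [hd, hl] at h1 h0
      simp only [LinearMap.zero_apply, zero_add] at h1 h0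
      linarith
    · have := hd x
      simp only [mem_planeOf]
      linarith
  · rcases t.eq_empty_or_nonempty with rfl | hne
    · exact ⟨∅, finite_empty, by simp, by simp⟩
    obtain ⟨y, hy⟩ := hne
    have hy' : y ∈ affineSpan ℝ (t : Set E3) := subset_affineSpan ℝ _ hy
    have hdir : (affineSpan ℝ (t : Set E3)).direction ≠ ⊤ := by
      rwa [Ne, AffineSubspace.direction_eq_top_iff_of_nonempty ⟨y, hy'⟩]
    obtain ⟨l, hl, hle⟩ := Submodule.exists_le_ker_of_lt_top _ (lt_top_iff_ne_top.2 hdir)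
    refine ⟨{(l, l y)}, finite_singleton _, by simpa using hl, fun x hx _ => ⟨_, rfl, ?_⟩⟩
    have hx' : x ∈ affineSpan ℝ (t : Set E3) := convexHull_subset_affineSpan _ hx
    have := hle (AffineSubspace.vsub_mem_direction hx' hy')
    rw [LinearMap.mem_ker, vsub_eq_sub, map_sub, sub_eq_zero] at this
    exact this

/-- The frontier of a polytope lies on finitely many planes: by Carathéodory's theorem it suffices
to look at simplices. -/
theorem exists_planes_of_finset (F : Finset E3) :
    ∃ H : Set ((E3 →ₗ[ℝ] ℝ) × ℝ), H.Finite ∧ (∀ h ∈ H, h.1 ≠ 0) ∧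
      ∀ x ∈ convexHull ℝ (F : Set E3), x ∉ interior (convexHull ℝ (F : Set E3)) →
        ∃ h ∈ H, x ∈ planeOf h := by
  have h1 : ∀ t : Finset E3, ∃ H : Set ((E3 →ₗ[ℝ] ℝ) × ℝ), H.Finite ∧ (∀ h ∈ H, h.1 ≠ 0) ∧
      (AffineIndependent ℝ ((↑) : t → E3) →
      ∀ x ∈ convexHull ℝ (t : Set E3), x ∉ interior (convexHull ℝ (t : Set E3)) →
        ∃ h ∈ H, x ∈ planeOf h) := by
    intro t
    by_cases ht : AffineIndependent ℝ ((↑) : t → E3)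
    · obtain ⟨H, h1, h2, h3⟩ := exists_planes_of_simplex ht
      exact ⟨H, h1, h2, fun _ => h3⟩
    · exact ⟨∅, finite_empty, by simp, fun h => absurd h ht⟩
  choose H hf hne hH using h1
  refine ⟨⋃ t ∈ F.powerset, H t, (Finset.finite_toSet _).biUnion fun t _ => hf t, ?_, ?_⟩
  · intro h hh
    simp only [mem_iUnion] at hh
    obtain ⟨t, -, ht⟩ := hh
    exact hne t h ht
  · intro x hx hxi
    have hx' := hx
    rw [convexHull_eq_union] at hx'
    simp only [mem_iUnion] at hx'
    obtain ⟨t, htF, hti, hxt⟩ := hx'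
    obtain ⟨h, hh, hxh⟩ := hH t hti x hxt fun h => hxi (interior_mono (convexHull_mono htF) h)
    refine ⟨h, ?_, hxh⟩
    simp only [mem_iUnion]
    exact ⟨t, Finset.mem_powerset.2 (by exact_mod_cast htF), hh⟩

theorem isClosed_convexHull_finset (F : Finset E3) : IsClosed (convexHull ℝ (F : Set E3)) :=
  (F.finite_toSet.isCompact_convexHull ℝ).isClosed

/-- A connected set that avoids the planes carrying the frontiers lies in the interior of a single
polytope. -/
theorem exists_subset_interior_of_disjoint_planes {P : Set (Finset E3)}
    {H : Set ((E3 →ₗ[ℝ] ℝ) × ℝ)}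
    (hH : ∀ F ∈ P, ∀ x ∈ convexHull ℝ (F : Set E3), x ∉ interior (convexHull ℝ (F : Set E3)) →
      ∃ h ∈ H, x ∈ planeOf h) {V : Set E3} (hV : IsPreconnected V) (hne : V.Nonempty)
    (hcov : ∀ x ∈ V, ∃ F ∈ P, x ∈ convexHull ℝ (F : Set E3))
    (hdis : ∀ x ∈ V, ∀ h ∈ H, x ∉ planeOf h) :
    ∃ F ∈ P, V ⊆ interior (convexHull ℝ (F : Set E3)) := by
  obtain ⟨y, hy⟩ := hne
  obtain ⟨F, hF, hyF⟩ := hcov y hy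
  have key : ∀ x ∈ V, x ∈ convexHull ℝ (F : Set E3) → x ∈ interior (convexHull ℝ (F : Set E3)) := by
    intro x hx hxF
    by_contra hxi
    grind
  refine ⟨F, hF, hV.subset_left_of_subset_union isOpen_interior
    (isClosed_convexHull_finset F).isOpen_compl ?_ ?_ ⟨y, hy, key y hy hyF⟩⟩
  · exact Set.disjoint_left.2 fun x hx hx' => hx' (interior_subset hx)
  · intro x hx
    by_cases hxF : x ∈ convexHull ℝ (F : Set E3)
    · exact Or.inl (key x hx hxF)
    · exact Or.inr hxF

open MeasureTheory in
theorem volume_planeOf {h : (E3 →ₗ[ℝ] ℝ) × ℝ} (h0 : h.1 ≠ 0) : volume (planeOf h) = 0 := by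
  obtain ⟨x, hx⟩ := LinearMap.surjective h0 h.2
  have e : planeOf h = (AffineSubspace.mk' x (LinearMap.ker h.1) : Set E3) := by
    ext y
    rw [SetLike.mem_coe, AffineSubspace.mem_mk', LinearMap.mem_ker, vsub_eq_sub, map_sub, hx,
      sub_eq_zero, mem_planeOf]
  rw [e]
  refine Measure.addHaar_affineSubspace _ _ fun htop => h0 ?_
  have h1 := congrArg AffineSubspace.direction htop
  rw [AffineSubspace.direction_mk', AffineSubspace.direction_top] at h1
  exact LinearMap.ker_eq_top.1 h1

theorem continuousOn_of_piecewise {f : E3 → E3} {P : Set (Finset E3 × (E3 →ᵃ[ℝ] E3))}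
    (hP : P.Finite) (hA : ∀ q ∈ P, ∀ p ∈ convexHull ℝ (q.1 : Set E3), f p = q.2 p) :
    ContinuousOn f (⋃ q ∈ P, convexHull ℝ (q.1 : Set E3)) := by
  have : Finite P := hP
  rw [biUnion_eq_iUnion]
  refine (locallyFinite_of_finite _).continuousOn_iUnion
    (fun q => isClosed_convexHull_finset q.1.1) fun q => ?_
  exact (q.1.2.continuous_of_finiteDimensional.continuousOn).congr fun p hp => hA q q.2 p hp

/-! ### The parametrization of the tubular neighbourhood -/

/-- The direction of the axis of the tube, which is the period of the parametrization. -/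
noncomputable def e0 : E3 := !₂[1, 0, 0]

@[simp] theorem e0_zero : e0 0 = 1 := rfl
@[simp] theorem e0_one : e0 1 = 0 := rfl
@[simp] theorem e0_two : e0 2 = 0 := rfl

theorem add_smul_e0_mem_tube {p : E3} (c : ℝ) : p + c • e0 ∈ tube ↔ p ∈ tube := by
  simp [tube]

/-- A continuous map on a compact set is a quotient map onto its image. -/
theorem continuousOn_range_of_comp {X Y Z : Type*} [TopologicalSpace X] [TopologicalSpace Y]
    [TopologicalSpace Z] [T2Space Y] {K : Set X} (hK : IsCompact K) {q : X → Y}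
    (hq : ContinuousOn q K) {g : Y → Z} (hg : ContinuousOn (g ∘ q) K) : ContinuousOn g (q '' K) := by
  rw [continuousOn_iff_isClosed]
  intro t ht
  obtain ⟨u, hu, hut⟩ := continuousOn_iff_isClosed.1 hg t ht
  refine ⟨q '' (K ∩ u), ((hK.inter_right hu).image_of_continuousOn
    (hq.mono inter_subset_left)).isClosed, ?_⟩
  ext y
  constructor
  · rintro ⟨hy, x, hx, rfl⟩
    have : x ∈ u ∩ K := by
      rw [← hut]
      exact ⟨hy, hx⟩
    exact ⟨⟨x, ⟨hx, this.1⟩, rfl⟩, x, hx, rfl⟩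
  · rintro ⟨⟨x, ⟨hx, hxu⟩, rfl⟩, -⟩
    have : x ∈ g ∘ q ⁻¹' t ∩ K := by
      rw [show (g ∘ q ⁻¹' t) = (g ∘ q) ⁻¹' t from rfl, hut]
      exact ⟨hxu, hx⟩
    exact ⟨this.1, x, hx, rfl⟩

theorem add_zsmul_of_add {E F : Type*} [AddGroup E] [AddGroup F] {h : E → F} {t : E} {e : F}
    (hper : ∀ u, h (u + t) = h u + e) (m : ℤ) (u : E) : h (u + m • t) = h u + m • e :=
  AddConstMapClass.map_add_zsmul (⟨h, hper⟩ : AddConstMap E F t e) u m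

theorem add_int_mul {h : ℝ → E3} {T : ℝ} {e : E3} (hper : ∀ u, h (u + T) = h u + e) (m : ℤ) (u : ℝ) :
    h (u + m * T) = h u + (m : ℝ) • e := by
  simpa [Int.cast_smul_eq_zsmul] using add_zsmul_of_add hper m u

namespace TubularNeighborhood

variable {K : PolygonalKnot} (N : TubularNeighborhood K)

theorem f_add_e0 (p : E3) : N.f (p + e0) = N.f p := N.periodic p

theorem f_add_int (p : E3) (m : ℤ) : N.f (p + (m : ℝ) • e0) = N.f p := by
  rw [Int.cast_smul_eq_zsmul]
  exact Function.Periodic.zsmul N.f_add_e0 m p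

/-- The fundamental domain of the tube. -/
def box : Set E3 := tube ∩ {p | p 0 ∈ Icc (0 : ℝ) 1}

theorem exists_mem_box {p : E3} (hp : p ∈ tube) : ∃ m : ℤ, p + (m : ℝ) • e0 ∈ box := by
  refine ⟨-⌊p 0⌋, (add_smul_e0_mem_tube _).2 hp, ?_⟩
  have h1 := Int.floor_le (p 0)
  have h2 := Int.lt_floor_add_one (p 0)
  simp
  constructor <;> linarith

/-- The pieces of linearity of the periodic parametrization of the tubular neighbourhood: the
translates of the pieces in a fundamental domain by multiples of the period. -/
theorem exists_pieces : ∃ P : Set (Finset E3 × (E3 →ᵃ[ℝ] E3)),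
    (∀ M : ℝ, {q ∈ P | ∃ p ∈ convexHull ℝ (q.1 : Set E3), |p 0| ≤ M}.Finite) ∧
    (∀ p ∈ tube, ∃ q ∈ P, p ∈ convexHull ℝ (q.1 : Set E3)) ∧
    (∀ q ∈ P, convexHull ℝ (q.1 : Set E3) ⊆ tube) ∧
    (∀ q ∈ P, Function.Injective q.2 ∧ ∀ p ∈ convexHull ℝ (q.1 : Set E3), N.f p = q.2 p) := by
  classical
  obtain ⟨P, hP, hcov, hA⟩ := N.piecewiseLinear
  -- `tr q m` is the piece `q` translated by `m` periods
  let tr : (Finset E3 × (E3 →ᵃ[ℝ] E3)) → ℤ → Finset E3 × (E3 →ᵃ[ℝ] E3) := fun q m =>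
    (q.1.image (fun p => p + (m : ℝ) • e0),
      q.2.comp (AffineEquiv.constVAdd ℝ E3 (-((m : ℝ) • e0))).toAffineMap)
  have hull : ∀ q m, ∀ p : E3, p ∈ convexHull ℝ ((tr q m).1 : Set E3) ↔
      p + (-((m : ℝ) • e0)) ∈ convexHull ℝ (q.1 : Set E3) := by
    intro q m p
    have e : (((tr q m).1 : Finset E3) : Set E3) =
        (AffineEquiv.constVAdd ℝ E3 ((m : ℝ) • e0)).toAffineMap '' (q.1 : Set E3) := by
      ext y
      simp [tr, add_comm]
    rw [e, ← AffineMap.image_convexHull]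
    constructor
    · rintro ⟨y, hy, rfl⟩
      simpa using hy
    · intro h
      exact ⟨_, h, by simp⟩
  have hbox : ∀ q ∈ P, convexHull ℝ (q.1 : Set E3) ⊆ box := by
    intro q hq p hp
    rw [box, ← hcov]
    exact mem_biUnion hq hp
  refine ⟨{r | ∃ q ∈ P, ∃ m : ℤ, r = tr q m}, fun M => ?_, fun p hp => ?_, ?_, ?_⟩
  · refine ((hP.prod (finite_Icc (-⌈M⌉ - 1) (⌈M⌉ + 1))).image (fun x => tr x.1 x.2)).subset ?_
    rintro _ ⟨⟨q, hq, m, rfl⟩, p, hp, hpM⟩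
    refine ⟨(q, m), ⟨hq, ?_⟩, rfl⟩
    rw [hull] at hp
    have h1 := (hbox q hq hp).2
    simp only [mem_ofPred_eq, PiLp.add_apply, PiLp.neg_apply, PiLp.smul_apply, e0_zero,
      smul_eq_mul, mul_one, mem_Icc] at h1
    have h2 := abs_le.1 hpM
    have h3 := Int.le_ceil M
    simp only [mem_Icc]
    constructor
    · have : (-⌈M⌉ - 1 : ℝ) ≤ m := by linarith
      exact_mod_cast this
    · have : (m : ℝ) ≤ ⌈M⌉ + 1 := by linarith
      exact_mod_cast this
  · obtain ⟨m, hm⟩ := exists_mem_box hp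
    have hm' := hm
    rw [box, ← hcov] at hm'
    simp only [mem_iUnion] at hm'
    obtain ⟨q, hq, hpq⟩ := hm'
    refine ⟨tr q (-m), ⟨q, hq, -m, rfl⟩, ?_⟩
    rw [hull]
    simpa using hpq
  · rintro _ ⟨q, hq, m, rfl⟩ p hp
    rw [hull] at hp
    have := (hbox q hq hp).1
    rw [← neg_smul] at this
    exact (add_smul_e0_mem_tube _).1 this
  · rintro _ ⟨q, hq, m, rfl⟩
    obtain ⟨hdet, hf⟩ := hA q hq
    refine ⟨?_, fun p hp => ?_⟩
    · have h1 : Function.Injective q.2 := by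
        rw [← q.2.linear_injective_iff]
        exact (LinearEquiv.ofIsUnitDet (f := q.2.linear) (isUnit_iff_ne_zero.2 (by
          rw [LinearMap.det_toMatrix]; exact hdet.ne'))
            (v := Module.finBasis ℝ E3) (v' := Module.finBasis ℝ E3)).injective
      exact h1.comp (AffineEquiv.injective _)
    · rw [hull] at hp
      have h1 := hf _ hp
      have h2 := N.f_add_int p (-m)
      push_cast at h2
      rw [neg_smul] at h2
      rw [← h2, h1]
      simp [tr, add_comm]

theorem continuousOn_f : ContinuousOn N.f tube := by
  obtain ⟨P, hfin, hcov, -, hA⟩ := N.exists_pieces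
  intro p hp
  have hU : IsOpen {x : E3 | |x 0| < |p 0| + 1} :=
    isOpen_lt (by fun_prop) continuous_const
  have h1 := continuousOn_of_piecewise (hfin (|p 0| + 1)) (fun q hq => (hA q hq.1).2)
  have h2 : tube ∩ {x : E3 | |x 0| < |p 0| + 1} ⊆
      ⋃ q ∈ {q ∈ P | ∃ p' ∈ convexHull ℝ (q.1 : Set E3), |p' 0| ≤ |p 0| + 1},
        convexHull ℝ (q.1 : Set E3) := by
    rintro x ⟨hx, hx'⟩
    obtain ⟨q, hq, hxq⟩ := hcov x hx
    exact mem_biUnion (⟨hq, x, hxq, hx'.le⟩ : q ∈ {q ∈ P | _}) hxq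
  have h3 : p ∈ {x : E3 | |x 0| < |p 0| + 1} := by simp
  exact (continuousWithinAt_inter (hU.mem_nhds h3)).1 ((h1.mono h2) p ⟨hp, h3⟩)

end TubularNeighborhood

/-! ### Coordinates in the tube -/

theorem E3.vec_sub (a b c a' b' c' : ℝ) :
    (!₂[a, b, c] : E3) - !₂[a', b', c'] = !₂[a - a', b - b', c - c'] := by
  ext i
  fin_cases i <;> simp

theorem E3.vec_add (a b c a' b' c' : ℝ) :
    (!₂[a, b, c] : E3) + !₂[a', b', c'] = !₂[a + a', b + b', c + c'] := by
  ext i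
  fin_cases i <;> simp

theorem E3.smul_vec (t a b c : ℝ) : t • (!₂[a, b, c] : E3) = !₂[t * a, t * b, t * c] := by
  ext i
  fin_cases i <;> simp

theorem E3.norm_vec_le (a b c : ℝ) : ‖(!₂[a, b, c] : E3)‖ ≤ |a| + |b| + |c| := by
  have e : (!₂[a, b, c] : E3) = !₂[a, 0, 0] + (!₂[0, b, 0] + !₂[0, 0, c]) := by
    simp only [E3.vec_add]
    simp
  have h : ‖(!₂[a, 0, 0] : E3)‖ = |a| ∧ ‖(!₂[0, b, 0] : E3)‖ = |b| ∧ ‖(!₂[0, 0, c] : E3)‖ = |c| := by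
    simp [EuclideanSpace.norm_eq, Fin.sum_univ_three, Real.sqrt_sq_eq_abs]
  have h1 := norm_add_le (!₂[a, 0, 0] : E3) (!₂[0, b, 0] + !₂[0, 0, c])
  have h2 := norm_add_le (!₂[0, b, 0] : E3) !₂[0, 0, c]
  rw [e]
  linarith [h.1, h.2.1, h.2.2]

theorem vec_add_one (a b c : ℝ) : (!₂[a + 1, b, c] : E3) = !₂[a, b, c] + e0 := by
  rw [e0, E3.vec_add]
  simp

/-- The point of the tube with longitudinal coordinate `x` and cross-sectional coordinate `z`. -/
noncomputable def cvec (x : ℝ) (z : ℂ) : E3 := !₂[x, z.re, z.im]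

theorem cvec_sub (x x' : ℝ) (z z' : ℂ) : cvec x z - cvec x' z' = cvec (x - x') (z - z') := by
  simp only [cvec, E3.vec_sub, Complex.sub_re, Complex.sub_im]

theorem cvec_add (x x' : ℝ) (z z' : ℂ) : cvec x z + cvec x' z' = cvec (x + x') (z + z') := by
  simp only [cvec, E3.vec_add, Complex.add_re, Complex.add_im]

theorem smul_cvec (t x : ℝ) (z : ℂ) : t • cvec x z = cvec (t * x) (t * z) := by
  simp only [cvec, E3.smul_vec, Complex.re_ofReal_mul, Complex.im_ofReal_mul]

theorem norm_cvec_le (x : ℝ) (z : ℂ) : ‖cvec x z‖ ≤ |x| + 2 * ‖z‖ := by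
  have := E3.norm_vec_le x z.re z.im
  rw [cvec]
  linarith [Complex.abs_re_le_norm z, Complex.abs_im_le_norm z]

theorem cvec_add_one (x : ℝ) (z : ℂ) : cvec (x + 1) z = cvec x z + e0 := vec_add_one _ _ _

/-- The point of angle `θ` on the unit circle. -/
noncomputable def cis (θ : ℝ) : ℂ := Complex.exp (Complex.I * θ)

theorem norm_cis (θ : ℝ) : ‖cis θ‖ = 1 := by
  rw [cis, mul_comm]
  exact Complex.norm_exp_ofReal_mul_I θ

theorem cis_add (a b : ℝ) : cis (a + b) = cis a * cis b := by
  rw [cis, cis, cis, ← Complex.exp_add]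
  congr 1
  push_cast
  ring

theorem cis_re (θ : ℝ) : (cis θ).re = Real.cos θ := by
  rw [cis, mul_comm, Complex.exp_ofReal_mul_I_re]

theorem cis_im (θ : ℝ) : (cis θ).im = Real.sin θ := by
  rw [cis, mul_comm, Complex.exp_ofReal_mul_I_im]

/-- The distance of a point from the origin in the maximum norm. -/
noncomputable def supAbs (z : ℂ) : ℝ := max |z.re| |z.im|

theorem norm_le_supAbs (z : ℂ) : ‖z‖ ≤ 2 * supAbs z := by
  have h1 : |z.re| ≤ supAbs z := le_max_left _ _
  have h2 : |z.im| ≤ supAbs z := le_max_right _ _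
  linarith [Complex.norm_le_abs_re_add_abs_im z]

/-- The point on the boundary of the square `[-1, 1] ^ 2` in the direction of `cis (2 π θ)`. -/
noncomputable def squarePoint (θ : ℝ) : ℂ :=
  ((supAbs (cis (2 * Real.pi * θ)))⁻¹ : ℝ) * cis (2 * Real.pi * θ)

theorem half_le_supAbs_cis (θ : ℝ) : 1 / 2 ≤ supAbs (cis θ) := by
  have := norm_le_supAbs (cis θ)
  rw [norm_cis] at this
  linarith

theorem supAbs_squarePoint (θ : ℝ) : supAbs (squarePoint θ) = 1 := by
  have h := half_le_supAbs_cis (2 * Real.pi * θ)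
  have h0 : 0 < supAbs (cis (2 * Real.pi * θ)) := by linarith
  have e : supAbs (squarePoint θ) =
      (supAbs (cis (2 * Real.pi * θ)))⁻¹ * supAbs (cis (2 * Real.pi * θ)) := by
    conv_lhs => rw [supAbs, squarePoint, Complex.re_ofReal_mul, Complex.im_ofReal_mul, abs_mul, abs_mul,
      abs_of_pos (inv_pos.2 h0)]
    rw [← mul_max_of_nonneg _ _ (inv_pos.2 h0).le]
    rfl
  rw [e, inv_mul_cancel₀ h0.ne']

namespace TubularNeighborhood

variable {K : PolygonalKnot} (N : TubularNeighborhood K)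

theorem torusPoint_eq (x θ : ℝ) : N.torusPoint x θ = N.f (cvec x (squarePoint θ)) := by
  simp only [torusPoint, cvec, squarePoint, Complex.re_ofReal_mul, Complex.im_ofReal_mul, supAbs,
    cis_re, cis_im, div_eq_inv_mul]

end TubularNeighborhood

/-! ### Curves that run in a finite union of segments -/

/-- One-dimensional invariance of domain: an injective curve stays for a while in a segment that is
part of the curve. -/
theorem eventually_mem_segment {γ : ℝ → E3} {A B u : ℝ} {p q : E3}
    (hγ : ContinuousOn γ (Icc A B)) (hu : u ∈ Ioo A B) (hinj : InjOn γ (Ioo A B))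
    (huniq : ∀ s ∈ Icc A B, γ s = γ u → s = u) (hσ : segment ℝ p q ⊆ γ '' Icc A B)
    (hup : γ u ∈ segment ℝ p q) (h1 : γ u ≠ p) (h2 : γ u ≠ q) :
    ∀ᶠ s in 𝓝 u, γ s ∈ segment ℝ p q := by
  have hpq : p ≠ q := by
    rintro rfl
    rw [segment_same] at hup
    exact h1 hup
  obtain ⟨A', hA', hA'u⟩ := exists_between hu.1
  obtain ⟨B', huB', hB'⟩ := exists_between hu.2
  have hsub : Icc A' B' ⊆ Ioo A B := fun s hs => ⟨hA'.trans_le hs.1, hs.2.trans_lt hB'⟩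
  have hC : IsClosed (γ '' (Icc A B \ Ioo A' B')) :=
    ((isCompact_Icc.diff isOpen_Ioo).image_of_continuousOn (hγ.mono sdiff_subset)).isClosed
  have huC : γ u ∉ γ '' (Icc A B \ Ioo A' B') := by grind
  let l : ℝ → E3 := fun t => AffineMap.lineMap p q t
  have hl : Continuous l := AffineMap.lineMap_continuous
  have hlinj : Function.Injective l := AffineMap.lineMap_injective ℝ hpq
  rw [segment_eq_image_lineMap] at hup hσ ⊢
  obtain ⟨t0, ht0, htu⟩ := hup
  have ht0' : t0 ∈ Ioo (0 : ℝ) 1 := by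
    refine ⟨lt_of_le_of_ne ht0.1 ?_, lt_of_le_of_ne ht0.2 ?_⟩
    · rintro rfl
      rw [AffineMap.lineMap_apply_zero] at htu
      exact h1 htu.symm
    · rintro rfl
      rw [AffineMap.lineMap_apply_one] at htu
      exact h2 htu.symm
  have hev : ∀ᶠ t in 𝓝 t0, t ∈ Ioo (0 : ℝ) 1 ∧ l t ∉ γ '' (Icc A B \ Ioo A' B') := by
    have hIoo : ∀ᶠ t in 𝓝 t0, t ∈ Ioo (0 : ℝ) 1 := isOpen_Ioo.mem_nhds ht0'
    refine hIoo.and ?_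
    refine hl.continuousAt.eventually (hC.isOpen_compl.mem_nhds ?_)
    grind
  obtain ⟨ε, hε, hball⟩ := Metric.nhds_basis_closedBall.mem_iff.1 hev
  rw [Real.closedBall_eq_Icc] at hball
  let inv := Function.invFunOn γ (Icc A' B')
  have hinv : ∀ s ∈ Icc A' B', inv (γ s) = s := fun s hs =>
    (hinj.mono hsub).leftInvOn_invFunOn hs
  have hinvc : ContinuousOn inv (γ '' Icc A' B') :=
    continuousOn_range_of_comp isCompact_Icc (hγ.mono (hsub.trans Ioo_subset_Icc_self))
      (continuousOn_id.congr hinv)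
  have hlm : ∀ t ∈ Icc (t0 - ε) (t0 + ε), l t ∈ γ '' Icc A' B' := by
    intro t ht
    obtain ⟨h3, h4⟩ := hball ht
    obtain ⟨s, hs, hst⟩ := hσ ⟨t, ⟨h3.1.le, h3.2.le⟩, rfl⟩
    refine ⟨s, ?_, hst⟩
    by_contra hcon
    exact h4 ⟨s, ⟨hs, fun h => hcon (Ioo_subset_Icc_self h)⟩, hst⟩
  -- the parameter `F t` of the point `l t` on the curve depends continuously and injectively on `t`, so
  -- its values fill an interval around `u`
  let F : ℝ → ℝ := fun t => inv (l t)
  have hFγ : ∀ t ∈ Icc (t0 - ε) (t0 + ε), γ (F t) = l t := by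
    intro t ht
    obtain ⟨s, hs, hst⟩ := hlm t ht
    grind
  have hFc : ContinuousOn F (Icc (t0 - ε) (t0 + ε)) := hinvc.comp hl.continuousOn hlm
  have hFinj : InjOn F (Icc (t0 - ε) (t0 + ε)) := by
    intro t ht t' ht' h
    grind
  have hFu : F t0 = u := by grind
  have hle : t0 - ε ≤ t0 + ε := by linarith
  have m0 : t0 ∈ Icc (t0 - ε) (t0 + ε) := ⟨by linarith, by linarith⟩
  have m1 : t0 - ε ∈ Icc (t0 - ε) (t0 + ε) := ⟨le_rfl, hle⟩
  have m2 : t0 + ε ∈ Icc (t0 - ε) (t0 + ε) := ⟨hle, le_rfl⟩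
  have hconc : ∀ s ∈ F '' Icc (t0 - ε) (t0 + ε), γ s ∈ AffineMap.lineMap p q '' Icc (0 : ℝ) 1 := by
    rintro _ ⟨t, ht, rfl⟩
    exact ⟨t, ⟨(hball ht).1.1.le, (hball ht).1.2.le⟩, (hFγ t ht).symm⟩
  rcases ContinuousOn.strictMonoOn_of_injOn_Icc' hle hFc hFinj with hm | hm
  · have h3 := hm m1 m0 (by linarith)
    have h4 := hm m0 m2 (by linarith)
    rw [hFu] at h3 h4
    filter_upwards [Ioo_mem_nhds h3 h4] with s hs
    exact hconc s (intermediate_value_Icc hle hFc (Ioo_subset_Icc_self hs))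
  · have h3 := hm m1 m0 (by linarith)
    have h4 := hm m0 m2 (by linarith)
    rw [hFu] at h3 h4
    filter_upwards [Ioo_mem_nhds h4 h3] with s hs
    exact hconc s (intermediate_value_Icc' hle hFc (Ioo_subset_Icc_self hs))

/-- An injective curve that runs in a segment is a segment. -/
theorem image_Icc_eq_segment {γ : ℝ → E3} {s t : ℝ} {p q : E3} (hst : s ≤ t)
    (hγ : ContinuousOn γ (Icc s t)) (hinj : InjOn γ (Icc s t))
    (h : ∀ u ∈ Icc s t, γ u ∈ segment ℝ p q) : γ '' Icc s t = segment ℝ (γ s) (γ t) := by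
  have ms : s ∈ Icc s t := ⟨le_rfl, hst⟩
  have mt : t ∈ Icc s t := ⟨hst, le_rfl⟩
  rcases eq_or_ne p q with rfl | hpq
  · simp only [segment_same, mem_singleton_iff] at h
    have : s = t := hinj ms mt (by rw [h s ms, h t mt])
    subst this
    simp
  have hqp : inner ℝ (q - p) (q - p) ≠ (0 : ℝ) := inner_self_ne_zero.2 (sub_ne_zero.2 hpq.symm)
  let co : E3 → ℝ := fun x => inner ℝ (x - p) (q - p) / inner ℝ (q - p) (q - p)
  have hco : Continuous co := by fun_prop
  have hcol : ∀ r : ℝ, co (AffineMap.lineMap p q r) = r := by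
    intro r
    simp only [co, AffineMap.lineMap_apply, vsub_eq_sub, vadd_eq_add, add_sub_cancel_right,
      inner_smul_left, conj_trivial]
    field_simp
  have hγco : ∀ u ∈ Icc s t, AffineMap.lineMap p q (co (γ u)) = γ u := by
    intro u hu
    have := h u hu
    rw [segment_eq_image_lineMap] at this
    obtain ⟨r, -, hr⟩ := this
    rw [← hr, hcol]
  let F : ℝ → ℝ := fun u => co (γ u)
  have hFc : ContinuousOn F (Icc s t) := hco.comp_continuousOn hγ
  have hFinj : InjOn F (Icc s t) := by
    intro u hu v hv huv
    apply hinj hu hv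
    grind
  have hF : F '' Icc s t = uIcc (F s) (F t) := by
    rcases ContinuousOn.strictMonoOn_of_injOn_Icc' hst hFc hFinj with hm | hm
    · rw [uIcc_of_le (hm.monotoneOn ms mt hst)]
      refine subset_antisymm ?_ (intermediate_value_Icc hst hFc)
      rintro _ ⟨u, hu, rfl⟩
      exact ⟨hm.monotoneOn ms hu hu.1, hm.monotoneOn hu mt hu.2⟩
    · rw [uIcc_of_ge (hm.antitoneOn ms mt hst)]
      refine subset_antisymm ?_ (intermediate_value_Icc' hst hFc)
      rintro _ ⟨u, hu, rfl⟩
      exact ⟨hm.antitoneOn hu mt hu.2, hm.antitoneOn ms hu hu.1⟩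
  have e : γ '' Icc s t = AffineMap.lineMap p q '' (F '' Icc s t) := by
    rw [image_image]
    exact image_congr fun u hu => (hγco u hu).symm
  rw [e, hF, ← segment_eq_uIcc, image_segment, hγco s ms, hγco t mt]

/-- A finite set of parameters with the given minimum and maximum, as an increasing sequence. -/
theorem exists_increasing_enumeration {Z : Set ℝ} (hZ : Z.Finite) {a b : ℝ} (hab : a < b) (ha : a ∈ Z)
    (hb : b ∈ Z) (hZab : Z ⊆ Icc a b) :
    ∃ (m : ℕ) (s : ℕ → ℝ), 0 < m ∧ s 0 = a ∧ s m = b ∧ (∀ i < m, s i < s (i + 1)) ∧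
      (∀ i ≤ m, s i ∈ Z) ∧ ∀ i < m, ∀ u ∈ Ioo (s i) (s (i + 1)), u ∉ Z := by
  classical
  obtain ⟨F, rfl⟩ := hZ.exists_finset_coe
  have ha' : a ∈ F := ha
  have hb' : b ∈ F := hb
  have hcard : 1 < F.card := Finset.one_lt_card.2 ⟨a, ha', b, hb', hab.ne⟩
  obtain ⟨m, hm⟩ : ∃ m, F.card = m + 1 := ⟨F.card - 1, by omega⟩
  let e := F.orderEmbOfFin hm
  have heF : ∀ i, e i ∈ F := fun i => F.orderEmbOfFin_mem hm i
  have hsurj : ∀ z ∈ F, ∃ i, e i = z := by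
    intro z hz
    have : z ∈ range e := by
      rw [F.range_orderEmbOfFin hm]
      exact hz
    exact this
  let s : ℕ → ℝ := fun i => e (Fin.ofNat (m + 1) i)
  have hs : ∀ i (h : i < m + 1), s i = e ⟨i, h⟩ := by
    intro i h
    simp only [s]
    congr 1
    ext
    simp [Nat.mod_eq_of_lt h]
  refine ⟨m, s, by omega, ?_, ?_, ?_, ?_, ?_⟩
  · rw [hs 0 (by omega)]
    refine le_antisymm ?_ (hZab (heF _)).1
    obtain ⟨i, hi⟩ := hsurj a ha'
    rw [← hi]
    exact e.monotone (Fin.zero_le i)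
  · rw [hs m (by omega)]
    refine le_antisymm (hZab (heF _)).2 ?_
    obtain ⟨i, hi⟩ := hsurj b hb'
    rw [← hi]
    exact e.monotone (Fin.le_last i)
  · intro i hi
    rw [hs i (by omega), hs (i + 1) (by omega)]
    exact e.strictMono (Fin.mk_lt_mk.2 (by omega))
  · grind
  · intro i hi u hu huF
    obtain ⟨j, rfl⟩ := hsurj u huF
    rw [hs i (by omega), hs (i + 1) (by omega)] at hu
    have h1 := e.lt_iff_lt.1 hu.1
    have h2 := e.lt_iff_lt.1 hu.2
    grind

/-- A closed set that the curve enters and leaves only at given parameters contains with an inner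
point of an interval the whole interval. -/
theorem forall_mem_of_locally_mem {γ : ℝ → E3} (hγ : Continuous γ) {s t : ℝ} {σ : Set E3}
    (hσ : IsClosed σ) (hopen : ∀ u ∈ Ioo s t, γ u ∈ σ → ∀ᶠ v in 𝓝 u, γ v ∈ σ) {u : ℝ}
    (hu : u ∈ Ioo s t) (huσ : γ u ∈ σ) : ∀ v ∈ Icc s t, γ v ∈ σ := by
  have h1 : Ioo s t ⊆ interior (γ ⁻¹' σ) := by
    refine isPreconnected_Ioo.subset_left_of_subset_union (v := (γ ⁻¹' σ)ᶜ) isOpen_interior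
      (hσ.preimage hγ).isOpen_compl ?_ ?_ ⟨u, hu, mem_interior_iff_mem_nhds.2 (hopen u hu huσ)⟩
    · exact Set.disjoint_left.2 fun x hx hx' => hx' (interior_subset hx)
    · intro v hv
      by_cases hvσ : γ v ∈ σ
      · exact Or.inl (mem_interior_iff_mem_nhds.2 (hopen v hv hvσ))
      · exact Or.inr hvσ
  have hst : s ≠ t := (hu.1.trans hu.2).ne
  intro v hv
  have h2 : Icc s t ⊆ γ ⁻¹' σ := by
    rw [← closure_Ioo hst]
    exact closure_minimal (h1.trans interior_subset) (hσ.preimage hγ)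
  exact h2 hv

/-! ### Broken lines -/

theorem lipschitz_of_unit_intervals {E : Type*} [NormedAddCommGroup E] {g : ℝ → E} {L : ℝ}
    (h : ∀ k : ℤ, ∀ s ∈ Icc (k : ℝ) (k + 1), ∀ s' ∈ Icc (k : ℝ) (k + 1),
      ‖g s - g s'‖ ≤ L * |s - s'|) (s s' : ℝ) : ‖g s - g s'‖ ≤ L * |s - s'| := by
  have key : ∀ n : ℕ, ∀ k : ℤ, ∀ s s' : ℝ, s ≤ s' → (k : ℝ) ≤ s → s' ≤ k + n →
      ‖g s - g s'‖ ≤ L * |s - s'| := by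
    intro n
    induction n with
    | zero =>
      intro k s s' h1 h2 h3
      have : s = s' := by
        push_cast at h3
        linarith
      rw [this]
      simp
    | succ n ih =>
      intro k s s' h1 h2 h3
      push_cast at h3
      rcases le_total s' (k + n) with h4 | h4
      · exact ih k s s' h1 h2 h4
      rcases le_total s (k + n) with h5 | h5
      · have h6 := ih k s (k + n) h5 h2 le_rfl
        have h7 := h (k + n) (k + n) (by push_cast; simp) s' (by
          push_cast
          exact ⟨h4, by linarith⟩)
        have h8 := norm_sub_le_norm_sub_add_norm_sub (g s) (g (k + n)) (g s')
        rw [abs_of_nonpos (by linarith)] at h6 h7 ⊢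
        linarith
      · exact h (k + n) s (by push_cast; exact ⟨h5, by linarith⟩) s' (by
          push_cast
          exact ⟨h4, by linarith⟩)
  have h0 : ∀ s s' : ℝ, s ≤ s' → ‖g s - g s'‖ ≤ L * |s - s'| := by
    intro s s' hs
    refine key (⌈s' - ⌊s⌋⌉₊) ⌊s⌋ s s' hs (Int.floor_le s) ?_
    have := Nat.le_ceil (s' - (⌊s⌋ : ℝ))
    linarith
  rcases le_total s s' with hs | hs
  · exact h0 s s' hs
  · rw [norm_sub_rev, abs_sub_comm]
    exact h0 s' s hs

/-- The broken line through the points `G k`, `k : ℤ`, which are reached at the times `k`. -/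
noncomputable def brokenLine {E : Type*} [AddCommGroup E] [Module ℝ E] (G : ℤ → E) (u : ℝ) : E :=
  AffineMap.lineMap (G ⌊u⌋) (G (⌊u⌋ + 1)) (Int.fract u)

theorem brokenLine_eq {E : Type*} [AddCommGroup E] [Module ℝ E] (G : ℤ → E) (k : ℤ) {u : ℝ} (hu : u ∈ Icc (k : ℝ) (k + 1)) :
    brokenLine G u = G k + (u - k) • (G (k + 1) - G k) := by
  rw [brokenLine]
  rcases hu.2.lt_or_eq with h | h
  · have : ⌊u⌋ = k := Int.floor_eq_iff.2 ⟨hu.1, h⟩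
    rw [Int.fract, this, AffineMap.lineMap_apply, vsub_eq_sub, vadd_eq_add, add_comm]
  · have h1 : ⌊u⌋ = k + 1 := by
      rw [h]
      have := Int.floor_intCast (R := ℝ) (k + 1)
      grind
    rw [Int.fract, h1, h]
    push_cast
    simp

theorem brokenLine_add {E : Type*} [AddCommGroup E] [Module ℝ E] {G : ℤ → E} {n : ℤ} {e : E}
    (hG : ∀ k, G (k + n) = G k + e) (u : ℝ) :
    brokenLine G (u + n) = brokenLine G u + e := by
  rw [brokenLine, brokenLine, Int.floor_add_intCast, Int.fract_add_intCast, hG, add_right_comm, hG]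
  simp only [AffineMap.lineMap_apply, vsub_eq_sub, vadd_eq_add]
  module

theorem exists_floor (u : ℝ) : ∃ k : ℤ, u ∈ Ico (k : ℝ) (k + 1) :=
  ⟨⌊u⌋, Int.floor_le u, Int.lt_floor_add_one u⟩

theorem brokenLine_intCast {E : Type*} [AddCommGroup E] [Module ℝ E] (G : ℤ → E) (k : ℤ) : brokenLine G k = G k := by
  rw [brokenLine_eq G k ⟨le_rfl, by linarith⟩]
  simp

theorem brokenLine_lipschitz {G : ℤ → E3} {L : ℝ} (hL : ∀ k, ‖G (k + 1) - G k‖ ≤ L) (u v : ℝ) :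
    ‖brokenLine G u - brokenLine G v‖ ≤ L * |u - v| := by
  refine lipschitz_of_unit_intervals (fun k u hu v hv => ?_) u v
  rw [brokenLine_eq G k hu, brokenLine_eq G k hv]
  have e : G k + (u - k) • (G (k + 1) - G k) - (G k + (v - k) • (G (k + 1) - G k)) =
      (u - v) • (G (k + 1) - G k) := by module
  rw [e, norm_smul, Real.norm_eq_abs, mul_comm]
  exact mul_le_mul_of_nonneg_right (hL k) (abs_nonneg _)

/-- An injective broken line is locally antilipschitz. -/
theorem brokenLine_locally_antilipschitz {G : ℤ → E3}
    (hinj : ∀ u, brokenLine G (u + 1) ≠ brokenLine G u) (u0 : ℝ) : ∃ c > 0, ∀ᶠ x in 𝓝 (u0, u0), c * |x.1 - x.2| ≤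
      ‖brokenLine G x.1 - brokenLine G x.2‖ := by
  -- on both sides of the vertex `k` the curve is linear, and its two branches form an angle
  have hvert : ∀ k : ℤ, ∃ c > 0, ∀ u ∈ Icc ((k : ℝ) - 1) (k + 1), ∀ v ∈ Icc ((k : ℝ) - 1) (k + 1),
      c * |u - v| ≤ ‖brokenLine G u - brokenLine G v‖ := by
    intro k
    let a := G (k + 1) - G k
    let b := G k - G (k - 1)
    have hr : ∀ u ∈ Icc (k : ℝ) (k + 1), brokenLine G u = G k + (u - k) • a :=
      fun u hu => brokenLine_eq G k hu
    have hl : ∀ u ∈ Icc ((k : ℝ) - 1) k, brokenLine G u = G k + (u - k) • b := by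
      intro u hu
      have := brokenLine_eq G (k - 1) (u := u) (by push_cast; simpa using hu)
      rw [this]
      push_cast
      rw [show k - 1 + 1 = k by ring]
      simp only [b]
      module
    have hne : ∀ x ∈ Icc (0 : ℝ) 1, (1 - x) • a + x • b ≠ 0 := by
      intro x hx h0
      have h1 := hr (k + (1 - x)) ⟨by linarith [hx.2], by linarith [hx.1]⟩
      have h2 := hl (k - x) ⟨by linarith [hx.2], by linarith [hx.1]⟩
      have h3 : brokenLine G (k + (1 - x)) = brokenLine G (k - x) := by
        rw [h1, h2, add_sub_cancel_left, sub_sub_cancel_left, eq_neg_of_add_eq_zero_left h0]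
        module
      exact hinj (k - x) (by rw [← h3]; congr 1; ring)
    have hcont : ContinuousOn (fun x : ℝ => ‖(1 - x) • a + x • b‖) (Icc 0 1) := by fun_prop
    obtain ⟨x0, hx0, hmin⟩ := isCompact_Icc.exists_isMinOn ⟨0, by simp⟩ hcont
    let c := ‖(1 - x0) • a + x0 • b‖
    have hc : 0 < c := norm_pos_iff.2 (hne x0 hx0)
    have hmin' : ∀ x ∈ Icc (0 : ℝ) 1, c ≤ ‖(1 - x) • a + x • b‖ := fun x hx => hmin hx
    have hca : c ≤ ‖a‖ := by simpa using hmin' 0 (by simp)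
    have hcb : c ≤ ‖b‖ := by simpa using hmin' 1 (by simp)
    have hcone : ∀ s t : ℝ, 0 ≤ s → 0 ≤ t → c * (s + t) ≤ ‖s • a + t • b‖ := by
      intro s t hs ht
      rcases (add_nonneg hs ht).eq_or_lt with h0 | h0
      · rw [← h0, mul_zero]
        exact norm_nonneg _
      · have h1 := hmin' (t / (s + t)) ⟨by positivity, by rw [div_le_one h0]; linarith⟩
        have e : s • a + t • b = (s + t) • ((1 - t / (s + t)) • a + (t / (s + t)) • b) := by
          rw [smul_add, smul_smul, smul_smul]
          grind
        rw [e, norm_smul, Real.norm_of_nonneg h0.le, mul_comm]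
        exact mul_le_mul_of_nonneg_left h1 h0.le
    have hmixed : ∀ u ∈ Icc (k : ℝ) (k + 1), ∀ v ∈ Icc ((k : ℝ) - 1) k,
        c * |u - v| ≤ ‖brokenLine G u - brokenLine G v‖ := by
      intro u hu v hv
      have h1 := hcone (u - k) (k - v) (by linarith [hu.1]) (by linarith [hv.2])
      rw [hr u hu, hl v hv, abs_of_nonneg (by linarith [hu.1, hv.2])]
      convert h1 using 2
      · ring
      · module
    refine ⟨c, hc, fun u hu v hv => ?_⟩
    rcases le_total (k : ℝ) u with h1 | h1 <;> rcases le_total (k : ℝ) v with h2 | h2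
    · rw [hr u ⟨h1, hu.2⟩, hr v ⟨h2, hv.2⟩]
      have e : G k + (u - k) • a - (G k + (v - k) • a) = (u - v) • a := by module
      rw [e, norm_smul, Real.norm_eq_abs, mul_comm]
      exact mul_le_mul_of_nonneg_left hca (abs_nonneg _)
    · exact hmixed u ⟨h1, hu.2⟩ v ⟨hv.1, h2⟩
    · rw [abs_sub_comm, norm_sub_rev]
      exact hmixed v ⟨h2, hv.2⟩ u ⟨hu.1, h1⟩
    · rw [hl u ⟨hu.1, h1⟩, hl v ⟨hv.1, h2⟩]
      have e : G k + (u - k) • b - (G k + (v - k) • b) = (u - v) • b := by module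
      rw [e, norm_smul, Real.norm_eq_abs, mul_comm]
      exact mul_le_mul_of_nonneg_left hcb (abs_nonneg _)
  obtain ⟨k, hk⟩ := exists_floor u0
  obtain ⟨c, hc, h⟩ := hvert k
  have hnb : ∀ᶠ u in 𝓝 u0, u ∈ Icc ((k : ℝ) - 1) (k + 1) :=
    Icc_mem_nhds (by linarith [hk.1]) hk.2
  refine ⟨c, hc, ?_⟩
  rw [nhds_prod_eq]
  filter_upwards [hnb.prod_mk hnb] with x hx
  exact h _ hx.1 _ hx.2

/-- An injective periodic broken line in the tube is antilipschitz. -/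
theorem brokenLine_antilipschitz {G : ℤ → E3} (hinj : Function.Injective (brokenLine G)) {n : ℤ}
    (hn : 0 < n) (hG : ∀ k, G (k + n) = G k + e0) :
    ∃ c > 0, ∀ u v : ℝ, c * min |u - v| 1 ≤ ‖brokenLine G u - brokenLine G v‖ := by
  have hn' : (0 : ℝ) < n := by exact_mod_cast hn
  have hGm : ∀ m : ℤ, ∀ k, G (k + m * n) = G k + (m : ℝ) • e0 := by
    intro m k
    simpa [Int.cast_smul_eq_zsmul] using add_zsmul_of_add hG m k
  have hbm : ∀ (m : ℤ) u, brokenLine G (u + m * n) = brokenLine G u + (m : ℝ) • e0 := by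
    intro m u
    have := brokenLine_add (hGm m) u
    push_cast at this
    exact this
  have hLex : ∃ L, ∀ k, ‖G (k + 1) - G k‖ ≤ L := by
    obtain ⟨L, hL⟩ := ((finite_Icc (0 : ℤ) n).image (fun k => ‖G (k + 1) - G k‖)).bddAbove
    refine ⟨L, fun k => ?_⟩
    have h1 := hGm (k / n) (k % n)
    have h2 := hGm (k / n) (k % n + 1)
    have h3 : k % n + (k / n) * n = k := Int.emod_add_ediv_mul k n
    rw [h3] at h1
    rw [add_right_comm, h3] at h2
    rw [h1, h2, add_sub_add_right_eq_sub]
    exact hL ⟨_, ⟨Int.emod_nonneg k hn.ne', (Int.emod_lt_of_pos k hn).le⟩, rfl⟩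
  obtain ⟨L, hL⟩ := hLex
  have hlip := brokenLine_lipschitz hL
  have hL0 : 0 ≤ L := (norm_nonneg _).trans (hL 0)
  have hcont := continuous_of_lipschitz_bound hlip
  let R : ℝ := n * (L * n + 3)
  have hR : 0 < R := by positivity
  -- compactness for bounded differences
  have hcomp : ∃ c > 0, ∀ x ∈ (Icc (0 : ℝ) n) ×ˢ (Icc (-R) (n + R)), c * min |x.1 - x.2| 1 ≤
      ‖brokenLine G x.1 - brokenLine G x.2‖ := by
    refine (isCompact_Icc.prod isCompact_Icc).induction_on (p := fun S : Set (ℝ × ℝ) =>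
      ∃ c > 0, ∀ x ∈ S, c * min |x.1 - x.2| 1 ≤ ‖brokenLine G x.1 - brokenLine G x.2‖)
      ⟨1, one_pos, by simp⟩ ?_ ?_ ?_
    · grind
    · rintro S T ⟨c, hc, h⟩ ⟨c', hc', h'⟩
      refine ⟨min c c', lt_min hc hc', ?_⟩
      have h0 : ∀ x : ℝ × ℝ, 0 ≤ min |x.1 - x.2| 1 := fun x => le_min (abs_nonneg _) zero_le_one
      rintro x (hx | hx)
      · exact (mul_le_mul_of_nonneg_right (min_le_left _ _) (h0 x)).trans (h x hx)
      · exact (mul_le_mul_of_nonneg_right (min_le_right _ _) (h0 x)).trans (h' x hx)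
    · rintro ⟨u, v⟩ -
      rcases eq_or_ne u v with rfl | huv
      · obtain ⟨c, hc, h⟩ := brokenLine_locally_antilipschitz
          (fun u e => by linarith [hinj e]) u
        exact ⟨_, mem_nhdsWithin_of_mem_nhds h, c, hc, fun x hx =>
          (mul_le_mul_of_nonneg_left (min_le_left _ _) hc.le).trans hx⟩
      · have hpos : 0 < ‖brokenLine G u - brokenLine G v‖ :=
          norm_pos_iff.2 (sub_ne_zero.2 fun h => huv (hinj h))
        have hev : ∀ᶠ x : ℝ × ℝ in 𝓝 (u, v), ‖brokenLine G u - brokenLine G v‖ / 2 <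
            ‖brokenLine G x.1 - brokenLine G x.2‖ := by
          have hc : Continuous fun x : ℝ × ℝ => ‖brokenLine G x.1 - brokenLine G x.2‖ := by fun_prop
          exact hc.continuousAt.eventually (lt_mem_nhds (half_lt_self hpos))
        refine ⟨_, mem_nhdsWithin_of_mem_nhds hev, _, half_pos hpos, fun x hx => ?_⟩
        exact (mul_le_of_le_one_right (half_pos hpos).le (min_le_right _ _)).trans (le_of_lt hx)
  obtain ⟨c, hc, h⟩ := hcomp
  refine ⟨min c 1, lt_min hc one_pos, fun u v => ?_⟩
  -- translate so that `u` lies in the first period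
  obtain ⟨m, hm⟩ : ∃ m : ℤ, u + m * n ∈ Icc (0 : ℝ) n := by
    refine ⟨-⌊u / n⌋, ?_⟩
    have h1 := Int.floor_le (u / n)
    have h2 := Int.lt_floor_add_one (u / n)
    rw [le_div_iff₀ hn'] at h1
    rw [div_lt_iff₀ hn'] at h2
    grind
  have e1 : u - v = (u + m * n) - (v + m * n) := by ring
  have e2 : brokenLine G u - brokenLine G v =
      brokenLine G (u + m * n) - brokenLine G (v + m * n) := by
    rw [hbm, hbm]
    abel
  rw [e1, e2]
  generalize u + m * n = u' at *
  generalize v + m * n = v' at *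
  have h0 : 0 ≤ min |u' - v'| 1 := le_min (abs_nonneg _) zero_le_one
  by_cases hv : v' ∈ Icc (-R) (n + R)
  · exact (mul_le_mul_of_nonneg_right (min_le_left _ _) h0).trans (h (u', v') ⟨hm, hv⟩)
  · -- far apart points have different longitudinal coordinates
    have hfar : R ≤ |u' - v'| := by grind
    have key : ∀ x y : ℝ, x ≤ y → R ≤ y - x → 1 ≤ ‖brokenLine G x - brokenLine G y‖ := by
      intro x y hxy hd
      let j := ⌊(y - x) / n⌋
      have h1 := Int.floor_le ((y - x) / n)
      have h2 := Int.lt_floor_add_one ((y - x) / n)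
      have h3 : L * n + 3 ≤ (y - x) / n := by
        rw [le_div_iff₀ hn', mul_comm]
        exact hd
      have h4 := hlip y (x + j * n)
      have h5 : |y - (x + j * n)| ≤ n := by
        rw [le_div_iff₀ hn'] at h1
        rw [div_lt_iff₀ hn'] at h2
        grind
      rw [hbm] at h4
      have h6 : ‖(j : ℝ) • e0‖ ≤ ‖brokenLine G x - brokenLine G y‖ +
          ‖brokenLine G y - (brokenLine G x + (j : ℝ) • e0)‖ := by
        rw [← norm_neg ((j : ℝ) • e0)]
        refine le_trans (le_of_eq ?_) (norm_add_le _ _)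
        congr 1
        abel
      have h7 : (j : ℝ) ≤ ‖(j : ℝ) • e0‖ := by
        have := E3.abs_coord_le ((j : ℝ) • e0) 0
        simp only [PiLp.smul_apply, e0_zero, smul_eq_mul, mul_one] at this
        exact (le_abs_self _).trans this
      have h8 := mul_le_mul_of_nonneg_left h5 hL0
      have h9 : (y - x) / n < (j : ℝ) + 1 := h2
      linarith
    have h1 : 1 ≤ ‖brokenLine G u' - brokenLine G v'‖ := by
      rcases le_total u' v' with h | h
      · rw [abs_sub_comm, abs_of_nonneg (by linarith)] at hfar
        exact key u' v' h hfar
      · rw [abs_of_nonneg (by linarith)] at hfar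
        rw [norm_sub_rev]
        exact key v' u' h hfar
    refine le_trans ?_ h1
    exact (mul_le_mul_of_nonneg_right (min_le_right _ _) h0).trans (by
      rw [one_mul]
      exact min_le_right _ _)

/-- A curve in a finite union of segments, which it leaves only through endpoints, is divided by its
passages through the endpoints into finitely many arcs that run in one segment each. -/
theorem exists_partition {γ : ℝ → E3} (hγ : Continuous γ) {a b : ℝ} (hab : a < b)
    {σ : Set (E3 × E3)}
    (hfin : {u | u ∈ Icc a b ∧ ∃ e ∈ σ, γ u = e.1 ∨ γ u = e.2}.Finite)
    (hQ : ∀ u ∈ Ioo a b, ∀ e ∈ σ, γ u ∈ segment ℝ e.1 e.2 → γ u ≠ e.1 → γ u ≠ e.2 →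
      ∀ᶠ v in 𝓝 u, γ v ∈ segment ℝ e.1 e.2) :
    ∃ (m : ℕ) (s : ℕ → ℝ), 0 < m ∧ s 0 = a ∧ s m = b ∧ (∀ i < m, s i < s (i + 1)) ∧
      (∀ i ≤ m, s i = a ∨ s i = b ∨ ∃ e ∈ σ, γ (s i) = e.1 ∨ γ (s i) = e.2) ∧
      (∀ i < m, ∀ u ∈ Ioo (s i) (s (i + 1)), ∀ e ∈ σ, γ u ≠ e.1 ∧ γ u ≠ e.2) ∧
      (∀ i ≤ m, s i ∈ Icc a b) ∧
      ∀ i < m, ∀ e ∈ σ, ∀ u ∈ Ioo (s i) (s (i + 1)), γ u ∈ segment ℝ e.1 e.2 →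
        ∀ v ∈ Icc (s i) (s (i + 1)), γ v ∈ segment ℝ e.1 e.2 := by
  set Z : Set ℝ := {u | u ∈ Icc a b ∧ ∃ e ∈ σ, γ u = e.1 ∨ γ u = e.2} ∪ {a, b} with hZ
  have hZf : Z.Finite := hfin.union (by simp)
  have hZab : Z ⊆ Icc a b := by grind
  obtain ⟨m, s, hm, h0, hmb, hinc, hmem, hno⟩ := exists_increasing_enumeration hZf hab
    (Or.inr (by simp)) (Or.inr (by simp)) hZab
  have hend : ∀ i < m, ∀ u ∈ Ioo (s i) (s (i + 1)), ∀ e ∈ σ, γ u ≠ e.1 ∧ γ u ≠ e.2 := by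
    intro i hi u hu e he
    grind
  refine ⟨m, s, hm, h0, hmb, hinc, ?_, hend, fun i hi => hZab (hmem i hi), ?_⟩
  · intro i hi
    rcases hmem i hi with h | h
    · exact Or.inr (Or.inr h.2)
    grind
  · intro i hi e he u hu hue
    have hIoo : ∀ v ∈ Ioo (s i) (s (i + 1)), v ∈ Ioo a b := fun v hv =>
      ⟨(hZab (hmem i hi.le)).1.trans_lt hv.1, hv.2.trans_le (hZab (hmem (i + 1) hi)).2⟩
    refine forall_mem_of_locally_mem hγ ?_ (fun v hv hve => ?_) hu hue
    · rw [segment_eq_image_lineMap]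
      exact (isCompact_Icc.image AffineMap.lineMap_continuous).isClosed
    · exact hQ v (hIoo v hv) e he hve (hend i hi v hv e he).1 (hend i hi v hv e he).2

section Cycles

variable {V : Type*} [DecidableEq V]

theorem pathEdges_map_range (v : ℕ → V) (m : ℕ) :
    pathEdges ((List.range (m + 1)).map v) = {e | ∃ i < m, e = {v i, v (i + 1)}} := by
  induction m with
  | zero => simp [pathEdges, List.range_succ]
  | succ m ih =>
    have h := pathEdges_append ((List.range m).map v) (v m) [v (m + 1)]
    have e1 : (List.range m).map v ++ [v m] = (List.range (m + 1)).map v := by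
      simp [List.range_succ]
    have e2 : (List.range m).map v ++ v m :: [v (m + 1)] = (List.range (m + 1 + 1)).map v := by
      simp [List.range_succ]
    rw [e1, e2, ih] at h
    rw [h]
    ext e
    simp only [pathEdges, mem_union, mem_ofPred_eq, mem_insert_iff, mem_empty_iff_false, or_false]
    grind

theorem cycEdges_map_range (v : ℕ → V) {m : ℕ} (hm : 2 ≤ m) (hv : v m = v 0) :
    cycEdges ((List.range m).map v) = {e | ∃ i < m, e = {v i, v (i + 1)}} := by
  obtain ⟨k, rfl⟩ : ∃ k, m = k + 1 + 1 := ⟨m - 2, by omega⟩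
  have e1 : (List.range (k + 1 + 1)).map v =
      v 0 :: ((List.range k).map (fun i => v (i + 1)) ++ [v (k + 1)]) := by
    rw [List.range_succ, List.range_succ_eq_map]
    simp [Function.comp_def]
  have h := cycEdges_eq (v 0) ((List.range k).map (fun i => v (i + 1))) (v (k + 1))
  rw [← e1, pathEdges_map_range v (k + 1)] at h
  rw [h]
  ext e
  grind

end Cycles

/-- A vertex that lies in a simplex is a vertex of this simplex. -/
theorem mem_of_mem_convexHull_of_mem_faces (T : Geometry.SimplicialComplex ℝ E3) {e e' : Finset E3}
    (he : e ∈ T.faces) (he' : e' ∈ T.faces) {x : E3} (hx : x ∈ e)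
    (hx' : x ∈ convexHull ℝ (e' : Set E3)) : x ∈ e' := by
  have h1 : ({x} : Finset E3) ∈ T.faces :=
    T.down_closed he (Finset.singleton_subset_iff.2 hx) (Finset.singleton_nonempty x)
  have h2 := T.inter_subset_convexHull h1 he' ⟨by simp, hx'⟩
  obtain ⟨v, hv⟩ := convexHull_nonempty_iff.1 ⟨x, h2⟩
  have : v = x := by simpa using hv.1
  exact this ▸ hv.2

/-- The local condition on a curve that stays in a segment of its image, for closed curves. -/
theorem eventually_mem_segment_of_periodic {γ : ℝ → E3} (hγ : Continuous γ)
    (hper : ∀ s s', γ s = γ s' ↔ ∃ m : ℤ, s' = s + m) {p q : E3} (hσ : segment ℝ p q ⊆ range γ)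
    (u : ℝ) (hu : γ u ∈ segment ℝ p q) (h1 : γ u ≠ p) (h2 : γ u ≠ q) :
    ∀ᶠ v in 𝓝 u, γ v ∈ segment ℝ p q := by
  have key : ∀ s s' : ℝ, γ s = γ s' → |s' - s| < 1 → s' = s := by
    intro s s' h h'
    obtain ⟨m, rfl⟩ := (hper s s').1 h
    rw [add_sub_cancel_left] at h'
    have : m = 0 := Int.abs_lt_one_iff.1 (by exact_mod_cast h')
    simp [this]
  refine eventually_mem_segment (A := u - 1 / 2) (B := u + 1 / 2) hγ.continuousOn
    ⟨by linarith, by linarith⟩ ?_ ?_ ?_ hu h1 h2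
  · intro s hs s' hs' h
    exact (key s s' h (by rw [abs_lt]; grind)).symm
  · grind
  · intro x hx
    obtain ⟨s, rfl⟩ := hσ hx
    refine ⟨s + (round (u - s) : ℤ), ?_, ((hper _ _).2 ⟨_, rfl⟩).symm⟩
    have := abs_sub_round (u - s)
    rw [abs_le] at this
    grind

/-- A simple closed curve that is a union of edges of a simplicial complex is an edge cycle. -/
theorem exists_cycle_of_curve (T : Geometry.SimplicialComplex ℝ E3) {𝒮 : Set (Finset E3)}
    (h𝒮 : 𝒮.Finite) (h𝒮T : 𝒮 ⊆ T.faces) (h2 : ∀ e ∈ 𝒮, e.card = 2) {γ : ℝ → E3}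
    (hγ : Continuous γ) (hper : ∀ s s', γ s = γ s' ↔ ∃ m : ℤ, s' = s + m)
    (hr : range γ = edgeCurve 𝒮) :
    ∃ l : List E3, l.Nodup ∧ 3 ≤ l.length ∧ edgeCurve (cycEdges l) = range γ ∧ cycEdges l ⊆ 𝒮 := by
  classical
  have key : ∀ s s' : ℝ, γ s = γ s' → |s' - s| < 1 → s' = s := by
    intro s s' h h'
    obtain ⟨m, rfl⟩ := (hper s s').1 h
    rw [add_sub_cancel_left] at h'
    have : m = 0 := Int.abs_lt_one_iff.1 (by exact_mod_cast h')
    simp [this]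
  have hhull : ∀ e ∈ 𝒮, convexHull ℝ (e : Set E3) ⊆ range γ := fun e he => by
    rw [hr]
    exact subset_biUnion_of_mem (u := fun e : Finset E3 => convexHull ℝ (e : Set E3)) he
  have hvert : ∀ e ∈ 𝒮, ∀ x ∈ e, x ∈ range γ := fun e he x hx =>
    hhull e he (subset_convexHull ℝ _ hx)
  -- start at a vertex
  obtain ⟨e₀, he₀⟩ : 𝒮.Nonempty := by
    have h : γ 0 ∈ edgeCurve 𝒮 := hr ▸ mem_range_self 0
    simp only [edgeCurve, mem_iUnion] at h
    obtain ⟨e, he, -⟩ := h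
    exact ⟨e, he⟩
  obtain ⟨x₀, hx₀⟩ : e₀.Nonempty := Finset.card_pos.1 (by rw [h2 e₀ he₀]; norm_num)
  obtain ⟨a, rfl⟩ := hvert e₀ he₀ x₀ hx₀
  have hper1 : γ (a + 1) = γ a := ((hper a (a + 1)).2 ⟨1, by simp⟩).symm
  let σ : Set (E3 × E3) := {e | ({e.1, e.2} : Finset E3) ∈ 𝒮}
  have hVfin : {x : E3 | ∃ e ∈ 𝒮, x ∈ e}.Finite := by
    have : {x : E3 | ∃ e ∈ 𝒮, x ∈ e} = ⋃ e ∈ 𝒮, (e : Set E3) := by ext; simp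
    rw [this]
    exact h𝒮.biUnion fun e _ => e.finite_toSet
  have hσ : σ.Finite := by
    refine (hVfin.prod hVfin).subset ?_
    rintro ⟨x, y⟩ h
    exact ⟨⟨_, h, by simp⟩, ⟨_, h, by simp⟩⟩
  have hseg : ∀ x y : E3, convexHull ℝ ((({x, y} : Finset E3)) : Set E3) = segment ℝ x y := by
    intro x y
    rw [Finset.coe_pair, convexHull_pair]
  have hσr : ∀ e ∈ σ, segment ℝ e.1 e.2 ⊆ range γ := fun e he => by
    rw [← hseg]
    exact hhull _ he
  have hcov : ∀ u ∈ Icc a (a + 1), ∃ e ∈ σ, γ u ∈ segment ℝ e.1 e.2 := by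
    intro u _
    have h : γ u ∈ edgeCurve 𝒮 := hr ▸ mem_range_self u
    simp only [edgeCurve, mem_iUnion] at h
    obtain ⟨e, he, hue⟩ := h
    obtain ⟨x, y, -, rfl⟩ := Finset.card_eq_two.1 (h2 e he)
    exact ⟨(x, y), he, by rwa [← hseg]⟩
  have hfin : {u | u ∈ Icc a (a + 1) ∧ ∃ e ∈ σ, γ u = e.1 ∨ γ u = e.2}.Finite := by
    have h3 : (γ '' ({u | u ∈ Ico a (a + 1) ∧ ∃ e ∈ 𝒮, γ u ∈ e})).Finite :=
      hVfin.subset (by rintro _ ⟨u, hu, rfl⟩; exact hu.2)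
    have h4 := Set.Finite.of_finite_image h3 (by
      intro s hs s' hs' h
      exact (key s s' h (by
        rw [abs_lt]; grind)).symm)
    refine (h4.union (finite_singleton (a + 1))).subset ?_
    rintro u ⟨hu, e, he, h⟩
    rcases hu.2.lt_or_eq with h5 | h5
    · exact Or.inl ⟨⟨hu.1, h5⟩, _, he, by grind⟩
    · exact Or.inr h5
  obtain ⟨m, s, hm, hs0, hsm, hinc, hend, hno, hIcc, hpiece'⟩ := exists_partition hγ
    (by linarith : a < a + 1) hfin
    fun u _ e he hu h1 h2 => eventually_mem_segment_of_periodic hγ hper (hσr e he) u hu h1 h2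
  have hpiece : ∀ i < m, ∃ e ∈ σ, ∀ u ∈ Icc (s i) (s (i + 1)), γ u ∈ segment ℝ e.1 e.2 := by
    intro i hi
    obtain ⟨u, hu⟩ := exists_between (hinc i hi)
    obtain ⟨e, he, hue⟩ := hcov u
      ⟨(hIcc i hi.le).1.trans hu.1.le, hu.2.le.trans (hIcc (i + 1) hi).2⟩
    exact ⟨e, he, hpiece' i hi e he u hu hue⟩
  let v : ℕ → E3 := fun i => γ (s i)
  have hvm : v m = v 0 := by grind
  have hmono : ∀ i j, i < j → j ≤ m → s i < s j := by
    intro i j hij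
    induction j, hij using Nat.le_induction with
    | base => exact fun h => hinc i h
    | succ j hj ih => grind
  have hvV : ∀ i ≤ m, ∃ e ∈ 𝒮, v i ∈ e := by
    intro i hi
    rcases hend i hi with h | h | ⟨e, he, h⟩
    · exact ⟨e₀, he₀, by simp only [v]; rwa [h]⟩
    · exact ⟨e₀, he₀, by simp only [v]; rwa [h, hper1]⟩
    · exact ⟨_, he, by grind⟩
  have hne : ∀ i < m, ∀ j < m, i ≠ j → v i ≠ v j := by
    have : ∀ i j, i < j → j < m → v i ≠ v j := by
      intro i j hij hj h
      have h3 := hmono i j hij hj.le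
      have h4 := hmono j m hj le_rfl
      rw [hsm] at h4
      have h5 := (hIcc i (by omega)).1
      have := key _ _ h (by rw [abs_lt]; constructor <;> linarith)
      linarith
    grind
  -- the arcs
  have hm2 : 2 ≤ m := by
    by_contra hcon
    obtain rfl : m = 1 := by omega
    obtain ⟨e, he, hue⟩ := hpiece 0 one_pos
    rw [zero_add, hs0, hsm] at hue
    have h3 : ∀ x ∈ ({e.1, e.2} : Finset E3), x = γ a := by
      intro x hx
      obtain ⟨u, rfl⟩ := hvert _ he x hx
      have h4 : γ (u - ⌊u - a⌋) = γ u := (hper _ _).2 ⟨⌊u - a⌋, by ring⟩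
      have h5 := Int.floor_le (u - a)
      have h6 := Int.lt_floor_add_one (u - a)
      rw [← h4]
      rcases h5.lt_or_eq with h7 | h7
      · exfalso
        have h8 := hno 0 one_pos (u - ⌊u - a⌋) ⟨by rw [hs0]; linarith, by
          rw [zero_add, hsm]; linarith⟩ e he
        rw [h4] at h8
        simp only [Finset.mem_insert, Finset.mem_singleton] at hx
        exact hx.elim h8.1 h8.2
      grind
    have h4 := h2 _ he
    have h5 : ({e.1, e.2} : Finset E3) ⊆ {γ a} := fun x hx => by simpa using h3 x hx
    have := Finset.card_le_card h5
    simp at this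
    omega
  have hnext : ∀ i < m, v i ≠ v (i + 1) := by grind
  have harc : ∀ i < m, ({v i, v (i + 1)} : Finset E3) ∈ 𝒮 ∧
      γ '' Icc (s i) (s (i + 1)) = segment ℝ (v i) (v (i + 1)) := by
    intro i hi
    obtain ⟨e, he, hue⟩ := hpiece i hi
    have hi1 : s (i + 1) - s i < 1 := by grind
    refine ⟨?_, image_Icc_eq_segment (hinc i hi).le hγ.continuousOn ?_ hue⟩
    · have h3 : ∀ j ≤ m, γ (s j) ∈ segment ℝ e.1 e.2 → v j ∈ ({e.1, e.2} : Finset E3) := by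
        intro j hj h
        obtain ⟨e', he', hv'⟩ := hvV j hj
        refine mem_of_mem_convexHull_of_mem_faces T (h𝒮T he') (h𝒮T he) hv' ?_
        rwa [hseg]
      have h4 := h3 i hi.le (hue _ ⟨le_rfl, (hinc i hi).le⟩)
      have h5 := h3 (i + 1) hi (hue _ ⟨(hinc i hi).le, le_rfl⟩)
      have h6 : ({v i, v (i + 1)} : Finset E3) ⊆ {e.1, e.2} := by
        intro x hx
        simp only [Finset.mem_insert, Finset.mem_singleton] at hx
        rcases hx with rfl | rfl
        · exact h4
        · exact h5
      rw [Finset.eq_of_subset_of_card_le h6 (by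
        rw [Finset.card_pair (hnext i hi)]; exact Finset.card_le_two)]
      exact he
    · intro x hx y hy h
      exact (key x y h (by rw [abs_lt]; grind)).symm
  have hm3 : 3 ≤ m := by
    by_contra hcon
    obtain rfl : m = 2 := by omega
    have h3 := (harc 0 (by omega)).2
    have h4 := (harc 1 (by omega)).2
    have h01 := hinc 0 (by omega)
    have h12 := hinc 1 (by omega)
    norm_num at h3 h4 h01 h12
    rw [hvm, segment_symm, ← h3] at h4
    -- the two arcs have an interior point in common
    have h5 : midpoint ℝ (v 0) (v 1) ∈ γ '' Icc (s 0) (s 1) := by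
      rw [h3]
      exact midpoint_mem_segment _ _
    have h01' := hnext 0 (by omega)
    rw [zero_add] at h01'
    have h6 := h5
    rw [← h4] at h6
    obtain ⟨x, hx, hxm⟩ := h5
    obtain ⟨y, hy, hym⟩ := h6
    obtain ⟨k, hk⟩ := (hper x y).1 (hxm.trans hym.symm)
    have h7 : x = s 1 ∨ x = s 0 := by
      have h8 : (k : ℝ) ≤ 1 := by linarith [hx.1, hy.2]
      have h9 : (0 : ℝ) ≤ k := by linarith [hx.2, hy.1]
      have h8' : k ≤ 1 := by exact_mod_cast h8
      have h9' : 0 ≤ k := by exact_mod_cast h9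
      obtain rfl | rfl : k = 0 ∨ k = 1 := by omega
      · grind
      grind
    rcases h7 with rfl | rfl
    · have : v 1 = midpoint ℝ (v 0) (v 1) := hxm
      exact h01' ((midpoint_eq_right_iff ℝ).1 this.symm)
    · have : v 0 = midpoint ℝ (v 0) (v 1) := hxm
      exact h01' ((midpoint_eq_left_iff ℝ).1 this.symm)
  refine ⟨(List.range m).map v, ?_, by simpa using hm3, ?_, ?_⟩
  · refine List.Nodup.map_on ?_ List.nodup_range
    grind
  · rw [edgeCurve, cycEdges_map_range v hm2 hvm]
    apply subset_antisymm
    · refine iUnion₂_subset ?_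
      rintro _ ⟨i, hi, rfl⟩
      rw [hseg, ← (harc i hi).2]
      exact image_subset_range _ _
    · rintro _ ⟨u, rfl⟩
      have h4 : γ (u - ⌊u - a⌋) = γ u := (hper _ _).2 ⟨⌊u - a⌋, by ring⟩
      have h5 := Int.floor_le (u - a)
      have h6 := Int.lt_floor_add_one (u - a)
      rw [← h4]
      set u' := u - ⌊u - a⌋
      have hlt : ∀ j ≤ m, u' < s j → ∃ i < m, u' ∈ Icc (s i) (s (i + 1)) := by
        intro j
        induction j with
        | zero =>
          grind
        | succ j ih =>
          intro hj h
          by_cases h' : u' < s j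
          · exact ih (by omega) h'
          grind
      obtain ⟨i, hi, hui⟩ := hlt m le_rfl (by grind)
      refine mem_biUnion (show ({v i, v (i + 1)} : Finset E3) ∈
        {e | ∃ i < m, e = ({v i, v (i + 1)} : Finset E3)} from ⟨i, hi, rfl⟩) ?_
      rw [hseg, ← (harc i hi).2]
      exact mem_image_of_mem _ hui
  · rw [cycEdges_map_range v hm2 hvm]
    rintro _ ⟨i, hi, rfl⟩
    exact (harc i hi).1

/-! ### The boundary curves of slope zero -/

theorem continuous_squarePoint : Continuous squarePoint := by
  have h1 : Continuous fun θ : ℝ => cis (2 * Real.pi * θ) := by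
    unfold cis
    fun_prop
  have h2 : Continuous fun θ : ℝ => supAbs (cis (2 * Real.pi * θ)) := by
    unfold supAbs
    fun_prop
  exact (Complex.continuous_ofReal.comp (h2.inv₀ fun θ => by linarith [half_le_supAbs_cis (2 * Real.pi * θ)])).mul h1

theorem continuous_cvec {X : ℝ → ℝ} {Z : ℝ → ℂ} (hX : Continuous X) (hZ : Continuous Z) :
    Continuous fun s => cvec (X s) (Z s) := by
  unfold cvec
  have h1 := Complex.continuous_re.comp hZ
  have h2 := Complex.continuous_im.comp hZ
  refine (PiLp.continuous_toLp 2 _).comp (continuous_pi fun i => ?_)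
  fin_cases i
  · exact hX
  · exact h1
  · exact h2

theorem cvec_squarePoint_mem_tube (x θ : ℝ) : cvec x (squarePoint θ) ∈ tube :=
  ⟨(le_max_left _ _).trans (supAbs_squarePoint θ).le, (le_max_right _ _).trans (supAbs_squarePoint θ).le⟩

namespace TubularNeighborhood

variable {K : PolygonalKnot} (N : TubularNeighborhood K)

/-- A curve of slope `0` lifts to a periodic curve in the boundary of the tube. -/
theorem exists_lift_of_represents {c : Set E3} (h : N.Represents c 0 1) :
    ∃ X Θ : ℝ → ℝ, Continuous X ∧ Continuous Θ ∧ (∀ s, X (s + 1) = X s + 1) ∧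
      (∀ s, Θ (s + 1) = Θ s) ∧
      (∀ s s', N.f (cvec (X s) (squarePoint (Θ s))) = N.f (cvec (X s') (squarePoint (Θ s'))) ↔
        ∃ m : ℤ, s' = s + m) ∧
      range (fun s => N.f (cvec (X s) (squarePoint (Θ s)))) = c := by
  obtain ⟨X, Θ, hX, hΘ, hX1, hΘ1, hinj, hc⟩ := h
  simp only [N.torusPoint_eq] at hinj hc
  push_cast at hX1 hΘ1
  have hΘc : Continuous fun s : ℝ => Θ (Int.fract s) := hΘ.comp_fract'' (by linarith)
  have hXc : Continuous fun s : ℝ => X (Int.fract s) - Int.fract s + s :=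
    ((hX.sub continuousOn_id).comp_fract'' (by simp; linarith)).add continuous_id
  have hval : ∀ s : ℝ, N.f (cvec (X (Int.fract s) - Int.fract s + s) (squarePoint (Θ (Int.fract s)))) =
      N.f (cvec (X (Int.fract s)) (squarePoint (Θ (Int.fract s)))) := by
    intro s
    rw [← N.f_add_int (cvec (X (Int.fract s)) _) ⌊s⌋]
    congr 1
    have e : e0 = cvec 1 0 := by simp [e0, cvec]
    rw [e, smul_cvec, cvec_add]
    congr 1
    · rw [Int.fract]
      ring
    · simp
  refine ⟨fun s => X (Int.fract s) - Int.fract s + s, fun s => Θ (Int.fract s), hXc, hΘc, ?_, ?_, ?_, ?_⟩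
  · intro s
    simp only [Int.fract_add_one]
    ring
  · intro s
    simp only [Int.fract_add_one]
  · intro s s'
    simp only [hval]
    constructor
    · intro h
      have h1 := hinj ⟨Int.fract_nonneg s, Int.fract_lt_one s⟩
        ⟨Int.fract_nonneg s', Int.fract_lt_one s'⟩ h
      refine ⟨⌊s'⌋ - ⌊s⌋, ?_⟩
      push_cast
      rw [Int.fract, Int.fract] at h1
      linarith
    · rintro ⟨m, rfl⟩
      rw [Int.fract_add_intCast]
  · simp only [hval]
    rw [← hc]
    apply subset_antisymm
    · rintro _ ⟨s, rfl⟩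
      exact ⟨Int.fract s, ⟨Int.fract_nonneg s, (Int.fract_lt_one s).le⟩, rfl⟩
    · rintro _ ⟨s, hs, rfl⟩
      rcases hs.2.lt_or_eq with h1 | rfl
      · exact ⟨s, by simp only [Int.fract_eq_self.2 ⟨hs.1, h1⟩]⟩
      · refine ⟨0, ?_⟩
        simp only [Int.fract_zero]
        have h2 : X 1 = X 0 + 1 := by linarith
        have h3 : Θ 1 = Θ 0 := by linarith
        rw [h2, h3, cvec_add_one, N.f_add_e0]

end TubularNeighborhood

namespace ProperSurface

variable {K : PolygonalKnot} {N : TubularNeighborhood K} (S : ProperSurface N)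

theorem bdry_eq : bdry S.T = edgeCurve S.freeEdges := rfl

/-- A boundary component is a union of free edges. -/
theorem connectedComponentIn_bdry (p : E3) : connectedComponentIn (bdry S.T) p =
    edgeCurve {e ∈ S.freeEdges | convexHull ℝ (e : Set E3) ⊆ connectedComponentIn (bdry S.T) p} := by
  apply subset_antisymm
  · intro x hx
    have hxb := connectedComponentIn_subset _ _ hx
    rw [bdry_eq, edgeCurve] at hxb
    simp only [mem_iUnion] at hxb
    obtain ⟨e, he, hxe⟩ := hxb
    refine mem_biUnion (x := e) ⟨he, ?_⟩ hxe
    rw [connectedComponentIn_eq hx]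
    refine (convex_convexHull ℝ _).isPreconnected.subset_connectedComponentIn hxe ?_
    exact subset_biUnion_of_mem (u := fun e : Finset E3 => convexHull ℝ (e : Set E3)) he
  · exact iUnion₂_subset fun e he => he.2

/-- If an essential surface of slope `0` has positive Euler characteristic, then one of its boundary
components is unknotted. -/
theorem exists_unknotted_boundary (hS : S.IsEssential) (h0 : S.HasBoundarySlope 0) (hχ : 0 < S.chi) :
    ∃ X Θ : ℝ → ℝ, Continuous X ∧ Continuous Θ ∧ (∀ s, X (s + 1) = X s + 1) ∧
      (∀ s, Θ (s + 1) = Θ s) ∧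
      (∀ s s', N.f (cvec (X s) (squarePoint (Θ s))) = N.f (cvec (X s') (squarePoint (Θ s'))) ↔
        ∃ m : ℤ, s' = s + m) ∧
      (∃ C : Set (Finset E3), C.Finite ∧ (∀ e ∈ C, e.card = 2) ∧
        range (fun s => N.f (cvec (X s) (squarePoint (Θ s)))) = edgeCurve C) ∧
      AmbientIsotopic (toS3 '' range fun s => N.f (cvec (X s) (squarePoint (Θ s)))) unknot := by
  obtain ⟨t, hD, hB, e, he, s, hs, hes⟩ := S.exists_component hS hχ
  -- the boundary component through a vertex of the free edge `e` is a curve of slope `0`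
  obtain ⟨p, hp⟩ : e.Nonempty := Finset.card_pos.1 (by rw [he.2.1]; norm_num)
  have hpb : p ∈ bdry S.T := by
    rw [bdry_eq]
    exact mem_biUnion (t := fun e : Finset E3 => convexHull ℝ (e : Set E3)) he
      (subset_convexHull ℝ _ hp)
  have hrep := h0.2 p hpb
  rw [Rat.num_zero, Rat.den_zero, Nat.cast_one] at hrep
  obtain ⟨X, Θ, hX, hΘ, hX1, hΘ1, hper, hr⟩ := N.exists_lift_of_represents hrep
  refine ⟨X, Θ, hX, hΘ, hX1, hΘ1, hper, ?_⟩
  have hfin : {e ∈ S.freeEdges | convexHull ℝ (e : Set E3) ⊆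
      connectedComponentIn (bdry S.T) p}.Finite :=
    S.finite.subset fun e he => he.1.1
  rw [hr]
  refine ⟨⟨_, hfin, fun e he => he.1.2.1, S.connectedComponentIn_bdry p⟩, ?_⟩
  have hr' := hr.trans (S.connectedComponentIn_bdry p)
  have hγ : Continuous fun s => N.f (cvec (X s) (squarePoint (Θ s))) :=
    N.continuousOn_f.comp_continuous (continuous_cvec hX (continuous_squarePoint.comp hΘ))
      fun s => cvec_squarePoint_mem_tube _ _
  obtain ⟨l, hl, hl3, hlc, hlE⟩ := exists_cycle_of_curve S.T hfin (fun e he => he.1.1)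
    (fun e he => he.1.2.1) hγ hper hr'
  -- the boundary component lies in the component of `S`, so its edge cycle bounds there
  have hsupp : connectedComponentIn (bdry S.T) p ⊆ support (comp S.finite.toFinset t) := by
    have hps : p ∈ support (comp S.finite.toFinset t) :=
      mem_biUnion (t := fun u : Finset E3 => convexHull ℝ (u : Set E3)) hs
        (subset_convexHull ℝ _ (hes hp))
    rw [← S.connectedComponentIn_space hps]
    refine connectedComponentIn_mono _ ?_
    rw [bdry_eq]
    exact iUnion₂_subset fun e he => S.T.convexHull_subset_space he.1
  have hD' : ∀ e ∈ cycEdges l, ∃ s ∈ comp S.finite.toFinset t, e ⊆ s := by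
    intro e he
    obtain ⟨h1, h2⟩ := hlE he
    obtain ⟨x, hx⟩ : e.Nonempty := Finset.card_pos.1 (by rw [h1.2.1]; norm_num)
    have hx' := subset_convexHull ℝ (e : Set E3) hx
    obtain ⟨u, hu, heu, hu3⟩ := S.pure e h1.1
    exact ⟨u, S.exists_mem_comp_of_inter h1.1 hx' (hsupp (h2 hx')) hu hu3 heu, heu⟩
  obtain ⟨R, hR, hF⟩ := hB l hl hl3 hD'
  rw [← hr, ← hlc]
  exact ambientIsotopic_unknot_of_fills S.T hD hB (fun u hu => (S.mem_faces_of_mem_comp hu).1) _ R hR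
    rfl l hF hl hl3

end ProperSurface

/-! ### Polygonal parametrization of the lifted boundary curve -/

theorem exists_mem_Icc_of_partition {s : ℕ → ℝ} {m : ℕ} {t : ℝ} (h0 : s 0 ≤ t) (hm : t < s m) :
    ∃ i < m, t ∈ Icc (s i) (s (i + 1)) := by
  induction m with
  | zero => exact absurd hm h0.not_gt
  | succ j ih =>
    grind

/-- A partition of the unit interval, repeated with period 1. -/
theorem exists_periodic_partition {m : ℕ} {s : ℕ → ℝ} (hm : 0 < m) (h0 : s 0 = 0) (h1 : s m = 1)
    (hinc : ∀ i < m, s i < s (i + 1)) :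
    ∃ σ : ℤ → ℝ, (∀ (d : ℤ), ∀ i ≤ m, σ (m * d + i) = s i + d) ∧ ∀ k, σ k < σ (k + 1) := by
  have hm' : (m : ℤ) ≠ 0 := by exact_mod_cast hm.ne'
  have key : ∀ (d : ℤ), ∀ i ≤ m, s (((m : ℤ) * d + i) % m).toNat + (((m : ℤ) * d + i) / m : ℤ) =
      s i + d := by
    intro d i hi
    rcases hi.lt_or_eq with h | rfl
    · have e1 : ((m : ℤ) * d + i) % m = i := by
        rw [Int.mul_add_emod_self_left, Int.emod_eq_of_lt (by positivity) (by exact_mod_cast h)]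
      have e2 : ((m : ℤ) * d + i) / m = d := by
        rw [Int.mul_add_ediv_left _ _ hm', Int.ediv_eq_zero_of_lt (by positivity) (by exact_mod_cast h),
          add_zero]
      rw [e1, e2, Int.toNat_natCast]
    · have e1 : ((i : ℤ) * d + i) % i = 0 := by simp
      have e2 : ((i : ℤ) * d + i) / i = d + 1 := by
        rw [Int.mul_add_ediv_left _ _ hm', Int.ediv_self hm']
      rw [e1, e2, h1, Int.toNat_zero, h0]
      push_cast
      ring
  refine ⟨fun k => s (k % m).toNat + (k / m : ℤ), key, fun k => ?_⟩
  have h2 := Int.emod_nonneg k hm'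
  have h3 := Int.emod_lt_of_pos k (by exact_mod_cast hm : (0 : ℤ) < m)
  obtain ⟨i, hi⟩ := Int.eq_ofNat_of_zero_le h2
  have h4 : i < m := by omega
  have h5 : k = m * (k / m) + i := by rw [← hi, Int.mul_ediv_add_emod]
  have h6 := key (k / m) i h4.le
  have h7 := key (k / m) (i + 1) h4
  rw [← h5] at h6
  grind

/-- A periodic curve in the tube that is a segment on each interval of a partition is a broken line,
up to a change of parameter `F`. -/
theorem exists_brokenLine_of_partition {g : ℝ → E3} (hg : Continuous g) (hinj : Function.Injective g)
    (hper : ∀ u, g (u + 1) = g u + e0) {m : ℕ} {s : ℕ → ℝ} (hm : 0 < m) (h0 : s 0 = 0) (h1 : s m = 1)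
    (hinc : ∀ i < m, s i < s (i + 1))
    (hpiece : ∀ i < m, ∃ p q, ∀ u ∈ Icc (s i) (s (i + 1)), g u ∈ segment ℝ p q) :
    ∃ (G : ℤ → E3) (F : ℝ → ℝ), (∀ k, G (k + m) = G k + e0) ∧ Continuous F ∧
      (∀ u, g (F u) = brokenLine G u) ∧ (∀ u, F (u + m) = F u + 1) ∧ Function.Surjective F ∧
      Function.Injective (brokenLine G) := by
  have hm' : (m : ℤ) ≠ 0 := by exact_mod_cast hm.ne'
  have hmr : (m : ℝ) ≠ 0 := by exact_mod_cast hm.ne'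
  obtain ⟨σ, hσ, hσinc⟩ := exists_periodic_partition hm h0 h1 hinc
  have hperd : ∀ (d : ℤ) u, g (u + d) = (d : ℝ) • e0 + g u := by
    intro d u
    induction d with
    | zero => simp
    | succ i ih =>
      push_cast at ih ⊢
      rw [← add_assoc, hper, ih]
      module
    | pred i ih =>
      have := hper (u + ((-(i : ℤ) - 1 : ℤ) : ℝ))
      push_cast at this ih ⊢
      rw [show u + (-(i : ℝ) - 1) + 1 = u + -i by ring, ih] at this
      rw [← sub_eq_iff_eq_add.2 this]
      module
  have hdecomp : ∀ k : ℤ, ∃ d : ℤ, ∃ i < m, k = m * d + i := by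
    intro k
    have h2 := Int.emod_nonneg k hm'
    have h3 := Int.emod_lt_of_pos k (by exact_mod_cast hm : (0 : ℤ) < m)
    obtain ⟨i, hi⟩ := Int.eq_ofNat_of_zero_le h2
    exact ⟨k / m, i, by omega, by rw [← hi, Int.mul_ediv_add_emod]⟩
  have hσ' : ∀ (d : ℤ), ∀ i < m, σ (m * d + i + 1) = s (i + 1) + d := by
    intro d i hi
    have := hσ d (i + 1) hi
    grind
  -- the vertices are the values of `g` at the partition points; `F u` is the parameter at which `g` passes
  -- through `brokenLine G u`
  let G : ℤ → E3 := fun k => g (σ k)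
  have hseg : ∀ k, g '' Icc (σ k) (σ (k + 1)) = segment ℝ (G k) (G (k + 1)) := by
    intro k
    obtain ⟨d, i, hi, rfl⟩ := hdecomp k
    obtain ⟨p, q, hpq⟩ := hpiece i hi
    refine image_Icc_eq_segment (p := (d : ℝ) • e0 + p) (q := (d : ℝ) • e0 + q) (hσinc _).le
      hg.continuousOn hinj.injOn fun u hu => ?_
    rw [hσ d i hi.le, hσ' d i hi] at hu
    have h2 := hpq (u - d) ⟨by linarith [hu.1], by linarith [hu.2]⟩
    have h3 := hperd d (u - d)
    rw [sub_add_cancel] at h3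
    rw [h3]
    exact (mem_segment_translate ℝ _).2 h2
  have hGne : ∀ k, G k ≠ G (k + 1) := fun k h => (hσinc k).ne (hinj h)
  have hline : ∀ k : ℤ, ∀ u ∈ Icc (k : ℝ) (k + 1), brokenLine G u =
      AffineMap.lineMap (G k) (G (k + 1)) (u - k) := by
    intro k u hu
    rw [brokenLine_eq G k hu, AffineMap.lineMap_apply, vsub_eq_sub, vadd_eq_add, add_comm]
  have himg : ∀ k : ℤ, ∀ u ∈ Icc (k : ℝ) (k + 1), brokenLine G u ∈ g '' Icc (σ k) (σ (k + 1)) := by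
    intro k u hu
    rw [hseg, hline k u hu, segment_eq_image_lineMap]
    grind
  let F : ℝ → ℝ := fun u => Function.invFun g (brokenLine G u)
  have hinv : ∀ t, Function.invFun g (g t) = t := Function.leftInverse_invFun hinj
  have hF : ∀ u, g (F u) = brokenLine G u := by
    intro u
    obtain ⟨k, hk⟩ := exists_floor u
    obtain ⟨t, -, ht⟩ := himg k u ⟨hk.1, hk.2.le⟩
    simp only [F]
    rw [← ht, hinv]
  have hFmem : ∀ k : ℤ, ∀ u ∈ Icc (k : ℝ) (k + 1), F u ∈ Icc (σ k) (σ (k + 1)) := by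
    intro k u hu
    obtain ⟨t, ht, htu⟩ := himg k u hu
    simp only [F]
    rwa [← htu, hinv]
  have hFk : ∀ k : ℤ, F k = σ k := by
    intro k
    simp only [F]
    rw [brokenLine_intCast, hinv]
  have hcell : ∀ k : ℤ, InjOn F (Icc (k : ℝ) (k + 1)) := by
    intro k u hu v hv h
    have h2 : brokenLine G u = brokenLine G v := by rw [← hF, ← hF, h]
    rw [hline k u hu, hline k v hv] at h2
    linarith [AffineMap.lineMap_injective ℝ (hGne k) h2]
  have hlt : ∀ k : ℤ, ∀ u ∈ Ico (k : ℝ) (k + 1), F u < σ (k + 1) := by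
    intro k u hu
    refine lt_of_le_of_ne (hFmem k u ⟨hu.1, hu.2.le⟩).2 fun h => ?_
    rw [← hFk (k + 1)] at h
    push_cast at h
    exact hu.2.ne (hcell k ⟨hu.1, hu.2.le⟩ ⟨by linarith, le_rfl⟩ h)
  have hσmono : StrictMono σ := strictMono_int_of_lt_succ hσinc
  have hFmono : ∀ u v, u < v → F u ≠ F v := by
    intro u v huv h
    obtain ⟨k, hk⟩ := exists_floor u
    obtain ⟨l, hl⟩ := exists_floor v
    rcases lt_trichotomy k l with h2 | h2 | h2
    · have h3 := hσmono.monotone (show k + 1 ≤ l by omega)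
      linarith [hlt k u hk, (hFmem l v ⟨hl.1, hl.2.le⟩).1]
    · subst h2
      exact huv.ne (hcell k ⟨hk.1, hk.2.le⟩ ⟨hl.1, hl.2.le⟩ h)
    · have : (l : ℝ) + 1 ≤ k := by exact_mod_cast h2
      linarith [hk.1, hl.2]
  have hFinj : Function.Injective F := by
    intro u v h
    grind
  have hGper : ∀ k, G (k + m) = G k + e0 := by
    intro k
    obtain ⟨d, i, hi, rfl⟩ := hdecomp k
    have e1 : (m : ℤ) * d + i + m = m * (d + 1) + i := by ring
    simp only [G]
    rw [e1, hσ _ i hi.le, hσ _ i hi.le, ← hper]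
    congr 1
    push_cast
    ring
  have hbl : Continuous (brokenLine G) := by
    have h2 : ∀ k : ℤ, ContinuousOn (brokenLine G) (Icc (k : ℝ) (k + 1)) := by
      intro k
      refine ContinuousOn.congr (f := fun u : ℝ => AffineMap.lineMap (G k) (G (k + 1)) (u - k)) ?_
        fun u hu => hline k u hu
      exact (AffineMap.lineMap_continuous.comp (continuous_id.sub continuous_const)).continuousOn
    rw [continuous_iff_continuousAt]
    intro u
    obtain ⟨k, hk⟩ := exists_floor u
    have h3 := (h2 (k - 1)).union_of_isClosed (h2 k) isClosed_Icc isClosed_Icc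
    push_cast at h3
    rw [show (k : ℝ) - 1 + 1 = k by ring, Icc_union_Icc_eq_Icc (by linarith) (by linarith)] at h3
    exact h3.continuousAt (Icc_mem_nhds (by linarith [hk.1]) hk.2)
  have hFc : Continuous F := by
    rw [continuous_iff_continuousAt]
    intro u
    obtain ⟨k, hk⟩ := exists_floor u
    have h2 : ContinuousOn (Function.invFun g) (g '' Icc (σ (k - 1)) (σ (k + 1))) :=
      continuousOn_range_of_comp isCompact_Icc hg.continuousOn
        (continuousOn_id.congr fun t _ => hinv t)
    have h3 : ContinuousOn F (Icc ((k : ℝ) - 1) (k + 1)) := by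
      refine h2.comp hbl.continuousOn fun v hv => ?_
      rcases le_total v k with h | h
      · have := himg (k - 1) v ⟨by push_cast; exact hv.1, by push_cast; linarith⟩
        rw [sub_add_cancel] at this
        exact image_mono (Icc_subset_Icc_right (hσinc k).le) this
      · have h4 := hσinc (k - 1)
        rw [sub_add_cancel] at h4
        exact image_mono (Icc_subset_Icc_left h4.le) (himg k v ⟨h, hv.2⟩)
    exact h3.continuousAt (Icc_mem_nhds (by linarith [hk.1]) hk.2)
  refine ⟨G, F, hGper, hFc, hF, ?_, ?_, fun u v h => by grind⟩
  · intro u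
    apply hinj
    rw [hF, hper, hF]
    exact_mod_cast brokenLine_add hGper u
  · intro t
    have h2 := Int.floor_le t
    have h3 := Int.lt_floor_add_one t
    obtain ⟨i, hi, hti⟩ := exists_mem_Icc_of_partition (s := s) (t := t - ⌊t⌋) (by rw [h0]; linarith)
      (by rw [h1]; linarith)
    have h4 : g t ∈ segment ℝ (G (m * ⌊t⌋ + i)) (G (m * ⌊t⌋ + i + 1)) := by
      rw [← hseg, hσ _ i hi.le, hσ' _ i hi]
      grind
    rw [segment_eq_image_lineMap] at h4
    obtain ⟨r, hr, hrt⟩ := h4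
    refine ⟨((m * ⌊t⌋ + i : ℤ) : ℝ) + r, hinj ?_⟩
    rw [hF, hline _ _ ⟨le_add_of_nonneg_right hr.1, add_le_add_right hr.2 _⟩, add_sub_cancel_left, hrt]

/-- A compact convex set on which an affine function is injective is a segment. -/
theorem exists_eq_segment_of_injOn {A : Set E3} (hA : IsCompact A) (hAc : Convex ℝ A)
    (hne : A.Nonempty) (ψ : E3 →ᵃ[ℝ] ℝ) (hψ : InjOn ψ A) :
    ∃ x ∈ A, ∃ y ∈ A, A = segment ℝ x y := by
  have hψc : Continuous ψ := ψ.continuous_of_finiteDimensional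
  obtain ⟨x, hx, hxm⟩ := hA.exists_isMinOn hne hψc.continuousOn
  obtain ⟨y, hy, hym⟩ := hA.exists_isMaxOn hne hψc.continuousOn
  refine ⟨x, hx, y, hy, subset_antisymm (fun z hz => ?_) (hAc.segment_subset hx hy)⟩
  have h1 : ψ x ≤ ψ z := hxm hz
  have h2 : ψ z ≤ ψ y := hym hz
  have h3 : ψ z ∈ ψ '' segment ℝ x y := by
    rw [image_segment, segment_eq_Icc (h1.trans h2)]
    exact ⟨h1, h2⟩
  obtain ⟨w, hw, hwz⟩ := h3
  rwa [← hψ (hAc.segment_subset hx hy hw) hz hwz]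

/-- The part of a polytope that an injective affine map sends to a segment is a segment. -/
theorem exists_eq_segment_of_preimage (F : Finset E3) {A : E3 →ᵃ[ℝ] E3} (hA : Function.Injective A)
    (p q : E3) (hne : (convexHull ℝ (F : Set E3) ∩ A ⁻¹' segment ℝ p q).Nonempty) :
    ∃ x y, convexHull ℝ (F : Set E3) ∩ A ⁻¹' segment ℝ p q = segment ℝ x y := by
  have hcl : IsClosed (segment ℝ p q) := by
    rw [segment_eq_image_lineMap]
    exact (isCompact_Icc.image AffineMap.lineMap_continuous).isClosed
  have hc : IsCompact (convexHull ℝ (F : Set E3) ∩ A ⁻¹' segment ℝ p q) :=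
    (F.finite_toSet.isCompact_convexHull ℝ).inter_right
      (hcl.preimage A.continuous_of_finiteDimensional)
  have hco : Convex ℝ (convexHull ℝ (F : Set E3) ∩ A ⁻¹' segment ℝ p q) :=
    (convex_convexHull ℝ _).inter ((convex_segment p q).affine_preimage A)
  obtain ⟨x, -, y, -, h⟩ := exists_eq_segment_of_injOn hc hco hne
    ((innerₛₗ ℝ (q - p)).toAffineMap.comp A) (by
      intro x hx y hy h
      apply hA
      have h1 := hx.2
      have h2 := hy.2
      rw [mem_preimage, segment_eq_image_lineMap] at h1 h2
      obtain ⟨t, -, ht⟩ := h1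
      obtain ⟨t', -, ht'⟩ := h2
      change inner ℝ (q - p) (A x) = inner ℝ (q - p) (A y) at h
      rw [← sub_eq_zero, ← inner_sub_right, ← ht, ← ht'] at h
      rw [← ht, ← ht']
      have e : AffineMap.lineMap p q t - AffineMap.lineMap p q t' = (t - t') • (q - p) := by
        simp only [AffineMap.lineMap_apply, vsub_eq_sub, vadd_eq_add]
        module
      rw [← sub_eq_zero, e]
      rw [e, inner_smul_right] at h
      rcases mul_eq_zero.1 h with h | h
      · rw [h, zero_smul]
      · rw [inner_self_eq_zero.1 h, smul_zero])
  exact ⟨x, y, h⟩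

theorem exists_bound_of_periodic {a : ℤ → ℝ} {n : ℤ} (hn : 0 < n) (h : ∀ k, a (k + n) = a k) :
    ∃ B, ∀ k, a k ≤ B := by
  have h1 : (range a).Finite := by
    rw [← Function.Periodic.image_Icc (show Function.Periodic a n from h) hn 0]
    exact (finite_Icc _ _).image _
  obtain ⟨B, hB⟩ := h1.bddAbove
  exact ⟨B, fun k => hB ⟨k, rfl⟩⟩

namespace TubularNeighborhood

variable {K : PolygonalKnot} (N : TubularNeighborhood K)

/-- `P` is a locally finite covering of the tube by polytopes on which `N.f` is affine; an element of
`P` is the set of vertices of a polytope together with the affine map. -/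
structure IsPieceSet (P : Set (Finset E3 × (E3 →ᵃ[ℝ] E3))) : Prop where
  finite : ∀ M : ℝ, {q ∈ P | ∃ p ∈ convexHull ℝ (q.1 : Set E3), |p 0| ≤ M}.Finite
  cover : ∀ p ∈ tube, ∃ q ∈ P, p ∈ convexHull ℝ (q.1 : Set E3)
  subset : ∀ q ∈ P, convexHull ℝ (q.1 : Set E3) ⊆ tube
  injective : ∀ q ∈ P, Function.Injective q.2
  eq : ∀ q ∈ P, ∀ p ∈ convexHull ℝ (q.1 : Set E3), N.f p = q.2 p

theorem exists_isPieceSet : ∃ P, N.IsPieceSet P := by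
  obtain ⟨P, h1, h2, h3, h4⟩ := N.exists_pieces
  exact ⟨P, h1, h2, h3, fun q hq => (h4 q hq).1, fun q hq => (h4 q hq).2⟩

end TubularNeighborhood

theorem convex_tube : Convex ℝ tube := by
  have h : ∀ i : Fin 3, Convex ℝ {p : E3 | |p i| ≤ 1} := by
    intro i p hp q hq a b ha hb hab
    simp only [mem_ofPred_eq, PiLp.add_apply, PiLp.smul_apply, smul_eq_mul] at hp hq ⊢
    rw [abs_le] at hp hq ⊢
    constructor <;> nlinarith [hp.1, hp.2, hq.1, hq.2]
  exact (h 1).inter (h 2)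

namespace TubularNeighborhood

variable {K : PolygonalKnot} {N : TubularNeighborhood K} {P : Set (Finset E3 × (E3 →ᵃ[ℝ] E3))}

/-- The preimage in the tube of a polygonal curve on the boundary torus is polygonal. -/
theorem IsPieceSet.exists_polygonal_lift (hP : N.IsPieceSet P) {X Θ : ℝ → ℝ} (hX : Continuous X)
    (hΘ : Continuous Θ) (hX1 : ∀ s, X (s + 1) = X s + 1) (hΘ1 : ∀ s, Θ (s + 1) = Θ s)
    (hper : ∀ s s', N.f (cvec (X s) (squarePoint (Θ s))) = N.f (cvec (X s') (squarePoint (Θ s'))) ↔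
      ∃ m : ℤ, s' = s + m) {C : Set (Finset E3)} (hC : C.Finite) (hC2 : ∀ e ∈ C, e.card = 2)
    (hr : range (fun s => N.f (cvec (X s) (squarePoint (Θ s)))) = edgeCurve C) :
    ∃ (n : ℕ) (G : ℤ → E3) (θ : ℝ → ℝ), 0 < n ∧ (∀ k, G (k + n) = G k + e0) ∧
      Function.Injective (brokenLine G) ∧ Continuous θ ∧ (∀ u, θ (u + n) = θ u) ∧
      (∀ u, ∃ x, brokenLine G u = cvec x (squarePoint (θ u))) ∧
      N.f '' range (brokenLine G) = range (fun s => N.f (cvec (X s) (squarePoint (Θ s)))) := by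
  set g : ℝ → E3 := fun s => cvec (X s) (squarePoint (Θ s)) with hgdef
  have hg : Continuous g := continuous_cvec hX (continuous_squarePoint.comp hΘ)
  have hgt : ∀ s, g s ∈ tube := fun s => cvec_squarePoint_mem_tube _ _
  have hg0 : ∀ s, g s 0 = X s := fun s => rfl
  have hg1 : ∀ s, g (s + 1) = g s + e0 := by
    intro s
    simp only [g]
    rw [hX1, hΘ1, cvec_add_one]
  have hXm : ∀ (m : ℤ) s, X (s + m) = X s + m := fun m s => by
    simpa using add_zsmul_of_add hX1 m s
  have hΘm : ∀ (m : ℤ) s, Θ (s + m) = Θ s := fun m s => by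
    simpa using Function.Periodic.zsmul hΘ1 m s
  have hgm : ∀ (m : ℤ) s, g (s + m) = g s + (m : ℝ) • e0 := by
    intro m s
    have e : e0 = cvec 1 0 := by simp [e0, cvec]
    simp only [g]
    rw [hXm, hΘm, e, smul_cvec, cvec_add]
    simp
  have hinj : Function.Injective g := by
    intro s s' h
    grind
  obtain ⟨M, hM⟩ := isCompact_Icc.exists_bound_of_continuousOn (s := Icc (0 : ℝ) 1) hX.continuousOn
  have hXs : ∀ s, |X s - s| ≤ M + 1 := by
    intro s
    have h1 := Int.floor_le s
    have h2 := Int.lt_floor_add_one s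
    have h3 := hXm ⌊s⌋ (s - ⌊s⌋)
    rw [sub_add_cancel] at h3
    have h4 := hM (s - ⌊s⌋) ⟨by linarith, by linarith⟩
    rw [Real.norm_eq_abs] at h4
    rw [h3]
    rw [abs_le] at h4 ⊢
    constructor <;> linarith [h4.1, h4.2]
  -- the edges of the preimage
  have hedge : ∀ e ∈ C, ∃ p q, convexHull ℝ (e : Set E3) = segment ℝ p q := by
    intro e he
    obtain ⟨p, q, -, rfl⟩ := Finset.card_eq_two.1 (hC2 e he)
    exact ⟨p, q, by rw [Finset.coe_pair, convexHull_pair]⟩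
  set Pf : Set (Finset E3 × (E3 →ᵃ[ℝ] E3)) :=
    {q ∈ P | ∃ p ∈ convexHull ℝ (q.1 : Set E3), |p 0| ≤ M} with hPf
  let part : (Finset E3 × (E3 →ᵃ[ℝ] E3)) × Finset E3 → Set E3 := fun a =>
    convexHull ℝ (a.1.1 : Set E3) ∩ a.1.2 ⁻¹' convexHull ℝ (a.2 : Set E3)
  have hpart : ∀ a ∈ {a ∈ Pf ×ˢ C | (part a).Nonempty}, ∃ w : E3 × E3, part a = segment ℝ w.1 w.2 := by
    rintro a ⟨⟨hq, he⟩, hne⟩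
    obtain ⟨p, q, hpq⟩ := hedge a.2 he
    simp only [part, hpq] at hne ⊢
    obtain ⟨x, y, h⟩ := exists_eq_segment_of_preimage a.1.1 (hP.injective _ hq.1) p q hne
    exact ⟨(x, y), h⟩
  choose! w hw using hpart
  -- finitely many segments, each of them the part of a piece that is mapped into an edge of `C`
  set σ : Set (E3 × E3) := w '' {a ∈ Pf ×ˢ C | (part a).Nonempty} with hσdef
  have hσ : σ.Finite := (((hP.finite M).prod hC).subset (sep_subset _ _)).image w
  have hσg : ∀ e ∈ σ, segment ℝ e.1 e.2 ⊆ range g := by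
    rintro _ ⟨a, ha, rfl⟩ p hp
    rw [← hw a ha] at hp
    have hpt := hP.subset _ ha.1.1.1 hp.1
    have h1 : N.f p ∈ range (fun s => N.f (cvec (X s) (squarePoint (Θ s)))) := by
      rw [hr, hP.eq _ ha.1.1.1 p hp.1]
      exact mem_biUnion (t := fun e : Finset E3 => convexHull ℝ (e : Set E3)) ha.1.2 hp.2
    obtain ⟨s, hs⟩ := h1
    obtain ⟨m, hm⟩ := N.injective _ (hgt s) _ hpt hs
    exact ⟨s + m, by rw [hgm, hm]; rfl⟩
  have hcov : ∀ s, N.f (g s) ∈ edgeCurve C := fun s => hr ▸ mem_range_self s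
  have hin : ∀ s ∈ Icc (0 : ℝ) 1, ∀ q ∈ P, g s ∈ convexHull ℝ (q.1 : Set E3) →
      ∃ e ∈ σ, g s ∈ segment ℝ e.1 e.2 ∧ segment ℝ e.1 e.2 ⊆ convexHull ℝ (q.1 : Set E3) := by
    intro s hs q hq hgq
    have h1 := hcov s
    simp only [edgeCurve, mem_iUnion] at h1
    obtain ⟨e, he, hse⟩ := h1
    rw [hP.eq q hq _ hgq] at hse
    have h2 : g s ∈ part (q, e) := ⟨hgq, hse⟩
    have h3 : (q, e) ∈ {a ∈ Pf ×ˢ C | (part a).Nonempty} :=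
      ⟨⟨⟨hq, g s, hgq, hM s hs⟩, he⟩, g s, h2⟩
    refine ⟨w (q, e), ⟨_, h3, rfl⟩, ?_, ?_⟩
    · rwa [← hw _ h3]
    · rw [← hw _ h3]
      exact inter_subset_left
  have hfin : {u | u ∈ Icc (0 : ℝ) 1 ∧ ∃ e ∈ σ, g u = e.1 ∨ g u = e.2}.Finite := by
    have h1 := ((hσ.image Prod.fst).union (hσ.image Prod.snd)).preimage hinj.injOn
    refine h1.subset ?_
    rintro u ⟨-, e, he, h | h⟩
    · exact Or.inl ⟨e, he, h.symm⟩
    · exact Or.inr ⟨e, he, h.symm⟩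
  have hQ : ∀ u ∈ Ioo (0 : ℝ) 1, ∀ e ∈ σ, g u ∈ segment ℝ e.1 e.2 → g u ≠ e.1 → g u ≠ e.2 →
      ∀ᶠ v in 𝓝 u, g v ∈ segment ℝ e.1 e.2 := by
    intro u hu e he hue h1 h2
    obtain ⟨R, hR⟩ := (isCompact_Icc (a := (0 : ℝ)) (b := 1)).exists_bound_of_continuousOn
      (f := fun t => (AffineMap.lineMap e.1 e.2 t : E3) 0)
      (((continuous_apply 0).comp (PiLp.continuous_ofLp 2 _)).comp
        AffineMap.lineMap_continuous).continuousOn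
    have hR0 : 0 ≤ R := (norm_nonneg _).trans (hR 0 (by simp))
    have hM0 : 0 ≤ M := (norm_nonneg _).trans (hM 0 (by simp))
    refine eventually_mem_segment (A := -(R + M + 2)) (B := R + M + 2) hg.continuousOn
      ⟨by linarith [hu.1], by linarith [hu.2]⟩ hinj.injOn (fun s _ h => hinj h) ?_ hue h1 h2
    intro p hp
    obtain ⟨s, rfl⟩ := hσg e he hp
    rw [segment_eq_image_lineMap] at hp
    obtain ⟨t, ht, htp⟩ := hp
    have h3 := hR t ht
    rw [htp, Real.norm_eq_abs, hg0, abs_le] at h3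
    have h4 := abs_le.1 (hXs s)
    exact ⟨s, ⟨by linarith [h3.1, h4.2], by linarith [h3.2, h4.1]⟩, rfl⟩
  obtain ⟨m, s, hm, hs0, hsm, hinc, -, -, hIcc, hpiece⟩ := exists_partition hg one_pos hfin hQ
  obtain ⟨G, F, hG, hF, hgF, hF1, hFs, hGi⟩ := exists_brokenLine_of_partition hg hinj hg1 hm hs0
    hsm hinc (by
      intro i hi
      obtain ⟨u, hu⟩ := exists_between (hinc i hi)
      have hu01 : u ∈ Icc (0 : ℝ) 1 :=
        ⟨(hIcc i hi.le).1.trans hu.1.le, hu.2.le.trans (hIcc (i + 1) hi).2⟩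
      obtain ⟨q, hq, hqu⟩ := hP.cover _ (hgt u)
      obtain ⟨e, he, hue, -⟩ := hin u hu01 q hq hqu
      exact ⟨e.1, e.2, hpiece i hi e he u hu hue⟩)
  refine ⟨m, G, Θ ∘ F, hm, hG, hGi, hΘ.comp hF, by grind, fun u => ⟨X (F u), (hgF u).symm⟩, ?_⟩
  change _ = range (N.f ∘ g)
  rw [range_comp, ← hFs.range_comp g]
  exact congrArg _ (congrArg range (funext fun u => (hgF u).symm))

end TubularNeighborhood

/-! ### Moves of polygonal curves across triangles on which the parametrization is affine -/

theorem mem_convexHull_triple {a b d x : E3} : x ∈ convexHull ℝ ({a, b, d} : Set E3) ↔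
    ∃ α β : ℝ, 0 ≤ α ∧ 0 ≤ β ∧ α + β ≤ 1 ∧ x = a + α • (b - a) + β • (d - a) := by
  rw [convexHull_insert (by simp), convexHull_pair, mem_convexJoin]
  constructor
  · rintro ⟨_, rfl, y, hy, hx⟩
    rw [segment_eq_image_lineMap] at hy hx
    obtain ⟨t, ht, rfl⟩ := hy
    obtain ⟨r, hr, rfl⟩ := hx
    refine ⟨r * (1 - t), r * t, mul_nonneg hr.1 (by linarith [ht.2]), mul_nonneg hr.1 ht.1, ?_, ?_⟩
    · linarith [hr.2]
    · simp only [AffineMap.lineMap_apply, vsub_eq_sub, vadd_eq_add]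
      module
  · rintro ⟨α, β, hα, hβ, hs, rfl⟩
    refine ⟨a, rfl, AffineMap.lineMap b d (β / (α + β)), ?_, ?_⟩
    · rw [segment_eq_image_lineMap]
      refine mem_image_of_mem _ ⟨by positivity, div_le_one_of_le₀ (by linarith) (by linarith)⟩
    · rw [segment_eq_image_lineMap]
      refine ⟨α + β, ⟨by linarith, hs⟩, ?_⟩
      simp only [AffineMap.lineMap_apply, vsub_eq_sub, vadd_eq_add]
      rcases (add_nonneg hα hβ).eq_or_lt with h | h
      · have h1 : α = 0 := by linarith
        have h2 : β = 0 := by linarith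
        simp [h1, h2]
      · have e : (α + β) * (β / (α + β)) = β := by field_simp
        rw [show (α + β) • ((β / (α + β)) • (d - b) + b - a) + a =
          a + (α + β) • (b - a) + ((α + β) * (β / (α + β))) • (d - b) by module, e]
        module

theorem Indep2.eq_and_eq {u v : E3} (h : Indep2 u v) {α β α' β' : ℝ} {a : E3}
    (e : a + α • u + β • v = a + α' • u + β' • v) : α = α' ∧ β = β' := by
  have := h (α - α') (β - β') (by
    rw [← sub_eq_zero] at e
    rw [← e]
    module)
  exact ⟨sub_eq_zero.1 this.1, sub_eq_zero.1 this.2⟩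

/-- A finite union of segments. -/
def IsPolygonal (A : Set E3) : Prop :=
  ∃ σ : Set (E3 × E3), σ.Finite ∧ A = ⋃ e ∈ σ, segment ℝ e.1 e.2

theorem IsPolygonal.union {A B : Set E3} (hA : IsPolygonal A) (hB : IsPolygonal B) :
    IsPolygonal (A ∪ B) := by
  obtain ⟨σ, hσ, rfl⟩ := hA
  obtain ⟨τ, hτ, rfl⟩ := hB
  exact ⟨σ ∪ τ, hσ.union hτ, by rw [biUnion_union]⟩

theorem isPolygonal_empty : IsPolygonal ∅ := ⟨∅, finite_empty, by simp⟩

theorem isPolygonal_segment (p q : E3) : IsPolygonal (segment ℝ p q) :=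
  ⟨{(p, q)}, finite_singleton _, by simp⟩

theorem isPolygonal_biUnion {ι : Type*} {s : Set ι} (hs : s.Finite) {A : ι → Set E3}
    (h : ∀ i ∈ s, IsPolygonal (A i)) : IsPolygonal (⋃ i ∈ s, A i) := by
  induction s, hs using Set.Finite.induction_on with
  | empty => simpa using isPolygonal_empty
  | insert _ _ ih =>
    rw [biUnion_insert]
    exact (h _ (mem_insert _ _)).union (ih fun i hi => h i (mem_insert_of_mem _ hi))

theorem eq_of_mem_segment_of_mem_segment {x y a : E3} (h1 : a ∈ segment ℝ x y)
    (h2 : y ∈ segment ℝ x a) : y = a := by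
  have e1 := dist_add_dist_of_mem_segment h1
  have e2 := dist_add_dist_of_mem_segment h2
  have : dist a y = 0 := by
    rw [dist_comm y a] at e2
    linarith [dist_nonneg (x := a) (y := y)]
  exact (dist_eq_zero.1 this).symm

theorem segment_union_of_mem {x y a : E3} (h : a ∈ segment ℝ x y) :
    segment ℝ x a ∪ segment ℝ a y = segment ℝ x y := by
  apply subset_antisymm
  · exact union_subset ((convex_segment x y).segment_subset (left_mem_segment ℝ x y) h)
      ((convex_segment x y).segment_subset h (right_mem_segment ℝ x y))
  · intro z hz
    rw [segment_eq_image_lineMap] at h hz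
    obtain ⟨t, ht, rfl⟩ := h
    obtain ⟨r, hr, rfl⟩ := hz
    rcases le_total r t with hrt | hrt
    · left
      have e : segment ℝ x (AffineMap.lineMap x y t) = AffineMap.lineMap x y '' segment ℝ 0 t := by
        rw [image_segment, AffineMap.lineMap_apply_zero]
      rw [e, segment_eq_Icc ht.1]
      exact mem_image_of_mem _ ⟨hr.1, hrt⟩
    · right
      have e : segment ℝ (AffineMap.lineMap x y t) y = AffineMap.lineMap x y '' segment ℝ t 1 := by
        rw [image_segment, AffineMap.lineMap_apply_one]
      rw [e, segment_eq_Icc ht.2]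
      exact mem_image_of_mem _ ⟨hrt, hr.2⟩

/-- The segments of a polygonal set can be cut at given points. -/
theorem IsPolygonal.exists_cut {A : Set E3} (hA : IsPolygonal A) (F : Finset E3) :
    ∃ σ : Set (E3 × E3), σ.Finite ∧ A = (⋃ e ∈ σ, segment ℝ e.1 e.2) ∧
      ∀ e ∈ σ, ∀ a ∈ F, a ∈ segment ℝ e.1 e.2 → a = e.1 ∨ a = e.2 := by
  classical
  induction F using Finset.induction_on with
  | empty =>
    obtain ⟨σ, hσ, h⟩ := hA
    exact ⟨σ, hσ, h, by simp⟩
  | insert a F _ ih =>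
    obtain ⟨σ, hσ, rfl, hF⟩ := ih
    refine ⟨{e ∈ σ | a ∉ segment ℝ e.1 e.2} ∪ ((fun e => (e.1, a)) '' {e ∈ σ | a ∈ segment ℝ e.1 e.2} ∪
      (fun e => (a, e.2)) '' {e ∈ σ | a ∈ segment ℝ e.1 e.2}), ?_, ?_, ?_⟩
    · exact (hσ.subset (sep_subset _ _)).union (((hσ.subset (sep_subset _ _)).image _).union
        ((hσ.subset (sep_subset _ _)).image _))
    · rw [biUnion_union, biUnion_union, biUnion_image, biUnion_image]
      ext x
      simp only [mem_iUnion, mem_union, mem_ofPred_eq, exists_prop]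
      constructor
      · rintro ⟨e, he, hx⟩
        by_cases hae : a ∈ segment ℝ e.1 e.2
        · rw [← segment_union_of_mem hae] at hx
          rcases hx with hx | hx
          · exact Or.inr (Or.inl ⟨e, ⟨he, hae⟩, hx⟩)
          · exact Or.inr (Or.inr ⟨e, ⟨he, hae⟩, hx⟩)
        · exact Or.inl ⟨e, ⟨he, hae⟩, hx⟩
      · rintro (⟨e, ⟨he, -⟩, hx⟩ | ⟨e, ⟨he, hae⟩, hx⟩ | ⟨e, ⟨he, hae⟩, hx⟩)
        · exact ⟨e, he, hx⟩
        · exact ⟨e, he, segment_union_of_mem hae ▸ Or.inl hx⟩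
        · exact ⟨e, he, segment_union_of_mem hae ▸ Or.inr hx⟩
    · rintro e (⟨he, hae⟩ | ⟨e, ⟨he, hae⟩, rfl⟩ | ⟨e, ⟨he, hae⟩, rfl⟩) c hc hce
      · rcases Finset.mem_insert.1 hc with rfl | hc
        · exact absurd hce hae
        · exact hF e he c hc hce
      · rcases Finset.mem_insert.1 hc with rfl | hc
        · exact Or.inr rfl
        · rcases hF e he c hc (segment_union_of_mem hae ▸ Or.inl hce) with h | h
          · exact Or.inl h
          · subst h
            exact Or.inr (eq_of_mem_segment_of_mem_segment hae hce)
      · rcases Finset.mem_insert.1 hc with rfl | hc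
        · exact Or.inl rfl
        · rcases hF e he c hc (segment_union_of_mem hae ▸ Or.inr hce) with h | h
          · subst h
            rw [segment_symm] at hae hce
            exact Or.inl (eq_of_mem_segment_of_mem_segment hae hce)
          · exact Or.inr h

/-- Triangle move: a side of a triangle may be replaced by the other two sides if the rest of the
curve meets the triangle at most in the end points of this side. -/
theorem IsPolygonal.ambientIsotopic_triangle_move {R : Set E3} (hR : IsPolygonal R) {a b d : E3}
    (hind : Indep2 (b - a) (d - a)) (h : ∀ x ∈ R, x ∈ convexHull ℝ {a, b, d} → x = a ∨ x = b) :
    AmbientIsotopic (toS3 '' (R ∪ segment ℝ a b))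
      (toS3 '' (R ∪ (segment ℝ a d ∪ segment ℝ d b))) := by
  classical
  obtain ⟨σ, hσ, rfl, hcut⟩ := hR.exists_cut {a, b}
  refine KnotSSC.ambientIsotopic_triangle_move hind hσ fun e he x hx hx' => ?_
  have h1 := h x (mem_biUnion (t := fun e : E3 × E3 => segment ℝ e.1 e.2) he hx) hx'
  refine ⟨h1, hcut e he x ?_ hx⟩
  rcases h1 with rfl | rfl <;> simp

/-- The triangle move for the image under a map that is affine on the triangle. -/
theorem IsPolygonal.ambientIsotopic_image_triangle_move {R : Set E3} (hR : IsPolygonal R) {a b d : E3}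
    (hind : Indep2 (b - a) (d - a)) {f : E3 → E3} {A : E3 →ᵃ[ℝ] E3} (hA : Function.Injective A)
    (hf : ∀ x ∈ convexHull ℝ {a, b, d}, f x = A x)
    (h : ∀ x ∈ convexHull ℝ {a, b, d}, f x ∈ R → x = a ∨ x = b) :
    AmbientIsotopic (toS3 '' (R ∪ f '' segment ℝ a b))
      (toS3 '' (R ∪ (f '' segment ℝ a d ∪ f '' segment ℝ d b))) := by
  have ha : a ∈ convexHull ℝ ({a, b, d} : Set E3) := subset_convexHull ℝ _ (by simp)
  have hb : b ∈ convexHull ℝ ({a, b, d} : Set E3) := subset_convexHull ℝ _ (by simp)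
  have hd : d ∈ convexHull ℝ ({a, b, d} : Set E3) := subset_convexHull ℝ _ (by simp)
  have himg : ∀ p ∈ convexHull ℝ ({a, b, d} : Set E3), ∀ q ∈ convexHull ℝ ({a, b, d} : Set E3),
      f '' segment ℝ p q = segment ℝ (A p) (A q) := by
    intro p hp q hq
    rw [← image_segment]
    exact image_congr fun x hx => hf x ((convex_convexHull ℝ _).segment_subset hp hq hx)
  rw [himg a ha b hb, himg a ha d hd, himg d hd b hb]
  refine hR.ambientIsotopic_triangle_move ?_ ?_
  · intro s t hst
    rw [← vsub_eq_sub, ← vsub_eq_sub, ← A.linearMap_vsub, ← A.linearMap_vsub, ← map_smul, ← map_smul,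
      ← map_add] at hst
    exact hind s t ((A.linear_injective_iff.2 hA) (by rw [map_zero]; exact hst))
  · intro x hx hx'
    have e : ({A a, A b, A d} : Set E3) = A '' {a, b, d} := by simp [image_insert_eq]
    rw [e, ← AffineMap.image_convexHull] at hx'
    obtain ⟨y, hy, rfl⟩ := hx'
    rw [← hf y hy] at hx
    rcases h y hy hx with rfl | rfl <;> simp

/-! ### Triangle moves in the tube -/

theorem abs_lineMap_zero_le (p p' : E3) {t : ℝ} (ht : t ∈ Icc (0 : ℝ) 1) :
    |(AffineMap.lineMap p p' t : E3) 0| ≤ |p 0| + |p' 0| := by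
  simp only [AffineMap.lineMap_apply, vsub_eq_sub, vadd_eq_add, PiLp.add_apply, PiLp.smul_apply,
    PiLp.sub_apply, smul_eq_mul]
  rw [show t * (p' 0 - p 0) + p 0 = (1 - t) * p 0 + t * p' 0 by ring]
  refine (abs_add_le _ _).trans ?_
  rw [abs_mul, abs_mul, abs_of_nonneg ht.1, abs_of_nonneg (by linarith [ht.2] : 0 ≤ 1 - t)]
  nlinarith [ht.1, ht.2, abs_nonneg (p 0), abs_nonneg (p' 0)]

theorem lineMap_mem_segment {p q : E3} {t : ℝ} (ht : t ∈ Icc (0 : ℝ) 1) :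
    AffineMap.lineMap p q t ∈ segment ℝ p q := by
  rw [segment_eq_image_lineMap]
  exact mem_image_of_mem _ ht

namespace TubularNeighborhood

variable {K : PolygonalKnot} {N : TubularNeighborhood K} {P : Set (Finset E3 × (E3 →ᵃ[ℝ] E3))}

theorem IsPieceSet.isPolygonal_image_segment (hP : N.IsPieceSet P) {p q : E3} (hp : p ∈ tube)
    (hq : q ∈ tube) : IsPolygonal (N.f '' segment ℝ p q) := by
  set M := |p 0| + |q 0|
  have hseg : segment ℝ p q ⊆ tube := convex_tube.segment_subset hp hq
  have e : N.f '' segment ℝ p q =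
      ⋃ r ∈ {r ∈ P | ∃ x ∈ convexHull ℝ (r.1 : Set E3), |x 0| ≤ M},
        r.2 '' (convexHull ℝ (r.1 : Set E3) ∩ segment ℝ p q) := by
    apply subset_antisymm
    · rintro _ ⟨x, hx, rfl⟩
      obtain ⟨r, hr, hxr⟩ := hP.cover x (hseg hx)
      have hM : |x 0| ≤ M := by
        rw [segment_eq_image_lineMap] at hx
        obtain ⟨t, ht, rfl⟩ := hx
        exact abs_lineMap_zero_le p q ht
      refine mem_biUnion (x := r) ⟨hr, x, hxr, hM⟩ ⟨x, ⟨hxr, hx⟩, (hP.eq r hr x hxr).symm⟩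
    · refine iUnion₂_subset ?_
      rintro r hr _ ⟨x, hx, rfl⟩
      exact ⟨x, hx.2, hP.eq r hr.1 x hx.1⟩
  rw [e]
  refine isPolygonal_biUnion (hP.finite M) fun r hr => ?_
  rcases (convexHull ℝ (r.1 : Set E3) ∩ segment ℝ p q).eq_empty_or_nonempty with h | h
  · rw [h, image_empty]
    exact isPolygonal_empty
  · have h1 := exists_eq_segment_of_preimage r.1 (A := AffineMap.id ℝ E3) (fun _ _ h => h) p q h
    obtain ⟨x, y, hxy⟩ := h1
    change convexHull ℝ (r.1 : Set E3) ∩ segment ℝ p q = segment ℝ x y at hxy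
    rw [hxy, image_segment]
    exact isPolygonal_segment _ _

end TubularNeighborhood

open MeasureTheory in
/-- Finitely many planes do not cover an open set. -/
theorem exists_mem_notMem_planes {U : Set E3} (hU : IsOpen U) (hne : U.Nonempty)
    {H : Set ((E3 →ₗ[ℝ] ℝ) × ℝ)} (hH : H.Finite) (h0 : ∀ h ∈ H, h.1 ≠ 0) :
    ∃ x ∈ U, ∀ h ∈ H, x ∉ planeOf h := by
  by_contra! hcon
  exact (hU.measure_pos volume hne).ne' (measure_mono_null (fun x hx => mem_iUnion₂.2 (by
    obtain ⟨h, hh, hx⟩ := hcon x hx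
    exact ⟨h, hh, hx⟩)) ((measure_biUnion_null_iff hH.countable).2 fun h hh => volume_planeOf (h0 h hh)))

/-- The interior of the tube. -/
def openTube : Set E3 := {p | |p 1| < 1 ∧ |p 2| < 1}

theorem openTube_subset_tube : openTube ⊆ tube := fun _ hp => ⟨hp.1.le, hp.2.le⟩

theorem isOpen_openTube : IsOpen openTube := by
  have h : ∀ i : Fin 3, IsOpen {p : E3 | |p i| < 1} := fun i =>
    isOpen_lt (by fun_prop) continuous_const
  exact (h 1).inter (h 2)

theorem convex_abs_lt (i : Fin 3) (M : ℝ) : Convex ℝ {p : E3 | |p i| < M} := by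
  simpa [preimage] using
    (convex_ball (0 : ℝ) M).linear_preimage (EuclideanSpace.proj i : E3 →L[ℝ] ℝ).toLinearMap

theorem tube_subset_closure_openTube : tube ⊆ closure openTube := fun p hp => by
  have key : ∀ x s : ℝ, |x| ≤ 1 → 0 < s → s ≤ 1 → |(1 - s) * x| < 1 := fun x s hx h0 h1 => by
    rw [abs_mul, abs_of_nonneg (by linarith)]
    nlinarith [abs_nonneg x]
  have hc : Continuous fun s : ℝ => (1 - s) • p := by fun_prop
  refine mem_closure_of_tendsto (b := 𝓝[>] (0 : ℝ)) (f := fun s => (1 - s) • p)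
    (tendsto_nhdsWithin_of_tendsto_nhds (by simpa using hc.tendsto 0)) ?_
  filter_upwards [Ioc_mem_nhdsGT one_pos] with s hs
  exact ⟨key _ _ hp.1 hs.1 hs.2, key _ _ hp.2 hs.1 hs.2⟩

theorem lineMap_apply_linear (l : E3 →ₗ[ℝ] ℝ) (x y : E3) (t : ℝ) :
    l (AffineMap.lineMap x y t) = (1 - t) * l x + t * l y := by
  simp only [AffineMap.lineMap_apply, vsub_eq_sub, vadd_eq_add, map_add, map_smul, map_sub, smul_eq_mul]
  ring

/-- All the points of a set lie on the same side of a plane. -/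
def OnSide (h : (E3 →ₗ[ℝ] ℝ) × ℝ) (A : Set E3) : Prop := (∀ x ∈ A, h.1 x ≤ h.2) ∨ ∀ x ∈ A, h.2 ≤ h.1 x

theorem OnSide.convexHull {h : (E3 →ₗ[ℝ] ℝ) × ℝ} {A : Set E3} (hA : OnSide h A) :
    OnSide h (convexHull ℝ A) :=
  hA.imp (fun h' => convexHull_min h' (convex_halfSpace_le h.1.isLinear _))
    fun h' => convexHull_min h' (convex_halfSpace_ge h.1.isLinear _)

theorem onSide_of_mul_nonneg {h : (E3 →ₗ[ℝ] ℝ) × ℝ} {a b c : E3}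
    (hab : 0 ≤ (h.1 a - h.2) * (h.1 b - h.2)) (hbc : 0 ≤ (h.1 b - h.2) * (h.1 c - h.2))
    (hac : 0 ≤ (h.1 a - h.2) * (h.1 c - h.2)) : OnSide h {a, b, c} := by
  simp only [OnSide, mem_insert_iff, mem_singleton_iff, forall_eq_or_imp, forall_eq]
  rcases lt_trichotomy (h.1 a) h.2 with h1 | h1 | h1 <;> rcases lt_trichotomy (h.1 b) h.2 with h2 | h2 | h2
    <;> rcases lt_trichotomy (h.1 c) h.2 with h3 | h3 | h3 <;>
    first | exact .inl ⟨by linarith, by linarith, by linarith⟩ |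
      exact .inr ⟨by linarith, by linarith, by linarith⟩ | nlinarith

/-- In a bounded part of the tube finitely many planes, which carry the faces of the pieces, decide
whether a triangle lies in a single piece: it suffices that none of them cuts the triangle. -/
theorem TubularNeighborhood.IsPieceSet.exists_triangle_planes {K : PolygonalKnot}
    {N : TubularNeighborhood K} {P : Set (Finset E3 × (E3 →ᵃ[ℝ] E3))} (hP : N.IsPieceSet P) (M : ℝ) :
    ∃ H : Set ((E3 →ₗ[ℝ] ℝ) × ℝ), H.Finite ∧ ∀ a b c : E3, {a, b, c} ⊆ tube ∩ {p | |p 0| < M} →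
      (∀ h ∈ H, OnSide h {a, b, c}) → ∃ q ∈ P, convexHull ℝ {a, b, c} ⊆ convexHull ℝ (q.1 : Set E3) := by
  choose H0 hf hn hH0 using exists_planes_of_finset
  set Q : Set (Finset E3) := Prod.fst '' {q ∈ P | ∃ p ∈ convexHull ℝ (q.1 : Set E3), |p 0| ≤ M}
  set H := ⋃ F ∈ Q, H0 F
  have hHf : H.Finite := ((hP.finite M).image _).biUnion fun F _ => hf F
  have hHn : ∀ h ∈ H, h.1 ≠ 0 := fun h hh => by
    obtain ⟨F, -, hh⟩ := mem_iUnion₂.1 hh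
    exact hn F h hh
  refine ⟨H, hHf, fun a b c habc hside => ?_⟩
  have hB : Convex ℝ (tube ∩ {p : E3 | |p 0| < M}) := convex_tube.inter (convex_abs_lt 0 M)
  set S := convexHull ℝ ({a, b, c} : Set E3) with hS
  have hSB : S ⊆ tube ∩ {p : E3 | |p 0| < M} := convexHull_min habc hB
  -- a point near the centroid, in general position
  have hz0 : a + (1 / 3 : ℝ) • (b - a) + (1 / 3 : ℝ) • (c - a) ∈ S :=
    mem_convexHull_triple.2 ⟨1 / 3, 1 / 3, by norm_num, by norm_num, by norm_num, rfl⟩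
  set z0 := a + (1 / 3 : ℝ) • (b - a) + (1 / 3 : ℝ) • (c - a) with hz0def
  have hlz : ∀ l : E3 →ₗ[ℝ] ℝ, l z0 = (l a + l b + l c) / 3 := fun l => by
    simp only [hz0def, map_add, map_smul, map_sub, smul_eq_mul]
    ring
  have hev : ∀ᶠ x in 𝓝 z0, |x 0| < M ∧ ∀ h ∈ H, (h.1 z0 < h.2 → h.1 x < h.2) ∧
      (h.2 < h.1 z0 → h.2 < h.1 x) := by
    have h1 : Continuous fun x : E3 => |x 0| := by fun_prop
    refine (h1.continuousAt.eventually_lt continuousAt_const (hSB hz0).2).and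
      ((eventually_all_finite hHf).2 fun h _ => ?_)
    have h2 := h.1.continuous_of_finiteDimensional.continuousAt (x := z0)
    refine .and ?_ ?_
    · by_cases h3 : h.1 z0 < h.2
      · filter_upwards [h2.eventually_lt continuousAt_const h3] with x hx _ using hx
      · exact .of_forall fun _ h => absurd h h3
    · by_cases h3 : h.2 < h.1 z0
      · filter_upwards [continuousAt_const.eventually_lt h2 h3] with x hx _ using hx
      · exact .of_forall fun _ h => absurd h h3
  obtain ⟨O, hO, hOo, hzO⟩ := mem_nhds_iff.1 hev
  obtain ⟨z, ⟨hzO, hzt⟩, hzH⟩ := exists_mem_notMem_planes (hOo.inter isOpen_openTube)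
    (mem_closure_iff.1 (tube_subset_closure_openTube (hSB hz0).1) O hOo hzO) hHf hHn
  have hzB : z ∈ tube ∩ {p : E3 | |p 0| < M} := ⟨openTube_subset_tube hzt, (hO hzO).1⟩
  set V : Set E3 := (fun p : E3 × ℝ => AffineMap.lineMap p.1 z p.2) '' (S ×ˢ Ioc (0 : ℝ) 1)
  have hline : Continuous fun p : E3 × ℝ => (AffineMap.lineMap p.1 z p.2 : E3) := by
    simp only [AffineMap.lineMap_apply, vsub_eq_sub, vadd_eq_add]
    fun_prop
  obtain ⟨F, ⟨q, hq, rfl⟩, hVF⟩ := exists_subset_interior_of_disjoint_planes (P := Q) (H := H) (V := V)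
    (fun F hF x hx hxi => by
      obtain ⟨h, hh, hxh⟩ := hH0 F x hx hxi
      exact ⟨h, mem_biUnion hF hh, hxh⟩)
    (((convex_convexHull ℝ _).isPreconnected.prod isPreconnected_Ioc).image _ hline.continuousOn)
    ⟨_, (z0, 1), ⟨hz0, by simp⟩, rfl⟩
    (by
      rintro _ ⟨⟨y, s⟩, ⟨hy, hs⟩, rfl⟩
      have h1 := hB.lineMap_mem (hSB hy) hzB ⟨hs.1.le, hs.2⟩
      obtain ⟨q, hq, hxq⟩ := hP.cover _ h1.1
      exact ⟨q.1, ⟨q, ⟨hq, _, hxq, h1.2.le⟩, rfl⟩, hxq⟩)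
    (by
      rintro _ ⟨⟨y, s⟩, ⟨hy, hs⟩, rfl⟩ h hh e
      simp only [mem_planeOf, lineMap_apply_linear] at e
      have h1 := (hO hzO).2 h hh
      have h2 : h.1 z ≠ h.2 := hzH h hh
      have h3 := hlz h.1
      have h4 : (∀ x ∈ ({a, b, c} : Set E3), h.1 x ≤ h.2) ∧ h.1 z < h.2 ∨
          (∀ x ∈ ({a, b, c} : Set E3), h.2 ≤ h.1 x) ∧ h.2 < h.1 z := by
        have h5 := hside h hh
        simp only [OnSide, mem_insert_iff, mem_singleton_iff, forall_eq_or_imp, forall_eq] at h5 ⊢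
        rcases h2.lt_or_gt with h6 | h6
        · have h7 : h.1 z0 ≤ h.2 := not_lt.1 fun h => (h1.2 h).not_gt h6
          exact .inl ⟨h5.elim id fun h => ⟨by linarith, by linarith, by linarith⟩, h6⟩
        · have h7 : h.2 ≤ h.1 z0 := not_lt.1 fun h => (h1.1 h).not_gt h6
          exact .inr ⟨h5.elim (fun h => ⟨by linarith, by linarith, by linarith⟩) id, h6⟩
      have hs0 : 0 < s := hs.1
      have hs1 : s ≤ 1 := hs.2
      rcases h4 with ⟨h4, h5⟩ | ⟨h4, h5⟩
      · have : h.1 y ≤ h.2 := convexHull_min h4 (convex_halfSpace_le h.1.isLinear _) hy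
        nlinarith
      · have : h.2 ≤ h.1 y := convexHull_min h4 (convex_halfSpace_ge h.1.isLinear _) hy
        nlinarith)
  refine ⟨q, hq.1, fun y hy => ?_⟩
  refine (isClosed_convexHull_finset q.1).mem_of_tendsto (b := 𝓝[>] (0 : ℝ))
    (f := fun s => AffineMap.lineMap y z s) ?_ ?_
  · refine tendsto_nhdsWithin_of_tendsto_nhds ?_
    simpa using (AffineMap.lineMap_continuous (p := y) (q := z)).tendsto (0 : ℝ)
  · filter_upwards [Ioc_mem_nhdsGT one_pos] with s hs
    exact interior_subset (hVF ⟨(y, s), ⟨hy, hs⟩, rfl⟩)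

/-- A curve `f '' [a, b] ∪ f '' [b, c]` in a polygon may be replaced by `f '' [a, c]` if the rest of the
polygon meets the image of the triangle at most in the images of `a` and `c`. -/
def Movable (f : E3 → E3) (a b c : E3) : Prop :=
  ∀ R, IsPolygonal R → (∀ x ∈ convexHull ℝ {a, b, c}, f x ∈ R → x = a ∨ x = c) →
    AmbientIsotopic (toS3 '' (R ∪ (f '' segment ℝ a b ∪ f '' segment ℝ b c)))
      (toS3 '' (R ∪ f '' segment ℝ a c))

section Movable

variable {f : E3 → E3} {a b c : E3}

theorem Movable.symm (h : Movable f a b c) : Movable f c b a := fun R hR hx => by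
  rw [segment_symm ℝ c b, segment_symm ℝ b a, segment_symm ℝ c a, union_comm (f '' _)]
  refine h R hR fun x hx1 hx2 => (hx x ?_ hx2).symm
  rwa [Set.insert_comm c, Set.pair_comm c, Set.insert_comm b]

theorem Indep2.of_det {u u' : E3} (h : Indep2 u u') {α β α' β' : ℝ} (hdet : α * β' - β * α' ≠ 0) :
    Indep2 (α • u + β • u') (α' • u + β' • u') := by
  intro s t e
  obtain ⟨h1, h2⟩ := h (s * α + t * α') (s * β + t * β') (by rw [← e]; module)
  have h3 : s * (α * β' - β * α') = 0 := by linear_combination β' * h1 - α' * h2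
  have h4 : t * (α * β' - β * α') = 0 := by linear_combination α * h2 - β * h1
  exact ⟨(mul_eq_zero.1 h3).resolve_right hdet, (mul_eq_zero.1 h4).resolve_right hdet⟩

theorem eq_of_mem_segment_of_mem_triangle (hind : Indep2 (b - a) (c - a)) {t : ℝ}
    (ht : t ∈ Ioo (0 : ℝ) 1) {x : E3} (hx : x ∈ segment ℝ a (AffineMap.lineMap a b t))
    (hx' : x ∈ convexHull ℝ {AffineMap.lineMap a b t, b, c}) : x = AffineMap.lineMap a b t := by
  rw [segment_eq_image_lineMap] at hx
  obtain ⟨s, hs, rfl⟩ := hx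
  obtain ⟨α, β, hα, hβ, h1, e⟩ := mem_convexHull_triple.1 hx'
  simp only [AffineMap.lineMap_apply, vsub_eq_sub, vadd_eq_add] at e ⊢
  obtain ⟨h2, h3⟩ := hind.eq_and_eq (a := a) (α := s * t) (β := 0)
    (α' := t + α * (1 - t) - β * t) (β' := β) (by rw [← sub_eq_zero] at e ⊢; rw [← e]; module)
  subst h3
  have : s = 1 := by nlinarith [hs.1, hs.2, ht.1, ht.2, mul_nonneg hα (sub_nonneg.2 ht.2.le)]
  simp [this]

theorem eq_of_mem_triangle_of_mem_segment (hind : Indep2 (b - a) (c - a)) {t : ℝ}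
    (ht : t ∈ Ioo (0 : ℝ) 1) {x : E3} (hx : x ∈ convexHull ℝ {a, AffineMap.lineMap a b t, c})
    (hx' : x ∈ segment ℝ c b) : x = c := by
  rw [segment_eq_image_lineMap] at hx'
  obtain ⟨s, hs, rfl⟩ := hx'
  obtain ⟨α, β, hα, hβ, h1, e⟩ := mem_convexHull_triple.1 hx
  simp only [AffineMap.lineMap_apply, vsub_eq_sub, vadd_eq_add] at e ⊢
  obtain ⟨h2, h3⟩ := hind.eq_and_eq (a := a) (α := s) (β := 1 - s)
    (α' := α * t) (β' := β) (by rw [← sub_eq_zero] at e ⊢; rw [← e]; module)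
  have : s = 0 := by nlinarith [hs.1, hs.2, ht.1, ht.2]
  simp [this]

/-- A triangle can be cut by a segment from `b` to a point on the side `[a, c]`. -/
theorem Movable.of_base (hind : Indep2 (c - a) (b - a)) (hinj : InjOn f (convexHull ℝ {a, b, c}))
    (hbc : IsPolygonal (f '' segment ℝ b c)) {t : ℝ} (ht : t ∈ Ioo (0 : ℝ) 1)
    (hap : IsPolygonal (f '' segment ℝ a (AffineMap.lineMap a c t)))
    (h1 : Movable f a (AffineMap.lineMap a c t) b) (h2 : Movable f (AffineMap.lineMap a c t) b c) :
    Movable f a b c := by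
  intro R hR h
  set p : E3 := AffineMap.lineMap a c t with hp
  have hpac : p ∈ segment ℝ a c := lineMap_mem_segment ⟨ht.1.le, ht.2.le⟩
  have hS := convex_convexHull ℝ ({a, b, c} : Set E3)
  have ha : a ∈ convexHull ℝ ({a, b, c} : Set E3) := subset_convexHull ℝ _ (by simp)
  have hb : b ∈ convexHull ℝ ({a, b, c} : Set E3) := subset_convexHull ℝ _ (by simp)
  have hc : c ∈ convexHull ℝ ({a, b, c} : Set E3) := subset_convexHull ℝ _ (by simp)
  have hpS := hS.segment_subset ha hc hpac
  have hs1 : convexHull ℝ {a, p, b} ⊆ convexHull ℝ {a, b, c} := convexHull_min (by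
    simp [insert_subset_iff, ha, hb, hpS]) hS
  have hs2 : convexHull ℝ {p, b, c} ⊆ convexHull ℝ {a, b, c} := convexHull_min (by
    simp [insert_subset_iff, hb, hc, hpS]) hS
  have hI1 : ∀ x ∈ convexHull ℝ {a, p, b}, x ∈ segment ℝ b c → x = b := fun x hx hx' =>
    eq_of_mem_triangle_of_mem_segment hind ht hx hx'
  have hI2 : ∀ x ∈ convexHull ℝ {p, b, c}, x ∈ segment ℝ a p → x = p := fun x hx hx' =>
    eq_of_mem_segment_of_mem_triangle hind ht hx' (by rwa [Set.pair_comm b c] at hx)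
  have e1 := h1 _ (hR.union hbc) (by
    rintro x hx (hxR | ⟨y, hy, e⟩)
    · refine (h x (hs1 hx) hxR).imp_right fun e => ?_
      subst e
      exact hI1 _ hx (right_mem_segment ..)
    · obtain rfl := hinj (hS.segment_subset hb hc hy) (hs1 hx) e
      exact .inr (hI1 _ hx hy))
  have e2 := h2 _ (hR.union hap) (by
    rintro x hx (hxR | ⟨y, hy, e⟩)
    · refine (h x (hs2 hx) hxR).imp_left fun e => ?_
      subst e
      exact hI2 _ hx (left_mem_segment ..)
    · obtain rfl := hinj (hS.segment_subset ha hpS hy) (hs2 hx) e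
      exact .inl (hI2 _ hx hy))
  rw [union_assoc, union_assoc, ← image_union, ← image_union, ← image_union] at e1
  rw [union_assoc, union_assoc, ← image_union, ← image_union, ← image_union, segment_union_of_mem hpac]
    at e2
  rw [← image_union, union_comm (segment ℝ a b)]
  refine e1.symm.trans ?_
  convert e2 using 4
  rw [segment_symm ℝ p b]
  ac_rfl

/-- A triangle can be cut by a segment from `c` to a point on the side `[a, b]`. -/
theorem Movable.of_side (hind : Indep2 (b - a) (c - a)) (hinj : InjOn f (convexHull ℝ {a, b, c}))
    {t : ℝ} (ht : t ∈ Ioo (0 : ℝ) 1)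
    (hap : IsPolygonal (f '' segment ℝ a (AffineMap.lineMap a b t)))
    (h1 : Movable f (AffineMap.lineMap a b t) b c) (h2 : Movable f a (AffineMap.lineMap a b t) c) :
    Movable f a b c := by
  intro R hR h
  set p : E3 := AffineMap.lineMap a b t with hp
  have hpab : p ∈ segment ℝ a b := lineMap_mem_segment ⟨ht.1.le, ht.2.le⟩
  have hS := convex_convexHull ℝ ({a, b, c} : Set E3)
  have ha : a ∈ convexHull ℝ ({a, b, c} : Set E3) := subset_convexHull ℝ _ (by simp)
  have hb : b ∈ convexHull ℝ ({a, b, c} : Set E3) := subset_convexHull ℝ _ (by simp)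
  have hc : c ∈ convexHull ℝ ({a, b, c} : Set E3) := subset_convexHull ℝ _ (by simp)
  have hpS := hS.segment_subset ha hb hpab
  have hs1 : convexHull ℝ {a, p, c} ⊆ convexHull ℝ {a, b, c} := convexHull_min (by
    simp [insert_subset_iff, ha, hc, hpS]) hS
  have hs2 : convexHull ℝ {p, b, c} ⊆ convexHull ℝ {a, b, c} := convexHull_min (by
    simp [insert_subset_iff, hb, hc, hpS]) hS
  have hI2 : ∀ x ∈ convexHull ℝ {p, b, c}, x ∈ segment ℝ a p → x = p := fun x hx hx' =>
    eq_of_mem_segment_of_mem_triangle hind ht hx' hx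
  have e1 := h1 _ (hR.union hap) (by
    rintro x hx (hxR | ⟨y, hy, e⟩)
    · refine (h x (hs2 hx) hxR).imp_left fun e => ?_
      subst e
      exact hI2 _ hx (left_mem_segment ..)
    · obtain rfl := hinj (hS.segment_subset ha hpS hy) (hs2 hx) e
      exact .inl (hI2 _ hx hy))
  have e2 := h2 R hR fun x hx => h x (hs1 hx)
  rw [union_assoc, ← union_assoc (f '' _), ← image_union, segment_union_of_mem hpab, union_assoc] at e1
  exact e1.trans e2

/-- It suffices to move across the triangles that are not cut by a given plane. -/
theorem movable_of_onSide {S : Set E3} (hS : Convex ℝ S) (hinj : InjOn f S)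
    (hseg : ∀ x ∈ S, ∀ y ∈ S, IsPolygonal (f '' segment ℝ x y)) (h : (E3 →ₗ[ℝ] ℝ) × ℝ)
    (hmove : ∀ a ∈ S, ∀ b ∈ S, ∀ c ∈ S, Indep2 (b - a) (c - a) → OnSide h {a, b, c} → Movable f a b c)
    (ha : a ∈ S) (hb : b ∈ S) (hc : c ∈ S) (hind : Indep2 (b - a) (c - a)) : Movable f a b c := by
  classical
  let z : E3 → ℕ := fun x => if h.1 x = h.2 then 1 else 0
  -- the number of vertices that are not on the plane decreases
  have key : ∀ n, ∀ a ∈ S, ∀ b ∈ S, ∀ c ∈ S, Indep2 (b - a) (c - a) → 2 ≤ n + z a + z b + z c →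
      Movable f a b c := by
    intro n
    induction n with
    | zero =>
      intro a ha b hb c hc hind hz
      refine hmove a ha b hb c hc hind ?_
      simp only [z] at hz
      apply onSide_of_mul_nonneg <;> split_ifs at hz with h1 h2 h3 h2 h3 h3 <;> first | omega | simp [*]
    | succ n ih =>
      intro a ha b hb c hc hind hz
      by_cases hside : OnSide h {a, b, c}
      · exact hmove a ha b hb c hc hind hside
      have hcut : ∀ x ∈ S, ∀ y ∈ S, (h.1 x - h.2) * (h.1 y - h.2) < 0 → ∃ t ∈ Ioo (0 : ℝ) 1,
          AffineMap.lineMap x y t ∈ S ∧ z (AffineMap.lineMap x y t) = 1 ∧ z x = 0 ∧ z y = 0 := by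
        intro x hx y hy hxy
        have hx0 : h.1 x - h.2 ≠ 0 := fun e => by simp [e] at hxy
        have hy0 : h.1 y - h.2 ≠ 0 := fun e => by simp [e] at hxy
        have ht : (h.1 x - h.2) / (h.1 x - h.1 y) ∈ Ioo (0 : ℝ) 1 := by
          rcases mul_neg_iff.1 hxy with h1 | h1
          · exact ⟨div_pos h1.1 (by linarith), (div_lt_one (by linarith)).2 (by linarith)⟩
          · exact ⟨div_pos_of_neg_of_neg h1.1 (by linarith),
              (div_lt_one_of_neg (by linarith)).2 (by linarith)⟩
        refine ⟨_, ht, hS.lineMap_mem hx hy ⟨ht.1.le, ht.2.le⟩, if_pos ?_, if_neg (sub_ne_zero.1 hx0),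
          if_neg (sub_ne_zero.1 hy0)⟩
        have : h.1 x - h.1 y ≠ 0 := fun e => by simp [e] at ht
        rw [lineMap_apply_linear]
        field_simp
        ring
      have hh : ∀ {a b c}, a ∈ S → b ∈ S → c ∈ S → convexHull ℝ {a, b, c} ⊆ S := fun ha hb hc =>
        convexHull_min (by simp [insert_subset_iff, ha, hb, hc]) hS
      have hl : ∀ {x y : E3} {t : ℝ}, AffineMap.lineMap x y t = x + t • (y - x) := by
        simp [AffineMap.lineMap_apply, add_comm]
      have hcase : ∀ a ∈ S, ∀ b ∈ S, ∀ c ∈ S, Indep2 (b - a) (c - a) → 2 ≤ n + 1 + z a + z b + z c →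
          (h.1 a - h.2) * (h.1 b - h.2) < 0 → Movable f a b c := by
        intro a ha b hb c hc hind hz hab
        obtain ⟨t, ht, hp, hz1, hz2, hz3⟩ := hcut a ha b hb hab
        refine Movable.of_side hind (hinj.mono (hh ha hb hc)) ht (hseg _ ha _ hp)
          (ih _ hp b hb c hc ?_ (by omega)) (ih a ha _ hp c hc ?_ (by omega))
        · convert hind.of_det (α := 1 - t) (β := 0) (α' := -t) (β' := 1)
            (by linarith [ht.2]) using 1 <;>
            (try simp only [hl]) <;> module
        · convert hind.of_det (α := t) (β := 0) (α' := 0) (β' := 1)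
            (by linarith [ht.1]) using 1 <;>
            (try simp only [hl]) <;> module
      have h3 : (h.1 a - h.2) * (h.1 b - h.2) < 0 ∨ (h.1 b - h.2) * (h.1 c - h.2) < 0 ∨
          (h.1 a - h.2) * (h.1 c - h.2) < 0 := by
        by_contra! hcon
        apply hside
        exact onSide_of_mul_nonneg hcon.1 hcon.2.1 hcon.2.2
      rcases h3 with h3 | h3 | h3
      · exact hcase a ha b hb c hc hind hz h3
      · refine (hcase c hc b hb a ha ?_ (by omega) (by linarith)).symm
        convert hind.of_det (α := 1) (β := -1) (α' := 0) (β' := -1) (by norm_num) using 1 <;> module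
      · obtain ⟨t, ht, hp, hz1, hz2, hz3⟩ := hcut a ha c hc h3
        refine Movable.of_base hind.symm (hinj.mono (hh ha hb hc)) (hseg _ hb _ hc) ht (hseg _ ha _ hp)
          (ih a ha _ hp b hb ?_ (by omega)) (ih _ hp b hb c hc ?_ (by omega))
        · convert hind.of_det (α := 0) (β := t) (α' := 1) (β' := 0)
            (by linarith [ht.1]) using 1 <;>
            (try simp only [hl]) <;> module
        · convert hind.of_det (α := 1) (β := -t) (α' := 0) (β' := 1 - t)
            (by linarith [ht.2]) using 1 <;>
            (try simp only [hl]) <;> module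
  exact key 2 a ha b hb c hc hind (by omega)

end Movable

/-- Every triangle that the parametrization of the tube embeds is movable: it is cut into triangles
that lie in single pieces. -/
theorem TubularNeighborhood.IsPieceSet.movable {K : PolygonalKnot} {N : TubularNeighborhood K}
    {P : Set (Finset E3 × (E3 →ᵃ[ℝ] E3))} (hP : N.IsPieceSet P) {a b c : E3} (habc : {a, b, c} ⊆ tube)
    (hind : Indep2 (b - a) (c - a)) (hinj : InjOn N.f (convexHull ℝ {a, b, c})) :
    Movable N.f a b c := by
  obtain ⟨H, hH, hpl⟩ := hP.exists_triangle_planes (|a 0| + |b 0| + |c 0| + 1)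
  set B := tube ∩ {p : E3 | |p 0| < |a 0| + |b 0| + |c 0| + 1}
  suffices h : ∀ H' : Set ((E3 →ₗ[ℝ] ℝ) × ℝ), H'.Finite → ∀ a b c : E3, convexHull ℝ {a, b, c} ⊆ B →
      Indep2 (b - a) (c - a) → InjOn N.f (convexHull ℝ {a, b, c}) →
      (∀ h ∈ H, h ∉ H' → OnSide h {a, b, c}) → Movable N.f a b c by
    refine h H hH a b c ?_ hind hinj fun h h1 h2 => absurd h1 h2
    refine convexHull_min (subset_inter habc ?_) (convex_tube.inter (convex_abs_lt 0 _))
    simp only [insert_subset_iff, singleton_subset_iff, mem_ofPred_eq]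
    exact ⟨by linarith [abs_nonneg (b 0), abs_nonneg (c 0)], by linarith [abs_nonneg (a 0), abs_nonneg (c 0)],
      by linarith [abs_nonneg (a 0), abs_nonneg (b 0)]⟩
  intro H' hH'
  induction H', hH' using Set.Finite.induction_on with
  | empty =>
    intro a b c hB hind hinj hside R hR h
    obtain ⟨q, hq, hqs⟩ := hpl a b c ((subset_convexHull ℝ _).trans hB) fun h hh => hside h hh (by simp)
    have e : ({a, c, b} : Set E3) = {a, b, c} := by rw [Set.pair_comm]
    exact (hR.ambientIsotopic_image_triangle_move (a := a) (b := c) (d := b) hind.symm (hP.injective q hq)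
      (fun x hx => hP.eq q hq x (hqs (e ▸ hx))) fun x hx => h x (e ▸ hx)).symm
  | @insert h H' _ _ ih =>
    intro a b c hB hind hinj hside
    refine movable_of_onSide (convex_convexHull ℝ {a, b, c}) hinj
      (fun x hx y hy => hP.isPolygonal_image_segment (hB hx).1 (hB hy).1) h
      (fun a' ha' b' hb' c' hc' hind' hside' => ?_) (subset_convexHull ℝ _ (by simp))
      (subset_convexHull ℝ _ (by simp)) (subset_convexHull ℝ _ (by simp)) hind
    have hs : ({a', b', c'} : Set E3) ⊆ convexHull ℝ {a, b, c} := by simp [insert_subset_iff, *]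
    have hs' := convexHull_min hs (convex_convexHull ℝ _)
    refine ih a' b' c' (hs'.trans hB) hind' (hinj.mono hs') fun h' hh' hn => ?_
    by_cases e : h' = h
    · exact e ▸ hside'
    · exact (hside h' hh' (by simp [e, hn])).convexHull.imp (fun h x hx => h x (hs hx))
        fun h x hx => h x (hs hx)

/-! ### Motions of polygons in the tube -/

theorem brokenLine_add_apply (A B : ℤ → E3) (u : ℝ) :
    brokenLine (fun i => A i + B i) u = brokenLine A u + brokenLine B u := by
  simp only [brokenLine, AffineMap.lineMap_apply, vsub_eq_sub, vadd_eq_add]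
  module

theorem brokenLine_mem {S : Set E3} (hS : Convex ℝ S) {G : ℤ → E3} (hG : ∀ i, G i ∈ S) (u : ℝ) :
    brokenLine G u ∈ S :=
  hS.lineMap_mem (hG _) (hG _) ⟨Int.fract_nonneg u, (Int.fract_lt_one u).le⟩

theorem norm_brokenLine_le {W : ℤ → E3} {B : ℝ} (hW : ∀ i, ‖W i‖ ≤ B) (u : ℝ) :
    ‖brokenLine W u‖ ≤ B := by
  simpa using brokenLine_mem (convex_closedBall 0 B) (fun i => by simpa using hW i) u

theorem brokenLine_lipschitz_of_norm_le {W : ℤ → E3} {B : ℝ} (hW : ∀ i, ‖W i‖ ≤ B) (u v : ℝ) :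
    ‖brokenLine W u - brokenLine W v‖ ≤ 2 * B * |u - v| :=
  brokenLine_lipschitz (fun k => by linarith [norm_sub_le (W (k + 1)) (W k), hW k, hW (k + 1)]) u v

theorem brokenLine_eq_lineMap (G : ℤ → E3) (k : ℤ) {u : ℝ} (hu : u ∈ Icc (k : ℝ) (k + 1)) :
    brokenLine G u = AffineMap.lineMap (G k) (G (k + 1)) (u - k) := by
  rw [brokenLine_eq G k hu, AffineMap.lineMap_apply, vsub_eq_sub, vadd_eq_add, add_comm]

theorem brokenLine_image (G : ℤ → E3) (k : ℤ) :
    brokenLine G '' Icc (k : ℝ) (k + 1) = segment ℝ (G k) (G (k + 1)) := by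
  rw [image_congr fun u hu => brokenLine_eq_lineMap G k hu,
    ← image_image (AffineMap.lineMap (G k) (G (k + 1))) (· - (k : ℝ)), image_sub_const_Icc,
    segment_eq_image_lineMap]
  simp

/-- The edge that leaves the vertex `T j` in the direction `σ = 1` or `σ = -1`. -/
theorem brokenLine_edge (T : ℤ → E3) (j : ℤ) {σ : ℤ} (hσ : σ = 1 ∨ σ = -1) {s : ℝ} (h0 : 0 ≤ s)
    (h1 : s ≤ 1) : brokenLine T (j + σ * s) = T j + s • (T (j + σ) - T j) := by
  obtain rfl | rfl := hσ
  · rw [brokenLine_eq T j (by push_cast; constructor <;> linarith)]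
    simp
  · rw [brokenLine_eq T (j - 1) (by push_cast; constructor <;> linarith), sub_add_cancel, ← sub_eq_add_neg]
    push_cast
    module

/-- The points of a triangle spanned by an edge of a polygon and a transversal vector `d` meet the
polygon, and its neighbouring displaced edge, only at the end points of the edge. -/
theorem triangle_brokenLine {T : ℤ → E3} {c : ℝ}
    (hanti : ∀ u v, c * min |u - v| 1 ≤ ‖brokenLine T u - brokenLine T v‖) {d : E3} (hdc : 2 * ‖d‖ < c)
    {j σ : ℤ} (hσ : σ = 1 ∨ σ = -1) (hd : d ∉ Submodule.span ℝ {T (j + σ) - T j, T (j - σ) - T j})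
    {α γ δ t : ℝ} (hα : 0 ≤ α) (hγ : 0 ≤ γ) (h1 : α + γ ≤ 1) (hδ : δ ∈ Icc (0 : ℝ) 1)
    (e : brokenLine T t + δ • d = T j + α • (T (j + σ) - T j) + γ • d)
    (ht : |t - j| ≤ 1 ∧ σ * (t - j) ≤ 0 ∨ 1 - α + δ ≤ |t - (j + σ * α)|) :
    α = 1 ∨ α = 0 ∧ γ = δ ∧ t = j := by
  rw [← brokenLine_edge T j hσ hα (by linarith)] at e
  have h2 := hanti t (j + σ * α)
  -- on the neighbouring edge the claim follows from the linear independence of the two edges and `d`;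
  -- elsewhere the distance between the two points of the polygon exceeds what multiples of `d` can make up
  rcases ht with ⟨h3, h4⟩ | h3
  · have h5 := brokenLine_edge T j (σ := -σ) (by omega) (abs_nonneg (t - j)) h3
    have hσt : (j : ℝ) + (-σ : ℤ) * |t - j| = t := by
      rcases hσ with rfl | rfl <;> norm_num at h4 ⊢
      · rw [abs_of_nonpos (by linarith)]
        ring
      · rw [abs_of_nonneg (by linarith)]
        ring
    rw [hσt, ← sub_eq_add_neg] at h5
    have h6 : γ = δ := by
      by_contra h
      apply hd
      rw [Submodule.mem_span_pair]
      refine ⟨-(γ - δ)⁻¹ * α, (γ - δ)⁻¹ * |t - j|, ?_⟩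
      rw [h5, brokenLine_edge T j hσ hα (by linarith)] at e
      rw [mul_smul, mul_smul, neg_smul, ← smul_neg, ← smul_add, inv_smul_eq_iff₀ (sub_ne_zero.2 h)]
      linear_combination (norm := module) e
    subst h6
    rw [add_right_cancel e, sub_self, norm_zero] at h2
    have h7 : t = j + σ * α := by
      have := le_min (abs_nonneg (t - (j + σ * α))) zero_le_one
      rcases min_choice |t - (j + σ * α)| 1 with h | h <;> rw [h] at h2 this
      · exact sub_eq_zero.1 (abs_eq_zero.1 (by nlinarith [norm_nonneg d]))
      · nlinarith [norm_nonneg d]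
    have h8 : (σ : ℝ) * σ = 1 := by rcases hσ with rfl | rfl <;> norm_num
    have h9 : α = 0 := by
      rw [h7] at h4
      nlinarith
    exact .inr ⟨h9, rfl, by simpa [h9] using h7⟩
  · left
    have h5 : brokenLine T t - brokenLine T (j + σ * α) = (γ - δ) • d := by
      linear_combination (norm := module) e
    rw [h5, norm_smul, Real.norm_eq_abs] at h2
    have h6 : |γ - δ| ≤ 1 - α + δ := abs_le.2 ⟨by linarith [hδ.1], by linarith [hδ.1]⟩
    have h7 := mul_le_mul_of_nonneg_right h6 (norm_nonneg d)
    have h8 : (1 - α + δ) / 2 ≤ min |t - (j + σ * α)| 1 :=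
      le_min (by linarith [hδ.1]) (by linarith [hδ.2])
    have h9 := mul_le_mul_of_nonneg_left h8 (by linarith [norm_nonneg d] : 0 ≤ c)
    by_contra hne
    have : 0 < 1 - α + δ := by linarith [hδ.1, lt_of_le_of_ne (by linarith : α ≤ 1) hne]
    nlinarith

namespace TubularNeighborhood

variable {K : PolygonalKnot} {N : TubularNeighborhood K} {P : Set (Finset E3 × (E3 →ᵃ[ℝ] E3))}

/-- One period of a polygon consists of the two edges at the vertex `T i₀` and of the others. -/
theorem image_range_brokenLine {T : ℤ → E3} {n : ℕ} (hn : 2 ≤ n) (hT : ∀ k, T (k + n) = T k + e0)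
    (i₀ : ℤ) : N.f '' range (brokenLine T) =
      (⋃ i ∈ Ico (1 : ℤ) (n - 1), N.f '' segment ℝ (T (i₀ + i)) (T (i₀ + i + 1))) ∪
        (N.f '' segment ℝ (T (i₀ - 1)) (T i₀) ∪ N.f '' segment ℝ (T i₀) (T (i₀ + 1))) := by
  have hsub : ∀ k, N.f '' segment ℝ (T k) (T (k + 1)) ⊆ N.f '' range (brokenLine T) := fun k => by
    rw [← brokenLine_image]
    exact image_mono (image_subset_range _ _)
  refine Subset.antisymm ?_ (union_subset (iUnion₂_subset fun i _ => hsub _)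
    (union_subset (by simpa using hsub (i₀ - 1)) (hsub _)))
  rintro _ ⟨_, ⟨u, rfl⟩, rfl⟩
  obtain ⟨v, hv, e⟩ := Function.Periodic.exists_mem_Ico (f := fun u => N.f (brokenLine T u))
    (c := (n : ℝ)) (fun u => by
      simpa using congrArg N.f (brokenLine_add (n := n) hT u) |>.trans (N.f_add_e0 _))
    (by exact_mod_cast (by omega : 0 < n)) u (i₀ - 1 : ℤ)
  obtain ⟨k, hk, hk'⟩ := exists_floor v
  have hkv : brokenLine T v ∈ segment ℝ (T k) (T (k + 1)) := by
    rw [← brokenLine_image]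
    exact mem_image_of_mem _ ⟨hk, hk'.le⟩
  have h1 : i₀ - 1 < k + 1 := by exact_mod_cast hv.1.trans_lt hk'
  have h2 : k < i₀ - 1 + n := by exact_mod_cast hk.trans_lt hv.2
  change N.f _ = _ at e
  rw [e]
  rcases (by omega : k = i₀ - 1 ∨ k = i₀ ∨ i₀ + 1 ≤ k) with rfl | rfl | h3
  · rw [sub_add_cancel] at hkv
    exact .inr (.inl (mem_image_of_mem _ hkv))
  · exact .inr (.inr (mem_image_of_mem _ hkv))
  · exact .inl (mem_biUnion (show k - i₀ ∈ Ico (1 : ℤ) (n - 1) from ⟨by omega, by omega⟩)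
      (by rw [add_sub_cancel]; exact mem_image_of_mem _ hkv))

/-- A vertex of a polygon in the tube can be moved by a small transversal vector. -/
theorem IsPieceSet.ambientIsotopic_move_vertex (hP : N.IsPieceSet P) {n : ℕ} (hn : 2 ≤ n) {T T' : ℤ → E3}
    (hT : ∀ k, T (k + n) = T k + e0) (hT' : ∀ k, T' (k + n) = T' k + e0) (ht : ∀ k, T k ∈ tube) {c : ℝ}
    (hanti : ∀ u v, c * min |u - v| 1 ≤ ‖brokenLine T u - brokenLine T v‖) {d : E3} (hdc : 2 * ‖d‖ < c)
    {j : ℤ} (hd : d ∉ Submodule.span ℝ {T (j + 1) - T j, T (j - 1) - T j}) (hj : T' j = T j + d)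
    (hp : T j + d ∈ tube) (hne : ∀ i, ¬ (n : ℤ) ∣ i - j → T' i = T i) :
    AmbientIsotopic (toS3 '' (N.f '' range (brokenLine T))) (toS3 '' (N.f '' range (brokenLine T'))) := by
  have hd' : ∀ {σ : ℤ}, σ = 1 ∨ σ = -1 → d ∉ Submodule.span ℝ {T (j + σ) - T j, T (j - σ) - T j} := by
    rintro σ (rfl | rfl)
    · exact hd
    · rwa [← sub_eq_add_neg, sub_neg_eq_add, Set.pair_comm]
  have hnj : ∀ i : ℤ, 0 < |i| → |i| < n → ¬ (n : ℤ) ∣ j + i - j := fun i h0 h1 h => by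
    rw [add_sub_cancel_left, ← dvd_abs] at h
    exact (Int.le_of_dvd h0 h).not_gt h1
  have hT1 : ∀ u, brokenLine T (u + n) = brokenLine T u + e0 := brokenLine_add hT
  -- the triangle spanned by the vector and an edge is embedded
  have hmov : ∀ {σ : ℤ}, σ = 1 ∨ σ = -1 → Movable N.f (T (j + σ)) (T j + d) (T j) ∧
      Movable N.f (T (j + σ)) (T j) (T j + d) := by
    intro σ hσ
    have hne0 : T (j + σ) - T j ≠ 0 := fun h => by
      have h1 := hanti (j + σ : ℤ) j
      rw [brokenLine_intCast, brokenLine_intCast, h, norm_zero] at h1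
      rcases hσ with rfl | rfl <;> norm_num at h1 <;> linarith [norm_nonneg d]
    have hind := indep2_of_notMem_span (by rw [Set.pair_comm]; exact hd' hσ) hne0
    have hsub : {T j, T (j + σ), T j + d} ⊆ tube := by simp [insert_subset_iff, ht, hp]
    have hinj : InjOn N.f (convexHull ℝ {T j, T (j + σ), T j + d}) := by
      intro x hx y hy e
      obtain ⟨m, hm⟩ := N.injective x (convexHull_min hsub convex_tube hx) y
        (convexHull_min hsub convex_tube hy) e
      obtain ⟨α, γ, hα, hγ, h1, rfl⟩ := mem_convexHull_triple.1 hx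
      obtain ⟨α', γ', hα', hγ', h1', rfl⟩ := mem_convexHull_triple.1 hy
      rw [← brokenLine_edge T j hσ hα (by linarith), ← brokenLine_edge T j hσ hα' (by linarith), add_sub_cancel_left,
        show !₂[(1 : ℝ), 0, 0] = e0 from rfl] at hm
      by_contra hne
      have h2 := hanti (j + σ * α') (j + σ * α + m * n)
      rw [add_int_mul hT1, show brokenLine T (j + σ * α') - (brokenLine T (j + σ * α) + (m : ℝ) • e0) =
        (γ - γ') • d by linear_combination (norm := module) hm, norm_smul, min_eq_right, Real.norm_eq_abs] at h2
      · nlinarith [norm_nonneg d, abs_le.2 (⟨by linarith, by linarith⟩ : -1 ≤ γ - γ' ∧ γ - γ' ≤ 1)]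
      · have hm0 : m ≠ 0 := fun h => by
          subst h
          refine hne ?_
          rw [← brokenLine_edge T j hσ hα (by linarith), ← brokenLine_edge T j hσ hα' (by linarith), add_sub_cancel_left, hm]
          simp
        have h3 : (2 : ℝ) ≤ |(m : ℝ) * n| := by
          rw [abs_mul, Nat.abs_cast]
          have h4 : (1 : ℝ) ≤ |(m : ℝ)| := by exact_mod_cast Int.one_le_abs hm0
          have h5 : (2 : ℝ) ≤ n := by exact_mod_cast hn
          nlinarith
        rcases hσ with rfl | rfl <;> push_cast <;> rcases le_abs.1 h3 with h3 | h3 <;> rw [le_abs] <;>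
          first | (left; linarith) | (right; linarith)
    have e1 : ({T (j + σ), T j + d, T j} : Set E3) = {T j, T (j + σ), T j + d} := by
      rw [Set.pair_comm, Set.insert_comm]
    have e2 : ({T (j + σ), T j, T j + d} : Set E3) = {T j, T (j + σ), T j + d} := Set.insert_comm ..
    refine ⟨hP.movable (e1 ▸ hsub) ?_ (e1 ▸ hinj), hP.movable (e2 ▸ hsub) ?_ (e2 ▸ hinj)⟩
    · convert hind.of_det (α := 1) (β := -1) (α' := 0) (β' := -1) (by norm_num) using 1 <;> module
    · convert hind.of_det (α := 0) (β := -1) (α' := 1) (β' := -1) (by norm_num) using 1 <;> module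
  have hT'p : T' (j + 1) = T (j + 1) := hne _ (hnj 1 (by simp) (by simp; omega))
  have hT'm : T' (j - 1) = T (j - 1) := hne _ (hnj (-1) (by simp) (by simp; omega))
  have hR : (⋃ i ∈ Ico (1 : ℤ) (n - 1), N.f '' segment ℝ (T' (j + i)) (T' (j + i + 1))) =
      ⋃ i ∈ Ico (1 : ℤ) (n - 1), N.f '' segment ℝ (T (j + i)) (T (j + i + 1)) :=
    iUnion₂_congr fun i hi => by
      rw [hne _ (hnj i (by simp; linarith [hi.1]) (by rw [abs_of_nonneg] <;> linarith [hi.1, hi.2])), add_assoc,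
        hne _ (hnj (i + 1) (by rw [abs_of_nonneg] <;> linarith [hi.1])
          (by rw [abs_of_nonneg] <;> linarith [hi.1, hi.2]))]
  rw [image_range_brokenLine hn hT j, image_range_brokenLine hn hT' j, hR, hj, hT'p, hT'm]
  have hn2 : (2 : ℝ) ≤ n := by exact_mod_cast hn
  set R := ⋃ i ∈ Ico (1 : ℤ) (n - 1), N.f '' segment ℝ (T (j + i)) (T (j + i + 1))
  have hRp : IsPolygonal R := isPolygonal_biUnion (finite_Ico _ _) fun i _ =>
    hP.isPolygonal_image_segment (ht _) (ht _)
  -- the triangles meet the remaining edges only at the end points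
  have hmeet : ∀ {σ : ℤ}, σ = 1 ∨ σ = -1 → ∀ {α γ : ℝ}, 0 ≤ α → 0 ≤ γ → α + γ ≤ 1 → ∀ {δ s : ℝ},
      δ ∈ Icc (0 : ℝ) 1 → N.f (T j + α • (T (j + σ) - T j) + γ • d) = N.f (brokenLine T s + δ • d) →
      brokenLine T s + δ • d ∈ tube → 
      δ = 0 ∧ j + 1 ≤ s ∧ s ≤ j + n - 1 ∨ σ * (s - j) ≤ 0 ∧ |s - j| + δ ≤ 1 →
      α = 1 ∨ α = 0 ∧ γ = δ ∧ s = j := by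
    intro σ hσ α γ hα hγ h1 δ s hδ e hmem hs
    obtain ⟨m, hm⟩ := N.injective _ hmem _ (convexHull_min
      (by simp [insert_subset_iff, ht, hp] : {T j, T (j + σ), T j + d} ⊆ tube) convex_tube
      (mem_convexHull_triple.2 ⟨α, γ, hα, hγ, h1, by rw [add_sub_cancel_left]⟩)) e.symm
    have h2 := triangle_brokenLine hanti hdc hσ (hd' hσ) hα hγ h1 hδ (t := s + m * n) (by
      rw [add_int_mul hT1, hm, add_right_comm]; rfl) ?_
    · refine h2.imp_right fun h => ⟨h.1, h.2.1, ?_⟩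
      have h3 : |(m : ℝ) * n| < n := by
        rw [show (m : ℝ) * n = -(s - j) by linarith [h.2.2], abs_neg]
        rcases hs with hs | hs
        · rw [abs_of_nonneg] <;> linarith [hs.2.1, hs.2.2]
        · linarith [hδ.1, hs.2]
      rw [abs_mul, Nat.abs_cast] at h3
      have h4 : |m| < 1 := by exact_mod_cast (mul_lt_iff_lt_one_left (by linarith : (0 : ℝ) < n)).1 h3
      simpa [Int.abs_lt_one_iff.1 h4] using h.2.2
    have hσα : |(σ : ℝ) * α| ≤ α := by rcases hσ with rfl | rfl <;> simp [abs_of_nonneg hα]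
    have h3 := abs_le.1 hσα
    rcases (by omega : m = 0 ∨ 1 ≤ m ∨ m ≤ -1) with rfl | hm | hm
    · rcases hs with hs | hs
      · exact .inr (le_abs.2 (.inl (by simp; linarith)))
      · exact .inl (by simpa [hs.1] using by linarith [hδ.1, hs.2])
    · have h4 : (n : ℝ) ≤ m * n := le_mul_of_one_le_left (by linarith) (by exact_mod_cast hm)
      refine .inr (le_abs.2 (.inl ?_))
      rcases hs with hs | hs
      · linarith
      · linarith [(abs_le.1 (by linarith [hs.2] : |s - j| ≤ 1 - δ)).1]
    · have h4 : (m : ℝ) * n ≤ -n := by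
        have : (m : ℝ) ≤ -1 := by exact_mod_cast hm
        nlinarith
      refine .inr (le_abs.2 (.inr ?_))
      rcases hs with hs | hs
      · linarith
      · linarith [(abs_le.1 (by linarith [hs.2] : |s - j| ≤ 1 - δ)).2]
  have hRs : ∀ x, N.f x ∈ R → ∃ s : ℝ, N.f x = N.f (brokenLine T s + (0 : ℝ) • d) ∧ j + 1 ≤ s ∧ s ≤ j + n - 1 := by
    intro x hx
    obtain ⟨i, hi, hx⟩ := mem_iUnion₂.1 hx
    rw [← brokenLine_image] at hx
    obtain ⟨_, ⟨s, hs, rfl⟩, e⟩ := hx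
    have h1 : (1 : ℝ) ≤ i := by exact_mod_cast hi.1
    have h2 : (i : ℝ) + 1 ≤ n - 1 := by exact_mod_cast (by linarith [hi.2] : i + 1 ≤ (n : ℤ) - 1)
    push_cast at hs
    exact ⟨s, by simp [e], by linarith [hs.1], by linarith [hs.2]⟩
  have hbt : ∀ s, brokenLine T s + (0 : ℝ) • d ∈ tube := fun s => by simpa using brokenLine_mem convex_tube ht s
  have e1 := (hmov (.inr rfl)).1 (R ∪ N.f '' segment ℝ (T j) (T (j + 1)))
    (hRp.union (hP.isPolygonal_image_segment (ht _) (ht _))) fun x hx hxR => by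
      rw [Set.pair_comm, Set.insert_comm] at hx
      obtain ⟨α, γ, hα, hγ, h1, rfl⟩ := mem_convexHull_triple.1 hx
      rw [add_sub_cancel_left] at hxR ⊢
      have h2 : α = 1 ∨ α = 0 ∧ γ = 0 := by
        rcases hxR with h | ⟨y, hy, e⟩
        · obtain ⟨s, e, hs⟩ := hRs _ h
          exact (hmeet (.inr rfl) hα hγ h1 (by simp) e (hbt s) (.inl ⟨rfl, hs⟩)).imp_right fun h => ⟨h.1, h.2.1⟩
        · rw [← brokenLine_image] at hy
          obtain ⟨s, hs, rfl⟩ := hy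
          exact (hmeet (.inr rfl) hα hγ h1 (by simp) (by rw [← e]; simp) (hbt s) (.inr ⟨by
            push_cast; linarith [hs.1], by rw [abs_of_nonneg] <;> linarith [hs.1, hs.2]⟩)).imp_right
              fun h => ⟨h.1, h.2.1⟩
      rcases h2 with rfl | ⟨rfl, rfl⟩
      · obtain rfl : γ = 0 := by linarith
        simp
      · simp
  have e2 := (hmov (.inl rfl)).2.symm (R ∪ N.f '' segment ℝ (T (j - 1)) (T j + d))
    (hRp.union (hP.isPolygonal_image_segment (ht _) hp)) fun x hx hxR => by
      rw [Set.insert_comm, Set.pair_comm] at hx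
      obtain ⟨α, γ, hα, hγ, h1, rfl⟩ := mem_convexHull_triple.1 hx
      rw [add_sub_cancel_left] at hxR ⊢
      have h2 : α = 1 ∨ α = 0 ∧ γ = 1 := by
        rcases hxR with h | ⟨y, hy, e⟩
        · obtain ⟨s, e, hs⟩ := hRs _ h
          refine (hmeet (.inl rfl) hα hγ h1 (by simp) e (hbt s) (.inl ⟨rfl, hs⟩)).imp_right fun h => ?_
          linarith [hs.1, h.2.2]
        · have hy' := convex_tube.segment_subset (ht _) hp hy
          rw [segment_symm, segment_eq_image_lineMap] at hy
          obtain ⟨r, hr, rfl⟩ := hy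
          have h3 : AffineMap.lineMap (T j + d) (T (j - 1)) r =
              brokenLine T (j + (-1 : ℤ) * r) + (1 - r) • d := by
            rw [brokenLine_edge T j (.inr rfl) hr.1 hr.2, AffineMap.lineMap_apply, vsub_eq_sub, vadd_eq_add,
              ← sub_eq_add_neg]
            module
          rw [h3] at e hy'
          refine (hmeet (.inl rfl) hα hγ h1 ⟨by linarith [hr.2], by linarith [hr.1]⟩ e.symm hy' (.inr
            ⟨by push_cast; linarith [hr.1], ?_⟩)).imp_right fun h => ⟨h.1, ?_⟩
          · simp [abs_of_nonneg hr.1]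
          · have := h.2.2
            push_cast at this
            linarith [h.2.1]
      rcases h2 with rfl | ⟨rfl, rfl⟩
      · obtain rfl : γ = 0 := by linarith
        simp
      · simp
  rw [← sub_eq_add_neg] at e1
  simp only [union_assoc, union_comm, union_left_comm] at e1 e2 ⊢
  exact e1.symm.trans e2

theorem exists_linearMap_eq_zero (u w : E3) : ∃ l : E3 →ₗ[ℝ] ℝ, l ≠ 0 ∧ l u = 0 ∧ l w = 0 := by
  obtain ⟨z, hz, -⟩ := exists_notMem_span_pairs u w 0 0
  obtain ⟨l, hl, h⟩ := Submodule.exists_le_ker_of_lt_top (Submodule.span ℝ {u, w})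
    (lt_top_iff_ne_top.2 fun h => hz (h ▸ Submodule.mem_top))
  exact ⟨l, hl, h (Submodule.subset_span (by simp)), h (Submodule.subset_span (by simp))⟩

/-- A small displacement of the vertices of a polygon in the tube is an ambient isotopy: the vertices
are moved one by one, each of them by two transversal vectors. -/
theorem IsPieceSet.ambientIsotopic_of_near (hP : N.IsPieceSet P) {n : ℕ} (hn : 2 ≤ n) {G G' : ℤ → E3}
    (hG : ∀ k, G (k + n) = G k + e0) (hG' : ∀ k, G' (k + n) = G' k + e0) (ht : ∀ k, G k ∈ tube)
    (ht' : ∀ k, G' k ∈ tube) {c : ℝ} (hc : 0 < c)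
    (hanti : ∀ u v, c * min |u - v| 1 ≤ ‖brokenLine G u - brokenLine G v‖)
    (hnear : ∀ k, ‖G' k - G k‖ ≤ c / 16) :
    AmbientIsotopic (toS3 '' (N.f '' range (brokenLine G))) (toS3 '' (N.f '' range (brokenLine G'))) := by
  let T : ℤ → ℤ → E3 := fun j k => if k % n < j then G' k else G k
  have hT : ∀ j k, T j (k + n) = T j k + e0 := fun j k => by
    simp only [T, Int.add_emod_right, hG, hG']
    split_ifs <;> rfl
  have hTt : ∀ j k, T j k ∈ tube := fun j k => by
    simp only [T]
    split_ifs
    exacts [ht' k, ht k]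
  have hTanti : ∀ j u v, c / 2 * min |u - v| 1 ≤ ‖brokenLine (T j) u - brokenLine (T j) v‖ := fun j u v => by
    have hW : ∀ k, ‖T j k - G k‖ ≤ c / 16 := fun k => by
      simp only [T]
      split_ifs
      exacts [hnear k, by simp; positivity]
    have e : T j = fun k => G k + (T j k - G k) := by simp
    rw [e, brokenLine_add_apply, brokenLine_add_apply]
    have h1 := hanti u v
    have h2 := brokenLine_lipschitz_of_norm_le hW u v
    have h3 := norm_sub_le (brokenLine (fun k => T j k - G k) u) (brokenLine (fun k => T j k - G k) v)
    have h4 := norm_sub_le_norm_add (brokenLine G u - brokenLine G v)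
      (brokenLine (fun k => T j k - G k) u - brokenLine (fun k => T j k - G k) v)
    rw [sub_add_sub_comm] at h4
    rcases min_choice |u - v| 1 with h | h <;> rw [h] at h1 ⊢
    · nlinarith [abs_nonneg (u - v)]
    · linarith [norm_brokenLine_le hW u, norm_brokenLine_le hW v]
  have key : ∀ j : ℕ, j ≤ n → AmbientIsotopic (toS3 '' (N.f '' range (brokenLine G)))
      (toS3 '' (N.f '' range (brokenLine (T j)))) := by
    intro j
    induction j with
    | zero =>
      intro _
      rw [show T (0 : ℕ) = G from funext fun k => if_neg (Int.emod_nonneg k (by omega)).not_gt]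
      exact AmbientIsotopic.refl _
    | succ j ih =>
      refine fun hj => (ih (by omega)).trans ?_
      have hjj : (j : ℤ) % n = j := Int.emod_eq_of_lt (by omega) (by omega)
      obtain ⟨l, hl, hl1, hl2⟩ := exists_linearMap_eq_zero (T j (j + 1) - T j j) (T j (j - 1) - T j j)
      obtain ⟨l', hl', hl1', hl2'⟩ := exists_linearMap_eq_zero (T (j + 1) (j + 1) - T (j + 1) j)
        (T (j + 1) (j - 1) - T (j + 1) j)
      obtain ⟨q, hq, hqd⟩ := Metric.mem_closure_iff.1 (tube_subset_closure_openTube (ht j)) (c / 16)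
        (by positivity)
      obtain ⟨p, ⟨hp1, hp2⟩, hp⟩ := exists_mem_notMem_planes
        ((Metric.isOpen_ball (x := G j) (ε := c / 16)).inter isOpen_openTube)
        ⟨q, by rwa [Metric.mem_ball, dist_comm], hq⟩
        (H := {(l, l (T j j)), (l', l' (T (j + 1) j))}) (by simp) (by simp [hl, hl'])
      simp only [mem_insert_iff, mem_singleton_iff, forall_eq_or_imp, forall_eq, planeOf, mem_ofPred_eq] at hp
      rw [Metric.mem_ball, dist_eq_norm] at hp1
      have hspan : ∀ {l : E3 →ₗ[ℝ] ℝ} {u w d : E3}, l u = 0 → l w = 0 → l d ≠ 0 →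
          d ∉ Submodule.span ℝ {u, w} := fun h1 h2 h3 h => by
        obtain ⟨a, b, rfl⟩ := Submodule.mem_span_pair.1 h
        simp [h1, h2] at h3
      -- both polygons differ from a third one in one vertex, in a transversal direction
      let T' : ℤ → E3 := fun k => if k % n = j then T j k + (p - T j j) else T j k
      have e0' : T j j = G j := if_neg (by omega)
      have e1 : T (j + 1) j = G' j := if_pos (by omega)
      have hT' : ∀ k, T' (k + n) = T' k + e0 := fun k => by
        simp only [T', Int.add_emod_right, hT]
        split_ifs
        exacts [add_right_comm .., rfl]
      have hT'j : T' j = p := by simp [T', hjj]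
      have hmod : ∀ i : ℤ, ¬ (n : ℤ) ∣ i - j → ¬ i % n = j := fun i hi h =>
        hi (Int.dvd_of_emod_eq_zero (Int.emod_eq_emod_iff_emod_sub_eq_zero.1 (h.trans hjj.symm)))
      refine (hP.ambientIsotopic_move_vertex hn (hT j) hT' (hTt j) (hTanti j) (d := p - T j j) (j := j) ?_
        (hspan hl1 hl2 ?_) (by simp [hT'j]) (by simpa using openTube_subset_tube hp2) fun i hi =>
        if_neg (hmod i hi)).trans (hP.ambientIsotopic_move_vertex hn (hT (j + 1)) hT' (hTt _) (hTanti _)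
        (d := p - T (j + 1) j) (j := j) ?_ (hspan hl1' hl2' ?_) (by simp [hT'j])
        (by simpa using openTube_subset_tube hp2) fun i hi => ?_).symm
      · rw [e0']
        linarith
      · rw [map_sub]
        exact sub_ne_zero.2 hp.1
      · rw [e1]
        linarith [norm_sub_le_norm_sub_add_norm_sub p (G j) (G' j), hnear j, norm_sub_rev (G j) (G' j)]
      · rw [map_sub]
        exact sub_ne_zero.2 hp.2
      · have := hmod i hi
        simp only [T', T]
        rw [if_neg this]
        congr 1
        exact propext (by omega)
  have h := key n le_rfl
  rwa [show T n = G' from funext fun k => if_pos (Int.emod_lt_of_pos k (by omega))] at h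

/-- A linear motion of the vertices of a polygon in the tube is an ambient isotopy if the polygon
remains embedded. -/
theorem IsPieceSet.ambientIsotopic_of_linear_path (hP : N.IsPieceSet P) {n : ℕ} (hn : 2 ≤ n)
    {G G' : ℤ → E3} (hG : ∀ k, G (k + n) = G k + e0) (hG' : ∀ k, G' (k + n) = G' k + e0)
    (ht : ∀ k, G k ∈ tube) (ht' : ∀ k, G' k ∈ tube)
    (hinj : ∀ r ∈ Icc (0 : ℝ) 1, Function.Injective (brokenLine fun k => G k + r • (G' k - G k))) :
    AmbientIsotopic (toS3 '' (N.f '' range (brokenLine G))) (toS3 '' (N.f '' range (brokenLine G'))) := by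
  have hTn : ∀ r : ℝ, ∀ k, G (k + n) + r • (G' (k + n) - G (k + n)) = G k + r • (G' k - G k) + e0 :=
    fun r k => by rw [hG, hG']; module
  have hTt : ∀ r ∈ Icc (0 : ℝ) 1, ∀ k, G k + r • (G' k - G k) ∈ tube := fun r hr k => by
    simpa [AffineMap.lineMap_apply, add_comm] using convex_tube.lineMap_mem (ht k) (ht' k) hr
  obtain ⟨B, hB⟩ := exists_bound_of_periodic (a := fun k => ‖G' k - G k‖) (n := n) (by omega)
    fun k => by rw [hG, hG', add_sub_add_right_eq_sub]
  have hB0 := (norm_nonneg _).trans (hB 0)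
  have := rel_of_locally_rel (fun A B => AmbientIsotopic (toS3 '' (N.f '' A)) (toS3 '' (N.f '' B)))
    (fun _ _ => AmbientIsotopic.symm) (fun _ _ _ => AmbientIsotopic.trans)
    (fun r => range (brokenLine fun k => G k + r • (G' k - G k))) fun r hr => by
      obtain ⟨c, hc, hanti⟩ := brokenLine_antilipschitz (n := n) (hinj r hr) (by omega) (hTn r)
      refine ⟨c / 16 / (B + 1), by positivity, fun r' hr' h => hP.ambientIsotopic_of_near hn (hTn r) (hTn r')
        (hTt r hr) (hTt r' hr') hc hanti fun k => ?_⟩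
      rw [show G k + r' • (G' k - G k) - (G k + r • (G' k - G k)) = (r' - r) • (G' k - G k) by module,
        norm_smul, Real.norm_eq_abs]
      rw [lt_div_iff₀ (by positivity)] at h
      nlinarith [hB k, abs_nonneg (r' - r)]
  simpa using this

end TubularNeighborhood

/-! ### Simple cross-sections -/

theorem supAbs_zpow_mul (j : ℤ) (z : ℂ) : supAbs (Complex.I ^ j * z) = supAbs z := by
  have h : ∀ z, supAbs (Complex.I * z) = supAbs z := fun z => by
    rw [supAbs, supAbs, Complex.I_mul_re, Complex.I_mul_im, abs_neg, max_comm]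
  induction j with
  | zero => simp
  | succ i ih => rw [zpow_add_one₀ Complex.I_ne_zero, mul_comm _ Complex.I, mul_assoc, h, ih]
  | pred i ih =>
    rw [← h, ← mul_assoc, ← zpow_one_add₀ Complex.I_ne_zero, add_sub_cancel, ih]

theorem squarePoint_add (θ : ℝ) (j : ℤ) : squarePoint (θ + j / 4) = Complex.I ^ j * squarePoint θ := by
  have e : cis (2 * Real.pi * (θ + j / 4)) = Complex.I ^ j * cis (2 * Real.pi * θ) := by
    rw [mul_add, cis_add, mul_comm]
    congr 1
    rw [cis, show Complex.I ^ j = Complex.exp (j * (Real.pi / 2 * Complex.I)) by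
      rw [Complex.exp_int_mul, Complex.exp_pi_div_two_mul_I]]
    push_cast
    ring_nf
  rw [squarePoint, squarePoint, e, supAbs_zpow_mul]
  ring

/-- The map `squarePoint` on the side `re = 1` of the square. -/
theorem squarePoint_of_abs_le {φ : ℝ} (h : |φ| ≤ 1 / 8) : |Real.tan (2 * Real.pi * φ)| ≤ 1 ∧
    squarePoint φ = 1 + (Real.tan (2 * Real.pi * φ) : ℝ) * Complex.I := by
  have h1 := abs_le.1 h
  have hpi := Real.pi_pos
  have hc : 0 < Real.cos (2 * Real.pi * φ) := Real.cos_pos_of_mem_Ioo ⟨by nlinarith, by nlinarith⟩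
  have h2 : 0 ≤ Real.cos (2 * (2 * Real.pi * φ)) :=
    Real.cos_nonneg_of_mem_Icc ⟨by nlinarith, by nlinarith⟩
  have hs : |Real.sin (2 * Real.pi * φ)| ≤ Real.cos (2 * Real.pi * φ) :=
    abs_le_of_sq_le_sq (by rw [Real.cos_two_mul'] at h2; linarith) hc.le
  refine ⟨by rwa [Real.tan_eq_sin_div_cos, abs_div, abs_of_pos hc, div_le_one hc], ?_⟩
  rw [squarePoint, supAbs, cis_re, cis_im, max_eq_left (by rwa [abs_of_pos hc]), abs_of_pos hc,
    Real.tan_eq_sin_div_cos]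
  apply Complex.ext
  · rw [Complex.re_ofReal_mul, cis_re, Complex.add_re, Complex.re_ofReal_mul]
    simp [hc.ne']
  · rw [Complex.im_ofReal_mul, cis_im, Complex.add_im, Complex.im_ofReal_mul]
    simp [div_eq_inv_mul]

/-- Beyond the corners, `squarePoint` leaves the side `re = 1`. -/
theorem re_squarePoint_lt {φ : ℝ} (h : 1 / 8 < |φ|) (h' : |φ| ≤ 1 / 4) : (squarePoint φ).re < 1 := by
  have hpi := Real.pi_pos
  have h2 : Real.cos (2 * (2 * Real.pi * φ)) < 0 := by
    rw [← Real.cos_abs, abs_mul, abs_mul, abs_of_pos (by positivity : 0 < 2 * Real.pi), abs_two]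
    exact Real.cos_neg_of_pi_div_two_lt_of_lt (by nlinarith) (by nlinarith)
  rw [Real.cos_two_mul'] at h2
  have h3 := sq_lt_sq.1 (by linarith : Real.cos (2 * Real.pi * φ) ^ 2 < Real.sin (2 * Real.pi * φ) ^ 2)
  rw [squarePoint, supAbs, Complex.re_ofReal_mul, cis_re, cis_im, max_eq_right h3.le, ← div_eq_inv_mul,
    div_lt_one ((abs_nonneg _).trans_lt h3)]
  exact (le_abs_self _).trans_lt h3

/-- The map `squarePoint` on the side number `j` of the square, the image of the side `re = 1` under the
rotation by `I ^ j`. -/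
theorem squarePoint_eq {θ : ℝ} {j : ℤ} (h : |4 * θ - j| ≤ 1 / 2) :
    |Real.tan (2 * Real.pi * (θ - j / 4))| ≤ 1 ∧
    squarePoint θ = Complex.I ^ j * (1 + (Real.tan (2 * Real.pi * (θ - j / 4)) : ℝ) * Complex.I) := by
  obtain ⟨h1, h2⟩ := squarePoint_of_abs_le (φ := θ - j / 4) (by
    rw [abs_le] at h ⊢
    constructor <;> linarith)
  refine ⟨h1, ?_⟩
  rw [← h2, ← squarePoint_add, sub_add_cancel]

/-- Each edge of a polygon on the boundary of the square lies in one side. -/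
theorem exists_side {θ : ℝ → ℝ} (hθ : Continuous θ)
    (hz : ∀ u, brokenLine (fun k : ℤ => squarePoint (θ k)) u = squarePoint (θ u)) (k : ℤ) :
    ∃ j : ℤ, (∀ u ∈ Icc (k : ℝ) (k + 1), |4 * θ u - j| ≤ 1 / 2) ∧
      ((j : ℝ) - 1 / 2 < 4 * θ k ∨ (j : ℝ) - 1 / 2 < 4 * θ (k + 1)) := by
  set j := round (4 * θ (k + 1 / 2)) with hj
  have hsq : ∀ u ∈ Icc (k : ℝ) (k + 1), squarePoint (θ u) =
      squarePoint (θ k) + (u - k) • (squarePoint (θ (k + 1)) - squarePoint (θ k)) := fun u hu => by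
    rw [← hz, brokenLine_eq _ k hu]
    push_cast
    rfl
  have hs : ∀ u, (squarePoint (θ u - j / 4)).re ≤ 1 := fun u =>
    ((le_abs_self _).trans (le_max_left _ _)).trans (supAbs_squarePoint _).le
  have hI : ∀ u, squarePoint (θ u - j / 4) = Complex.I ^ (-j) * squarePoint (θ u) := fun u => by
    rw [← squarePoint_add]
    push_cast
    ring_nf
  have hlin : ∀ u ∈ Icc (k : ℝ) (k + 1), (squarePoint (θ u - j / 4)).re = (squarePoint (θ k - j / 4)).re +
      (u - k) * ((squarePoint (θ (k + 1) - j / 4)).re - (squarePoint (θ k - j / 4)).re) := fun u hu => by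
    rw [hI, hI, hI, hsq u hu, ← Complex.sub_re, ← Complex.re_ofReal_mul, ← Complex.add_re, Complex.real_smul]
    congr 1
    ring
  have hm : (k : ℝ) + 1 / 2 ∈ Icc (k : ℝ) (k + 1) := ⟨by linarith, by linarith⟩
  have hone : ∀ u ∈ Icc (k : ℝ) (k + 1), (squarePoint (θ u - j / 4)).re = 1 := fun u hu => by
    have h1 := hlin _ hm
    rw [(squarePoint_of_abs_le (φ := θ (k + 1 / 2) - j / 4) (by
      have := abs_le.1 (abs_sub_round (4 * θ (k + 1 / 2)))
      rw [abs_le]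
      constructor <;> linarith)).2] at h1
    rw [Complex.add_re, Complex.re_ofReal_mul, Complex.I_re, mul_zero, add_zero, Complex.one_re,
      add_sub_cancel_left] at h1
    rw [hlin u hu]
    have h2 := hs k
    have h3 := hs (k + 1)
    rw [show (squarePoint (θ k - j / 4)).re = 1 by linarith, show (squarePoint (θ (k + 1) - j / 4)).re = 1 by
      linarith]
    ring
  have hside : ∀ u ∈ Icc (k : ℝ) (k + 1), |4 * θ u - j| ≤ 1 / 2 := by
    intro u hu
    by_contra! h
    have h0 := abs_sub_round (4 * θ (k + 1 / 2))
    obtain ⟨v, hv, e⟩ := isPreconnected_Icc.intermediate_value hm hu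
      (f := fun u => |4 * θ u - j|) (by fun_prop)
      (⟨h0.trans (le_min h.le (by norm_num)), min_le_left _ _⟩ : min |4 * θ u - j| 1 ∈ Icc _ _)
    simp only at e
    have e2 : |θ v - j / 4| = |4 * θ v - j| / 4 := by
      rw [show θ v - j / 4 = (4 * θ v - j) / 4 by ring, abs_div]
      norm_num
    refine (re_squarePoint_lt (φ := θ v - j / 4) ?_ ?_).ne (hone v hv) <;> rw [e2, e]
    · linarith [lt_min h (by norm_num : (1 / 2 : ℝ) < 1)]
    · linarith [min_le_right |4 * θ u - j| 1]
  by_cases hst : (j : ℝ) - 1 / 2 < 4 * θ k ∨ (j : ℝ) - 1 / 2 < 4 * θ (k + 1)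
  · exact ⟨j, hside, hst⟩
  -- the edge is parallel to the axis, over a corner of the square
  push Not at hst
  have hk := (abs_le.1 (hside k ⟨le_rfl, by linarith⟩)).1
  have hk1 := (abs_le.1 (hside (k + 1) ⟨by linarith, le_rfl⟩)).1
  have he : θ (k + 1) = θ k := by linarith
  refine ⟨j - 1, fun u hu => ?_, .inl (by push_cast; linarith)⟩
  have h1 := hsq u hu
  rw [he, sub_self, smul_zero, add_zero, (squarePoint_eq (hside u hu)).2,
    (squarePoint_eq (hside k ⟨le_rfl, by linarith⟩)).2] at h1
  have h2 := congrArg Complex.im (mul_left_cancel₀ (zpow_ne_zero _ Complex.I_ne_zero) h1)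
  simp only [Complex.add_im, Complex.im_ofReal_mul, Complex.I_im, mul_one, add_right_inj] at h2
  have hpi := Real.pi_pos
  have hb : ∀ v ∈ Icc (k : ℝ) (k + 1), 2 * Real.pi * (θ v - j / 4) ∈ Ioo (-(Real.pi / 2)) (Real.pi / 2) := by
    intro v hv
    have := abs_le.1 (hside v hv)
    constructor <;> nlinarith
  have h3 := Real.injOn_tan (hb u hu) (hb k ⟨le_rfl, by linarith⟩) h2
  have h4 : θ u - j / 4 = θ k - j / 4 := mul_left_cancel₀ (by positivity) h3
  push_cast
  rw [abs_le]
  constructor <;> linarith [hst.1]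

/-- The point of the boundary of the square with lifted coordinate `s`, on the side `j`. -/
noncomputable def sidePoint (j : ℤ) (l p : ℝ) : ℂ :=
  Complex.I ^ j * (l + (p - 2 * j * l : ℝ) * Complex.I)

theorem sidePoint_eq {l p : ℝ} {j j' : ℤ} (hl : 0 < l) (h : |p - 2 * j * l| ≤ l) (h' : |p - 2 * j' * l| ≤ l) :
    sidePoint j l p = sidePoint j' l p := by
  have key : ∀ {j j' : ℤ}, |p - 2 * j * l| ≤ l → |p - 2 * j' * l| ≤ l → j < j' →
      sidePoint j l p = sidePoint j' l p := by
    intro j j' h h' hlt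
    rw [abs_le] at h h'
    have h1 : (j : ℝ) + 1 ≤ j' := by exact_mod_cast hlt
    obtain rfl : j' = j + 1 := by
      have : (j' : ℝ) < j + 2 := by nlinarith
      have : j' < j + 2 := by exact_mod_cast this
      omega
    push_cast at h'
    obtain rfl : p = (2 * j + 1) * l := by linarith
    rw [sidePoint, sidePoint, zpow_add_one₀ Complex.I_ne_zero]
    push_cast
    linear_combination (Complex.I ^ j * l) * Complex.I_mul_I
  rcases lt_trichotomy j j' with hj | rfl | hj
  exacts [key h h' hj, rfl, (key h' h hj).symm]

/-- The developing map of the punctured plane, which sends `sidePoint j l p` to `(l, p)`, is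
single-valued up to full turns. -/
theorem eq_of_sidePoint_eq {j j' : ℤ} {l l' p p' : ℝ} (hl : 0 < l) (hl' : 0 < l') (h : |p - 2 * j * l| ≤ l)
    (h' : |p' - 2 * j' * l'| ≤ l') (e : sidePoint j l p = sidePoint j' l' p') :
    l = l' ∧ ∃ m : ℤ, p - p' = 8 * m * l := by
  obtain ⟨t, r, hr, rfl⟩ : ∃ t r : ℤ, (r = 0 ∨ r = 1 ∨ r = 2 ∨ r = 3) ∧ j = j' + (4 * t + r) :=
    ⟨(j - j') / 4, (j - j') % 4, by omega, by omega⟩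
  rw [sidePoint, sidePoint, zpow_add₀ Complex.I_ne_zero, zpow_add₀ Complex.I_ne_zero, zpow_mul,
    show Complex.I ^ (4 : ℤ) = 1 from Complex.I_pow_four, one_zpow, one_mul, mul_assoc] at e
  have e := mul_left_cancel₀ (zpow_ne_zero _ Complex.I_ne_zero) e
  generalize hq : p - 2 * ((j' + (4 * t + r) : ℤ) : ℝ) * l = q at *
  generalize hq' : p' - 2 * (j' : ℝ) * l' = q' at *
  rw [abs_le] at h h'
  push_cast at hq
  have hre := congrArg Complex.re e
  have him := congrArg Complex.im e
  rcases hr with rfl | rfl | rfl | rfl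
  · simp at hre him
    subst hre
    exact ⟨rfl, t, by push_cast at hq; linear_combination hq - hq' + him⟩
  · simp at hre him
    obtain rfl : l = l' := by linarith
    exact ⟨rfl, t, by push_cast at hq; linear_combination hq - hq' - hre + him⟩
  · rw [show Complex.I ^ (2 : ℤ) = -1 from Complex.I_sq] at hre
    simp at hre
    linarith
  · rw [show Complex.I ^ (3 : ℤ) = -Complex.I from Complex.I_pow_three] at hre him
    simp at hre him
    obtain rfl : l = l' := by linarith
    exact ⟨rfl, t + 1, by push_cast at hq ⊢; linear_combination hq - hq' + hre + him⟩

theorem brokenLine_sub_int_mul {E : Type*} [AddCommGroup E] [Module ℝ E] {z : ℤ → E} {n : ℕ}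
    (hz : ∀ k, z (k + n) = z k) (u : ℝ) (m : ℤ) : brokenLine z (u - m * n) = brokenLine z u := by
  have h : Function.Periodic (brokenLine z) n := fun u => by
    simpa using brokenLine_add (G := z) (n := n) (e := 0) (by simpa using hz) u
  exact h.sub_int_mul_eq m

/-- A closed polygon is simple if its vertices rise and lie on one side of the closing edge. -/
theorem closed_polygon_simple {n : ℕ} (hn : 3 ≤ n) {z y : ℤ → ℝ} (hz : ∀ k, z (k + n) = z k)
    (hy : ∀ k, y (k + n) = y k) (hlt : ∀ k : ℤ, 0 ≤ k → k < n - 1 → z k < z (k + 1))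
    (hch : ∀ k : ℤ, 0 < k → k < n - 1 → (z (n - 1) - z 0) * (y k - y 0) < (z k - z 0) * (y (n - 1) - y 0))
    {u v : ℝ} (h1 : brokenLine z u = brokenLine z v) (h2 : brokenLine y u = brokenLine y v) :
    ∃ m : ℤ, u = v + m * n := by
  have hn0 : (0 : ℝ) < n := by exact_mod_cast (by omega : 0 < n)
  have hmono : ∀ i j : ℤ, 0 ≤ i → i ≤ j → j ≤ n - 1 → z i ≤ z j := fun i j hi hij => by
    induction j, hij using Int.leInduction with
    | base => exact fun _ => le_rfl
    | succ j hj ih => exact fun h => (ih (by omega)).trans (hlt j (by omega) (by omega)).le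
  have hz0 : z 0 < z (n - 1) := (hlt 0 le_rfl (by omega)).trans_le (hmono _ _ (by omega) (by omega) le_rfl)
  have hzn : z (n - 1 + 1) = z 0 := by rw [sub_add_cancel, ← hz 0, zero_add]
  have hyn : y (n - 1 + 1) = y 0 := by rw [sub_add_cancel, ← hy 0, zero_add]
  have key : ∀ u ∈ Ico (0 : ℝ) n, ∀ v ∈ Ico (0 : ℝ) n, brokenLine z u = brokenLine z v →
      brokenLine y u = brokenLine y v → ¬ u < v := by
    intro u hu v hv h1 h2 huv
    obtain ⟨k, hk⟩ := exists_floor u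
    obtain ⟨l, hl⟩ := exists_floor v
    have hk0 : 0 ≤ k := Int.lt_add_one_iff.1 (by exact_mod_cast hu.1.trans_lt hk.2)
    have hkl : k ≤ l := Int.lt_add_one_iff.1 (by exact_mod_cast (hk.1.trans_lt huv).trans hl.2)
    have hln : l < n := by exact_mod_cast hl.1.trans_lt hv.2
    rw [brokenLine_eq z k ⟨hk.1, hk.2.le⟩, brokenLine_eq z l ⟨hl.1, hl.2.le⟩, smul_eq_mul, smul_eq_mul] at h1
    rw [brokenLine_eq y k ⟨hk.1, hk.2.le⟩, brokenLine_eq y l ⟨hl.1, hl.2.le⟩, smul_eq_mul, smul_eq_mul] at h2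
    obtain ⟨hk1, hk2⟩ := hk
    obtain ⟨hl1, hl2⟩ := hl
    -- two of the rising edges lie over different values of `z`; the closing edge meets the others only at
    -- its end points, since all other vertices lie strictly on one side of it
    rcases (by omega : l < n - 1 ∨ l = n - 1) with h3 | rfl
    · have h4 := hlt k hk0 (by omega)
      have h5 := hlt l (by omega) h3
      rcases hkl.eq_or_lt with rfl | h
      · nlinarith
      · have h6 := hmono (k + 1) l (by omega) (by omega) h3.le
        nlinarith
    · rw [hzn] at h1
      rw [hyn] at h2
      rcases hkl.eq_or_lt with rfl | h
      · rw [hzn] at h1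
        nlinarith
      · have h3 : ∀ i : ℤ, 0 ≤ i → i ≤ n - 1 →
            (z (n - 1) - z 0) * (y i - y 0) ≤ (z i - z 0) * (y (n - 1) - y 0) := fun i h0 h1 => by
          rcases h0.eq_or_lt with rfl | h0
          · simp
          rcases h1.eq_or_lt with rfl | h1
          · rw [mul_comm]
          · exact (hch i h0 h1).le
        have h4 : (z (n - 1) - z 0) * (y k + (u - k) * (y (k + 1) - y k) - y 0) =
            (z k + (u - k) * (z (k + 1) - z k) - z 0) * (y (n - 1) - y 0) := by
          rw [h1, h2]
          ring
        have h5 := h3 (k + 1) (by omega) (by omega)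
        rcases hk0.eq_or_lt with rfl | hk0
        · have h6 := hch 1 one_pos (by omega)
          norm_num at h4 h1 hk1
          have hu0 : u = 0 := by
            by_contra hne
            have : 0 < u := lt_of_le_of_ne hu.1 (Ne.symm hne)
            nlinarith
          subst hu0
          push_cast at hl2
          nlinarith
        · have h6 := hch k hk0 h
          nlinarith
  obtain ⟨m, hm, -⟩ := existsUnique_sub_zsmul_mem_Ico hn0 u 0
  obtain ⟨m', hm', -⟩ := existsUnique_sub_zsmul_mem_Ico hn0 v 0
  simp only [zsmul_eq_mul, zero_add] at hm hm'
  have h3 : u - m * n = v - m' * n := by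
    rcases lt_trichotomy (u - m * n) (v - m' * n) with h | h | h
    · exact absurd h (key _ hm _ hm' (by rw [brokenLine_sub_int_mul hz, brokenLine_sub_int_mul hz, h1])
        (by rw [brokenLine_sub_int_mul hy, brokenLine_sub_int_mul hy, h2]))
    · exact h
    · exact absurd h (key _ hm' _ hm (by rw [brokenLine_sub_int_mul hz, brokenLine_sub_int_mul hz, h1])
        (by rw [brokenLine_sub_int_mul hy, brokenLine_sub_int_mul hy, h2]))
  exact ⟨m - m', by push_cast; linear_combination h3⟩

/-- The position of `squarePoint t` on the boundary of the square, as a length along the universal cover. -/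
noncomputable def develop (t : ℝ) : ℝ :=
  2 * round (4 * t) + Real.tan (2 * Real.pi * (t - round (4 * t) / 4))

theorem develop_eq {t : ℝ} {j : ℤ} (h : |4 * t - j| ≤ 1 / 2) :
    develop t = 2 * j + Real.tan (2 * Real.pi * (t - j / 4)) := by
  have h0 := abs_sub_round (4 * t)
  rw [develop]
  generalize round (4 * t) = r at *
  rw [abs_le] at h h0
  have h1 : r ≤ j + 1 := by exact_mod_cast (by linarith : (r : ℝ) ≤ j + 1)
  have h2 : j ≤ r + 1 := by exact_mod_cast (by linarith : (j : ℝ) ≤ r + 1)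
  rcases (by omega : r = j ∨ r = j + 1 ∨ j = r + 1) with rfl | rfl | rfl
  · rfl
  all_goals
    push_cast at *
  · obtain rfl : t = j / 4 + 1 / 8 := by linarith
    rw [show 2 * Real.pi * ((j : ℝ) / 4 + 1 / 8 - (j + 1) / 4) = -(Real.pi / 4) by ring,
      show 2 * Real.pi * ((j : ℝ) / 4 + 1 / 8 - j / 4) = Real.pi / 4 by ring, Real.tan_neg,
      Real.tan_pi_div_four]
    ring
  · obtain rfl : t = r / 4 + 1 / 8 := by linarith
    rw [show 2 * Real.pi * ((r : ℝ) / 4 + 1 / 8 - (r + 1) / 4) = -(Real.pi / 4) by ring,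
      show 2 * Real.pi * ((r : ℝ) / 4 + 1 / 8 - r / 4) = Real.pi / 4 by ring, Real.tan_neg,
      Real.tan_pi_div_four]
    ring

/-- On the side number `j`, `develop` is the coordinate of `sidePoint j 1`. -/
theorem develop_spec {t : ℝ} {j : ℤ} (h : |4 * t - j| ≤ 1 / 2) :
    |develop t - 2 * j| ≤ 1 ∧ squarePoint t = sidePoint j 1 (develop t) := by
  obtain ⟨h1, h2⟩ := squarePoint_eq h
  rw [sidePoint, develop_eq h, mul_one, add_sub_cancel_left]
  exact ⟨h1, by simpa using h2⟩

theorem lt_develop {t : ℝ} {j : ℤ} (h : |4 * t - j| ≤ 1 / 2) (h' : j - 1 / 2 < 4 * t) :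
    2 * j - 1 < develop t := by
  have hpi := Real.pi_pos
  rw [develop_eq h]
  rw [abs_le] at h
  have := Real.tan_lt_tan_of_lt_of_lt_pi_div_two (x := -(Real.pi / 4)) (y := 2 * Real.pi * (t - j / 4))
    (by linarith) (by nlinarith) (by nlinarith)
  rw [Real.tan_neg, Real.tan_pi_div_four] at this
  linarith

/-- A closed polygon on the boundary of the square lifts to the universal cover. -/
theorem exists_development {θ : ℝ → ℝ} (hθ : Continuous θ) {n : ℕ} (hn : 0 < n) (hθ1 : ∀ u, θ (u + n) = θ u)
    (hz : ∀ u, brokenLine (fun k : ℤ => squarePoint (θ k)) u = squarePoint (θ u)) :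
    ∃ (S : ℤ → ℝ) (J : ℤ → ℤ), (∀ k : ℤ, squarePoint (θ k) = sidePoint (J k) 1 (S k)) ∧
      (∀ k, |S k - 2 * J k| ≤ 1) ∧ (∀ k, |S (k + 1) - 2 * J k| ≤ 1) ∧ (∀ k, S (k + n) = S k) ∧
      (∀ k, 2 * J k - 1 < S k ∨ 2 * J k - 1 < S (k + 1)) ∧ ∀ k, 1 ≤ S k := by
  choose j hj hs using exists_side hθ hz
  obtain ⟨B, hB⟩ := exists_bound_of_periodic (a := fun k : ℤ => -θ k) (n := n) (by omega)
    fun k => by push_cast; rw [hθ1]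
  obtain ⟨q, hq⟩ := exists_int_gt (B + 1)
  have hsq : ∀ t, squarePoint (t + q) = squarePoint t := fun t => by
    have := squarePoint_add t (4 * q)
    rwa [zpow_mul, show Complex.I ^ (4 : ℤ) = 1 from Complex.I_pow_four, one_zpow, one_mul, Int.cast_mul,
      Int.cast_ofNat, mul_div_cancel_left₀ _ (by norm_num)] at this
  have hj' : ∀ k : ℤ, ∀ u ∈ Icc (k : ℝ) (k + 1), |4 * (θ u + q) - (j k + 4 * q : ℤ)| ≤ 1 / 2 :=
    fun k u hu => by
      have := hj k u hu
      push_cast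
      rwa [show 4 * (θ u + q) - (j k + 4 * q) = 4 * θ u - j k by ring]
  have h1 := fun k : ℤ => hj' k k ⟨le_rfl, by linarith⟩
  have h2 := fun k : ℤ => hj' k (k + 1 : ℤ) ⟨by push_cast; linarith, by push_cast; rfl⟩
  refine ⟨fun k => develop (θ k + q), fun k => j k + 4 * q, fun k => ?_, fun k => (develop_spec (h1 k)).1,
    fun k => (develop_spec (h2 k)).1, fun k => ?_, fun k => (hs k).imp (fun h => lt_develop (h1 k) ?_)
      fun h => lt_develop (h2 k) ?_, fun k => ?_⟩
  · rw [← (develop_spec (h1 k)).2, hsq]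
  · push_cast
    rw [hθ1]
  · push_cast
    linarith
  · push_cast
    linarith
  · have h3 := abs_le.1 (develop_spec (h1 k)).1
    have h4 := abs_le.1 (h1 k)
    linarith [hB k]

theorem norm_sidePoint_sub (j : ℤ) (s s' : ℝ) : ‖sidePoint j 1 s - sidePoint j 1 s'‖ = |s - s'| := by
  rw [sidePoint, sidePoint, ← mul_sub, norm_mul, norm_zpow, Complex.norm_I, one_zpow, one_mul,
    add_sub_add_left_eq_sub, ← sub_mul, norm_mul, Complex.norm_I, mul_one, ← Complex.ofReal_sub,
    Complex.norm_real, Real.norm_eq_abs, sub_sub_sub_cancel_right]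

theorem supAbs_sidePoint {j : ℤ} {l p : ℝ} (h : |p - 2 * j * l| ≤ l) : supAbs (sidePoint j l p) = l := by
  rw [sidePoint, supAbs_zpow_mul, supAbs]
  simp only [Complex.add_re, Complex.ofReal_re, Complex.re_ofReal_mul, Complex.I_re, mul_zero, add_zero,
    Complex.add_im, Complex.ofReal_im, Complex.im_ofReal_mul, Complex.I_im, mul_one, zero_add]
  rw [abs_of_nonneg ((abs_nonneg _).trans h), max_eq_left h]

theorem sidePoint_mul (j : ℤ) (l s : ℝ) : sidePoint j l (l * s) = l * sidePoint j 1 s := by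
  simp only [sidePoint]
  push_cast
  ring

theorem sidePoint_lerp (j : ℤ) (l l' p p' t : ℝ) : sidePoint j l p + t • (sidePoint j l' p' - sidePoint j l p) =
    sidePoint j (l + t * (l' - l)) (p + t * (p' - p)) := by
  simp only [sidePoint, Complex.real_smul]
  push_cast
  ring

/-- A broken line in the square is the broken line of its coordinates `(l, p)`, if consecutive vertices
lie over a common side of the square. -/
theorem brokenLine_sidePoint {l p : ℤ → ℝ} {J : ℤ → ℤ} (hl : ∀ k, 0 < l k)
    (h1 : ∀ k, |p k - 2 * J k * l k| ≤ l k) (h2 : ∀ k, |p (k + 1) - 2 * J k * l (k + 1)| ≤ l (k + 1)) (u : ℝ) :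
    ∃ j : ℤ, brokenLine (fun k => sidePoint (J k) (l k) (p k)) u = sidePoint j (brokenLine l u) (brokenLine p u) ∧
      |brokenLine p u - 2 * j * brokenLine l u| ≤ brokenLine l u := by
  obtain ⟨k, hk⟩ := exists_floor u
  have hu : u ∈ Icc (k : ℝ) (k + 1) := ⟨hk.1, hk.2.le⟩
  refine ⟨J k, ?_, ?_⟩
  · rw [brokenLine_eq _ k hu, brokenLine_eq _ k hu, brokenLine_eq _ k hu,
      sidePoint_eq (hl _) (h1 (k + 1)) (h2 k), sidePoint_lerp]
    rfl
  · rw [brokenLine_eq _ k hu, brokenLine_eq _ k hu]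
    have h3 := abs_le.1 (h1 k)
    have h4 := abs_le.1 (h2 k)
    have ht : 0 ≤ u - k := by linarith [hk.1]
    have ht1 : 0 ≤ 1 - (u - k) := by linarith [hk.2]
    simp only [smul_eq_mul]
    rw [abs_le]
    constructor <;> nlinarith [mul_le_mul_of_nonneg_left h3.1 ht1, mul_le_mul_of_nonneg_left h3.2 ht1,
      mul_le_mul_of_nonneg_left h4.1 ht, mul_le_mul_of_nonneg_left h4.2 ht]

set_option maxHeartbeats 400000 in
/-- The vertices of a closed polygon on the boundary of the square can be moved towards the centre so
that the polygon becomes simple. In the coordinates radius `l` and lifted position `p`, the height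
`l + ε * p` is made to increase slowly along one turn of the polygon, and the closing edge, which starts
at the vertex where the winding is largest, has all other vertices strictly on one side. -/
theorem exists_simple_polygon_of_max {n : ℕ} (hn : 3 ≤ n) {S : ℤ → ℝ} {J : ℤ → ℤ} (h1 : ∀ k, |S k - 2 * J k| ≤ 1)
    (h2 : ∀ k, |S (k + 1) - 2 * J k| ≤ 1) (hS : ∀ k, S (k + n) = S k)
    (h4 : ∀ k, 2 * J k - 1 < S k ∨ 2 * J k - 1 < S (k + 1)) (h5 : ∀ k, 1 ≤ S k) (hmax : ∀ k, S k ≤ S (-1))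
    {δ : ℝ} (hδ : 0 < δ) :
    ∃ Z : ℤ → ℂ, (∀ k, Z (k + n) = Z k) ∧ (∀ k, ‖Z k - sidePoint (J k) 1 (S k)‖ ≤ δ) ∧
      (∀ k, supAbs (Z k) ≤ 1) ∧ ∀ u v, brokenLine Z u = brokenLine Z v → ∃ m : ℤ, u = v + m * n := by
  set M := S (-1) with hM
  have hM1 : 1 ≤ M := h5 _
  have hn0 : (0 : ℝ) < n := by exact_mod_cast (by omega : 0 < n)
  -- the sides are bounded away from the maximum
  obtain ⟨ρ, hρ, hρδ, hρ2, hρJ⟩ : ∃ ρ > 0, ρ ≤ δ / 2 ∧ ρ ≤ 1 / 2 ∧ ∀ k, 2 * J k - 1 ≤ M - ρ := by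
    have h : 0 < M + 1 - 2 * ((⌈(M + 1) / 2⌉ : ℝ) - 1) := by linarith [Int.ceil_lt_add_one ((M + 1) / 2)]
    refine ⟨min (δ / 2) (min (1 / 2) (M + 1 - 2 * ((⌈(M + 1) / 2⌉ : ℝ) - 1))), by positivity, min_le_left _ _,
      (min_le_right _ _).trans (min_le_left _ _), fun k => ?_⟩
    have h6 : (J k : ℝ) < (M + 1) / 2 := by
      rcases h4 k with h | h
      · linarith [hmax k]
      · linarith [hmax (k + 1)]
    have h7 : (J k : ℝ) ≤ ⌈(M + 1) / 2⌉ - 1 := by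
      exact_mod_cast Int.le_sub_one_of_lt (Int.lt_ceil.2 h6)
    linarith [min_le_right (δ / 2) (min (1 / 2) (M + 1 - 2 * ((⌈(M + 1) / 2⌉ : ℝ) - 1))),
      min_le_right (1 / 2) (M + 1 - 2 * ((⌈(M + 1) / 2⌉ : ℝ) - 1))]
  -- the positions are lowered a little so that the vertex `n - 1` becomes the only maximum in its period
  let S' : ℤ → ℝ := fun k => if (n : ℤ) ∣ k + 1 then S k else min (S k) (M - ρ)
  have hS' : ∀ k, S' (k + n) = S' k := fun k => by
    simp only [S', hS, add_right_comm k _ 1, dvd_add_self_right]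
  have hle : ∀ k, S' k ≤ S k := fun k => by
    simp only [S']
    split_ifs
    exacts [le_rfl, min_le_left _ _]
  have hge : ∀ k, min (S k) (M - ρ) ≤ S' k := fun k => by
    simp only [S']
    split_ifs
    exacts [min_le_left _ _, le_rfl]
  have hhalf : ∀ k, 1 / 2 ≤ S' k := fun k =>
    (le_min (by linarith [h5 k]) (by linarith)).trans (hge k)
  have hdist : ∀ k, |S' k - S k| ≤ ρ := fun k => abs_le.2
    ⟨by linarith [hge k, le_min (by linarith : S k - ρ ≤ S k) (by linarith [hmax k] : S k - ρ ≤ M - ρ)],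
      by linarith [hle k]⟩
  have h1' : ∀ k, |S' k - 2 * J k| ≤ 1 := fun k => by
    have h := abs_le.1 (h1 k)
    exact abs_le.2 ⟨by linarith [hge k, le_min (by linarith : 2 * J k - 1 ≤ S k) (hρJ k)], by linarith [hle k]⟩
  have h2' : ∀ k, |S' (k + 1) - 2 * J k| ≤ 1 := fun k => by
    have h := abs_le.1 (h2 k)
    exact abs_le.2 ⟨by linarith [hge (k + 1), le_min (by linarith : 2 * J k - 1 ≤ S (k + 1)) (hρJ k)],
      by linarith [hle (k + 1)]⟩
  -- `ε` keeps the radii close to `1`, and `κ` keeps the heights after the first edge close to their maximum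
  obtain ⟨ε, hε, hεδ, hεM⟩ : ∃ ε > 0, ε * (1 + M) ≤ δ / 4 ∧ ε * (1 + M) ≤ 1 / 2 := by
    refine ⟨min (δ / 4) (1 / 2) / (1 + M), by positivity, ?_, ?_⟩ <;> rw [div_mul_cancel₀ _ (by positivity)]
    exacts [min_le_left _ _, min_le_right _ _]
  obtain ⟨κ, hκ, hκM⟩ : ∃ κ > 0, κ * M = ρ / 8 := ⟨ρ / 8 / M, by positivity, div_mul_cancel₀ _ (by positivity)⟩
  have hκ1 : κ ≤ 1 / 16 := by nlinarith
  -- `ζ` jumps from `0` almost to `1` on the first edge and then rises slowly to `1`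
  let ζ : ℤ → ℝ := fun k => if k % n = 0 then 0 else 1 - κ * ((n - 1 - (k % n : ℤ)) / n)
  have hfrac : ∀ k : ℤ, 0 ≤ ((n : ℝ) - 1 - (k % n : ℤ)) / n ∧ ((n : ℝ) - 1 - (k % n : ℤ)) / n ≤ 1 := fun k => by
    have h6 : ((k % n : ℤ) : ℝ) + 1 ≤ n := by exact_mod_cast Int.emod_lt_of_pos k (by omega)
    have h7 : (0 : ℝ) ≤ (k % n : ℤ) := by exact_mod_cast Int.emod_nonneg k (by omega)
    exact ⟨div_nonneg (by linarith) hn0.le, (div_le_one hn0).2 (by linarith)⟩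
  have hζ : ∀ k, 0 ≤ ζ k ∧ ζ k ≤ 1 := fun k => by
    simp only [ζ]
    split_ifs
    · simp
    · constructor <;> nlinarith [hfrac k]
  let Λ : ℤ → ℝ := fun k => 1 - ε * (1 - ζ k)
  have hΛ : ∀ k, 1 - ε ≤ Λ k ∧ Λ k ≤ 1 := fun k => by
    constructor <;> simp only [Λ] <;> nlinarith [hζ k]
  have hΛn : ∀ k, Λ (k + n) = Λ k := fun k => by simp only [Λ, ζ, Int.add_emod_right]
  have hd : ∀ k, 1 ≤ 1 + ε * S' k ∧ 1 + ε * S' k ≤ 1 + ε * M := fun k =>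
    ⟨by nlinarith [hhalf k], by nlinarith [hle k, hmax k]⟩
  have hε1 : ε ≤ 1 / 4 := by nlinarith
  -- the radius is chosen so that the height `l + ε * p` is `Λ`; then `(l, p) ↦ (Λ, p)` is linear and
  -- injective, and the polygon may be examined in the coordinates `(Λ, p)`
  let l : ℤ → ℝ := fun k => Λ k / (1 + ε * S' k)
  have hl : ∀ k, 1 / 2 ≤ l k ∧ 1 - ε * (1 + M) ≤ l k ∧ l k ≤ 1 := fun k => by
    obtain ⟨h6, h7⟩ := hd k
    obtain ⟨h8, h9⟩ := hΛ k
    have h10 : 0 < 1 + ε * S' k := by linarith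
    simp only [l]
    rw [le_div_iff₀ h10, le_div_iff₀ h10, div_le_iff₀ h10]
    refine ⟨by nlinarith, by nlinarith, by linarith⟩
  have hl0 : ∀ k, 0 < l k := fun k => by linarith [hl k]
  have hlΛ : ∀ k, l k + ε * (l k * S' k) = Λ k := fun k => by
    rw [show l k + ε * (l k * S' k) = l k * (1 + ε * S' k) by ring]
    exact div_mul_cancel₀ _ (by linarith [hd k])
  have hs : ∀ {s : ℝ} {j : ℤ} (k), |s - 2 * j| ≤ 1 → |l k * s - 2 * j * l k| ≤ l k := fun {s j} k h => by
    rw [show l k * s - 2 * j * l k = l k * (s - 2 * j) by ring, abs_mul, abs_of_pos (hl0 k)]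
    exact mul_le_of_le_one_right (hl0 k).le h
  have hp1 := fun k => hs k (h1' k)
  have hp2 := fun k => hs (k + 1) (h2' k)
  let p : ℤ → ℝ := fun k => l k * S' k
  have hln : ∀ k, l (k + n) = l k := fun k => by simp only [l, hΛn, hS']
  have hpn : ∀ k, p (k + n) = p k := fun k => by simp only [p, hln, hS']
  have hbl : ∀ u, brokenLine l u + ε * brokenLine p u = brokenLine Λ u := fun u => by
    obtain ⟨k, hk⟩ := exists_floor u
    have hu : u ∈ Icc (k : ℝ) (k + 1) := ⟨hk.1, hk.2.le⟩
    rw [brokenLine_eq _ k hu, brokenLine_eq _ k hu, brokenLine_eq _ k hu, ← hlΛ, ← hlΛ]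
    simp only [smul_eq_mul, p]
    ring
  have hmem : ∀ {a b : ℝ} {y : ℤ → ℝ}, (∀ k, y k ∈ Icc a b) → ∀ u, brokenLine y u ∈ Icc a b :=
    fun {a b y} hy u => (convex_Icc a b).lineMap_mem (hy _) (hy _) ⟨Int.fract_nonneg u, (Int.fract_lt_one u).le⟩
  refine ⟨fun k => sidePoint (J k) (l k) (p k), fun k => ?_, fun k => ?_, fun k => ?_, fun u v h => ?_⟩
  · have h6 := hp1 (k + n)
    rw [hln, hS'] at h6
    simp only [hln, hpn]
    exact sidePoint_eq (hl0 k) h6 (hp1 k)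
  · simp only [p]
    rw [sidePoint_mul, show (l k : ℂ) * sidePoint (J k) 1 (S' k) - sidePoint (J k) 1 (S k) =
      (sidePoint (J k) 1 (S' k) - sidePoint (J k) 1 (S k)) - ((1 - l k : ℝ) : ℂ) * sidePoint (J k) 1 (S' k) by
        push_cast; ring]
    refine (norm_sub_le _ _).trans ?_
    have h6 := norm_le_supAbs (sidePoint (J k) 1 (S' k))
    rw [supAbs_sidePoint (by simpa using h1' k)] at h6
    rw [norm_sidePoint_sub, norm_mul, Complex.norm_real, Real.norm_of_nonneg (by linarith [hl k])]
    nlinarith [hdist k, hl k]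
  · rw [supAbs_sidePoint (hp1 k)]
    exact (hl k).2.2
  obtain ⟨j, hj, hjl⟩ := brokenLine_sidePoint hl0 hp1 hp2 u
  obtain ⟨j', hj', hjl'⟩ := brokenLine_sidePoint hl0 hp1 hp2 v
  have hpos := fun u => (hmem (fun k => ⟨(hl k).1, (hl k).2.2⟩) u).1
  obtain ⟨e1, m, e2⟩ := eq_of_sidePoint_eq (by linarith [hpos u]) (by linarith [hpos v]) hjl hjl'
    (hj.symm.trans (h.trans hj'))
  -- the two points have the same lift, because the radii change by less than one turn would require
  have hm : m = 0 := by
    have h6 := hmem hΛ u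
    have h7 := hmem hΛ v
    rw [← hbl, ← e1] at h7
    rw [← hbl] at h6
    have h8 := hpos u
    have h9 : |8 * (m : ℝ) * brokenLine l u| ≤ 1 := by
      rw [← e2, abs_le]
      constructor <;> refine le_of_mul_le_mul_left ?_ hε <;> linarith [h6.1, h6.2, h7.1, h7.2]
    rw [abs_mul, abs_mul, abs_of_pos (by linarith : 0 < brokenLine l u), abs_of_pos (by norm_num)] at h9
    have h10 : |(m : ℝ)| < 1 := by nlinarith [abs_nonneg (m : ℝ)]
    exact Int.abs_lt_one_iff.1 (by exact_mod_cast h10)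
  have e3 : brokenLine p u = brokenLine p v := by
    rw [hm] at e2
    linarith [show (8 * ((0 : ℤ) : ℝ) * brokenLine l u) = 0 by simp]
  have hmod : ∀ k : ℤ, 0 ≤ k → k < n → k % n = k := fun k => Int.emod_eq_of_lt
  have hz0 : Λ 0 = 1 - ε := by simp [Λ, ζ]
  have hz1 : ∀ k : ℤ, 0 < k → k < n → Λ k = 1 - ε * (κ * ((n - 1 - k) / n)) := fun k h0 h => by
    simp only [Λ, ζ, hmod k h0.le h, h0.ne', if_false]
    ring
  have hzl : Λ (n - 1) = 1 := by
    rw [hz1 _ (by omega) (by omega)]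
    simp
  have hSl : S' (n - 1) = M := by
    simp only [S', sub_add_cancel, dvd_refl, if_true]
    rw [sub_eq_neg_add, hS]
  refine closed_polygon_simple hn hΛn hpn (fun k h0 h => ?_) (fun k h0 h => ?_)
    (by rw [← hbl, ← hbl, e1, e3]) e3
  · rw [hz1 (k + 1) (by omega) (by omega)]
    have h6 := hfrac (k + 1)
    rw [hmod (k + 1) (by omega) (by omega)] at h6
    rcases h0.eq_or_lt with rfl | h0
    · rw [hz0]
      have := mul_le_of_le_one_right hκ.le h6.2
      nlinarith
    · rw [hz1 k h0 (by omega)]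
      have : ((n : ℝ) - 1 - (k + 1 : ℤ)) / n < (n - 1 - k) / n := by
        push_cast
        gcongr
        linarith
      nlinarith [mul_pos hε hκ]
  · have h6 := hfrac k
    rw [hmod k h0.le (by omega)] at h6
    rw [hzl, hz0, hz1 k h0 (by omega)]
    have hS'k : S' k ≤ M - ρ := by
      simp only [S']
      rw [if_neg fun h => by have := Int.le_of_dvd (by omega) h; omega]
      exact min_le_right _ _
    have hpk : p k < (1 - κ) * p (n - 1) := by
      have h7 : p k ≤ S' k / (1 + ε * S' k) := by
        simp only [p, l]
        rw [div_mul_eq_mul_div]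
        have := hhalf k
        have := (hd k).1
        gcongr
        nlinarith [hΛ k]
      have h8 : p (n - 1) = M / (1 + ε * M) := by
        simp only [p, l]
        rw [hzl, hSl, div_mul_eq_mul_div, one_mul]
      rw [h8]
      refine h7.trans_lt ?_
      rw [← mul_div_assoc, div_lt_div_iff₀ (by linarith [hd k]) (by positivity)]
      have h9 : κ * M * (1 + ε * S' k) ≤ ρ / 8 * (3 / 2) := by
        rw [hκM]
        gcongr
        linarith [(hd k).2]
      linarith
    have hp0 : 0 ≤ p 0 := mul_nonneg (hl0 0).le (by linarith [hhalf 0])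
    have hpl : 0 ≤ p (n - 1) := mul_nonneg (hl0 _).le (by linarith [hhalf (n - 1)])
    have h9 : p k - p 0 < (1 - κ * ((n - 1 - k) / n)) * (p (n - 1) - p 0) := by
      linarith [mul_le_mul_of_nonneg_right (mul_le_of_le_one_right hκ.le h6.2) hpl,
        mul_nonneg (mul_nonneg hκ.le h6.1) hp0]
    linarith [mul_lt_mul_of_pos_left h9 hε]

/-- The cross-section of a polygon that lies over the boundary of the square becomes a simple polygon
after an arbitrarily small displacement of its vertices into the square. -/
theorem exists_simple_cross_section {θ : ℝ → ℝ} (hθ : Continuous θ) {n : ℕ} (hn : 3 ≤ n)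
    (hθ1 : ∀ u, θ (u + n) = θ u)
    (hz : ∀ u, brokenLine (fun k : ℤ => squarePoint (θ k)) u = squarePoint (θ u)) {δ : ℝ} (hδ : 0 < δ) :
    ∃ Z : ℤ → ℂ, (∀ k, Z (k + n) = Z k) ∧ (∀ k, ‖Z k - squarePoint (θ k)‖ ≤ δ) ∧
      (∀ k, supAbs (Z k) ≤ 1) ∧ ∀ u v, brokenLine Z u = brokenLine Z v → ∃ m : ℤ, u = v + m * n := by
  obtain ⟨S, J, h0, h1, h2, h3, h4, h5⟩ := exists_development hθ (by omega) hθ1 hz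
  obtain ⟨i, -, hi⟩ := (Finset.Ico (0 : ℤ) n).exists_max_image S ⟨0, by simp; omega⟩
  have hmax : ∀ k, S k ≤ S i := fun k => by
    obtain ⟨k', hk', e⟩ := Function.Periodic.exists_mem_Ico₀ (f := S) (c := (n : ℤ)) h3 (by omega) k
    exact e ▸ hi k' (by simpa using hk')
  obtain ⟨Z, hZn, hZ, hZ1, hZinj⟩ := exists_simple_polygon_of_max hn (S := fun k => S (k + (i + 1)))
    (J := fun k => J (k + (i + 1))) (fun k => h1 _) (fun k => by simpa only [add_right_comm] using h2 (k + (i + 1)))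
    (fun k => by simpa only [add_right_comm] using h3 (k + (i + 1)))
    (fun k => by simpa only [add_right_comm] using h4 (k + (i + 1))) (fun k => h5 _)
    (fun k => by simpa using hmax _) hδ
  have hb : ∀ u, brokenLine (fun k => Z (k - (i + 1))) u = brokenLine Z (u - (i + 1 : ℤ)) := fun u => by
    simp only [brokenLine, Int.floor_sub_intCast, Int.fract_sub_intCast, sub_add_eq_add_sub]
  refine ⟨fun k => Z (k - (i + 1)), fun k => ?_, fun k => ?_, fun k => hZ1 _, fun u v h => ?_⟩
  · simp only [add_sub_right_comm, hZn]
  · rw [h0]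
    simpa only [sub_add_cancel] using hZ (k - (i + 1))
  · rw [hb, hb] at h
    obtain ⟨m, hm⟩ := hZinj _ _ h
    exact ⟨m, by linear_combination hm⟩

/-! ### The colored Jones polynomials of the unknot -/

/-- The `k`-fold cable of the trivial diagram has no crossings and consists of `k` parallel circles. -/
theorem Diagram.loops_trivial {k : ℕ} (s : Diagram.trivial.CableCrossing k → Bool) :
    Diagram.trivial.loops s = k := by
  have hinv : ∀ x y, Diagram.trivial.Joined s x y → x.2.1 = y.2.1 := by
    intro x y h
    cases h with
    | next p j => rfl
    | base j r => rfl
    | oriented y => exact y.1.elim0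
    | oriented' y => exact y.1.elim0
    | unoriented y => exact y.1.elim0
    | unoriented' y => exact y.1.elim0
  let φ : Quot (Diagram.trivial.Joined s) → Fin k := Quot.lift (fun x => x.2.1) hinv
  have hφ : Function.Bijective φ := by
    constructor
    · intro x y
      have key : ∀ z : Diagram.trivial.Node k, Quot.mk (Diagram.trivial.Joined s) z =
          Quot.mk _ (Fin.last _, z.2.1, 0) := by
        rintro ⟨p, j, r⟩
        have hp : p = Fin.last (2 * Diagram.trivial.c) := by
          apply Fin.ext
          have h1 : (Diagram.trivial).c = 0 := rfl
          have := p.2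
          simp only [Fin.val_last]
          omega
        subst hp
        exact (Quot.sound (Diagram.Joined.base j r)).symm
      induction x using Quot.inductionOn with
      | _ x =>
        induction y using Quot.inductionOn with
        | _ y =>
          intro h
          have h' : x.2.1 = y.2.1 := h
          rw [key x, key y, h']
    · intro j
      exact ⟨Quot.mk _ (Fin.last _, j, 0), rfl⟩
  rw [Diagram.loops, Nat.card_eq_of_bijective φ hφ]
  simp

open LaurentPolynomial in
theorem Diagram.bracket_trivial (k : ℕ) :
    Diagram.trivial.bracket k = (-T 2 - T (-2)) ^ k := by
  have : IsEmpty (Diagram.trivial.CableCrossing k) := ⟨fun y => y.1.elim0⟩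
  rw [Diagram.bracket, Fintype.sum_unique, Diagram.loops_trivial]
  simp

open LaurentPolynomial in
theorem coeff_T_mul' (m k : ℤ) (p : LaurentPolynomial ℤ) :
    (T m * p).coeff k = p.coeff (k - m) := by
  have := AddMonoidAlgebra.coeff_single_mul_add p (1 : ℤ) m (k - m)
  rw [add_sub_cancel, one_mul] at this
  exact this

open LaurentPolynomial in
/-- The value of the Chebyshev polynomial `S m` at `-T 2 - T (-2)` has extreme terms of degrees
`2 * m` and `-2 * m`, with coefficients `1` or `-1`. -/
theorem coeff_eval₂_chebyshev (m : ℕ) :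
    let p := (Polynomial.Chebyshev.S ℤ m).eval₂ C (-T 2 - T (-2) : LaurentPolynomial ℤ)
    (∀ k : ℤ, 2 * m < |k| → p.coeff k = 0) ∧ p.coeff (2 * m) = (-1) ^ m ∧
      p.coeff (-(2 * m)) = (-1) ^ m := by
  induction m using Nat.strong_induction_on with
  | _ m ih =>
  match m with
  | 0 =>
    simp only [Nat.cast_zero, Polynomial.Chebyshev.S_zero, Polynomial.eval₂_one, mul_zero, pow_zero]
    rw [← T_zero]
    refine ⟨fun k hk => ?_, by simp [-T_zero], by simp [-T_zero]⟩
    rw [T_apply, if_neg]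
    rintro rfl
    simp at hk
  | 1 =>
    simp only [Nat.cast_one, Polynomial.Chebyshev.S_one, Polynomial.eval₂_X]
    refine ⟨fun k hk => ?_, ?_, ?_⟩
    · have h1 : (2 : ℤ) ≠ k := by
        rintro rfl
        norm_num at hk
      have h2 : (-2 : ℤ) ≠ k := by
        rintro rfl
        norm_num at hk
      simp [h1, h2]
    · simp
    · simp
  | m + 2 =>
    obtain ⟨h1, h2, h3⟩ := ih (m + 1) (by omega)
    obtain ⟨g1, -, -⟩ := ih m (by omega)
    have e : (Polynomial.Chebyshev.S ℤ ((m + 2 : ℕ) : ℤ)).eval₂ C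
        (-T 2 - T (-2) : LaurentPolynomial ℤ) =
        -(T 2 * (Polynomial.Chebyshev.S ℤ ((m + 1 : ℕ) : ℤ)).eval₂ C (-T 2 - T (-2)))
        - T (-2) * (Polynomial.Chebyshev.S ℤ ((m + 1 : ℕ) : ℤ)).eval₂ C (-T 2 - T (-2))
        - (Polynomial.Chebyshev.S ℤ ((m : ℕ) : ℤ)).eval₂ C (-T 2 - T (-2)) := by
      push_cast
      rw [Polynomial.Chebyshev.S_add_two, Polynomial.eval₂_sub, Polynomial.eval₂_mul,
        Polynomial.eval₂_X]
      ring
    simp only [e]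
    push_cast at h1 h2 h3 ⊢
    simp only [AddMonoidAlgebra.coeff_sub, AddMonoidAlgebra.coeff_neg, Finsupp.sub_apply, Finsupp.neg_apply,
      coeff_T_mul']
    refine ⟨fun k hk => ?_, ?_, ?_⟩
    · rw [h1, h1, g1]
      · ring
      · rcases lt_abs.1 hk with h | h <;> apply lt_abs.2 <;> [left; right] <;> linarith
      · rcases lt_abs.1 hk with h | h <;> apply lt_abs.2 <;> [left; right] <;> linarith
      · rcases lt_abs.1 hk with h | h <;> apply lt_abs.2 <;> [left; right] <;> linarith
    · rw [h1 (2 * (m + 2) - -2), g1 (2 * (m + 2))]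
      · have : (2 * ((m : ℤ) + 2) - 2) = 2 * (m + 1) := by ring
        rw [this, h2]
        ring
      · apply lt_abs.2; left; linarith
      · apply lt_abs.2; left; linarith
    · rw [h1 (-(2 * (m + 2)) - 2), g1 (-(2 * (m + 2)))]
      · have : (-(2 * ((m : ℤ) + 2)) - -2) = -(2 * (m + 1)) := by ring
        rw [this, h3]
        ring
      · apply lt_abs.2; right; linarith
      · apply lt_abs.2; right; linarith

open LaurentPolynomial in
theorem Diagram.coeff_coloredJones_trivial (m : ℕ) :
    (∀ k : ℤ, 2 * m < |k| → (Diagram.trivial.coloredJones (m + 1)).coeff k = 0) ∧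
      (Diagram.trivial.coloredJones (m + 1)).coeff (2 * m) ≠ 0 ∧
      (Diagram.trivial.coloredJones (m + 1)).coeff (-(2 * m)) ≠ 0 := by
  have hw : Diagram.trivial.writhe = 0 := Fintype.sum_empty (ι := Fin 0) _
  have e : ((m + 1 : ℕ) : ℤ) - 1 = m := by push_cast; ring
  obtain ⟨h1, h2, h3⟩ := coeff_eval₂_chebyshev m
  have hJ : ∀ k, (Diagram.trivial.coloredJones (m + 1)).coeff k =
      ((m : ℤ).negOnePow : ℤ) *
        ((Polynomial.Chebyshev.S ℤ m).eval₂ C (-T 2 - T (-2) : LaurentPolynomial ℤ)).coeff k := by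
    intro k
    have : Diagram.trivial.coloredJones (m + 1) = ((m : ℤ).negOnePow : ℤ) •
        (Polynomial.Chebyshev.S ℤ m).eval₂ C (-T 2 - T (-2) : LaurentPolynomial ℤ) := by
      rw [Diagram.coloredJones, hw, e, smul_eq_C_mul, Polynomial.eval₂_eq_sum]
      simp [Diagram.bracket_trivial]
    rw [this, AddMonoidAlgebra.coeff_smul, Finsupp.smul_apply, smul_eq_mul]
  refine ⟨fun k hk => by rw [hJ, h1 k hk, mul_zero], ?_, ?_⟩
  · rw [hJ, h2]
    exact mul_ne_zero (Units.ne_zero _) (pow_ne_zero _ (by norm_num))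
  · rw [hJ, h3]
    exact mul_ne_zero (Units.ne_zero _) (pow_ne_zero _ (by norm_num))

theorem Diagram.dPlus_trivial {n : ℕ} (hn : 1 ≤ n) : Diagram.trivial.dPlus n = ((n : ℚ) - 1) / 2 := by
  obtain ⟨m, rfl⟩ : ∃ m, n = m + 1 := ⟨n - 1, by omega⟩
  obtain ⟨h1, h2, -⟩ := Diagram.coeff_coloredJones_trivial m
  have : (Diagram.trivial.coloredJones (m + 1)).degree = ((2 * m : ℤ) : WithBot ℤ) := by
    refine le_antisymm (Finset.max_le fun k hk => ?_) (Finset.le_max (Finsupp.mem_support_iff.2 h2))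
    rw [Finsupp.mem_support_iff] at hk
    rw [WithBot.coe_le_coe]
    by_contra! h
    exact hk (h1 k (lt_abs.2 (Or.inl h)))
  rw [Diagram.dPlus, this, WithBot.unbotD_coe]
  push_cast
  ring

theorem Diagram.dMinus_trivial {n : ℕ} (hn : 1 ≤ n) :
    Diagram.trivial.dMinus n = -(((n : ℚ) - 1) / 2) := by
  obtain ⟨m, rfl⟩ : ∃ m, n = m + 1 := ⟨n - 1, by omega⟩
  obtain ⟨h1, -, h2⟩ := Diagram.coeff_coloredJones_trivial m
  have : (Diagram.trivial.coloredJones (m + 1)).coeff.support.min = ((-(2 * m) : ℤ) : WithTop ℤ) := by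
    refine le_antisymm (Finset.min_le (Finsupp.mem_support_iff.2 h2)) (Finset.le_min fun k hk => ?_)
    rw [Finsupp.mem_support_iff] at hk
    rw [WithTop.coe_le_coe]
    by_contra! h
    exact hk (h1 k (lt_abs.2 (Or.inr (by linarith))))
  rw [Diagram.dMinus, this, WithTop.untopD_coe]
  push_cast
  ring

/-! ### The surface provided by the strong slope conjecture -/

theorem eq_of_mapClusterPt_of_tendsto {u : ℕ → ℝ} {x y : ℝ} (h : MapClusterPt x atTop u)
    (hu : Tendsto u atTop (𝓝 y)) : x = y := by
  have h1 : ClusterPt x (𝓝 y) := ClusterPt.mono h hu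
  have h2 : (𝓝 x ⊓ 𝓝 y).NeBot := h1
  exact eq_of_nhds_neBot h2

/-- A linear degree function has the slope `0`. -/
theorem zero_mem_slopeSet {d : ℕ → ℚ} {ε : ℚ} (hd : ∀ n, 1 ≤ n → d n = ε * (((n : ℚ) - 1) / 2)) :
    (0 : ℝ) ∈ slopeSet d := by
  refine Tendsto.mapClusterPt ?_
  have h1 : Tendsto (fun n : ℕ => 2 * (ε : ℝ) * ((n : ℝ)⁻¹ - (n : ℝ)⁻¹ * (n : ℝ)⁻¹)) atTop
      (𝓝 (2 * (ε : ℝ) * (0 - 0 * 0))) := by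
    have := tendsto_inv_atTop_nhds_zero_nat (𝕜 := ℝ)
    exact (this.sub (this.mul this)).const_mul _
  simp only [mul_zero, sub_zero] at h1
  refine h1.congr' ?_
  filter_upwards [eventually_ge_atTop 1] with n hn
  rw [hd n hn]
  push_cast
  have : (n : ℝ) ≠ 0 := by positivity
  field_simp
  ring

/-- However a linear degree function is written as a quadratic quasi-polynomial, its second difference
along the period shows that the quadratic coefficient vanishes, and its first difference then determines
the linear one. -/
theorem eq_of_mem_linearSet {d : ℕ → ℚ} {ε : ℚ} (hd : ∀ n, 1 ≤ n → d n = ε * (((n : ℚ) - 1) / 2))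
    {x : ℝ} (hx : x ∈ linearSet d) : x = ε := by
  obtain ⟨a, b, c, ⟨⟨p, hp, ha, hb, hc⟩, N, hN⟩, hcl⟩ := hx
  refine eq_of_mapClusterPt_of_tendsto hcl (tendsto_const_nhds.congr' ?_)
  filter_upwards [eventually_gt_atTop N] with n hn
  have hp' : (p : ℚ) ≠ 0 := by positivity
  have hb1 : b n = ε / 2 := by
    have e0 := hN n hn
    have e1 := hN (n + p) (by omega)
    have e2 := hN (n + p + p) (by omega)
    rw [ha (n + p), hb (n + p), hc (n + p)] at e2
    rw [ha n, hb n, hc n] at e1 e2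
    rw [hd _ (by omega)] at e0 e1 e2
    push_cast at e0 e1 e2
    have h1 : a n * (p : ℚ) ^ 2 = 0 := by linear_combination -(e2 - 2 * e1 + e0) / 2
    have h2 : a n = 0 := by
      rcases mul_eq_zero.1 h1 with h | h
      · exact h
      · exact absurd (pow_eq_zero_iff (two_ne_zero)|>.1 h) hp'
    rw [h2] at e0 e1
    have h3 : (b n - ε / 2) * p = 0 := by linear_combination -(e1 - e0)
    rcases mul_eq_zero.1 h3 with h | h
    · linarith
    · exact absurd h hp'
  rw [hb1]
  have : (n : ℝ) ≠ 0 := by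
    have : 0 < n := by omega
    positivity
  push_cast
  field_simp

/-- The strong slope conjecture provides a surface with boundary slope `0` whose Euler
characteristic is the number of its boundary components. -/
theorem exists_surface_of_degree {K : PolygonalKnot} {N : TubularNeighborhood K} {D : Diagram}
    (hK : SatisfiesStrongSlopeConjecture N D)
    (h : (∀ n : ℕ, 1 ≤ n → D.dPlus n = Diagram.trivial.dPlus n) ∨
      (∀ n : ℕ, 1 ≤ n → D.dMinus n = Diagram.trivial.dMinus n)) :
    ∃ S : ProperSurface N, S.IsEssential ∧ S.HasBoundarySlope 0 ∧ 0 < S.chi := by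
  have key : ∀ S : ProperSurface N, (S.chi : ℚ) / (S.numBdry * (0 : ℚ).den) = 1 → 0 < S.chi := by
    intro S hS
    have h1 : ((S.numBdry : ℚ) * (0 : ℚ).den) ≠ 0 := by
      intro h0
      rw [h0, div_zero] at hS
      exact zero_ne_one hS
    rw [div_eq_one_iff_eq h1] at hS
    have h2 : 0 < ((S.numBdry : ℚ) * (0 : ℚ).den) := lt_of_le_of_ne (by positivity) (Ne.symm h1)
    rw [← hS] at h2
    exact_mod_cast h2
  rcases h with h | h
  · have hd : ∀ n, 1 ≤ n → D.dPlus n = 1 * (((n : ℚ) - 1) / 2) := by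
      intro n hn
      rw [h n hn, Diagram.dPlus_trivial hn, one_mul]
    obtain ⟨S, h1, h2, h3⟩ := hK.1 0 (by simpa using zero_mem_slopeSet hd)
    refine ⟨S, h1, h2, key S ?_⟩
    exact_mod_cast eq_of_mem_linearSet hd h3
  · have hd : ∀ n, 1 ≤ n → D.dMinus n = (-1) * (((n : ℚ) - 1) / 2) := by
      intro n hn
      rw [h n hn, Diagram.dMinus_trivial hn, neg_one_mul]
    obtain ⟨S, h1, h2, h3⟩ := hK.2 0 (by simpa using zero_mem_slopeSet hd)
    refine ⟨S, h1, h2, key S ?_⟩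
    have := eq_of_mem_linearSet hd h3
    have h4 : -((S.chi : ℚ) / (S.numBdry * (0 : ℚ).den)) = -1 := by exact_mod_cast this
    linarith

/-! ### Contraction of a longitudinal polygon to the core -/

/-- Dividing each edge into `M` equal parts changes a broken line only by the factor `M` in the
parameter. -/
theorem brokenLine_refine (G : ℤ → E3) {M : ℕ} (hM : 0 < M) (u : ℝ) :
    brokenLine (fun i => brokenLine G (i / M)) u = brokenLine G (u / M) := by
  obtain ⟨k, hk, hk'⟩ := exists_floor u
  have hM' : (0 : ℝ) < M := by exact_mod_cast hM
  have h1 : (M : ℝ) * (k / M : ℤ) ≤ k := by exact_mod_cast Int.mul_ediv_self_le (by omega)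
  have h2 : (k : ℝ) + 1 ≤ M * ((k / M : ℤ) + 1) := by
    have := Int.lt_mul_ediv_self_add (x := k) (by omega : 0 < (M : ℤ))
    exact_mod_cast (by linarith : k + 1 ≤ M * (k / M + 1))
  have key : ∀ v : ℝ, k ≤ v → v ≤ k + 1 → brokenLine G (v / M) =
      G (k / M) + (v / M - (k / M : ℤ)) • (G (k / M + 1) - G (k / M)) := fun v hv hv' =>
    brokenLine_eq G _ ⟨by rw [le_div_iff₀ hM']; linarith, by rw [div_le_iff₀ hM']; linarith⟩
  rw [brokenLine_eq _ k ⟨hk, hk'.le⟩, key u hk hk'.le, key k le_rfl (by linarith)]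
  push_cast
  rw [key (k + 1) (by linarith) le_rfl]
  module

theorem brokenLine_cvec (x : ℤ → ℝ) (z : ℤ → ℂ) (u : ℝ) :
    brokenLine (fun k => cvec (x k) (z k)) u = cvec (brokenLine x u) (brokenLine z u) := by
  simp only [brokenLine, AffineMap.lineMap_apply, vsub_eq_sub, vadd_eq_add, cvec_sub, smul_cvec, cvec_add]
  rfl

theorem cvec_mem_tube {x : ℝ} {z : ℂ} : cvec x z ∈ tube ↔ supAbs z ≤ 1 := max_le_iff.symm

variable {K : PolygonalKnot} {N : TubularNeighborhood K} {P : Set (Finset E3 × (E3 →ᵃ[ℝ] E3))}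

/-- A polygon on the boundary torus that runs once along the longitude is isotopic to the core: a small
displacement of its vertices makes its cross-section simple; then straightening the longitudinal
coordinate and contracting the cross-section both keep it embedded. -/
theorem TubularNeighborhood.IsPieceSet.ambientIsotopic_core (hP : N.IsPieceSet P) {n : ℕ} (hn : 0 < n)
    {G : ℤ → E3} (hG : ∀ k, G (k + n) = G k + e0) (hinj : Function.Injective (brokenLine G)) {θ : ℝ → ℝ}
    (hθ : Continuous θ) (hθ1 : ∀ u, θ (u + n) = θ u)
    (hb : ∀ u, ∃ x, brokenLine G u = cvec x (squarePoint (θ u))) :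
    AmbientIsotopic (toS3 '' (N.f '' range (brokenLine G))) K.inS3 := by
  -- subdivision of the edges gives at least three vertices in each period
  wlog hn3 : 3 ≤ n generalizing n G θ
  · have hr := brokenLine_refine G (M := 3) (by norm_num)
    have h := this (n := 3 * n) (G := fun i => brokenLine G (i / (3 : ℕ))) (θ := fun u => θ (u / (3 : ℕ))) (by omega)
      (fun k => by
        have := brokenLine_add (n := n) hG (k / 3)
        push_cast at this ⊢
        rw [← this]
        ring_nf) (fun u v h => by
          rw [hr, hr] at h
          simpa using hinj h) (by fun_prop) (fun u => by
        rw [← hθ1 (u / _)]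
        push_cast
        ring_nf) (fun u => by rw [hr]; exact hb _) (by omega)
    rwa [funext hr, show (range fun u : ℝ => brokenLine G (u / (3 : ℕ))) = range (brokenLine G) from
      Function.Surjective.range_comp (f := fun u : ℝ => u / (3 : ℕ)) (fun u => ⟨u * (3 : ℕ), by simp⟩)
        (brokenLine G)] at h
  have hn0 : (0 : ℝ) < n := by exact_mod_cast hn
  obtain ⟨c, hc, hanti⟩ := brokenLine_antilipschitz (n := n) hinj (by omega) hG
  have hcv : ∀ {x x' z z'}, cvec x z = cvec x' z' → x = x' ∧ z = z' := fun {x x' z z'} h =>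
    ⟨congrArg (fun p : E3 => p 0) h, Complex.ext (congrArg (fun p : E3 => p 1) h) (congrArg (fun p : E3 => p 2) h)⟩
  have hGk : ∀ k : ℤ, cvec (G k 0) (squarePoint (θ k)) = G k := fun k => by
    obtain ⟨x, hx⟩ := hb k
    rw [brokenLine_intCast] at hx
    rw [hx]
    rfl
  have hz : ∀ u, brokenLine (fun k : ℤ => squarePoint (θ k)) u = squarePoint (θ u) := fun u => by
    obtain ⟨x, hx⟩ := hb u
    rw [← funext hGk, brokenLine_cvec] at hx
    exact (hcv hx).2
  obtain ⟨Z, hZn, hZ, hZ1, hZinj⟩ := exists_simple_cross_section hθ hn3 hθ1 hz (δ := c / 32) (by positivity)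
  have hX : ∀ k, G (k + n) 0 = G k 0 + 1 := fun k => by rw [hG]; simp
  have hZ' : ∀ x : ℤ → ℝ, (∀ k, x (k + n) = x k + 1) → ∀ k, cvec (x (k + n)) (Z (k + n)) = cvec (x k) (Z k) + e0 :=
    fun x hx k => by rw [hx, hZn, cvec_add_one]
  have hL : ∀ k : ℤ, ((k + n : ℤ) : ℝ) / n = k / n + 1 := fun k => by
    push_cast
    field_simp
  have hLu : ∀ u, brokenLine (fun k : ℤ => (k : ℝ) / n) u = u / n := fun u => by
    obtain ⟨k, hk⟩ := exists_floor u
    rw [brokenLine_eq _ k ⟨hk.1, hk.2.le⟩]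
    push_cast
    simp only [smul_eq_mul]
    ring
  have hlin : ∀ (x y : ℤ → ℝ) (r : ℝ) (z w : ℤ → ℂ), (fun k => cvec (x k) (z k) + r • (cvec (y k) (w k) - cvec (x k) (z k))) =
      fun k => cvec (x k + r * (y k - x k)) (z k + r * (w k - z k)) := fun x y r z w => by
    simp only [cvec_sub, smul_cvec, cvec_add]
  -- the cross-section becomes simple
  have h1 := hP.ambientIsotopic_of_near (G' := fun k => cvec (G k 0) (Z k)) (by omega) hG (hZ' (fun k => G k 0) hX) (fun k => hGk k ▸ cvec_mem_tube.2
    (supAbs_squarePoint _).le) (fun k => cvec_mem_tube.2 (hZ1 k)) hc hanti fun k => by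
      conv_lhs => rw [← hGk k, cvec_sub]
      refine (norm_cvec_le _ _).trans ?_
      have := hZ k
      rw [hGk, sub_self, abs_zero]
      linarith
  -- the longitudinal coordinate becomes linear; injectivity is that of the cross-section
  have h2 := hP.ambientIsotopic_of_linear_path (n := n) (by omega) (hZ' (fun k => G k 0) hX) (hZ' (fun k => k / n) hL) (fun k => cvec_mem_tube.2 (hZ1 k))
    (fun k => cvec_mem_tube.2 (hZ1 k)) fun r hr u v h => by
      rw [hlin, brokenLine_cvec, brokenLine_cvec] at h
      simp only [sub_self, mul_zero, add_zero] at h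
      obtain ⟨h3, h4⟩ := hcv h
      obtain ⟨m, rfl⟩ := hZinj _ _ h4
      have h5 : ∀ u, brokenLine (fun k => G k 0 + r * ((k : ℝ) / n - G k 0)) (u + n) =
          brokenLine (fun k => G k 0 + r * ((k : ℝ) / n - G k 0)) u + 1 := fun u => by
        simpa using brokenLine_add (n := n) (G := fun k : ℤ => G k 0 + r * ((k : ℝ) / n - G k 0)) (e := 1)
          (fun k => by rw [hX, hL]; ring) u
      have h6 := add_zsmul_of_add h5 m v
      simp only [zsmul_eq_mul, mul_one] at h6
      rw [h6] at h3
      simpa [hn.ne'] using h3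
  -- the cross-section contracts; injectivity is that of the longitudinal coordinate
  have h3 := hP.ambientIsotopic_of_linear_path (n := n) (G := fun k => cvec ((k : ℝ) / n) (Z k))
    (G' := fun k => cvec ((k : ℝ) / n) 0) (by omega) (hZ' (fun k => k / n) hL)
    (fun k => by rw [hL, cvec_add_one]) (fun k => cvec_mem_tube.2 (hZ1 k))
    (fun k => cvec_mem_tube.2 (by simp [supAbs])) fun r hr u v h => by
      rw [hlin, brokenLine_cvec, brokenLine_cvec] at h
      have h3 := (hcv h).1
      simp only [sub_self, mul_zero, add_zero] at h3
      rw [hLu, hLu] at h3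
      exact (div_left_inj' hn0.ne').1 h3
  have hax : N.f '' range (brokenLine fun k : ℤ => cvec ((k : ℝ) / n) 0) = K.carrier := by
    rw [← N.core]
    congr 1
    ext p
    simp only [mem_range, brokenLine_cvec, hLu]
    constructor
    · rintro ⟨u, rfl⟩
      simp [brokenLine, cvec]
    · rintro ⟨h1, h2⟩
      refine ⟨n * p 0, ?_⟩
      ext i
      fin_cases i <;> simp [brokenLine, cvec, h1, h2, hn0.ne']
  rw [hax] at h3
  exact h1.trans (h2.trans h3)

end KnotSSC

theorem mainTheorem3 (K : KnotSSC.PolygonalKnot) (N : KnotSSC.TubularNeighborhood K)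
    (D : KnotSSC.Diagram) (hD : D.IsDiagramOf K)
    (hK : KnotSSC.SatisfiesStrongSlopeConjecture N D)
    (h : (∀ n : ℕ, 1 ≤ n → D.dPlus n = KnotSSC.Diagram.trivial.dPlus n) ∨
      (∀ n : ℕ, 1 ≤ n → D.dMinus n = KnotSSC.Diagram.trivial.dMinus n)) :
    KnotSSC.AmbientIsotopic K.inS3 KnotSSC.unknot := by
  obtain ⟨S, hS, h0, hχ⟩ := KnotSSC.exists_surface_of_degree hK h
  obtain ⟨X, Θ, hX, hΘ, hX1, hΘ1, hper, ⟨C, hC, hC2, hr⟩, hu⟩ := S.exists_unknotted_boundary hS h0 hχ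
  obtain ⟨P, hP⟩ := N.exists_isPieceSet
  obtain ⟨n, G, θ, hn, hG, hinj, hθ, hθ1, hb, himg⟩ :=
    hP.exists_polygonal_lift hX hΘ hX1 hΘ1 hper hC hC2 hr
  have h1 := hP.ambientIsotopic_core hn hG hinj hθ hθ1 hb
  rw [himg] at h1
  exact h1.symm.trans hu
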